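/- **Conventions.** Let $\mu,\rho\in\mathbb C$, $d\in\mathbb Z$, $e(t)=e^{2\pi i t}$. Let $J_\nu(z)=\sum_{n\ge 0}\frac{(-1)^n(z/2)^{\nu+2n}}{n!\,\Gamma(\nu+n+1)}$ be the Bessel function of the first kind. For $z\in\mathbb C\smallsetminus\{0\}$ put $J_{\mu,d}(z)=J_{\mu+d}(z)\,J_{\mu-d}(\bar z)$, where $\arg\bar z=-\arg z$ (the product does not depend on the choice of $\arg z$), and $$\boldsymbol J_{\mu,d}(z)=\frac{1}{\sin(\pi\mu)}\bigl(J_{-\mu,-d}(4\pi z)-J_{\mu,d}(4\pi z)\bigr),$$ the right hand side being replaced by its limit if $\mu$ is an integer. Let ${}_2F_1(a,b;c;z)$ be the Gauss hypergeometric function: the analytic continuation of the Gauss series to $\mathbb C\smallsetminus[1,\infty)$, and at $z=1$ the sum of the series (when it converges). Define $$C^{\rho}_{\mu,d}=-\frac{\sin(\pi(\rho+\mu))}{(2\pi)^{2\rho}\sin(\pi\mu)}\,\frac{\Gamma(\rho+\mu+d)\,\Gamma(\rho+\mu-d)}{\Gamma(1+\mu+d)\,\Gamma(1+\mu-d)},$$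 $$F^{(1)}_{\rho,\nu}(z)={}_2F_1\Bigl(\tfrac{\rho+\nu}{2},\tfrac{1+\rho+\nu}{2};1+\nu;z\Bigr),\qquad F^{(2)}_{\rho,\nu}(z)={}_2F_1\Bigl(\tfrac{\rho-\nu}{2},\tfrac{1+\rho-\nu}{2};1-\nu;z\Bigr).$$ **Theorem.** (1) Suppose $|\mathrm{Re}\,\mu|<\mathrm{Re}\,\rho<\frac12$, $y\in[0,\infty)$ and $\theta\in[0,2\pi)$. Then the following double integral converges absolutely and $$\int_0^{2\pi}\!\!\int_0^\infty \boldsymbol J_{\mu,d}(xe^{i\phi})\,e(-2xy\cos(\phi+\theta))\,x^{2\rho-1}\,dx\,d\phi$$ $$=\frac{C^{\rho}_{\mu,d}\,F^{(1)}_{\rho,\mu+d}\bigl(4/(y^2e^{2i\theta})\bigr)F^{(1)}_{\rho,\mu-d}\bigl(4e^{2i\theta}/y^2\bigr)}{y^{2\rho+2\mu}e^{2id\theta}}+\frac{C^{\rho}_{-\mu,-d}\,F^{(2)}_{\rho,\mu+d}\bigl(4/(y^2e^{2i\theta})\bigr)F^{(2)}_{\rho,\mu-d}\bigl(4e^{2i\theta}/y^2\bigr)}{y^{2\rho-2\mu}e^{-2id\theta}}.\qquad(*)$$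 (2) Suppose $|\mathrm{Re}\,\mu|<\mathrm{Re}\,\rho<1$, $y>2$ and $\theta\in[0,2\pi)$. Then the integral in $(*)$, read as $\lim_{R\to\infty}\int_0^{2\pi}\int_0^R$ (where for each finite $R$ the integral is absolutely convergent), converges, and $(*)$ holds. Here the right hand side of $(*)$ is to be read literally when $y>0$, $\mu\neq0$, $ye^{i\theta}\notin(-2,2)$ and, if $d\ne0$, $\rho+\mu\neq1$ and $\rho-\mu\ne1$. At every other point $(\mu,y,\theta)$ it is to be replaced by its limit as $(\mu,y,\theta)$ is approached through points of the former kind, with $\rho$ and $d$ fixed; the existence of this limit is part of the claim. -/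

import Mathlib

open Real Set Filter Topology MeasureTheory

noncomputable section

namespace WeberSchafheitlin

/-- The additive character `e(t) = exp(2πit)`. -/
def e (t : ℝ) : ℂ := Complex.exp (2 * π * t * Complex.I)

/-- The Bessel function of the first kind on the Riemann surface of the logarithm: for `z = exp w`,
`besselJ ν w` is `J_ν(z) = ∑ₙ (-1)ⁿ (z/2)^(ν+2n) / (n! Γ(ν+n+1))`, the powers of `z/2` being
`(z/2)^s = exp (s (w - log 2))`. (The terms with `Γ(ν+n+1)` at a pole are `0`,
as Mathlib's `Gamma` is `0` there.) -/
def besselJ (ν w : ℂ) : ℂ :=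
  ∑' n : ℕ, (-1) ^ n * Complex.exp ((ν + 2 * n) * (w - Real.log 2)) /
    ((n.factorial : ℂ) * Complex.Gamma (ν + n + 1))

/-- `J_{μ,d}(z) = J_{μ+d}(z) J_{μ-d}(z̄)` for `z ≠ 0`, with `arg z̄ = - arg z`. -/
def besselJJ (μ : ℂ) (d : ℤ) (z : ℂ) : ℂ :=
  besselJ (μ + d) (Complex.log z) * besselJ (μ - d) (starRingEnd ℂ (Complex.log z))

/-- `(J_{-μ,-d}(4πz) - J_{μ,d}(4πz)) / sin(πμ)`, meaningful when `μ` is not an integer. -/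
def boldJGeneric (μ : ℂ) (d : ℤ) (z : ℂ) : ℂ :=
  (besselJJ (-μ) (-d) (4 * π * z) - besselJJ μ d (4 * π * z)) / Complex.sin (π * μ)

open Classical in
/-- The Bessel function `𝑱_{μ,d}(z)` over the complex numbers; when `μ` is an integer
the defining quotient is replaced by its limit. -/
def boldJ (μ : ℂ) (d : ℤ) (z : ℂ) : ℂ :=
  if ∃ m : ℤ, μ = m then limUnder (𝓝[≠] μ) (fun μ' => boldJGeneric μ' d z)
  else boldJGeneric μ d z

/-- The complex plane cut along `[1, ∞)`. -/
def cutPlane : Set ℂ := {z | ¬ (z.im = 0 ∧ 1 ≤ z.re)}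

/-- `f` is an analytic continuation of the Gauss series to the plane cut along `[1, ∞)`. -/
def IsGaussContinuation (a b c : ℂ) (f : ℂ → ℂ) : Prop :=
  DifferentiableOn ℂ f cutPlane ∧ ∀ z : ℂ, ‖z‖ < 1 → f z = ₂F₁ a b c z

open Classical in
/-- The Gauss hypergeometric function: on the plane cut along `[1, ∞)` it is the analytic
continuation of the Gauss series (unique, by the identity theorem); at `z = 1` it is the
sum of the Gauss series. No meaning is attached to its values at real `z > 1`. -/
def hyp2F1 (a b c z : ℂ) : ℂ :=
  if h : z ∈ cutPlane ∧ ∃ f : ℂ → ℂ, IsGaussContinuation a b c f then h.2.choose z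
  else ₂F₁ a b c z

/-- `F⁽¹⁾_{ρ,ν}`. -/
def F1 (ρ ν z : ℂ) : ℂ := hyp2F1 ((ρ + ν) / 2) ((1 + ρ + ν) / 2) (1 + ν) z

/-- `F⁽²⁾_{ρ,ν}`. -/
def F2 (ρ ν z : ℂ) : ℂ := hyp2F1 ((ρ - ν) / 2) ((1 + ρ - ν) / 2) (1 - ν) z

/-- The constant `C^ρ_{μ,d}`. -/
def C (ρ μ : ℂ) (d : ℤ) : ℂ :=
  -(Complex.sin (π * (ρ + μ)) / (((2 * π : ℝ) : ℂ) ^ (2 * ρ) * Complex.sin (π * μ))) *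
    (Complex.Gamma (ρ + μ + d) * Complex.Gamma (ρ + μ - d) /
      (Complex.Gamma (1 + μ + d) * Complex.Gamma (1 + μ - d)))

/-- The integrand `𝑱_{μ,d}(x e^{iφ}) e(-2xy cos(φ+θ)) x^{2ρ-1}`. -/
def integrand (ρ μ : ℂ) (d : ℤ) (y θ φ x : ℝ) : ℂ :=
  boldJ μ d (x * Complex.exp (φ * Complex.I)) * e (-2 * x * y * Real.cos (φ + θ)) *
    (x : ℂ) ^ (2 * ρ - 1)

/-- The right hand side of the formula, read literally. -/
def rhs (ρ μ : ℂ) (d : ℤ) (y θ : ℝ) : ℂ :=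
  C ρ μ d * F1 ρ (μ + d) (4 / (y ^ 2 * Complex.exp (2 * θ * Complex.I))) *
      F1 ρ (μ - d) (4 * Complex.exp (2 * θ * Complex.I) / y ^ 2) /
    ((y : ℂ) ^ (2 * ρ + 2 * μ) * Complex.exp (2 * d * θ * Complex.I)) +
  C ρ (-μ) (-d) * F2 ρ (μ + d) (4 / (y ^ 2 * Complex.exp (2 * θ * Complex.I))) *
      F2 ρ (μ - d) (4 * Complex.exp (2 * θ * Complex.I) / y ^ 2) /
    ((y : ℂ) ^ (2 * ρ - 2 * μ) * Complex.exp (-2 * d * θ * Complex.I))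

/-- For `|Re μ| < Re ρ < 1` and `y ≥ 0`, the points where every symbol in the right hand side is
literally meaningful: `y > 0`; the arguments `4 y⁻² e^{∓2iθ}` do not lie on the branch cut
`(1, ∞)`; `μ ≠ 0` (at `μ = 0` the sine in `C` vanishes, and for `d ≠ 0` a parameter `c` of
a hypergeometric function is in `{0, -1, -2, …}`); and no `Γ(ρ ± μ ± d)` is at a pole. -/
def RhsMeaningful (ρ μ : ℂ) (d : ℤ) (y θ : ℝ) : Prop :=
  0 < y ∧ ¬ (y < 2 ∧ Real.sin θ = 0) ∧ μ ≠ 0 ∧ (d = 0 ∨ (ρ + μ ≠ 1 ∧ ρ - μ ≠ 1))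

/-- `I` is the value of the right hand side, which at the exceptional points is replaced by its
limit, as `(μ, y, θ)` is approached through the points where it is meaningful. -/
def IsRhsValue (ρ μ : ℂ) (d : ℤ) (y θ : ℝ) (I : ℂ) : Prop :=
  (RhsMeaningful ρ μ d y θ → I = rhs ρ μ d y θ) ∧
  (¬ RhsMeaningful ρ μ d y θ →
    Tendsto (fun p : ℂ × ℝ × ℝ => rhs ρ p.1 d p.2.1 p.2.2)
      (𝓝[{p : ℂ × ℝ × ℝ | RhsMeaningful ρ p.1 d p.2.1 p.2.2}] (μ, y, θ)) (𝓝 I))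

end WeberSchafheitlin

end

noncomputable section

namespace WeberSchafheitlin

/-! ### The entire series behind the Bessel function -/

/-! Put z = x e^{iφ} = e^w and u = y e^{iθ}. The polar integral becomes an integral over the
cylinder `ℂ / 2πiℤ` of 𝑱(z) |z|^{2ρ} against the character `planeWave z u`; it is a Fourier
transform in u, called `impInt`. The theorem follows from differential equations for this function
of u, a monodromy argument, and one asymptotic comparison that fixes the constants.

Size of 𝑱. Near z = 0 it is O(|z|^{-2σ}) for any σ with |Re μ| < σ < 1. At infinity, a quarter turn
rewrites J_{-ν₁}J_{-ν₂} - J_{ν₁}J_{ν₂} as a sum of products of a growing I-Bessel function and a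
decaying I_{-ν} - I_ν, whose exponentials cancel, so that 𝑱 = O(1/|z|) (`exists_growth_besselI`,
`exists_decay_besselD`, `exists_bound_besselP_of_nonneg`). All bounds are uniform in μ, across μ = 0
as well (`exists_bound_divSin`). Absolute convergence for Re ρ < 1/2 is immediate.

Differential equations. 𝑱 satisfies Bessel's equation in z and in z̄. Stokes' theorem on the
cylinder turns this into linear relations `besselComb` between the moments of 𝑱 with extra factors
z^j z̄^k, and these factors are derivatives in u and ū. The relations are also used to sum the
conditionally convergent integral away from u² = 4 (`exists_bound_tail`), and to continue the
moments over |z| > 1 to exponents where their integrals diverge (`WaveFamily.step`). Adding the part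
|z| ≤ 1 cancels the boundary terms, and `impInt` satisfies a second order equation in u and another
in ū, singular only at u² = 4 (`exists_momentFamily`).

Solution. With u = 2 cosh ζ the equations become Jacobi's equations in ζ and ζ̄
(`exists_jacobiPair`). Their solutions exp((ρ±ν)ζ) ₂F₁(ρ±ν, ρ; 1±ν; e^{2ζ}) are, by Gauss's
quadratic transformation, the functions F⁽¹⁾ and F⁽²⁾ at 4/u². A joint solution is a combination of
four products; evenness in u, which is periodicity under ζ ↦ ζ + πi, kills the two mixed ones
because μ is not an integer (`JacobiPair.eq_combination`, `exists_impInt_eq`).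

Constants. Both sides are paired with u^{2n+2} ū² exp(-b|u|²) as b = e^{-x} tends to 0. On the u
side the leading term at infinity of the Gauss functions is seen; on the z side the Fourier
transform concentrates at z = 0 and the leading power of 𝑱 is seen. Comparison of the coefficients
of e^{-μx} gives the constant `C` (`exists_asymptotics_left`, `exists_asymptotics_right`,
`coeff_eq_C`), and the symmetry (μ, d) ↦ (-μ, -d) gives the other one.

Exceptional points. `impInt` is jointly continuous in (μ, u) in the ranges of the theorem, so
wherever the right hand side is not literally meaningful its limit exists and is the integral. At y
= 2 on the cut, the Gauss series converges absolutely at 1 when Re ρ < 1/2 and the formula is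
reached from y > 2. -/

lemma exists_bound_inv_Gamma (M : ℝ) :
    ∃ B : ℝ, 0 ≤ B ∧ ∀ ν : ℂ, ‖ν‖ ≤ M → ∀ n : ℕ, ‖(Complex.Gamma (ν + n + 1))⁻¹‖ ≤ B := by
  obtain ⟨N, hN⟩ := exists_nat_ge M
  have hb : ∀ n : ℕ, ∃ b : ℝ, ∀ ν : ℂ, ‖ν‖ ≤ M → ‖(Complex.Gamma (ν + n + 1))⁻¹‖ ≤ b := by
    intro n
    have hc : Continuous fun ν : ℂ => (Complex.Gamma (ν + n + 1))⁻¹ :=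
      Complex.differentiable_one_div_Gamma.continuous.comp (by fun_prop)
    obtain ⟨b, hb⟩ := (isCompact_closedBall (0 : ℂ) M).exists_bound_of_continuousOn hc.continuousOn
    exact ⟨b, fun ν hν => hb ν (by simpa using hν)⟩
  choose b hb using hb
  -- Once n ≥ N ≥ M, the functional equation divides by ν + n + 1, of modulus at least 1, so 1/Γ no
  -- longer increases and finitely many compactness bounds suffice.
  refine ⟨∑ n ∈ Finset.range (N + 1), |b n|, Finset.sum_nonneg fun _ _ => abs_nonneg _, ?_⟩
  intro ν hν n
  have key : ∀ n ≤ N, ‖(Complex.Gamma (ν + n + 1))⁻¹‖ ≤ ∑ n ∈ Finset.range (N + 1), |b n| := by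
    intro n hn
    refine (hb n ν hν).trans ((le_abs_self _).trans ?_)
    exact Finset.single_le_sum (f := fun n => |b n|) (fun _ _ => abs_nonneg _)
      (Finset.mem_range.2 (by omega))
  rcases le_total n N with h | h
  · exact key n h
  · induction n, h using Nat.le_induction with
    | base => exact key N le_rfl
    | succ n hn ih =>
      have h1 : (1 : ℝ) ≤ ‖ν + n + 1‖ := by
        have h2 := norm_sub_le_norm_add ((n : ℂ) + 1) ν
        have h3 : ‖(n : ℂ) + 1‖ = n + 1 := by
          rw [show (n : ℂ) + 1 = ((n + 1 : ℕ) : ℂ) by push_cast; ring, Complex.norm_natCast]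
          push_cast; ring
        rw [h3] at h2
        have h4 : (N : ℝ) ≤ n := by exact_mod_cast hn
        rw [show ν + n + 1 = (n : ℂ) + 1 + ν by ring]
        linarith
      have h0 : ν + n + 1 ≠ 0 := by
        intro h; rw [h, norm_zero] at h1; linarith
      have : Complex.Gamma (ν + (n + 1 : ℕ) + 1) = (ν + n + 1) * Complex.Gamma (ν + n + 1) := by
        rw [← Complex.Gamma_add_one _ h0]; push_cast; ring_nf
      rw [this, mul_inv, norm_mul, norm_inv]
      calc ‖ν + n + 1‖⁻¹ * ‖(Complex.Gamma (ν + n + 1))⁻¹‖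
          ≤ 1 * ‖(Complex.Gamma (ν + n + 1))⁻¹‖ := by
            gcongr; exact inv_le_one_of_one_le₀ h1
        _ ≤ _ := by rw [one_mul]; exact ih

/-- The terms of the entire series `∑ (-q)ⁿ / (n! Γ(ν+n+1))`. -/
def besselTerm (ν q : ℂ) (n : ℕ) : ℂ :=
  ((n.factorial : ℂ)⁻¹ * (Complex.Gamma (ν + n + 1))⁻¹) * (-q) ^ n

/-- The entire function `∑ (-q)ⁿ / (n! Γ(ν+n+1))`, so that `J_ν(z) = (z/2)^ν besselS ν (z²/4)`. -/
def besselS (ν q : ℂ) : ℂ := ∑' n, besselTerm ν q n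

lemma exists_bound_besselTerm (M Q : ℝ) :
    ∃ v : ℕ → ℝ, Summable v ∧ ∀ ν q : ℂ, ‖ν‖ ≤ M → ‖q‖ ≤ Q → ∀ n, ‖besselTerm ν q n‖ ≤ v n := by
  obtain ⟨B, hB0, hB⟩ := exists_bound_inv_Gamma M
  refine ⟨fun n => B * (Q ^ n / n.factorial), (Real.summable_pow_div_factorial Q).mul_left B, ?_⟩
  intro ν q hν hq n
  rw [besselTerm, norm_mul, norm_mul, norm_pow, norm_neg, norm_inv, Complex.norm_natCast]
  have := hB ν hν n
  calc ((n.factorial : ℝ)⁻¹ * ‖(Complex.Gamma (ν + n + 1))⁻¹‖) * ‖q‖ ^ n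
      ≤ ((n.factorial : ℝ)⁻¹ * B) * Q ^ n := by gcongr
    _ = B * (Q ^ n / n.factorial) := by ring

lemma summable_besselTerm (ν q : ℂ) : Summable (besselTerm ν q) := by
  obtain ⟨v, hv, h⟩ := exists_bound_besselTerm ‖ν‖ ‖q‖
  exact Summable.of_norm_bounded hv (h ν q le_rfl le_rfl)

lemma continuous_besselTerm (n : ℕ) : Continuous fun p : ℂ × ℂ => besselTerm p.1 p.2 n := by
  unfold besselTerm
  have : Continuous fun p : ℂ × ℂ => (Complex.Gamma (p.1 + n + 1))⁻¹ :=
    Complex.differentiable_one_div_Gamma.continuous.comp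
      (f := fun p : ℂ × ℂ => p.1 + n + 1) (by fun_prop)
  fun_prop

lemma continuous_besselS : Continuous fun p : ℂ × ℂ => besselS p.1 p.2 := by
  rw [continuous_iff_continuousAt]
  intro p
  obtain ⟨v, hv, h⟩ := exists_bound_besselTerm (‖p‖ + 1) (‖p‖ + 1)
  have hc : ContinuousOn (fun p : ℂ × ℂ => besselS p.1 p.2) (Metric.ball p 1) := by
    refine continuousOn_tsum (fun n => (continuous_besselTerm n).continuousOn) hv ?_
    intro n x hx
    have h1 : ‖x‖ ≤ ‖p‖ + 1 := by
      have := norm_le_norm_add_norm_sub' x p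
      rw [Metric.mem_ball, dist_eq_norm] at hx
      linarith
    exact h _ _ ((norm_fst_le x).trans h1) ((norm_snd_le x).trans h1) n
  exact hc.continuousAt (Metric.ball_mem_nhds p one_pos)

lemma differentiable_besselS_left (q : ℂ) : Differentiable ℂ fun ν => besselS ν q := by
  intro ν
  obtain ⟨v, hv, h⟩ := exists_bound_besselTerm (‖ν‖ + 1) ‖q‖
  have hc : DifferentiableOn ℂ (fun ν => besselS ν q) (Metric.ball ν 1) := by
    refine Complex.differentiableOn_tsum_of_summable_norm hv (fun n => ?_) Metric.isOpen_ball ?_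
    · have : Differentiable ℂ fun ν : ℂ => (Complex.Gamma (ν + n + 1))⁻¹ :=
        Complex.differentiable_one_div_Gamma.comp (by fun_prop)
      unfold besselTerm
      exact Differentiable.differentiableOn (by fun_prop)
    · intro n x hx
      refine h x q ?_ le_rfl n
      have := norm_le_norm_add_norm_sub' x ν
      rw [Metric.mem_ball, dist_eq_norm] at hx
      linarith
  exact hc.differentiableAt (Metric.ball_mem_nhds ν one_pos)

lemma hasDerivAt_besselS (ν q : ℂ) : HasDerivAt (besselS ν) (-besselS (ν + 1) q) q := by
  obtain ⟨v, hv, h⟩ := exists_bound_besselTerm ‖ν‖ (‖q‖ + 1)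
  have hs := Complex.hasSum_deriv_of_summable_norm (F := fun n q => besselTerm ν q n)
    (U := Metric.ball q 1) hv
    (fun n => Differentiable.differentiableOn (by unfold besselTerm; fun_prop)) Metric.isOpen_ball
    (fun n x hx => h ν x le_rfl (by
      have := norm_le_norm_add_norm_sub' x q
      rw [Metric.mem_ball, dist_eq_norm] at hx
      linarith) n) (Metric.mem_ball_self one_pos)
  have hd : DifferentiableAt ℂ (besselS ν) q := by
    refine (Complex.differentiableOn_tsum_of_summable_norm (F := fun n q => besselTerm ν q n) hv
      (fun n => Differentiable.differentiableOn (by unfold besselTerm; fun_prop))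
      (Metric.isOpen_ball (x := q) (ε := 1))
      (fun n x hx => h ν x le_rfl (by
        have := norm_le_norm_add_norm_sub' x q
        rw [Metric.mem_ball, dist_eq_norm] at hx
        linarith) n)).differentiableAt (Metric.ball_mem_nhds q one_pos)
  have hderiv : ∀ n : ℕ, deriv (fun q => besselTerm ν q (n + 1)) q = -besselTerm (ν + 1) q n := by
    intro n
    have h1 : HasDerivAt (fun q : ℂ => (-q) ^ (n + 1)) (((n + 1 : ℕ) : ℂ) * (-q) ^ n * (-1)) q :=
      (hasDerivAt_neg q).pow (n + 1)
    have h2 := h1.const_mul (((n + 1).factorial : ℂ)⁻¹ * (Complex.Gamma (ν + (n + 1 : ℕ) + 1))⁻¹)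
    unfold besselTerm
    rw [h2.deriv, Nat.factorial_succ]
    have h3 : ((n : ℂ) + 1) ≠ 0 := by exact_mod_cast Nat.succ_ne_zero n
    have h4 : (n.factorial : ℂ) ≠ 0 := by exact_mod_cast n.factorial_ne_zero
    rw [show ν + (n + 1 : ℕ) + 1 = ν + 1 + n + 1 by push_cast; ring]
    push_cast
    field_simp
  have h0 : deriv (fun q => besselTerm ν q 0) q = 0 := by
    simp [besselTerm]
  have hs' : HasSum (fun n => deriv (fun q => besselTerm ν q n) q) (-besselS (ν + 1) q) := by
    rw [← hasSum_nat_add_iff' 1]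
    simp only [Finset.range_one, Finset.sum_singleton, h0, sub_zero, hderiv]
    exact (summable_besselTerm (ν + 1) q).hasSum.neg
  have := hs.unique hs'
  rw [← this]
  exact hd.hasDerivAt

lemma besselS_recurrence (ν q : ℂ) :
    besselS (ν - 1) q = ν * besselS ν q - q * besselS (ν + 1) q := by
  have key : ∀ n : ℕ, besselTerm (ν - 1) q (n + 1) =
      ν * besselTerm ν q (n + 1) - q * besselTerm (ν + 1) q n := by
    intro n
    unfold besselTerm
    have h4 : (n.factorial : ℂ) ≠ 0 := by exact_mod_cast n.factorial_ne_zero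
    have h3 : ((n : ℂ) + 1) ≠ 0 := by exact_mod_cast Nat.succ_ne_zero n
    rw [show ν - 1 + (n + 1 : ℕ) + 1 = ν + n + 1 by push_cast; ring,
      show ν + (n + 1 : ℕ) + 1 = ν + n + 1 + 1 by push_cast; ring,
      show ν + 1 + n + 1 = ν + n + 1 + 1 by ring, Nat.factorial_succ, pow_succ]
    have hG := Complex.one_div_Gamma_eq_self_mul_one_div_Gamma_add_one (ν + n + 1)
    rw [hG]
    push_cast
    field_simp
    ring
  have k0 : besselTerm (ν - 1) q 0 = ν * besselTerm ν q 0 := by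
    unfold besselTerm
    have hG := Complex.one_div_Gamma_eq_self_mul_one_div_Gamma_add_one ν
    simp [hG]
  unfold besselS
  rw [(summable_besselTerm (ν - 1) q).tsum_eq_zero_add, (summable_besselTerm ν q).tsum_eq_zero_add,
    k0, mul_add, ← tsum_mul_left, ← tsum_mul_left]
  simp_rw [key]
  have s1 : Summable fun n => ν * besselTerm ν q (n + 1) :=
    ((summable_nat_add_iff 1).2 (summable_besselTerm ν q)).mul_left ν
  have s2 : Summable fun n => q * besselTerm (ν + 1) q n :=
    (summable_besselTerm (ν + 1) q).mul_left q
  rw [s1.tsum_sub s2]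
  ring

lemma besselS_neg_nat (n : ℕ) (q : ℂ) : besselS (-n) q = (-q) ^ n * besselS n q := by
  unfold besselS
  rw [← (summable_besselTerm (-n) q).sum_add_tsum_nat_add n, ← tsum_mul_left]
  -- `Gamma` is 0 at its poles, so its inverse is 0 there too, in agreement with the entire function
  -- 1/Γ; the first n terms vanish.
  have h0 : ∑ i ∈ Finset.range n, besselTerm (-n) q i = 0 := by
    refine Finset.sum_eq_zero fun i hi => ?_
    have hi := Finset.mem_range.1 hi
    have : Complex.Gamma (-n + i + 1) = 0 := by
      rw [Complex.Gamma_eq_zero_iff]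
      refine ⟨n - 1 - i, ?_⟩
      have : (((n - 1 - i : ℕ) : ℤ) : ℂ) = (n : ℂ) - 1 - i := by
        rw [show ((n - 1 - i : ℕ) : ℤ) = (n : ℤ) - 1 - i by omega]; push_cast; ring
      rw [← Int.cast_natCast (R := ℂ) (n - 1 - i), this]; ring
    simp [besselTerm, this]
  rw [h0, zero_add]
  refine tsum_congr fun k => ?_
  unfold besselTerm
  rw [show (-(n : ℂ) + ((k + n : ℕ) : ℂ) + 1) = k + 1 by push_cast; ring,
    show ((n : ℂ) + k + 1) = ((k + n : ℕ) : ℂ) + 1 by push_cast; ring,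
    Complex.Gamma_nat_eq_factorial, Complex.Gamma_nat_eq_factorial, pow_add]
  ring

/-! ### The Bessel function on the logarithmic plane -/

/-- Isolates the multivalued power (z/2)^ν from an entire function of z²/4; joint continuity,
holomorphy in ν and all monodromy formulas are read off from this. -/
lemma besselJ_eq (ν w : ℂ) : besselJ ν w =
    Complex.exp (ν * (w - Real.log 2)) * besselS ν (Complex.exp (2 * (w - Real.log 2))) := by
  unfold besselJ besselS
  rw [← tsum_mul_left]
  refine tsum_congr fun n => ?_
  unfold besselTerm
  rw [neg_pow (Complex.exp _), ← Complex.exp_nat_mul, add_mul, Complex.exp_add,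
    show (2 : ℂ) * n * (w - Real.log 2) = n * (2 * (w - Real.log 2)) by ring]
  rw [div_eq_mul_inv, mul_inv]
  ring

lemma continuous_besselJ : Continuous fun p : ℂ × ℂ => besselJ p.1 p.2 := by
  simp_rw [besselJ_eq]
  have : Continuous fun p : ℂ × ℂ =>
      besselS p.1 (Complex.exp (2 * (p.2 - Real.log 2))) :=
    continuous_besselS.comp
      (f := fun p : ℂ × ℂ => (p.1, Complex.exp (2 * (p.2 - Real.log 2)))) (by fun_prop)
  fun_prop

lemma differentiable_besselJ_left (w : ℂ) : Differentiable ℂ fun ν => besselJ ν w := by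
  simp_rw [besselJ_eq]
  have := differentiable_besselS_left (Complex.exp (2 * (w - Real.log 2)))
  fun_prop

lemma exp_two_sub_log (w : ℂ) : 2 * Complex.exp (w - Real.log 2) = Complex.exp w := by
  rw [Complex.exp_sub, ← Complex.ofReal_exp, Real.exp_log two_pos]
  push_cast
  field_simp

lemma hasDerivAt_besselJ (ν w : ℂ) : HasDerivAt (besselJ ν)
    (ν * besselJ ν w - Complex.exp w * besselJ (ν + 1) w) w := by
  have h1 : HasDerivAt (fun w : ℂ => Complex.exp (ν * (w - Real.log 2)))
      (Complex.exp (ν * (w - Real.log 2)) * ν) w := by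
    have := (((hasDerivAt_id w).sub_const (Real.log 2 : ℂ)).const_mul ν).cexp
    simpa using this
  have h2 : HasDerivAt (fun w : ℂ => Complex.exp (2 * (w - Real.log 2)))
      (Complex.exp (2 * (w - Real.log 2)) * 2) w := by
    have := (((hasDerivAt_id w).sub_const (Real.log 2 : ℂ)).const_mul 2).cexp
    simpa using this
  have h3 := (hasDerivAt_besselS ν (Complex.exp (2 * (w - Real.log 2)))).comp w h2
  have h4 := h1.mul h3
  have h5 : besselJ ν = fun w => Complex.exp (ν * (w - Real.log 2)) *
      besselS ν (Complex.exp (2 * (w - Real.log 2))) := funext (besselJ_eq ν)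
  rw [h5]
  refine h4.congr_deriv ?_
  simp only [Function.comp]
  rw [besselJ_eq (ν + 1) w, ← exp_two_sub_log w, two_mul (w - _), Complex.exp_add, add_mul,
    Complex.exp_add, one_mul]
  ring

lemma besselJ_recurrence (ν w : ℂ) : Complex.exp w * besselJ (ν - 1) w =
    2 * ν * besselJ ν w - Complex.exp w * besselJ (ν + 1) w := by
  have e1 (x : ℂ) : Complex.exp ((ν - 1) * x) = Complex.exp (ν * x) / Complex.exp x := by
    rw [sub_mul, one_mul, Complex.exp_sub]
  have e2 (x : ℂ) : Complex.exp ((ν + 1) * x) = Complex.exp (ν * x) * Complex.exp x := by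
    rw [add_mul, one_mul, Complex.exp_add]
  have e3 (x : ℂ) : Complex.exp (2 * x) = Complex.exp x * Complex.exp x := by
    rw [two_mul, Complex.exp_add]
  rw [besselJ_eq, besselJ_eq, besselJ_eq, besselS_recurrence, ← exp_two_sub_log w, e1, e2, e3]
  have := Complex.exp_ne_zero (w - Real.log 2)
  generalize Complex.exp (w - Real.log 2) = X at *
  field_simp

/-- The derivative of `besselJ ν` on the logarithmic plane. -/
def besselJ' (ν w : ℂ) : ℂ := ν * besselJ ν w - Complex.exp w * besselJ (ν + 1) w

lemma hasDerivAt_besselJ' (ν w : ℂ) : HasDerivAt (besselJ' ν)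
    ((ν ^ 2 - Complex.exp w ^ 2) * besselJ ν w) w := by
  have h := ((hasDerivAt_besselJ ν w).const_mul ν).sub
    ((Complex.hasDerivAt_exp w).mul (hasDerivAt_besselJ (ν + 1) w))
  refine h.congr_deriv ?_
  have := besselJ_recurrence (ν + 1) w
  rw [add_sub_cancel_right] at this
  linear_combination (Complex.exp w) * this

lemma differentiable_besselJ'_left (w : ℂ) : Differentiable ℂ fun ν => besselJ' ν w := by
  have h1 := differentiable_besselJ_left w
  have h2 : Differentiable ℂ fun ν => besselJ (ν + 1) w := h1.comp (by fun_prop)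
  unfold besselJ'
  fun_prop

lemma besselJ_add_pi_mul_I (ν w : ℂ) :
    besselJ ν (w + π * Complex.I) = Complex.exp (ν * (π * Complex.I)) * besselJ ν w := by
  rw [besselJ_eq, besselJ_eq, show w + π * Complex.I - Real.log 2 =
    (w - Real.log 2) + π * Complex.I by ring, mul_add, mul_add, Complex.exp_add,
    Complex.exp_add (2 * _), show (2 : ℂ) * (π * Complex.I) = 2 * π * Complex.I by ring,
    Complex.exp_two_pi_mul_I]
  ring_nf

lemma besselJ_neg_nat (n : ℕ) (w : ℂ) : besselJ (-n) w = (-1) ^ n * besselJ n w := by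
  rw [besselJ_eq, besselJ_eq, besselS_neg_nat, neg_pow, ← Complex.exp_nat_mul]
  have : Complex.exp (-n * (w - Real.log 2)) * Complex.exp (n * (2 * (w - Real.log 2))) =
      Complex.exp (n * (w - Real.log 2)) := by
    rw [← Complex.exp_add]; ring_nf
  linear_combination ((-1) ^ n * besselS n (Complex.exp (2 * (w - Real.log 2)))) * this

lemma besselJ_neg_int (n : ℤ) (w : ℂ) : besselJ (-n) w = (-1) ^ n * besselJ n w := by
  obtain ⟨k, rfl | rfl⟩ := n.eq_nat_or_neg
  · simpa using besselJ_neg_nat k w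
  · have := besselJ_neg_nat k w
    have h1 : ((-1 : ℂ) ^ k) * (-1) ^ k = 1 := by rw [← mul_pow]; simp
    have h2 : ((-1 : ℂ) ^ (-(k : ℤ))) = (-1) ^ k := by
      rw [zpow_neg, zpow_natCast]; exact inv_eq_of_mul_eq_one_left h1
    rw [h2]
    push_cast
    rw [neg_neg, this, ← mul_assoc, h1, one_mul]

/-! ### The modified Bessel function on the logarithmic plane -/

/-- The modified Bessel function `I_ν` on the logarithmic plane. -/
def besselI (ν w : ℂ) : ℂ :=
  Complex.exp (-ν * (π / 2 * Complex.I)) * besselJ ν (w + π / 2 * Complex.I)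

lemma exp_pi_div_two_mul_I : Complex.exp (π / 2 * Complex.I) = Complex.I :=
  Complex.exp_pi_div_two_mul_I

lemma besselJ_add_pi_div_two (ν w : ℂ) : besselJ ν (w + π / 2 * Complex.I) =
    Complex.exp (ν * (π / 2 * Complex.I)) * besselI ν w := by
  rw [besselI, ← mul_assoc, ← Complex.exp_add]
  simp

lemma besselI_succ (ν w : ℂ) : besselI (ν + 1) w =
    -Complex.I * (Complex.exp (-ν * (π / 2 * Complex.I)) *
      besselJ (ν + 1) (w + π / 2 * Complex.I)) := by
  rw [besselI, show -(ν + 1) * (π / 2 * Complex.I) =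
    -ν * (π / 2 * Complex.I) - π / 2 * Complex.I by ring, Complex.exp_sub, exp_pi_div_two_mul_I]
  have := Complex.I_ne_zero
  field_simp
  simp [Complex.I_sq]

lemma besselI_recurrence (ν w : ℂ) : Complex.exp w * besselI (ν - 1) w =
    2 * ν * besselI ν w + Complex.exp w * besselI (ν + 1) w := by
  have h := besselJ_recurrence ν (w + π / 2 * Complex.I)
  rw [Complex.exp_add, exp_pi_div_two_mul_I] at h
  have h1 : besselI (ν - 1) w = Complex.I * (Complex.exp (-ν * (π / 2 * Complex.I)) *
      besselJ (ν - 1) (w + π / 2 * Complex.I)) := by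
    rw [besselI, show -(ν - 1) * (π / 2 * Complex.I) =
      -ν * (π / 2 * Complex.I) + π / 2 * Complex.I by ring, Complex.exp_add,
      exp_pi_div_two_mul_I]
    ring
  rw [h1, besselI_succ, besselI]
  linear_combination Complex.exp (-ν * (π / 2 * Complex.I)) * h

/-- The derivative of `besselI ν`. -/
def besselI' (ν w : ℂ) : ℂ := ν * besselI ν w + Complex.exp w * besselI (ν + 1) w

lemma hasDerivAt_besselI (ν w : ℂ) : HasDerivAt (besselI ν) (besselI' ν w) w := by
  have h := ((hasDerivAt_besselJ ν (w + π / 2 * Complex.I)).comp_add_const w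
    (π / 2 * Complex.I)).const_mul (Complex.exp (-ν * (π / 2 * Complex.I)))
  refine h.congr_deriv ?_
  rw [besselI', besselI_succ, besselI, Complex.exp_add, exp_pi_div_two_mul_I]
  ring

lemma besselI'_eq (ν w : ℂ) :
    besselI' ν w = -ν * besselI ν w + Complex.exp w * besselI (ν - 1) w := by
  rw [besselI_recurrence, besselI']; ring

lemma hasDerivAt_besselI' (ν w : ℂ) : HasDerivAt (besselI' ν)
    ((Complex.exp w ^ 2 + ν ^ 2) * besselI ν w) w := by
  have h := ((hasDerivAt_besselI ν w).const_mul ν).add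
    ((Complex.hasDerivAt_exp w).mul (hasDerivAt_besselI (ν + 1) w))
  refine h.congr_deriv ?_
  rw [besselI'_eq (ν + 1), add_sub_cancel_right, besselI']
  ring

lemma continuous_besselI : Continuous fun p : ℂ × ℂ => besselI p.1 p.2 := by
  have : Continuous fun p : ℂ × ℂ => besselJ p.1 (p.2 + π / 2 * Complex.I) :=
    continuous_besselJ.comp (f := fun p : ℂ × ℂ => (p.1, p.2 + π / 2 * Complex.I)) (by fun_prop)
  unfold besselI
  fun_prop

lemma continuous_besselI' : Continuous fun p : ℂ × ℂ => besselI' p.1 p.2 := by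
  have h1 := continuous_besselI
  have h2 : Continuous fun p : ℂ × ℂ => besselI (p.1 + 1) p.2 :=
    h1.comp (f := fun p : ℂ × ℂ => (p.1 + 1, p.2)) (by fun_prop)
  unfold besselI'
  fun_prop

lemma besselI_eq (ν w : ℂ) : besselI ν w = Complex.exp (ν * (w - Real.log 2)) *
    besselS ν (-Complex.exp (2 * (w - Real.log 2))) := by
  rw [besselI, besselJ_eq, ← mul_assoc, ← Complex.exp_add]
  congr 2
  · ring
  · rw [show 2 * (w + π / 2 * Complex.I - Real.log 2) =
      2 * (w - Real.log 2) + π * Complex.I by ring, Complex.exp_add, Complex.exp_pi_mul_I]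
    ring

/-! ### A Gronwall estimate along rays of the right half plane -/

/-- In the variable z = e^w, the function f = √z g satisfies f'' = (1 + κ/z²) f with κ = ν² - 1/4.
Along a ray this is the constant coefficient equation up to a perturbation κ/z² whose integral from
|z| = 1 is at most |κ|, hence growth like e^{Re z} with an explicit constant, uniform in ν and in
the ray. -/
lemma norm_le_of_modified_bessel_ode {g g₁ : ℂ → ℂ} {ν : ℂ} {A : ℝ} {α : ℝ}
    (hg : ∀ w, HasDerivAt g (g₁ w) w)
    (hg₁ : ∀ w, HasDerivAt g₁ ((Complex.exp w ^ 2 + ν ^ 2) * g w) w) (hα : 0 ≤ Real.cos α)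
    (h0 : ‖g (α * Complex.I)‖ ≤ A) (h1 : ‖g₁ (α * Complex.I)‖ ≤ A) {τ : ℝ} (hτ : 0 ≤ τ) :
    ‖g (τ + α * Complex.I)‖ ≤ 4 * A * Real.exp ‖ν ^ 2 - 1 / 4‖ *
      (Real.exp (-τ / 2) * Real.exp (Real.exp τ * Real.cos α)) := by
  set κ : ℂ := ν ^ 2 - 1 / 4 with hκ
  set f : ℝ → ℂ := fun t => Complex.exp ((t + α * Complex.I) / 2) * g (t + α * Complex.I)
    with hf
  set h : ℝ → ℂ := fun t => Complex.exp (-(t + α * Complex.I) / 2) *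
    (g (t + α * Complex.I) / 2 + g₁ (t + α * Complex.I)) with hh
  set E : ℝ → ℂ := fun t => Complex.exp (t + α * Complex.I) with hE
  have hw : ∀ t : ℝ, HasDerivAt (fun t : ℝ => (t : ℂ) + α * Complex.I) 1 t := fun t =>
    (Complex.ofRealCLM.hasDerivAt (x := t)).add_const _
  have hgt : ∀ t : ℝ, HasDerivAt (fun t : ℝ => g (t + α * Complex.I))
      (g₁ (t + α * Complex.I)) t := fun t => by
    simpa using! (hg (t + α * Complex.I)).comp t (hw t)
  have hg₁t : ∀ t : ℝ, HasDerivAt (fun t : ℝ => g₁ (t + α * Complex.I))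
      ((Complex.exp (t + α * Complex.I) ^ 2 + ν ^ 2) * g (t + α * Complex.I)) t := fun t => by
    simpa using! (hg₁ (t + α * Complex.I)).comp t (hw t)
  have hfd : ∀ t, HasDerivAt f (E t * h t) t := by
    intro t
    have h1 := ((hw t).div_const 2).cexp.mul (hgt t)
    refine h1.congr_deriv ?_
    simp only [hE, hh]
    rw [← mul_assoc, ← Complex.exp_add,
      show (t + α * Complex.I) + -(t + α * Complex.I) / 2 = (t + α * Complex.I) / 2 by ring]
    ring
  have hhd : ∀ t, HasDerivAt h ((E t + κ * (E t)⁻¹) * f t) t := by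
    intro t
    have h1 := ((hw t).neg.div_const 2).cexp.mul (((hgt t).div_const 2).add (hg₁t t))
    refine h1.congr_deriv ?_
    simp only [hE, hf, ← Complex.exp_neg]
    have e1 : Complex.exp (-(t + α * Complex.I)) * Complex.exp ((t + α * Complex.I) / 2) =
      Complex.exp (-(t + α * Complex.I) / 2) := by rw [← Complex.exp_add]; ring_nf
    have e2 : Complex.exp (t + α * Complex.I) * Complex.exp (-(t + α * Complex.I) / 2) =
      Complex.exp ((t + α * Complex.I) / 2) := by rw [← Complex.exp_add]; ring_nf
    simp only [Pi.add_apply]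
    linear_combination (-κ * g (t + α * Complex.I)) * e1 +
      (Complex.exp (t + α * Complex.I) * g (t + α * Complex.I)) * e2
  -- Here h = df/dz. The combinations h + f and h - f diagonalize the unperturbed system: they grow
  -- and decay at the rate Re z, and the perturbation contributes the factor ‖κ‖ e^{-t}.
  set N : ℝ → ℝ := fun t => ‖h t + f t‖ ^ 2 + ‖h t - f t‖ ^ 2 with hN
  have hNd : ∀ t, HasDerivAt N (2 * inner ℝ (h t + f t) ((E t + κ * (E t)⁻¹) * f t + E t * h t) +
      2 * inner ℝ (h t - f t) ((E t + κ * (E t)⁻¹) * f t - E t * h t)) t := fun t =>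
    ((hhd t).add (hfd t)).norm_sq.add ((hhd t).sub (hfd t)).norm_sq
  have hEn : ∀ t, ‖E t‖ = Real.exp t := fun t => by simp [hE, Complex.norm_exp]
  have hEre : ∀ t, (E t).re = Real.exp t * Real.cos α := fun t => by
    simp [hE, Complex.exp_re]
  have hNle : ∀ t, 2 * inner ℝ (h t + f t) ((E t + κ * (E t)⁻¹) * f t + E t * h t) +
      2 * inner ℝ (h t - f t) ((E t + κ * (E t)⁻¹) * f t - E t * h t) ≤
      (2 * (Real.exp t * Real.cos α) + 2 * (‖κ‖ * Real.exp (-t))) * N t := by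
    intro t
    have i1 : ∀ a z : ℂ, inner ℝ z (a * z) = a.re * ‖z‖ ^ 2 := by
      intro a z
      rw [Complex.inner, Complex.sq_norm, Complex.normSq_apply]
      simp; ring
    have i2 : ∀ z : ℂ, inner ℝ z (κ * (E t)⁻¹ * f t) ≤ ‖κ‖ * Real.exp (-t) * (‖z‖ * ‖f t‖) := by
      intro z
      refine (real_inner_le_norm _ _).trans_eq ?_
      rw [norm_mul, norm_mul, norm_inv, hEn, Real.exp_neg]; ring
    have e1 : (E t + κ * (E t)⁻¹) * f t + E t * h t = E t * (h t + f t) + κ * (E t)⁻¹ * f t := by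
      ring
    have e2 : (E t + κ * (E t)⁻¹) * f t - E t * h t =
      (-E t) * (h t - f t) + κ * (E t)⁻¹ * f t := by ring
    rw [e1, e2, inner_add_right, inner_add_right, i1, i1, Complex.neg_re, hEre]
    have j1 := i2 (h t + f t)
    have j2 := i2 (h t - f t)
    have j3 : ‖f t‖ ≤ (‖h t + f t‖ + ‖h t - f t‖) / 2 := by
      have : (2 : ℂ) * f t = (h t + f t) - (h t - f t) := by ring
      have h2 := norm_sub_le (h t + f t) (h t - f t)
      rw [← this, norm_mul] at h2
      simp at h2
      linarith
    have hk : 0 ≤ ‖κ‖ * Real.exp (-t) := by positivity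
    have hc : 0 ≤ Real.exp t * Real.cos α := by positivity
    have a0 := norm_nonneg (h t + f t)
    have b0 := norm_nonneg (h t - f t)
    simp only [hN]
    generalize ‖h t + f t‖ = a at *
    generalize ‖h t - f t‖ = b at *
    have k1 : ‖κ‖ * Real.exp (-t) * ((a + b) * ‖f t‖) ≤ ‖κ‖ * Real.exp (-t) * (a ^ 2 + b ^ 2) := by
      gcongr
      nlinarith [sq_nonneg (a - b)]
    nlinarith [mul_nonneg hc (sq_nonneg b)]
  -- The integrating factor: Φ is minus a primitive of the growth rate found for N.
  set Φ : ℝ → ℝ := fun t => -2 * (Real.exp t * Real.cos α) + 2 * (‖κ‖ * Real.exp (-t)) with hΦ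
  have hΦd : ∀ t, HasDerivAt Φ (-2 * (Real.exp t * Real.cos α) - 2 * (‖κ‖ * Real.exp (-t))) t := by
    intro t
    have h1 := (((Real.hasDerivAt_exp t).mul_const (Real.cos α)).const_mul (-2)).add
      (((hasDerivAt_neg t).exp.const_mul ‖κ‖).const_mul 2)
    refine h1.congr_deriv ?_
    ring
  have hanti : Antitone fun t => N t * Real.exp (Φ t) := by
    refine antitone_of_hasDerivAt_nonpos (fun t => (hNd t).mul (hΦd t).exp) fun t => ?_
    have := hNle t
    have he := (Real.exp_pos (Φ t)).le
    simp only [Pi.zero_apply]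
    nlinarith
  -- At t = 0 one has |f| ≤ A and |h| ≤ 3A/2, so the parallelogram law gives 13A²/2; the value 16 is
  -- a convenient square.
  have hN0 : N 0 ≤ 16 * A ^ 2 := by
    have hA : 0 ≤ A := (norm_nonneg _).trans h0
    have e1 : ‖f 0‖ ≤ A := by simpa [hf, Complex.norm_exp] using h0
    have e2 : ‖h 0‖ ≤ A / 2 + A := by
      have : ‖h 0‖ = ‖g (α * Complex.I) / 2 + g₁ (α * Complex.I)‖ := by
        simp [hh, Complex.norm_exp]
      rw [this]
      refine (norm_add_le _ _).trans ?_
      rw [norm_div]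
      simp only [Complex.norm_ofNat]
      linarith
    have e3 := parallelogram_law_with_norm ℝ (h 0) (f 0)
    simp only [hN]
    have := norm_nonneg (f 0)
    have := norm_nonneg (h 0)
    nlinarith
  have hmain := hanti hτ
  simp only at hmain
  have hfN : ‖f τ‖ ^ 2 ≤ N τ := by
    have e3 := parallelogram_law_with_norm ℝ (h τ) (f τ)
    simp only [hN]
    nlinarith [sq_nonneg ‖h τ‖, sq_nonneg ‖f τ‖]
  have hfτ : ‖f τ‖ ≤ 4 * A * Real.exp ‖κ‖ * Real.exp (Real.exp τ * Real.cos α) := by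
    have hA : 0 ≤ A := (norm_nonneg _).trans h0
    refine (sq_le_sq₀ (norm_nonneg _) (by positivity)).1 ?_
    have h2 : N τ ≤ 16 * A ^ 2 * Real.exp (Φ 0) * Real.exp (-Φ τ) := by
      have : N τ = N τ * Real.exp (Φ τ) * Real.exp (-Φ τ) := by
        rw [mul_assoc, ← Real.exp_add]; simp
      rw [this]
      refine mul_le_mul_of_nonneg_right (hmain.trans ?_) (Real.exp_pos _).le
      gcongr
    refine hfN.trans (h2.trans ?_)
    have h3 : Real.exp (Φ 0) * Real.exp (-Φ τ) ≤
        (Real.exp ‖κ‖ * Real.exp (Real.exp τ * Real.cos α)) ^ 2 := by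
      rw [← Real.exp_add, ← Real.exp_add, sq, ← Real.exp_add]
      refine Real.exp_le_exp.2 ?_
      simp only [hΦ, Real.exp_zero, neg_zero]
      have : 0 ≤ ‖κ‖ * Real.exp (-τ) := by positivity
      linarith
    calc 16 * A ^ 2 * Real.exp (Φ 0) * Real.exp (-Φ τ)
        = 16 * A ^ 2 * (Real.exp (Φ 0) * Real.exp (-Φ τ)) := by ring
      _ ≤ 16 * A ^ 2 * (Real.exp ‖κ‖ * Real.exp (Real.exp τ * Real.cos α)) ^ 2 := by gcongr
      _ = _ := by ring
  have hfg : ‖g (τ + α * Complex.I)‖ = Real.exp (-τ / 2) * ‖f τ‖ := by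
    simp only [hf]
    rw [norm_mul, Complex.norm_exp, ← mul_assoc, ← Real.exp_add]
    simp
    rw [neg_div, neg_add_cancel, Real.exp_zero, one_mul]
  rw [hfg]
  calc _ ≤ Real.exp (-τ / 2) * (4 * A * Real.exp ‖κ‖ * Real.exp (Real.exp τ * Real.cos α)) := by
        gcongr
    _ = _ := by ring

/-- `I_{-ν} - I_ν`, a multiple of the recessive function `K_ν`. -/
def besselD (ν w : ℂ) : ℂ := besselI (-ν) w - besselI ν w

/-- The derivative of `besselD ν`. -/
def besselD' (ν w : ℂ) : ℂ := besselI' (-ν) w - besselI' ν w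

lemma hasDerivAt_besselD (ν w : ℂ) : HasDerivAt (besselD ν) (besselD' ν w) w :=
  (hasDerivAt_besselI (-ν) w).sub (hasDerivAt_besselI ν w)

lemma continuous_besselD : Continuous fun p : ℂ × ℂ => besselD p.1 p.2 := by
  have h1 := continuous_besselI
  have h2 : Continuous fun p : ℂ × ℂ => besselI (-p.1) p.2 :=
    h1.comp (f := fun p : ℂ × ℂ => (-p.1, p.2)) (by fun_prop)
  exact h2.sub h1

lemma besselD_succ (ν w : ℂ) : Complex.exp w * besselD (ν + 1) w =
    Complex.exp w * besselD (ν - 1) w - 2 * ν * besselD ν w := by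
  have h1 := besselI_recurrence ν w
  have h2 := besselI_recurrence (-ν) w
  unfold besselD
  rw [show -(ν + 1) = -ν - 1 by ring, show -(ν - 1) = -ν + 1 by ring]
  linear_combination h1 + h2

lemma besselD'_eq (ν w : ℂ) :
    besselD' ν w = ν * besselD ν w + Complex.exp w * besselD (ν + 1) w := by
  unfold besselD' besselD
  rw [besselI'_eq (-ν), besselI', show -(ν + 1) = -ν - 1 by ring]
  ring

lemma exists_bound_besselI (M : ℝ) : ∃ A : ℝ, 0 ≤ A ∧ ∀ ν : ℂ, ‖ν‖ ≤ M → ∀ α : ℝ, |α| ≤ π / 2 →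
    ‖besselI ν (α * Complex.I)‖ ≤ A ∧ ‖besselI' ν (α * Complex.I)‖ ≤ A := by
  have hK : IsCompact (Metric.closedBall (0 : ℂ) M ×ˢ Metric.closedBall (0 : ℝ) (π / 2)) :=
    (isCompact_closedBall _ _).prod (isCompact_closedBall _ _)
  have c1 : Continuous fun p : ℂ × ℝ => besselI p.1 (p.2 * Complex.I) :=
    continuous_besselI.comp (f := fun p : ℂ × ℝ => (p.1, (p.2 : ℂ) * Complex.I)) (by fun_prop)
  have c2 : Continuous fun p : ℂ × ℝ => besselI' p.1 (p.2 * Complex.I) :=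
    continuous_besselI'.comp (f := fun p : ℂ × ℝ => (p.1, (p.2 : ℂ) * Complex.I)) (by fun_prop)
  obtain ⟨a, ha⟩ := hK.exists_bound_of_continuousOn c1.continuousOn
  obtain ⟨b, hb⟩ := hK.exists_bound_of_continuousOn c2.continuousOn
  refine ⟨max 0 (max a b), le_max_left _ _, fun ν hν α hα => ?_⟩
  have hm : (ν, α) ∈ Metric.closedBall (0 : ℂ) M ×ˢ Metric.closedBall (0 : ℝ) (π / 2) := by
    simp [hν, hα]
  exact ⟨(ha _ hm).trans ((le_max_left _ _).trans (le_max_right _ _)),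
    (hb _ hm).trans ((le_max_right _ _).trans (le_max_right _ _))⟩

lemma norm_sq_sub_le {ν : ℂ} {M : ℝ} (hν : ‖ν‖ ≤ M) : ‖ν ^ 2 - 1 / 4‖ ≤ M ^ 2 + 1 / 4 := by
  refine (norm_sub_le _ _).trans ?_
  rw [norm_pow]
  have : ‖(1 / 4 : ℂ)‖ = 1 / 4 := by norm_num
  rw [this]
  gcongr

/-- The initial values on the arc |z| = 1, |arg z| ≤ π/2 are bounded by compactness, uniformly for
‖ν‖ ≤ M; the Gronwall estimate carries them along each ray. -/
lemma exists_growth_besselI (M : ℝ) : ∃ C : ℝ, 0 ≤ C ∧ ∀ ν : ℂ, ‖ν‖ ≤ M → ∀ τ α : ℝ, 0 ≤ τ →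
    |α| ≤ π / 2 → ‖besselI ν (τ + α * Complex.I)‖ ≤
      C * (Real.exp (-τ / 2) * Real.exp (Real.exp τ * Real.cos α)) := by
  obtain ⟨A, hA0, hA⟩ := exists_bound_besselI M
  refine ⟨4 * A * Real.exp (M ^ 2 + 1 / 4), by positivity, fun ν hν τ α hτ hα => ?_⟩
  have hc : 0 ≤ Real.cos α := Real.cos_nonneg_of_mem_Icc ⟨by linarith [neg_abs_le α], by
    linarith [le_abs_self α]⟩
  refine (norm_le_of_modified_bessel_ode (hasDerivAt_besselI ν) (hasDerivAt_besselI' ν) hc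
    (hA ν hν α hα).1 (hA ν hν α hα).2 hτ).trans ?_
  gcongr
  exact norm_sq_sub_le hν

lemma exists_growth_besselD (M : ℝ) : ∃ C : ℝ, 0 ≤ C ∧ ∀ ν : ℂ, ‖ν‖ ≤ M → ∀ τ α : ℝ, 0 ≤ τ →
    |α| ≤ π / 2 → ‖besselD ν (τ + α * Complex.I)‖ ≤
      C * (Real.exp (-τ / 2) * Real.exp (Real.exp τ * Real.cos α)) := by
  obtain ⟨C, hC0, hC⟩ := exists_growth_besselI M
  refine ⟨C + C, by positivity, fun ν hν τ α hτ hα => ?_⟩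
  rw [add_mul]
  exact (norm_sub_le _ _).trans
    (add_le_add (hC (-ν) (by simpa using hν) τ α hτ hα) (hC ν hν τ α hτ hα))

/-! ### The Macdonald integral and the decay of `I_{-ν} - I_ν` -/

lemma integral_exp_image {E : Type*} [NormedAddCommGroup E] [NormedSpace ℝ E] {s : Set ℝ}
    (hs : MeasurableSet s) (g : ℝ → E) :
    ∫ x in Real.exp '' s, g x = ∫ t in s, Real.exp t • g (Real.exp t) := by
  rw [integral_image_eq_integral_abs_deriv_smul hs
    (fun x _ => (Real.hasDerivAt_exp x).hasDerivWithinAt) Real.exp_injective.injOn]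
  simp

lemma integrableOn_exp_image_iff {E : Type*} [NormedAddCommGroup E] [NormedSpace ℝ E] {s : Set ℝ}
    (hs : MeasurableSet s) (g : ℝ → E) :
    IntegrableOn g (Real.exp '' s) ↔ IntegrableOn (fun t => Real.exp t • g (Real.exp t)) s := by
  rw [integrableOn_image_iff_integrableOn_abs_deriv_smul hs
    (fun x _ => (Real.hasDerivAt_exp x).hasDerivWithinAt) Real.exp_injective.injOn]
  simp

lemma one_add_sq_div_two_le_cosh (t : ℝ) : 1 + t ^ 2 / 2 ≤ Real.cosh t := by
  have h1 : Real.cosh t = 1 + 2 * Real.sinh (t / 2) ^ 2 := by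
    conv_lhs => rw [show t = 2 * (t / 2) by ring, Real.cosh_two_mul, Real.cosh_sq]
    ring
  have h2 : (t / 2) ^ 2 ≤ Real.sinh (t / 2) ^ 2 := by
    rw [sq_le_sq, Real.abs_sinh]
    exact Real.self_le_sinh_iff.2 (abs_nonneg _)
  rw [h1]; nlinarith

lemma integrable_exp_quadratic {b : ℝ} (hb : 0 < b) (c : ℝ) :
    Integrable fun t : ℝ => Real.exp (-b * t ^ 2 + c * t) := by
  have h := (integrable_cexp_quadratic (b := b) (by simpa using hb) c 0).norm
  refine h.congr (Eventually.of_forall fun t => ?_)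
  simp only [Complex.norm_exp]
  congr 1
  norm_cast
  simp

/-- The bound cosh t ≥ 1 + t²/2 extracts the factor e^{-x} and leaves a Gaussian, which serves both
as an integrable majorant and as the source of the factor 1/√x. -/
lemma exp_neg_cosh_le {x : ℝ} (hx : 0 ≤ x) (σ t : ℝ) :
    Real.exp (-x * Real.cosh t + σ * t) ≤ Real.exp (-x) * Real.exp (-(x / 2) * t ^ 2 + σ * t) := by
  rw [← Real.exp_add]
  refine Real.exp_le_exp.2 ?_
  nlinarith [one_add_sq_div_two_le_cosh t]

lemma integrable_exp_neg_cosh {x : ℝ} (hx : 0 < x) (σ : ℝ) :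
    Integrable fun t : ℝ => Real.exp (-x * Real.cosh t + σ * t) := by
  refine ((integrable_exp_quadratic (half_pos hx) σ).const_mul (Real.exp (-x))).mono'
    (by fun_prop) (Eventually.of_forall fun t => ?_)
  rw [Real.norm_of_nonneg (Real.exp_pos _).le]
  exact exp_neg_cosh_le hx.le σ t

/-- The Macdonald integral `2 K_ν(x)`. -/
def macdonald (ν : ℂ) (x : ℝ) : ℂ := ∫ t : ℝ, Complex.exp (-x * Real.cosh t + ν * t)

lemma norm_macdonald_integrand (ν : ℂ) (x t : ℝ) :
    ‖Complex.exp (-x * Real.cosh t + ν * t)‖ = Real.exp (-x * Real.cosh t + ν.re * t) := by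
  rw [Complex.norm_exp]
  congr 1
  rw [show (-x * Real.cosh t + ν * t : ℂ) = ((-x * Real.cosh t : ℝ) : ℂ) + ν * t by push_cast; ring]
  simp

lemma integrable_macdonald (ν : ℂ) {x : ℝ} (hx : 0 < x) :
    Integrable fun t : ℝ => Complex.exp (-x * Real.cosh t + ν * t) := by
  refine (integrable_exp_neg_cosh hx ν.re).mono' (by fun_prop) (Eventually.of_forall fun t => ?_)
  rw [norm_macdonald_integrand]

lemma macdonald_neg (ν : ℂ) (x : ℝ) : macdonald (-ν) x = macdonald ν x := by
  unfold macdonald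
  rw [← integral_neg_eq_self]
  refine integral_congr_ae (Eventually.of_forall fun t => ?_)
  simp

lemma macdonald_exp_split (ν : ℂ) (x t : ℝ) :
    Real.cosh t * Complex.exp (-x * Real.cosh t + ν * t) =
      (Complex.exp (-x * Real.cosh t + (ν + 1) * t) +
        Complex.exp (-x * Real.cosh t + (ν - 1) * t)) / 2 := by
  rw [show (-x * Real.cosh t + (ν + 1) * t : ℂ) = (-x * Real.cosh t + ν * t) + t by ring,
    show (-x * Real.cosh t + (ν - 1) * t : ℂ) = (-x * Real.cosh t + ν * t) + -t by ring,
    Complex.exp_add _ (t : ℂ), Complex.exp_add _ (-t : ℂ), Complex.ofReal_cosh, Complex.cosh]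
  ring

lemma hasDerivAt_macdonald (ν : ℂ) {x : ℝ} (hx : 0 < x) :
    HasDerivAt (macdonald ν) (-(macdonald (ν + 1) x + macdonald (ν - 1) x) / 2) x := by
  have key := hasDerivAt_integral_of_dominated_loc_of_deriv_le (μ := volume)
    (F := fun (x : ℝ) (t : ℝ) => Complex.exp (-x * Real.cosh t + ν * t))
    (F' := fun (x : ℝ) (t : ℝ) => -(Real.cosh t * Complex.exp (-x * Real.cosh t + ν * t)))
    (x₀ := x) (s := Ioi (x / 2))
    (bound := fun t => (Real.exp (-(x / 2) * Real.cosh t + (ν.re + 1) * t) +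
      Real.exp (-(x / 2) * Real.cosh t + (ν.re - 1) * t)) / 2)
    (Ioi_mem_nhds (by linarith)) (Eventually.of_forall fun y => by fun_prop)
    (integrable_macdonald ν hx) (by fun_prop) ?_ ?_ ?_
  · refine key.2.congr_deriv ?_
    simp only [macdonald_exp_split]
    rw [integral_neg, integral_div, integral_add (integrable_macdonald _ hx)
      (integrable_macdonald _ hx)]
    unfold macdonald
    ring
  · refine Eventually.of_forall fun t y hy => ?_
    rw [macdonald_exp_split, norm_neg, norm_div]
    have h1 : ∀ σ : ℝ, Real.exp (-y * Real.cosh t + σ * t) ≤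
        Real.exp (-(x / 2) * Real.cosh t + σ * t) := fun σ => by
      refine Real.exp_le_exp.2 ?_
      have : x / 2 < y := hy
      nlinarith [Real.cosh_pos t]
    simp only [Complex.norm_ofNat]
    gcongr
    refine (norm_add_le _ _).trans ?_
    rw [norm_macdonald_integrand, norm_macdonald_integrand]
    simpa using add_le_add (h1 (ν.re + 1)) (h1 (ν.re - 1))
  · exact ((integrable_exp_neg_cosh (half_pos hx) _).add
      (integrable_exp_neg_cosh (half_pos hx) _)).div_const 2
  · refine Eventually.of_forall fun t y hy => ?_
    have h1 : HasDerivAt (fun y : ℝ => (-(y : ℂ) * Real.cosh t + ν * t)) (-(Real.cosh t : ℂ)) y := by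
      have := (((Complex.ofRealCLM.hasDerivAt (x := y)).neg.mul_const
        (Real.cosh t : ℂ))).add_const (ν * t)
      simpa using! this
    exact h1.cexp.congr_deriv (by ring)

/-- The integral over the line of the t-derivative of the integrand vanishes. -/
lemma macdonald_recurrence (ν : ℂ) {x : ℝ} (hx : 0 < x) :
    x * macdonald (ν - 1) x = x * macdonald (ν + 1) x - 2 * ν * macdonald ν x := by
  have h1 : ∀ t : ℝ, HasDerivAt (fun t : ℝ => Complex.exp (-x * Real.cosh t + ν * t))
      (ν * Complex.exp (-x * Real.cosh t + ν * t) -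
        x * ((Complex.exp (-x * Real.cosh t + (ν + 1) * t) -
        Complex.exp (-x * Real.cosh t + (ν - 1) * t)) / 2)) t := by
    intro t
    have h2 : HasDerivAt (fun t : ℝ => (-(x : ℂ) * Real.cosh t + ν * t))
        (-(x : ℂ) * Real.sinh t + ν) t := by
      have := ((Real.hasDerivAt_cosh t).ofReal_comp.const_mul (-(x : ℂ))).add
        ((Complex.ofRealCLM.hasDerivAt (x := t)).const_mul ν)
      simpa using! this
    refine h2.cexp.congr_deriv ?_
    rw [show (-x * Real.cosh t + (ν + 1) * t : ℂ) = (-x * Real.cosh t + ν * t) + t by ring,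
      show (-x * Real.cosh t + (ν - 1) * t : ℂ) = (-x * Real.cosh t + ν * t) + -t by ring,
      Complex.exp_add _ (t : ℂ), Complex.exp_add _ (-t : ℂ), Complex.ofReal_sinh, Complex.sinh]
    ring
  have i0 := integrable_macdonald ν hx
  have i1 := integrable_macdonald (ν + 1) hx
  have i2 := integrable_macdonald (ν - 1) hx
  have h3 := integral_eq_zero_of_hasDerivAt_of_integrable h1
    ((i0.const_mul ν).sub (((i1.sub i2).div_const 2).const_mul (x : ℂ))) i0
  have e1 : macdonald ν x = ∫ t : ℝ, Complex.exp (-x * Real.cosh t + ν * t) := rfl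
  have e2 : macdonald (ν + 1) x = ∫ t : ℝ, Complex.exp (-x * Real.cosh t + (ν + 1) * t) := rfl
  have e3 : macdonald (ν - 1) x = ∫ t : ℝ, Complex.exp (-x * Real.cosh t + (ν - 1) * t) := rfl
  have j1 : Integrable fun t : ℝ => x * ((Complex.exp (-x * Real.cosh t + (ν + 1) * t) -
      Complex.exp (-x * Real.cosh t + (ν - 1) * t)) / 2) :=
    ((i1.sub i2).div_const 2).const_mul (x : ℂ)
  rw [integral_sub (i0.const_mul ν) j1, integral_const_mul, integral_const_mul, integral_div, integral_sub i1 i2, ← e1, ← e2, ← e3] at h3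
  linear_combination (2 : ℂ) * h3

/-- Rescaling t by √x makes the Gaussian majorant independent of x; for x ≥ 1 the factor e^{Re ν t}
only becomes milder, and the Jacobian gives 1/√x. -/
lemma norm_macdonald_le (ν : ℂ) : ∃ C : ℝ, ∀ x : ℝ, 1 ≤ x →
    ‖macdonald ν x‖ ≤ C * (Real.exp (-x) * (Real.sqrt x)⁻¹) := by
  set σ := |ν.re| with hσ
  refine ⟨∫ s : ℝ, (Real.exp (-(1 / 2) * s ^ 2 + σ * s) + Real.exp (-(1 / 2) * s ^ 2 + -σ * s)),
    fun x hx => ?_⟩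
  have hx0 : 0 < x := by linarith
  have hs1 : 1 ≤ Real.sqrt x := Real.one_le_sqrt.2 hx
  have hs0 : 0 < Real.sqrt x := by linarith
  set B : ℝ → ℝ := fun s => Real.exp (-(1 / 2) * s ^ 2 + σ * s) +
    Real.exp (-(1 / 2) * s ^ 2 + -σ * s) with hB
  have hBi : Integrable B := (integrable_exp_quadratic (by norm_num) _).add
    (integrable_exp_quadratic (by norm_num) _)
  have h1 : ∀ t : ℝ, ‖Complex.exp (-x * Real.cosh t + ν * t)‖ ≤
      Real.exp (-x) * B (Real.sqrt x * t) := by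
    intro t
    rw [norm_macdonald_integrand]
    refine (exp_neg_cosh_le hx0.le _ t).trans ?_
    gcongr
    have e1 : -(x / 2) * t ^ 2 = -(1 / 2) * (Real.sqrt x * t) ^ 2 := by
      rw [mul_pow, Real.sq_sqrt hx0.le]; ring
    have e2 : ν.re * t ≤ σ * |Real.sqrt x * t| := by
      rw [abs_mul, abs_of_pos hs0]
      calc ν.re * t ≤ σ * |t| := by rw [hσ, ← abs_mul]; exact le_abs_self _
        _ ≤ σ * (Real.sqrt x * |t|) := by
            gcongr
            exact le_mul_of_one_le_left (abs_nonneg t) hs1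
    rw [e1]
    refine (Real.exp_le_exp.2 (add_le_add_right e2 _)).trans ?_
    simp only [hB]
    rcases abs_cases (Real.sqrt x * t) with ⟨h, _⟩ | ⟨h, _⟩ <;> rw [h]
    · exact le_add_of_nonneg_right (Real.exp_pos _).le
    · rw [mul_neg, neg_mul σ]
      exact le_add_of_nonneg_left (Real.exp_pos _).le
  have hBi' : Integrable fun t => Real.exp (-x) * B (Real.sqrt x * t) :=
    (hBi.comp_mul_left' hs0.ne').const_mul _
  refine (norm_integral_le_of_norm_le hBi' (Eventually.of_forall h1)).trans_eq ?_
  rw [integral_const_mul, Measure.integral_comp_mul_left, abs_of_pos (by positivity), smul_eq_mul]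
  ring

/-! ### Small arguments: the Macdonald integral as a Gamma integral, and its Wronskian with I_ν. -/

lemma integrable_exp_neg_exp {σ : ℝ} (hσ : 0 < σ) :
    Integrable fun s : ℝ => Real.exp (-Real.exp s + σ * s) := by
  have h := Real.GammaIntegral_convergent hσ
  rw [← Real.range_exp, ← image_univ, integrableOn_exp_image_iff MeasurableSet.univ,
    integrableOn_univ] at h
  refine h.congr (Eventually.of_forall fun s => ?_)
  simp only [smul_eq_mul]
  rw [← Real.exp_mul, ← Real.exp_add, ← Real.exp_add]
  ring_nf

lemma integral_cexp_neg_exp {ν : ℂ} (hν : 0 < ν.re) :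
    ∫ s : ℝ, Complex.exp (-Real.exp s + ν * s) = Complex.Gamma ν := by
  rw [Complex.Gamma_eq_integral hν, Complex.GammaIntegral, ← Real.range_exp, ← image_univ,
    integral_exp_image MeasurableSet.univ, Measure.restrict_univ]
  refine integral_congr_ae (Eventually.of_forall fun s => ?_)
  simp only [Complex.real_smul]
  rw [Complex.cpow_def_of_ne_zero (by exact_mod_cast Real.exp_ne_zero s),
    ← Complex.ofReal_log (Real.exp_pos s).le, Real.log_exp, Complex.ofReal_exp (-Real.exp s),
    ← Complex.exp_add, Complex.ofReal_exp s, ← Complex.exp_add]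
  push_cast
  ring_nf

/-- Translating t by log(x/2), with x = e^τ, turns x cosh t into e^s + (x/2)² e^{-s}; as x → 0 only
the integrand of Γ(ν) remains. -/
lemma macdonald_eq_shift (ν : ℂ) (τ : ℝ) : macdonald ν (Real.exp τ) =
    Complex.exp (-ν * (τ - Real.log 2)) * ∫ s : ℝ, Complex.exp
      (-Real.exp s - Real.exp (2 * (τ - Real.log 2)) * Real.exp (-s) + ν * s) := by
  unfold macdonald
  rw [← integral_sub_right_eq_self _ (τ - Real.log 2), ← integral_const_mul]
  refine integral_congr_ae (Eventually.of_forall fun s => ?_)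
  simp only
  rw [← Complex.exp_add]
  congr 1
  have : Real.exp τ * Real.cosh (s - (τ - Real.log 2)) =
      Real.exp s + Real.exp (2 * (τ - Real.log 2)) * Real.exp (-s) := by
    have h2 : Real.exp τ = 2 * Real.exp (τ - Real.log 2) := by
      rw [Real.exp_sub, Real.exp_log two_pos]; ring
    rw [Real.cosh_eq, h2, neg_sub, Real.exp_sub s, Real.exp_sub _ s, two_mul (τ - _), Real.exp_add,
      Real.exp_neg]
    have := Real.exp_ne_zero (τ - Real.log 2)
    have := Real.exp_ne_zero s
    field_simp
  rw [neg_mul, ← Complex.ofReal_mul, this]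
  push_cast
  ring

lemma tendsto_macdonald {ν : ℂ} (hν : 0 < ν.re) :
    Tendsto (fun τ : ℝ => Complex.exp (ν * (τ - Real.log 2)) * macdonald ν (Real.exp τ)) atBot
      (𝓝 (Complex.Gamma ν)) := by
  have h : ∀ τ : ℝ, Complex.exp (ν * (τ - Real.log 2)) * macdonald ν (Real.exp τ) =
      ∫ s : ℝ, Complex.exp
      (-Real.exp s - Real.exp (2 * (τ - Real.log 2)) * Real.exp (-s) + ν * s) := fun τ => by
    rw [macdonald_eq_shift, ← mul_assoc, ← Complex.exp_add, neg_mul, add_neg_cancel,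
      Complex.exp_zero, one_mul]
  simp_rw [h, ← integral_cexp_neg_exp hν]
  refine tendsto_integral_filter_of_dominated_convergence
    (fun s => Real.exp (-Real.exp s + ν.re * s)) (Eventually.of_forall fun τ => by fun_prop)
    (Eventually.of_forall fun τ => Eventually.of_forall fun s => ?_)
    (integrable_exp_neg_exp hν) (Eventually.of_forall fun s => ?_)
  · rw [Complex.norm_exp]
    refine Real.exp_le_exp.2 ?_
    rw [show (-Real.exp s - Real.exp (2 * (τ - Real.log 2)) * Real.exp (-s) + ν * s : ℂ) =
      ((-Real.exp s - Real.exp (2 * (τ - Real.log 2)) * Real.exp (-s) : ℝ) : ℂ) + ν * s by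
        push_cast; ring]
    have : 0 < Real.exp (2 * (τ - Real.log 2)) * Real.exp (-s) := by positivity
    rw [Complex.add_re, Complex.ofReal_re, Complex.re_mul_ofReal]
    linarith
  · have h1 : Tendsto (fun τ : ℝ => Real.exp (2 * (τ - Real.log 2))) atBot (𝓝 0) := by
      refine Real.tendsto_exp_atBot.comp ?_
      exact (tendsto_atBot_add_const_right _ (-Real.log 2) tendsto_id).const_mul_atBot two_pos
    have h2 : Tendsto (fun τ : ℝ => ((Real.exp (2 * (τ - Real.log 2)) : ℝ) : ℂ)) atBot (𝓝 0) := by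
      exact_mod_cast (Complex.continuous_ofReal.tendsto 0).comp h1
    have h3 := ((h2.mul_const ((Real.exp (-s) : ℝ) : ℂ)).const_sub (-(Real.exp s : ℂ))).add_const
      (ν * s)
    have h4 := (Complex.continuous_exp.tendsto _).comp h3
    simpa using! h4

lemma hasDerivAt_macdonald_exp (ν : ℂ) (τ : ℝ) :
    HasDerivAt (fun τ : ℝ => macdonald ν (Real.exp τ))
      (ν * macdonald ν (Real.exp τ) - Real.exp τ * macdonald (ν + 1) (Real.exp τ)) τ := by
  have h := (hasDerivAt_macdonald ν (Real.exp_pos τ)).scomp τ (Real.hasDerivAt_exp τ)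
  refine h.congr_deriv ?_
  have := macdonald_recurrence ν (Real.exp_pos τ)
  rw [Complex.real_smul]
  linear_combination (-1 / 2 : ℂ) * this

lemma hasDerivAt_besselI_ofReal (ν : ℂ) (τ : ℝ) :
    HasDerivAt (fun τ : ℝ => besselI ν τ) (besselI' ν τ) τ :=
  (hasDerivAt_besselI ν τ).comp_ofReal

lemma tendsto_exp_mul_of_re_pos {s : ℂ} (hs : 0 < s.re) :
    Tendsto (fun τ : ℝ => Complex.exp (s * (τ - Real.log 2))) atBot (𝓝 0) := by
  rw [tendsto_zero_iff_norm_tendsto_zero]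
  have h : ∀ τ : ℝ, ‖Complex.exp (s * (τ - Real.log 2))‖ = Real.exp (s.re * (τ - Real.log 2)) := by
    intro τ
    rw [Complex.norm_exp, ← Complex.ofReal_sub, Complex.re_mul_ofReal]
  simp_rw [h]
  refine Real.tendsto_exp_atBot.comp ?_
  exact (tendsto_atBot_add_const_right _ (-Real.log 2) tendsto_id).const_mul_atBot hs

lemma tendsto_besselI_normalized (ν : ℂ) :
    Tendsto (fun τ : ℝ => besselS ν (-Complex.exp (2 * (τ - Real.log 2)))) atBot
      (𝓝 (Complex.Gamma (ν + 1))⁻¹) := by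
  have h1 : besselS ν 0 = (Complex.Gamma (ν + 1))⁻¹ := by
    unfold besselS
    rw [tsum_eq_single 0]
    · simp [besselTerm]
    · intro n hn; simp [besselTerm, hn]
  rw [← h1]
  have h2 := (tendsto_exp_mul_of_re_pos (s := 2) (by simp)).neg
  rw [neg_zero] at h2
  have h3 : Continuous (besselS ν) :=
    continuous_iff_continuousAt.2 fun q => (hasDerivAt_besselS ν q).continuousAt
  exact (h3.tendsto 0).comp h2

/-- Replaces an order of arbitrary real part by a positive real order, to which `tendsto_macdonald`
applies. The two exponentials e^{σt} and e^{-σt} contribute equally, hence the factor 2. -/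
lemma norm_macdonald_le_real {ν : ℂ} {σ : ℝ} (h : |ν.re| ≤ σ) {x : ℝ} (hx : 0 < x) :
    ‖macdonald ν x‖ ≤ 2 * ‖macdonald σ x‖ := by
  have h1 : ∀ s : ℝ, macdonald s x = ((∫ t : ℝ, Real.exp (-x * Real.cosh t + s * t) : ℝ) : ℂ) := by
    intro s
    rw [macdonald, ← integral_complex_ofReal]
    refine integral_congr_ae (Eventually.of_forall fun t => ?_)
    push_cast; rfl
  have hpos : ∀ s : ℝ, ‖macdonald s x‖ = ∫ t : ℝ, Real.exp (-x * Real.cosh t + s * t) := by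
    intro s
    rw [h1, Complex.norm_real, Real.norm_of_nonneg]
    exact integral_nonneg fun t => (Real.exp_pos _).le
  have h2 : ‖macdonald (σ : ℂ) x‖ = ∫ t : ℝ, Real.exp (-x * Real.cosh t + -σ * t) := by
    rw [← hpos (-σ)]
    push_cast
    rw [macdonald_neg]
  rw [two_mul]
  nth_rewrite 1 [hpos σ]
  rw [h2, ← integral_add (integrable_exp_neg_cosh hx σ) (integrable_exp_neg_cosh hx (-σ))]
  refine norm_integral_le_of_norm_le ((integrable_exp_neg_cosh hx σ).add
    (integrable_exp_neg_cosh hx (-σ))) (Eventually.of_forall fun t => ?_)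
  rw [norm_macdonald_integrand]
  have hσ := abs_le.1 h
  rcases le_total 0 t with ht | ht
  · refine le_trans (Real.exp_le_exp.2 ?_) (le_add_of_nonneg_right (Real.exp_pos _).le)
    nlinarith
  · refine le_trans (Real.exp_le_exp.2 ?_) (le_add_of_nonneg_left (Real.exp_pos _).le)
    nlinarith

/-- The derivative vanishes by the recurrences, so the value is the limit as x → 0. There x I_ν ·
2K_{ν+1} tends to 2 by the leading terms, and the other product tends to 0. -/
lemma besselI_macdonald_wronskian {ν : ℂ} (hν : |ν.re| < 1) (τ : ℝ) :
    Real.exp τ * (besselI ν τ * macdonald (ν + 1) (Real.exp τ) +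
      besselI (ν + 1) τ * macdonald ν (Real.exp τ)) = 2 := by
  have hν' := abs_lt.1 hν
  set A : ℝ → ℂ := fun τ => Real.exp τ * (besselI ν τ * macdonald (ν + 1) (Real.exp τ) +
      besselI (ν + 1) τ * macdonald ν (Real.exp τ)) with hA
  have hd : ∀ τ, HasDerivAt A 0 τ := by
    intro τ
    have h := (Real.hasDerivAt_exp τ).ofReal_comp.mul
      (((hasDerivAt_besselI_ofReal ν τ).mul (hasDerivAt_macdonald_exp (ν + 1) τ)).add
        ((hasDerivAt_besselI_ofReal (ν + 1) τ).mul (hasDerivAt_macdonald_exp ν τ)))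
    refine h.congr_deriv ?_
    have h1 := macdonald_recurrence (ν + 1) (Real.exp_pos τ)
    rw [add_sub_cancel_right] at h1
    simp only [Pi.add_apply, Pi.mul_apply]
    rw [besselI'_eq (ν + 1), besselI', add_sub_cancel_right, ← Complex.ofReal_exp]
    linear_combination ((Real.exp τ : ℂ) * besselI ν τ) * h1
  have hconst : ∀ τ, A τ = A 0 := fun τ => is_const_of_deriv_eq_zero
    (fun τ => (hd τ).differentiableAt) (fun τ => (hd τ).deriv) τ 0
  have hlim : Tendsto A atBot (𝓝 2) := by
    have hΓ : Complex.Gamma (ν + 1) ≠ 0 := Complex.Gamma_ne_zero_of_re_pos (by simp; linarith)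
    have t1 := (tendsto_besselI_normalized ν).mul
      (tendsto_macdonald (ν := ν + 1) (by simp; linarith))
    rw [inv_mul_cancel₀ hΓ] at t1
    -- An exponent between |Re ν| and 1: then 2K_ν = O(x^{-σ}), while x I_{ν+1} is of order x^{Re ν
    -- + 2}, and Re ν + 2 - σ > 0.
    set σ : ℝ := (1 + |ν.re|) / 2 with hσ
    have a0 := abs_nonneg ν.re
    have t2 : Tendsto (fun τ : ℝ => Complex.exp ((ν + 1 + 1 - σ) * (τ - Real.log 2)) *
        besselS (ν + 1) (-Complex.exp (2 * (τ - Real.log 2))) *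
        (Complex.exp (σ * (τ - Real.log 2)) * macdonald ν (Real.exp τ))) atBot (𝓝 0) := by
      have u1 := (tendsto_exp_mul_of_re_pos (s := ν + 1 + 1 - σ) (by
        simp; rw [hσ]; linarith [neg_abs_le ν.re])).mul (tendsto_besselI_normalized (ν + 1))
      rw [zero_mul] at u1
      refine u1.zero_mul_isBoundedUnder_le ?_
      have u2 := (tendsto_macdonald (ν := (σ : ℂ)) (by simp; linarith)).norm.const_mul 2
      refine u2.isBoundedUnder_le.mono_le (Eventually.of_forall fun τ => ?_)
      simp only [Function.comp, norm_mul]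
      have := norm_macdonald_le_real (ν := ν) (σ := σ) (by linarith) (Real.exp_pos τ)
      calc _ ≤ ‖Complex.exp (σ * (τ - Real.log 2))‖ * (2 * ‖macdonald σ (Real.exp τ)‖) := by
            gcongr
        _ = _ := by ring
    have t3 := (t1.const_mul 2).add (t2.const_mul 2)
    rw [mul_one, mul_zero, add_zero] at t3
    refine t3.congr fun τ => ?_
    simp only [hA]
    have hE : ((Real.exp τ : ℝ) : ℂ) = 2 * Complex.exp (τ - Real.log 2) := by
      rw [exp_two_sub_log]; push_cast; rfl
    rw [hE, besselI_eq, besselI_eq, show (ν + 1 + 1 - σ) * (τ - Real.log 2 : ℂ) =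
      (ν + 1) * (τ - Real.log 2) + (τ - Real.log 2) + -(σ * (τ - Real.log 2)) by ring,
      Complex.exp_add, Complex.exp_add, Complex.exp_neg, add_mul ν, one_mul, Complex.exp_add]
    have := Complex.exp_ne_zero (σ * (τ - Real.log 2))
    field_simp
  have := tendsto_nhds_unique hlim (tendsto_const_nhds.congr fun τ => (hconst τ).symm)
  exact (hconst τ).trans this.symm

/-- `√x eˣ (I_{-ν} - I_ν)(x)` is bounded for real `x ≥ 1`. -/
def IsRecessive (ν : ℂ) : Prop :=
  ∃ C : ℝ, ∀ τ : ℝ, 0 ≤ τ → ‖besselD ν τ‖ ≤ C * (Real.exp (-τ / 2) * Real.exp (-Real.exp τ))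

/-- I_{-ν} - I_ν is a constant multiple of K_ν. Eliminating between the Wronskian relations for ν
and for -ν expresses the multiple through B, the Wronskian of I_ν and I_{-ν}, which is constant; its
value is not needed. -/
lemma isRecessive_of_re_mem_Ioo {ν : ℂ} (h0 : 0 < ν.re) (h1 : ν.re < 1) : IsRecessive ν := by
  set B : ℝ → ℂ := fun τ => Real.exp τ *
    (besselI (-ν) τ * besselI (ν + 1) τ - besselI ν τ * besselI (-ν - 1) τ) with hB
  have hd : ∀ τ, HasDerivAt B 0 τ := by
    intro τ
    have h := (Real.hasDerivAt_exp τ).ofReal_comp.mul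
      (((hasDerivAt_besselI_ofReal (-ν) τ).mul (hasDerivAt_besselI_ofReal (ν + 1) τ)).sub
        ((hasDerivAt_besselI_ofReal ν τ).mul (hasDerivAt_besselI_ofReal (-ν - 1) τ)))
    refine h.congr_deriv ?_
    simp only [Pi.sub_apply, Pi.mul_apply]
    rw [besselI'_eq (ν + 1), besselI'_eq (-ν)]
    simp only [besselI', add_sub_cancel_right, sub_add_cancel, ← Complex.ofReal_exp]
    ring
  have hconst : ∀ τ, B τ = B 0 := fun τ => is_const_of_deriv_eq_zero
    (fun τ => (hd τ).differentiableAt) (fun τ => (hd τ).deriv) τ 0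
  obtain ⟨C, hC⟩ := norm_macdonald_le ν
  refine ⟨‖B 0‖ * C / 2, fun τ hτ => ?_⟩
  have key : 2 * besselD ν τ = B 0 * macdonald ν (Real.exp τ) := by
    have w1 := besselI_macdonald_wronskian (ν := ν) (by rw [abs_lt]; constructor <;> linarith) τ
    have w2 := besselI_macdonald_wronskian (ν := -ν)
      (by rw [abs_lt, Complex.neg_re]; constructor <;> linarith) τ
    rw [macdonald_neg, show -ν + 1 = -(ν - 1) by ring, macdonald_neg,
      show -(ν - 1) = -ν + 1 by ring] at w2
    have r1 := macdonald_recurrence ν (Real.exp_pos τ)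
    have r2 := besselI_recurrence (-ν) τ
    rw [← Complex.ofReal_exp] at r2
    rw [← hconst τ, besselD]
    simp only [hB]
    have hx : ((Real.exp τ : ℝ) : ℂ) ≠ 0 := by exact_mod_cast Real.exp_ne_zero τ
    linear_combination (-besselI (-ν) τ) * w1 + (besselI ν τ) * w2 -
      (besselI ν τ * besselI (-ν) τ) * r1 + (besselI ν τ * macdonald ν (Real.exp τ)) * r2
  have h2 : ‖besselD ν τ‖ = ‖B 0‖ * ‖macdonald ν (Real.exp τ)‖ / 2 := by
    have := congrArg norm key
    rw [norm_mul, norm_mul] at this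
    simp at this
    linarith
  rw [h2]
  have h3 := hC (Real.exp τ) (Real.one_le_exp hτ)
  have h4 : (Real.sqrt (Real.exp τ))⁻¹ = Real.exp (-τ / 2) := by
    rw [Real.sqrt_eq_rpow, ← Real.exp_mul, ← Real.exp_neg]; ring_nf
  rw [h4] at h3
  calc _ ≤ ‖B 0‖ * (C * (Real.exp (-Real.exp τ) * Real.exp (-τ / 2))) / 2 := by gcongr
    _ = _ := by ring

lemma IsRecessive.neg {ν : ℂ} (h : IsRecessive ν) : IsRecessive (-ν) := by
  obtain ⟨C, hC⟩ := h
  refine ⟨C, fun τ hτ => ?_⟩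
  have : besselD (-ν) τ = -besselD ν τ := by unfold besselD; rw [neg_neg]; ring
  rw [this, norm_neg]
  exact hC τ hτ

lemma IsRecessive.succ {ν : ℂ} (h : IsRecessive ν) (h' : IsRecessive (ν - 1)) :
    IsRecessive (ν + 1) := by
  obtain ⟨C, hC⟩ := h
  obtain ⟨C', hC'⟩ := h'
  refine ⟨C' + 2 * ‖ν‖ * C, fun τ hτ => ?_⟩
  have h1 := besselD_succ ν τ
  have hx : Complex.exp τ ≠ 0 := Complex.exp_ne_zero _
  have h2 : besselD (ν + 1) τ = besselD (ν - 1) τ - Complex.exp (-τ) * (2 * ν * besselD ν τ) := by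
    rw [Complex.exp_neg]
    field_simp
    linear_combination h1
  have hC0 := (norm_nonneg _).trans (hC τ hτ)
  rw [h2, add_mul]
  refine (norm_sub_le _ _).trans (add_le_add (hC' τ hτ) ?_)
  rw [norm_mul, norm_mul, norm_mul, Complex.norm_exp]
  have h3 : Real.exp (-(τ : ℂ)).re ≤ 1 := by rw [Real.exp_le_one_iff]; simpa using hτ
  calc _ ≤ 1 * (‖(2 : ℂ)‖ * ‖ν‖ * (C * (Real.exp (-τ / 2) * Real.exp (-Real.exp τ)))) := by
        gcongr
        exact hC τ hτ
    _ = _ := by simp; ring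

/-- The three-term recurrence needs two consecutive orders. The initial pair μ, μ - 1 with 0 < Re μ
< 1 comes from the strip, the second through 1 - μ and the symmetry ν ↦ -ν. -/
lemma isRecessive_of_re_notMem_int {ν : ℂ} (h : ∀ n : ℤ, ν.re ≠ n) : IsRecessive ν := by
  have key : ∀ n : ℕ, ∀ μ : ℂ, 0 < μ.re → μ.re < 1 → IsRecessive (μ + n) ∧ IsRecessive (μ + n - 1) := by
    intro n
    induction n with
    | zero =>
      intro μ h0 h1
      refine ⟨by simpa using isRecessive_of_re_mem_Ioo h0 h1, ?_⟩
      have := (isRecessive_of_re_mem_Ioo (ν := 1 - μ) (by simpa using h1) (by simpa using h0)).neg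
      simpa using this
    | succ n ih =>
      intro μ h0 h1
      obtain ⟨i1, i2⟩ := ih μ h0 h1
      refine ⟨?_, ?_⟩
      · have := i1.succ i2
        push_cast
        rwa [← add_assoc]
      · push_cast
        rwa [← add_assoc, add_sub_cancel_right]
  have pos : ∀ ν : ℂ, (∀ n : ℤ, ν.re ≠ n) → 0 < ν.re → IsRecessive ν := by
    intro ν h h0
    set n := ⌊ν.re⌋₊ with hn
    have h1 := Nat.floor_le h0.le
    have h2 := Nat.lt_floor_add_one ν.re
    have h3 : ν.re ≠ n := by exact_mod_cast h n
    have := (key n (ν - n) (by simp; exact lt_of_le_of_ne h1 h3.symm)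
      (by simp; linarith)).1
    simpa using this
  rcases lt_trichotomy ν.re 0 with h0 | h0 | h0
  · have := (pos (-ν) (fun n hn => h (-n) (by simp at hn ⊢; linarith)) (by simpa using h0)).neg
    simpa using this
  · exact absurd h0 (by simpa using h 0)
  · exact pos ν h h0

/-- Phragmén–Lindelöf in the half plane Re z ≥ 1, applied to √z e^z (I_{-ν} - I_ν)(z). It has
exponential type and is bounded on the boundary line by the growth estimate; on the real axis mere
boundedness is required. The resulting constant comes from the boundary line alone, so it is uniform
in ν although the bound in `IsRecessive` is not. -/
lemma exists_decay_besselD_of_re_notMem_int (M : ℝ) : ∃ C : ℝ, 0 ≤ C ∧ ∀ ν : ℂ, ‖ν‖ ≤ M →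
    (∀ n : ℤ, ν.re ≠ n) → ∀ τ α : ℝ, 0 ≤ τ → |α| ≤ π / 2 → ‖besselD ν (τ + α * Complex.I)‖ ≤
      C * (Real.exp (-τ / 2) * Real.exp (-(Real.exp τ * Real.cos α))) := by
  obtain ⟨C, hC0, hC⟩ := exists_growth_besselD M
  refine ⟨C * Real.exp 2, by positivity, fun ν hν hint τ α hτ hα => ?_⟩
  -- For Re z ≤ 1 growth is as good as decay, since e^{Re z} ≤ e² e^{-Re z}.
  rcases le_total 1 (Real.exp τ * Real.cos α) with h1 | h1
  swap
  · refine (hC ν hν τ α hτ hα).trans ?_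
    rw [mul_assoc]
    refine mul_le_mul_of_nonneg_left ?_ hC0
    rw [mul_left_comm]
    refine mul_le_mul_of_nonneg_left ?_ (Real.exp_pos _).le
    rw [← Real.exp_add]
    exact Real.exp_le_exp.2 (by linarith)
  -- With z = V + 1 the logarithm is holomorphic and |z| ≥ 1 on the whole closed half plane Re V ≥
  -- 0.
  set f : ℂ → ℂ := fun V => Complex.exp (V + 1 + Complex.log (V + 1) / 2) *
    besselD ν (Complex.log (V + 1)) with hf
  have hpolar : ∀ V : ℂ, Complex.log (V + 1) = (Real.log ‖V + 1‖ : ℝ) +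
      ((V + 1).arg : ℝ) * Complex.I := fun V => by rw [Complex.log]
  have hnorm : ∀ V : ℂ, 0 ≤ V.re → ‖f V‖ = Real.exp ((V.re + 1) + Real.log ‖V + 1‖ / 2) *
      ‖besselD ν ((Real.log ‖V + 1‖ : ℝ) + ((V + 1).arg : ℝ) * Complex.I)‖ := by
    intro V hV
    simp only [hf]
    rw [norm_mul, Complex.norm_exp, ← hpolar]
    congr 2
    simp [Complex.log_re]
  have hge : ∀ V : ℂ, 0 ≤ V.re → 1 ≤ ‖V + 1‖ := fun V hV => by
    refine le_trans ?_ (Complex.re_le_norm _)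
    simpa using hV
  have hre : ∀ V : ℂ, 0 ≤ V.re → ‖V + 1‖ * Real.cos (V + 1).arg = V.re + 1 := fun V hV => by
    rw [Complex.norm_mul_cos_arg]; simp
  have harg : ∀ V : ℂ, 0 ≤ V.re → |(V + 1).arg| ≤ π / 2 := fun V hV =>
    Complex.abs_arg_le_pi_div_two_iff.2 (by simp; linarith)
  have hgrow : ∀ V : ℂ, 0 ≤ V.re → ‖f V‖ ≤ C * Real.exp (2 * (V.re + 1)) := by
    intro V hV
    have h2 := hge V hV
    rw [hnorm V hV]
    have h3 := hC ν hν (Real.log ‖V + 1‖) (V + 1).arg (Real.log_nonneg h2) (harg V hV)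
    rw [Real.exp_log (by linarith), hre V hV] at h3
    refine (mul_le_mul_of_nonneg_left h3 (Real.exp_pos _).le).trans_eq ?_
    rw [mul_left_comm, ← Real.exp_add, ← Real.exp_add]
    ring_nf
  have hd : DiffContOnCl ℂ f {V | 0 < V.re} := by
    refine DifferentiableOn.diffContOnCl fun V hV => ?_
    have hV' : 0 ≤ V.re := by
      have : closure {V : ℂ | 0 < V.re} ⊆ {V : ℂ | 0 ≤ V.re} :=
        closure_minimal (fun V (hV : 0 < V.re) => hV.le) (isClosed_le continuous_const Complex.continuous_re)
      exact this hV
    have hs : V + 1 ∈ Complex.slitPlane := Or.inl (by simp; linarith)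
    have hl : DifferentiableAt ℂ (fun V => Complex.log (V + 1)) V :=
      (by fun_prop : DifferentiableAt ℂ (fun V : ℂ => V + 1) V).clog hs
    have hb : DifferentiableAt ℂ (fun V => besselD ν (Complex.log (V + 1))) V :=
      (hasDerivAt_besselD ν _).differentiableAt.comp V hl
    refine DifferentiableAt.differentiableWithinAt ?_
    simp only [hf]
    fun_prop
  have hPL : ∀ V : ℂ, 0 ≤ V.re → ‖f V‖ ≤ C * Real.exp 2 := by
    intro V hV
    refine PhragmenLindelof.right_half_plane_of_bounded_on_real hd ⟨1, by norm_num, 2, ?_⟩ ?_ ?_ hV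
    · refine Asymptotics.IsBigO.of_bound (C * Real.exp 2) ?_
      refine eventually_inf_principal.2 (Eventually.of_forall fun V (hV : 0 < V.re) => ?_)
      refine (hgrow V hV.le).trans ?_
      rw [Real.norm_of_nonneg (Real.exp_pos _).le, Real.rpow_one, mul_assoc, ← Real.exp_add]
      gcongr
      linarith [Complex.re_le_norm V]
    · obtain ⟨C', hC'⟩ := isRecessive_of_re_notMem_int hint
      refine isBoundedUnder_of_eventually_le (a := C') ?_
      filter_upwards [eventually_ge_atTop (0 : ℝ)] with x hx
      rw [hnorm x (by simpa using hx)]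
      have e1 : ((x : ℂ) + 1) = ((x + 1 : ℝ) : ℂ) := by push_cast; rfl
      have e2 : ‖(x : ℂ) + 1‖ = x + 1 := by
        rw [e1, Complex.norm_real, Real.norm_of_nonneg (by linarith)]
      rw [e2, e1, Complex.arg_ofReal_of_nonneg (by linarith)]
      have := hC' (Real.log (x + 1)) (Real.log_nonneg (by linarith))
      rw [Real.exp_log (by linarith)] at this
      simp only [Complex.ofReal_zero, zero_mul, add_zero, Complex.ofReal_re]
      refine (mul_le_mul_of_nonneg_left this (Real.exp_pos _).le).trans_eq ?_
      rw [mul_left_comm, ← Real.exp_add, ← Real.exp_add]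
      ring_nf
      simp
    · intro y
      refine (hgrow (y * Complex.I) (by simp)).trans_eq ?_
      simp
  have hW := hPL (Complex.exp (τ + α * Complex.I) - 1) (by simp [Complex.exp_re]; linarith)
  have hα' : |α| < π := by linarith [Real.pi_pos]
  have hlog : Complex.log (Complex.exp (τ + α * Complex.I)) = τ + α * Complex.I :=
    Complex.log_exp (by simpa using (abs_lt.1 hα').1) (by simpa using (abs_lt.1 hα').2.le)
  simp only [hf, sub_add_cancel, hlog] at hW
  rw [norm_mul, Complex.norm_exp] at hW
  have e3 : (Complex.exp (τ + α * Complex.I) + (τ + α * Complex.I) / 2).re =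
      Real.exp τ * Real.cos α + τ / 2 := by
    simp [Complex.exp_re]
  rw [e3] at hW
  have e4 : ‖besselD ν (τ + α * Complex.I)‖ = Real.exp (-(Real.exp τ * Real.cos α + τ / 2)) *
      (Real.exp (Real.exp τ * Real.cos α + τ / 2) * ‖besselD ν (τ + α * Complex.I)‖) := by
    rw [← mul_assoc, ← Real.exp_add]; simp
  rw [e4]
  refine (mul_le_mul_of_nonneg_left hW (Real.exp_pos _).le).trans_eq ?_
  rw [mul_comm, ← Real.exp_add (-τ / 2)]
  ring_nf

/-- The constant is uniform, so orders with integral real part are reached by continuity from ν + ε;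
for small ε > 0 these have non-integral real part and norm at most M + 1. -/
lemma exists_decay_besselD (M : ℝ) : ∃ C : ℝ, 0 ≤ C ∧ ∀ ν : ℂ, ‖ν‖ ≤ M →
    ∀ τ α : ℝ, 0 ≤ τ → |α| ≤ π / 2 → ‖besselD ν (τ + α * Complex.I)‖ ≤
      C * (Real.exp (-τ / 2) * Real.exp (-(Real.exp τ * Real.cos α))) := by
  obtain ⟨C, hC0, hC⟩ := exists_decay_besselD_of_re_notMem_int (M + 1)
  refine ⟨C, hC0, fun ν hν τ α hτ hα => ?_⟩
  have hc : Continuous fun ε : ℝ => ‖besselD (ν + ε) (τ + α * Complex.I)‖ :=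
    (continuous_besselD.comp (f := fun ε : ℝ => (ν + ε, (τ + α * Complex.I : ℂ)))
      (by fun_prop)).norm
  have ht : Tendsto (fun ε : ℝ => ‖besselD (ν + ε) (τ + α * Complex.I)‖) (𝓝[>] 0)
      (𝓝 ‖besselD ν (τ + α * Complex.I)‖) := by
    have := (hc.tendsto 0).mono_left (nhdsWithin_le_nhds (s := Ioi 0))
    simpa using this
  refine le_of_tendsto ht ?_
  have hfl : 0 < min 1 ((⌊ν.re⌋ : ℝ) + 1 - ν.re) := by
    have := Int.lt_floor_add_one ν.re
    exact lt_min one_pos (by linarith)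
  filter_upwards [Ioo_mem_nhdsGT hfl] with ε hε
  refine hC (ν + ε) ?_ ?_ τ α hτ hα
  · refine (norm_add_le _ _).trans (add_le_add hν ?_)
    rw [Complex.norm_real, Real.norm_of_nonneg hε.1.le]
    exact (hε.2.trans_le (min_le_left _ _)).le
  · intro n hn
    simp only [Complex.add_re, Complex.ofReal_re] at hn
    have h1 := Int.floor_le ν.re
    have h2 : ν.re + ε < ⌊ν.re⌋ + 1 := by linarith [hε.2.trans_le (min_le_right _ _)]
    have h3 : (⌊ν.re⌋ : ℝ) < n := by linarith [hε.1]
    have h4 : (n : ℝ) < ((⌊ν.re⌋ + 1 : ℤ) : ℝ) := by push_cast; linarith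
    have h3' : ⌊ν.re⌋ < n := by exact_mod_cast h3
    have h4' : n < ⌊ν.re⌋ + 1 := by exact_mod_cast h4
    omega

/-! ### Products of Bessel functions at conjugate points -/

/-- `J_{-ν₁}(s) J_{-ν₂}(s̄) - J_{ν₁}(s) J_{ν₂}(s̄)` on the logarithmic plane. -/
def besselP (ν₁ ν₂ s : ℂ) : ℂ :=
  besselJ (-ν₁) s * besselJ (-ν₂) (starRingEnd ℂ s) - besselJ ν₁ s * besselJ ν₂ (starRingEnd ℂ s)

/-- The holomorphic derivative of `besselP`. -/
def besselP' (ν₁ ν₂ s : ℂ) : ℂ :=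
  besselJ' (-ν₁) s * besselJ (-ν₂) (starRingEnd ℂ s) -
    besselJ' ν₁ s * besselJ ν₂ (starRingEnd ℂ s)

lemma besselJ_sub_pi_mul_I (ν w : ℂ) :
    besselJ ν (w - π * Complex.I) = Complex.exp (-ν * (π * Complex.I)) * besselJ ν w := by
  have := besselJ_add_pi_mul_I ν (w - π * Complex.I)
  rw [sub_add_cancel] at this
  rw [this, ← mul_assoc, ← Complex.exp_add]
  simp

lemma besselJ_sub_pi_div_two (ν w : ℂ) : besselJ ν (w - π / 2 * Complex.I) =
    Complex.exp (-ν * (π / 2 * Complex.I)) * besselI ν w := by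
  rw [show w - π / 2 * Complex.I = w + π / 2 * Complex.I - π * Complex.I by ring,
    besselJ_sub_pi_mul_I, besselJ_add_pi_div_two, ← mul_assoc, ← Complex.exp_add]
  congr 2; ring

lemma besselJ'_add_pi_mul_I (ν w : ℂ) :
    besselJ' ν (w + π * Complex.I) = Complex.exp (ν * (π * Complex.I)) * besselJ' ν w := by
  unfold besselJ'
  rw [besselJ_add_pi_mul_I, besselJ_add_pi_mul_I, add_mul ν, one_mul, Complex.exp_add,
    Complex.exp_add, Complex.exp_pi_mul_I]
  ring

lemma besselJ'_add_pi_div_two (ν w : ℂ) : besselJ' ν (w + π / 2 * Complex.I) =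
    Complex.exp (ν * (π / 2 * Complex.I)) * besselI' ν w := by
  unfold besselJ' besselI'
  rw [besselJ_add_pi_div_two, besselJ_add_pi_div_two, add_mul ν, one_mul, Complex.exp_add,
    Complex.exp_add, exp_pi_div_two_mul_I]
  linear_combination (-Complex.exp w * Complex.exp (ν * (π / 2 * Complex.I)) * besselI (ν + 1) w) *
    Complex.I_sq

lemma exp_int_mul_pi_mul_I (d : ℤ) : Complex.exp (d * (π * Complex.I)) = (-1) ^ d := by
  rw [Complex.exp_int_mul, Complex.exp_pi_mul_I]

lemma exp_neg_int_mul_pi_mul_I (d : ℤ) : Complex.exp (-(d * (π * Complex.I))) = (-1) ^ d := by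
  rw [Complex.exp_neg, exp_int_mul_pi_mul_I, ← inv_zpow]
  norm_num

lemma exp_order_mul_exp_order {ν₁ ν₂ : ℂ} {d : ℤ} (h : ν₁ - ν₂ = 2 * d) :
    Complex.exp (ν₁ * (π / 2 * Complex.I)) *
    Complex.exp (-ν₂ * (π / 2 * Complex.I)) = (-1) ^ d := by
  rw [← Complex.exp_add, ← exp_int_mul_pi_mul_I]
  congr 1
  linear_combination (π / 2 * Complex.I) * h

lemma exp_neg_order_mul_exp_order {ν₁ ν₂ : ℂ} {d : ℤ} (h : ν₁ - ν₂ = 2 * d) :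
    Complex.exp (-ν₁ * (π / 2 * Complex.I)) *
    Complex.exp (ν₂ * (π / 2 * Complex.I)) = (-1) ^ d := by
  rw [← Complex.exp_add, ← exp_neg_int_mul_pi_mul_I]
  congr 1
  linear_combination (-(π / 2 * Complex.I)) * h

lemma exp_order_mul_exp_order_pi {ν₁ ν₂ : ℂ} {d : ℤ} (h : ν₁ - ν₂ = 2 * d) :
    Complex.exp (ν₁ * (π * Complex.I)) *
    Complex.exp (-ν₂ * (π * Complex.I)) = 1 := by
  rw [← Complex.exp_add, ← Complex.exp_int_mul_two_pi_mul_I d]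
  congr 1
  linear_combination (π * Complex.I) * h

lemma exp_neg_order_mul_exp_order_pi {ν₁ ν₂ : ℂ} {d : ℤ} (h : ν₁ - ν₂ = 2 * d) :
    Complex.exp (-ν₁ * (π * Complex.I)) *
    Complex.exp (ν₂ * (π * Complex.I)) = 1 := by
  have h1 := exp_order_mul_exp_order_pi h
  rw [← Complex.exp_add] at h1 ⊢
  rw [show -ν₁ * (π * Complex.I) + ν₂ * (π * Complex.I) =
    -(ν₁ * (π * Complex.I) + -ν₂ * (π * Complex.I)) by ring, Complex.exp_neg, h1, inv_one]

/-- The quarter turns of z and z̄ go in opposite directions, so the phases of the two orders combine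
to (-1)^d when ν₁ - ν₂ = 2d. The remaining difference I_{-ν₁}I_{-ν₂} - I_{ν₁}I_{ν₂} is rearranged so
that each term contains one recessive factor. -/
lemma besselP_add_pi_div_two {ν₁ ν₂ : ℂ} {d : ℤ} (h : ν₁ - ν₂ = 2 * d) (s : ℂ) : besselP ν₁ ν₂ (s + π / 2 * Complex.I) =
    (-1) ^ d * (besselD ν₁ s * besselI (-ν₂) (starRingEnd ℂ s) +
      besselI ν₁ s * besselD ν₂ (starRingEnd ℂ s)) := by
  have hc : starRingEnd ℂ (s + π / 2 * Complex.I) = starRingEnd ℂ s - π / 2 * Complex.I := by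
    simp [map_ofNat]; ring
  have h1 := exp_order_mul_exp_order h
  have h2 := exp_neg_order_mul_exp_order h
  unfold besselP besselD
  rw [hc, besselJ_add_pi_div_two, besselJ_add_pi_div_two, besselJ_sub_pi_div_two,
    besselJ_sub_pi_div_two, neg_neg]
  linear_combination (besselI (-ν₁) s * besselI (-ν₂) (starRingEnd ℂ s)) * h2 -
    (besselI ν₁ s * besselI ν₂ (starRingEnd ℂ s)) * h1

lemma besselP'_add_pi_div_two {ν₁ ν₂ : ℂ} {d : ℤ} (h : ν₁ - ν₂ = 2 * d) (s : ℂ) : besselP' ν₁ ν₂ (s + π / 2 * Complex.I) =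
    (-1) ^ d * (besselD' ν₁ s * besselI (-ν₂) (starRingEnd ℂ s) +
      besselI' ν₁ s * besselD ν₂ (starRingEnd ℂ s)) := by
  have hc : starRingEnd ℂ (s + π / 2 * Complex.I) = starRingEnd ℂ s - π / 2 * Complex.I := by
    simp [map_ofNat]; ring
  have h1 := exp_order_mul_exp_order h
  have h2 := exp_neg_order_mul_exp_order h
  unfold besselP' besselD besselD'
  rw [hc, besselJ'_add_pi_div_two, besselJ'_add_pi_div_two, besselJ_sub_pi_div_two,
    besselJ_sub_pi_div_two, neg_neg]
  linear_combination (besselI' (-ν₁) s * besselI (-ν₂) (starRingEnd ℂ s)) * h2 -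
    (besselI' ν₁ s * besselI ν₂ (starRingEnd ℂ s)) * h1

lemma besselP_add_pi {ν₁ ν₂ : ℂ} {d : ℤ} (h : ν₁ - ν₂ = 2 * d) (s : ℂ) : besselP ν₁ ν₂ (s + π * Complex.I) = besselP ν₁ ν₂ s := by
  have hc : starRingEnd ℂ (s + π * Complex.I) = starRingEnd ℂ s - π * Complex.I := by
    simp; ring
  have h1 := exp_order_mul_exp_order_pi h
  have h2 := exp_neg_order_mul_exp_order_pi h
  unfold besselP
  rw [hc, besselJ_add_pi_mul_I, besselJ_add_pi_mul_I, besselJ_sub_pi_mul_I, besselJ_sub_pi_mul_I,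
    neg_neg]
  linear_combination (besselJ (-ν₁) s * besselJ (-ν₂) (starRingEnd ℂ s)) * h2 -
    (besselJ ν₁ s * besselJ ν₂ (starRingEnd ℂ s)) * h1

lemma besselP'_add_pi {ν₁ ν₂ : ℂ} {d : ℤ} (h : ν₁ - ν₂ = 2 * d) (s : ℂ) : besselP' ν₁ ν₂ (s + π * Complex.I) = besselP' ν₁ ν₂ s := by
  have hc : starRingEnd ℂ (s + π * Complex.I) = starRingEnd ℂ s - π * Complex.I := by
    simp; ring
  have h1 := exp_order_mul_exp_order_pi h
  have h2 := exp_neg_order_mul_exp_order_pi h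
  unfold besselP'
  rw [hc, besselJ'_add_pi_mul_I, besselJ'_add_pi_mul_I, besselJ_sub_pi_mul_I, besselJ_sub_pi_mul_I,
    neg_neg]
  linear_combination (besselJ' (-ν₁) s * besselJ (-ν₂) (starRingEnd ℂ s)) * h2 -
    (besselJ' ν₁ s * besselJ ν₂ (starRingEnd ℂ s)) * h1

/-- In each term the exponentials e^{Re z} and e^{-Re z} cancel and the two factors |z|^{-1/2}
remain. The derivative in w = log z costs one factor |z|, so it is merely bounded. -/
lemma exists_bound_besselP_of_nonneg (M : ℝ) : ∃ C : ℝ, 0 ≤ C ∧ ∀ (ν₁ ν₂ : ℂ) (d : ℤ),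
    ν₁ - ν₂ = 2 * d → ‖ν₁‖ ≤ M → ‖ν₂‖ ≤ M → ∀ s : ℂ, 0 ≤ s.re →
    ‖besselP ν₁ ν₂ s‖ ≤ C * Real.exp (-s.re) ∧ ‖besselP' ν₁ ν₂ s‖ ≤ C := by
  obtain ⟨A, hA0, hA⟩ := exists_growth_besselI (M + 1)
  obtain ⟨B, hB0, hB⟩ := exists_decay_besselD (M + 1)
  refine ⟨2 * (A * B) * (|M| + 2), by positivity, fun ν₁ ν₂ d h hν₁ hν₂ s hs => ?_⟩
  have hM : 0 ≤ M := (norm_nonneg _).trans hν₁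
  rw [abs_of_nonneg hM]
  have main : ∀ τ α : ℝ, 0 ≤ τ → |α| ≤ π / 2 →
      ‖besselP ν₁ ν₂ (τ + α * Complex.I + π / 2 * Complex.I)‖ ≤
        2 * (A * B) * (M + 2) * Real.exp (-τ) ∧
      ‖besselP' ν₁ ν₂ (τ + α * Complex.I + π / 2 * Complex.I)‖ ≤ 2 * (A * B) * (M + 2) := by
    intro τ α hτ hα
    have hc : starRingEnd ℂ (τ + α * Complex.I) = τ + ((-α : ℝ) : ℂ) * Complex.I := by
      simp
    have hα' : |-α| ≤ π / 2 := by rwa [abs_neg]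
    have hI : ∀ ν : ℂ, ‖ν‖ ≤ M + 1 → _ := fun ν hν => hA ν hν τ α hτ hα
    have hI' : ∀ ν : ℂ, ‖ν‖ ≤ M + 1 → _ := fun ν hν => hA ν hν τ (-α) hτ hα'
    have hD : ∀ ν : ℂ, ‖ν‖ ≤ M + 1 → _ := fun ν hν => hB ν hν τ α hτ hα
    have hD' : ∀ ν : ℂ, ‖ν‖ ≤ M + 1 → _ := fun ν hν => hB ν hν τ (-α) hτ hα'
    rw [Real.cos_neg] at hI' hD'
    set X := Real.exp (Real.exp τ * Real.cos α) with hX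
    have hY : Real.exp (-(Real.exp τ * Real.cos α)) = X⁻¹ := Real.exp_neg _
    rw [hY] at hD hD'
    set T := Real.exp (-τ / 2) with hT
    have hTT : T * T = Real.exp (-τ) := by rw [hT, ← Real.exp_add]; ring_nf
    have hX0 : 0 < X := Real.exp_pos _
    have hT0 : 0 < T := Real.exp_pos _
    have n1 : ‖ν₁‖ ≤ M + 1 := by linarith
    have n2 : ‖ν₂‖ ≤ M + 1 := by linarith
    have n2' : ‖-ν₂‖ ≤ M + 1 := by rwa [norm_neg]
    have n3 : ‖ν₁ + 1‖ ≤ M + 1 := (norm_add_le _ _).trans (by simpa using hν₁)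
    have hE : ‖Complex.exp (τ + α * Complex.I)‖ = Real.exp τ := by simp [Complex.norm_exp]
    have hsgn : ‖((-1 : ℂ) ^ d)‖ = 1 := by simp
    have hexp : 1 ≤ Real.exp τ := Real.one_le_exp hτ
    constructor
    · rw [besselP_add_pi_div_two h, hc, norm_mul, hsgn, one_mul]
      calc _ ≤ B * (T * X⁻¹) * (A * (T * X)) + A * (T * X) * (B * (T * X⁻¹)) := by
            refine (norm_add_le _ _).trans ?_
            rw [norm_mul, norm_mul]
            gcongr
            exacts [hD _ n1, hI' _ n2', hI _ n1, hD' _ n2]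
        _ = 2 * (A * B) * 1 * (T * T) := by field_simp; ring
        _ ≤ _ := by
            rw [hTT]
            gcongr
            linarith
    · rw [besselP'_add_pi_div_two h, hc, norm_mul, hsgn, one_mul]
      have hI1 : ‖besselI' ν₁ (τ + α * Complex.I)‖ ≤ (M + 1) * Real.exp τ * (A * (T * X)) := by
        unfold besselI'
        calc _ ≤ M * (A * (T * X)) + Real.exp τ * (A * (T * X)) := by
              refine (norm_add_le _ _).trans ?_
              rw [norm_mul, norm_mul, hE]
              gcongr
              exacts [hI _ n1, hI _ n3]
          _ ≤ M * Real.exp τ * (A * (T * X)) + Real.exp τ * (A * (T * X)) := by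
              gcongr
              exact le_mul_of_one_le_right hM hexp
          _ = _ := by ring
      have hD1 : ‖besselD' ν₁ (τ + α * Complex.I)‖ ≤ (M + 1) * Real.exp τ * (B * (T * X⁻¹)) := by
        rw [besselD'_eq]
        calc _ ≤ M * (B * (T * X⁻¹)) + Real.exp τ * (B * (T * X⁻¹)) := by
              refine (norm_add_le _ _).trans ?_
              rw [norm_mul, norm_mul, hE]
              gcongr
              exacts [hD _ n1, hD _ n3]
          _ ≤ M * Real.exp τ * (B * (T * X⁻¹)) + Real.exp τ * (B * (T * X⁻¹)) := by
              gcongr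
              exact le_mul_of_one_le_right hM hexp
          _ = _ := by ring
      calc _ ≤ (M + 1) * Real.exp τ * (B * (T * X⁻¹)) * (A * (T * X)) +
            (M + 1) * Real.exp τ * (A * (T * X)) * (B * (T * X⁻¹)) := by
            refine (norm_add_le _ _).trans ?_
            rw [norm_mul, norm_mul]
            gcongr
            exacts [hI' _ n2', hD' _ n2]
        _ = 2 * (A * B) * (M + 1) * (Real.exp τ * (T * T)) := by field_simp; ring
        _ = 2 * (A * B) * (M + 1) := by rw [hTT, ← Real.exp_add]; simp
        _ ≤ _ := by
            gcongr
            linarith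
  have per : ∀ (n : ℤ) (s : ℂ), besselP ν₁ ν₂ (s + n * (π * Complex.I)) = besselP ν₁ ν₂ s ∧
      besselP' ν₁ ν₂ (s + n * (π * Complex.I)) = besselP' ν₁ ν₂ s := by
    intro n s
    have p1 : Function.Periodic (besselP ν₁ ν₂) (π * Complex.I) := besselP_add_pi h
    have p2 : Function.Periodic (besselP' ν₁ ν₂) (π * Complex.I) := besselP'_add_pi h
    exact ⟨p1.int_mul n s, p2.int_mul n s⟩
  -- The product has period πi, so Im s may be moved into [0, π], a window of half-width π/2 around
  -- π/2.
  set n : ℤ := ⌊s.im / π⌋ with hn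
  have hfl := Int.floor_le (s.im / π)
  have hfl' := Int.lt_floor_add_one (s.im / π)
  rw [← hn] at hfl hfl'
  rw [le_div_iff₀ Real.pi_pos] at hfl
  rw [div_lt_iff₀ Real.pi_pos] at hfl'
  have hs' : s = (s.re : ℂ) + ((s.im - n * π - π / 2 : ℝ) : ℂ) * Complex.I + π / 2 * Complex.I +
      n * (π * Complex.I) := by
    conv_lhs => rw [← Complex.re_add_im s]
    push_cast; ring
  have := main s.re (s.im - n * π - π / 2) hs (abs_le.2 ⟨by linarith, by linarith⟩)
  have pp := per n ((s.re : ℂ) + ((s.im - n * π - π / 2 : ℝ) : ℂ) * Complex.I + π / 2 * Complex.I)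
  rw [← hs'] at pp
  rw [pp.1, pp.2]
  exact this

/-! ### Size of the products near the origin. -/

lemma besselJ'_eq_exp (ν s : ℂ) : besselJ' ν s = Complex.exp (ν * (s - Real.log 2)) *
    (ν * besselS ν (Complex.exp (2 * (s - Real.log 2))) - 2 * Complex.exp (2 * (s - Real.log 2)) *
      besselS (ν + 1) (Complex.exp (2 * (s - Real.log 2)))) := by
  unfold besselJ'
  rw [besselJ_eq, besselJ_eq, ← exp_two_sub_log s, add_mul ν, one_mul, Complex.exp_add (ν * _),
    two_mul (s - _), Complex.exp_add (s - _)]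
  ring

lemma norm_exp_mul_exp_conj {ν₁ ν₂ : ℂ} (h : ν₁.im = ν₂.im) (x : ℂ) :
    ‖Complex.exp (ν₁ * x) * Complex.exp (ν₂ * starRingEnd ℂ x)‖ =
      Real.exp ((ν₁.re + ν₂.re) * x.re) := by
  rw [← Complex.exp_add, Complex.norm_exp]
  congr 1
  simp [h]
  ring

/-- When ν₁ and ν₂ have equal imaginary parts, |z^{ν₁} z̄^{ν₂}| is a power of |z| with exponent Re
ν₁ + Re ν₂; the entire factors are bounded by compactness. The exponent lies in [-2σ, 2σ], and the
worst case is |z|^{-2σ}. -/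
lemma exists_bound_besselP_of_le (M L : ℝ) : ∃ C : ℝ, 0 ≤ C ∧ ∀ (ν₁ ν₂ : ℂ) (σ : ℝ),
    ν₁.im = ν₂.im → |ν₁.re + ν₂.re| ≤ 2 * σ → σ ≤ M → ‖ν₁‖ ≤ M → ‖ν₂‖ ≤ M → ∀ s : ℂ, s.re ≤ L →
    ‖besselP ν₁ ν₂ s‖ ≤ C * Real.exp (-2 * σ * s.re) ∧
    ‖besselP' ν₁ ν₂ s‖ ≤ C * Real.exp (-2 * σ * s.re) := by
  set Q : ℝ := Real.exp (2 * |L|) with hQ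
  have hK : IsCompact (Metric.closedBall (0 : ℂ) (M + 1) ×ˢ Metric.closedBall (0 : ℂ) Q) :=
    (isCompact_closedBall _ _).prod (isCompact_closedBall _ _)
  obtain ⟨B', hB'⟩ := hK.exists_bound_of_continuousOn continuous_besselS.continuousOn
  set B := max B' 0 with hBdef
  have hB0 : 0 ≤ B := le_max_right _ _
  have hB : ∀ ν q : ℂ, ‖ν‖ ≤ M + 1 → ‖q‖ ≤ Q → ‖besselS ν q‖ ≤ B := fun ν q h1 h2 =>
    (hB' (ν, q) (by simp [h1, h2])).trans (le_max_left _ _)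
  -- Absorbs the shift by log 2 and the range 0 ≤ Re s ≤ L, where |z|^{-2σ} is not the larger power.
  set E : ℝ := Real.exp (4 * |M| * (|L| + 1)) with hE
  refine ⟨2 * ((|M| + 2 * Q) * B * B * E + B * B * E), by positivity, ?_⟩
  intro ν₁ ν₂ σ him hre hσM hν₁ hν₂ s hs
  have hM : 0 ≤ M := (norm_nonneg _).trans hν₁
  have hσ : 0 ≤ σ := by linarith [abs_nonneg (ν₁.re + ν₂.re)]
  set x : ℂ := s - Real.log 2 with hx
  have hl2 : 0 < Real.log 2 := Real.log_pos one_lt_two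
  have hl2' : Real.log 2 < 1 := by linarith [Real.log_two_lt_d9]
  have hxre : x.re = s.re - Real.log 2 := by rw [hx, Complex.sub_re, Complex.ofReal_re]
  have hxc : starRingEnd ℂ s - Real.log 2 = starRingEnd ℂ x := by
    rw [hx, map_sub, Complex.conj_ofReal]
  have hq : ‖Complex.exp (2 * x)‖ ≤ Q := by
    rw [Complex.norm_exp, hQ]
    refine Real.exp_le_exp.2 ?_
    have : (2 * x).re = 2 * x.re := by simp
    rw [this, hxre]
    linarith [le_abs_self L]
  have hq' : ‖Complex.exp (2 * starRingEnd ℂ x)‖ ≤ Q := by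
    rw [Complex.norm_exp] at hq ⊢
    simpa using hq
  have hexp : ∀ κ : ℝ, |κ| ≤ 2 * σ → Real.exp (κ * x.re) ≤ E * Real.exp (-2 * σ * s.re) := by
    intro κ hκ
    rw [hE, ← Real.exp_add]
    refine Real.exp_le_exp.2 ?_
    have h1 : κ * x.re ≤ 2 * σ * |x.re| := by
      calc _ ≤ |κ * x.re| := le_abs_self _
        _ = |κ| * |x.re| := abs_mul _ _
        _ ≤ _ := by gcongr
    have h2 : |x.re| ≤ -s.re + 2 * (|L| + 1) := by
      rw [hxre]
      refine abs_le.2 ⟨?_, ?_⟩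
      · linarith [abs_nonneg L]
      · linarith [le_abs_self L]
    have h3 : 2 * σ * |x.re| ≤ 2 * σ * (-s.re + 2 * (|L| + 1)) := by gcongr
    have h4 : σ * (|L| + 1) ≤ |M| * (|L| + 1) := by
      gcongr
      exact hσM.trans (le_abs_self _)
    nlinarith
  have n1 : ‖ν₁‖ ≤ M + 1 := by linarith
  have n2 : ‖ν₂‖ ≤ M + 1 := by linarith
  have m1 : ‖-ν₁‖ ≤ M + 1 := by rwa [norm_neg]
  have m2 : ‖-ν₂‖ ≤ M + 1 := by rwa [norm_neg]
  have n3 : ‖ν₁ + 1‖ ≤ M + 1 := (norm_add_le _ _).trans (by simpa using hν₁)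
  have m3 : ‖-ν₁ + 1‖ ≤ M + 1 := (norm_add_le _ _).trans (by simpa using hν₁)
  have e1 : ‖Complex.exp (ν₁ * x) * Complex.exp (ν₂ * starRingEnd ℂ x)‖ ≤
      E * Real.exp (-2 * σ * s.re) := by
    rw [norm_exp_mul_exp_conj him]
    exact hexp _ hre
  have e2 : ‖Complex.exp (-ν₁ * x) * Complex.exp (-ν₂ * starRingEnd ℂ x)‖ ≤
      E * Real.exp (-2 * σ * s.re) := by
    rw [norm_exp_mul_exp_conj (by simpa using him)]
    refine hexp _ ?_
    rw [Complex.neg_re, Complex.neg_re, ← neg_add, abs_neg]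
    exact hre
  have prod : ∀ a b u v : ℂ, ∀ β : ℝ, ‖a * b‖ ≤ E * Real.exp (-2 * σ * s.re) → ‖u‖ ≤ β → ‖v‖ ≤ B →
      ‖(a * u) * (b * v)‖ ≤ β * B * E * Real.exp (-2 * σ * s.re) := by
    intro a b u v β h1 h2 h3
    have hβ := (norm_nonneg _).trans h2
    rw [show (a * u) * (b * v) = (a * b) * (u * v) by ring, norm_mul, norm_mul u]
    calc _ ≤ E * Real.exp (-2 * σ * s.re) * (β * B) := by gcongr
      _ = _ := by ring
  have dS : ∀ ν : ℂ, ‖ν‖ ≤ M → ‖ν * besselS ν (Complex.exp (2 * x)) -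
      2 * Complex.exp (2 * x) * besselS (ν + 1) (Complex.exp (2 * x))‖ ≤ (|M| + 2 * Q) * B := by
    intro ν hν
    have hν1 : ‖ν + 1‖ ≤ M + 1 := (norm_add_le _ _).trans (by simpa using hν)
    refine (norm_sub_le _ _).trans ?_
    rw [norm_mul, norm_mul, norm_mul, add_mul]
    simp only [Complex.norm_ofNat]
    gcongr
    exacts [hν.trans (le_abs_self _), hB _ _ (by linarith) hq, hB _ _ hν1 hq]
  have hQ0 : 0 < Q := Real.exp_pos _
  have hEx := Real.exp_pos (-2 * σ * s.re)
  have hE0 : 0 < E := Real.exp_pos _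
  have t1 : 0 ≤ B * B * E * Real.exp (-2 * σ * s.re) := by positivity
  have t2 : 0 ≤ (|M| + 2 * Q) * B * B * E * Real.exp (-2 * σ * s.re) := by positivity
  constructor
  · unfold besselP
    rw [besselJ_eq, besselJ_eq, besselJ_eq, besselJ_eq, hxc, ← hx]
    refine (norm_sub_le _ _).trans ?_
    have p1 := prod _ _ _ _ B e2 (hB _ _ m1 hq) (hB _ _ m2 hq')
    have p2 := prod _ _ _ _ B e1 (hB _ _ n1 hq) (hB _ _ n2 hq')
    linarith
  · unfold besselP'
    rw [besselJ'_eq_exp, besselJ'_eq_exp, besselJ_eq, besselJ_eq, hxc, ← hx]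
    refine (norm_sub_le _ _).trans ?_
    have p1 := prod _ _ _ _ _ e2 (dS (-ν₁) (by rwa [norm_neg])) (hB _ _ m2 hq')
    have p2 := prod _ _ _ _ _ e1 (dS ν₁ hν₁) (hB _ _ n2 hq')
    linarith

/-! ### Wirtinger derivatives -/

/-- The real-linear map `v ↦ p v + q v̄`. -/
def wirt (p q : ℂ) : ℂ →L[ℝ] ℂ :=
  p • (1 : ℂ →L[ℝ] ℂ) + q • (Complex.conjCLE : ℂ →L[ℝ] ℂ)

/-- `f` is real-differentiable at `z` with `∂f = p` and `∂̄f = q`. -/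
def HasWirt (f : ℂ → ℂ) (p q z : ℂ) : Prop := HasFDerivAt f (wirt p q) z

@[simp] lemma wirt_apply (p q v : ℂ) : wirt p q v = p * v + q * starRingEnd ℂ v := by
  simp [wirt]

lemma wirt_inj {p q p' q' : ℂ} (h : wirt p q = wirt p' q') : p = p' ∧ q = q' := by
  have h1 := congrArg (fun L : ℂ →L[ℝ] ℂ => L 1) h
  have h2 := congrArg (fun L : ℂ →L[ℝ] ℂ => L Complex.I) h
  simp only [wirt_apply, map_one, mul_one, Complex.conj_I] at h1 h2
  have h3 : p - q = p' - q' := mul_right_cancel₀ Complex.I_ne_zero (by linear_combination h2)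
  constructor
  · linear_combination (h1 + h3) / 2
  · linear_combination (h1 - h3) / 2

namespace HasWirt

variable {f g : ℂ → ℂ} {p q p' q' z : ℂ}

lemma unique (h : HasWirt f p q z) (h' : HasWirt f p' q' z) : p = p' ∧ q = q' :=
  wirt_inj (HasFDerivAt.unique h h')

lemma continuousAt (h : HasWirt f p q z) : ContinuousAt f z := HasFDerivAt.continuousAt h

lemma congr_wirt (h : HasWirt f p q z) (hp : p = p') (hq : q = q') : HasWirt f p' q' z := by
  subst hp hq; exact h

lemma congr_fun (h : HasWirt f p q z) (hfg : g =ᶠ[𝓝 z] f) : HasWirt g p q z :=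
  HasFDerivAt.congr_of_eventuallyEq h hfg

lemma add (h : HasWirt f p q z) (h' : HasWirt g p' q' z) :
    HasWirt (fun z => f z + g z) (p + p') (q + q') z := by
  refine (HasFDerivAt.add h h').congr_fderiv ?_
  ext v; simp; ring

lemma sub (h : HasWirt f p q z) (h' : HasWirt g p' q' z) :
    HasWirt (fun z => f z - g z) (p - p') (q - q') z := by
  refine (HasFDerivAt.sub h h').congr_fderiv ?_
  ext v; simp; ring

lemma mul (h : HasWirt f p q z) (h' : HasWirt g p' q' z) :
    HasWirt (fun z => f z * g z) (p * g z + f z * p') (q * g z + f z * q') z := by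
  refine (HasFDerivAt.mul h h').congr_fderiv ?_
  ext v; simp; ring

lemma const_mul (a : ℂ) (h : HasWirt f p q z) : HasWirt (fun z => a * f z) (a * p) (a * q) z := by
  refine (HasFDerivAt.const_mul h a).congr_fderiv ?_
  ext v; simp; ring

lemma comp_holo {g' : ℂ} (h : HasWirt f p q (g z)) (hg : HasDerivAt g g' z) :
    HasWirt (fun z => f (g z)) (p * g') (q * starRingEnd ℂ g') z := by
  have := HasFDerivAt.comp z h (hg.hasFDerivAt.restrictScalars ℝ)
  refine this.congr_fderiv ?_
  ext v
  simp [ContinuousLinearMap.toSpanSingleton_apply]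
  ring

lemma holo_comp {f' : ℂ} (hf : HasDerivAt f f' (g z)) (h : HasWirt g p q z) :
    HasWirt (fun z => f (g z)) (f' * p) (f' * q) z := by
  have := HasFDerivAt.comp z (hf.hasFDerivAt.restrictScalars ℝ) h
  refine this.congr_fderiv ?_
  ext v
  simp [ContinuousLinearMap.toSpanSingleton_apply]
  ring

lemma comp_conj (h : HasWirt f p q (starRingEnd ℂ z)) :
    HasWirt (fun z => f (starRingEnd ℂ z)) q p z := by
  have := HasFDerivAt.comp z h (Complex.conjCLE.toContinuousLinearMap.hasFDerivAt (x := z))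
  refine this.congr_fderiv ?_
  ext v
  simp
  ring

end HasWirt

lemma hasWirt_of_hasDerivAt {f : ℂ → ℂ} {p z : ℂ} (h : HasDerivAt f p z) : HasWirt f p 0 z := by
  refine (h.hasFDerivAt.restrictScalars ℝ).congr_fderiv ?_
  ext v
  simp [ContinuousLinearMap.toSpanSingleton_apply]
  ring

lemma hasWirt_conj_of_hasDerivAt {f : ℂ → ℂ} {p z : ℂ} (h : HasDerivAt f p (starRingEnd ℂ z)) :
    HasWirt (fun z => f (starRingEnd ℂ z)) 0 p z :=
  (hasWirt_of_hasDerivAt h).comp_conj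

lemma hasWirt_id (z : ℂ) : HasWirt (fun z => z) 1 0 z := hasWirt_of_hasDerivAt (hasDerivAt_id z)

lemma hasWirt_conj (z : ℂ) : HasWirt (fun z => starRingEnd ℂ z) 0 1 z :=
  hasWirt_conj_of_hasDerivAt (hasDerivAt_id _)

lemma hasWirt_const (a z : ℂ) : HasWirt (fun _ => a) 0 0 z :=
  hasWirt_of_hasDerivAt (hasDerivAt_const _ _)

lemma eq_of_hasWirt_zero {S : Set ℂ} (hS : IsOpen S) (hc : Convex ℝ S) {f : ℂ → ℂ}
    (hf : ∀ z ∈ S, HasWirt f 0 0 z) {x y : ℂ} (hx : x ∈ S) (hy : y ∈ S) : f x = f y := by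
  refine hS.is_const_of_fderiv_eq_zero (𝕜 := ℝ) hc.isPreconnected
    (fun z hz => (hf z hz).differentiableAt.differentiableWithinAt) (fun z hz => ?_) hx hy
  rw [HasFDerivAt.fderiv (hf z hz)]
  ext v; simp

/-! ### Plane waves -/

/-- The additive character `exp (-2πi (zu + z̄ū))` of `ℂ`. -/
def planeWave (z u : ℂ) : ℂ :=
  Complex.exp (-2 * π * Complex.I * (z * u + starRingEnd ℂ (z * u)))

lemma norm_planeWave (z u : ℂ) : ‖planeWave z u‖ = 1 := by
  unfold planeWave
  rw [Complex.add_conj, Complex.norm_exp]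
  simp

lemma continuous_planeWave : Continuous fun p : ℂ × ℂ => planeWave p.1 p.2 := by
  unfold planeWave
  fun_prop

lemma planeWave_conj (z u : ℂ) :
    planeWave (starRingEnd ℂ z) (starRingEnd ℂ u) = planeWave z u := by
  unfold planeWave
  rw [← map_mul, Complex.conj_conj, add_comm]

lemma planeWave_comm (z u : ℂ) : planeWave z u = planeWave u z := by
  unfold planeWave; rw [mul_comm z]

lemma hasWirt_planeWave (z u : ℂ) : HasWirt (fun u => planeWave z u)
    (-2 * π * Complex.I * z * planeWave z u)
    (-2 * π * Complex.I * starRingEnd ℂ z * planeWave z u) u := by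
  unfold planeWave
  have h1 : HasWirt (fun u => z * u + starRingEnd ℂ (z * u)) z (starRingEnd ℂ z) u := by
    simp only [map_mul]
    refine (((hasWirt_id u).const_mul z).add ((hasWirt_conj u).const_mul _)).congr_wirt ?_ ?_ <;>
    simp
  refine (HasWirt.holo_comp (f := Complex.exp) (Complex.hasDerivAt_exp _)
    (h1.const_mul (-2 * π * Complex.I))).congr_wirt ?_ ?_ <;> ring

/-- The derivatives in u and ū bring down φ and its conjugate, which have equal modulus, so
integrability of h φ justifies both differentiations under the integral. -/
lemma hasWirt_integral_planeWave {X : Type*} [MeasurableSpace X] {m : Measure X} {h φ : X → ℂ}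
    (hh : Integrable h m) (hφ : AEStronglyMeasurable φ m)
    (hhφ : Integrable (fun x => h x * φ x) m) (u : ℂ) :
    HasWirt (fun u => ∫ x, h x * planeWave (φ x) u ∂m)
      (-2 * π * Complex.I * ∫ x, h x * φ x * planeWave (φ x) u ∂m)
      (-2 * π * Complex.I * ∫ x, h x * starRingEnd ℂ (φ x) * planeWave (φ x) u ∂m) u := by
  have hw : ∀ u, AEStronglyMeasurable (fun x => planeWave (φ x) u) m := fun u =>
    (continuous_planeWave.comp (f := fun z : ℂ => (z, u)) (by fun_prop)).comp_aestronglyMeasurable hφ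
  have hhφ' : Integrable (fun x => h x * starRingEnd ℂ (φ x)) m := by
    refine hhφ.mono (hh.1.mul (Complex.continuous_conj.comp_aestronglyMeasurable hφ)) ?_
    exact Eventually.of_forall fun x => by simp
  have bdd : ∀ {k : X → ℂ}, Integrable k m → Integrable (fun x => k x * planeWave (φ x) u) m :=
    fun {k} hk => hk.mul_bdd (c := 1) (hw u)
      (Eventually.of_forall fun x => (norm_planeWave _ _).le)
  have key := hasFDerivAt_integral_of_dominated_of_fderiv_le (𝕜 := ℝ) (μ := m)
    (F := fun u x => h x * planeWave (φ x) u)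
    (F' := fun u x => wirt (h x * (-2 * π * Complex.I * φ x * planeWave (φ x) u))
      (h x * (-2 * π * Complex.I * starRingEnd ℂ (φ x) * planeWave (φ x) u)))
    (x₀ := u) (s := univ) (bound := fun x => ‖4 * π * (h x * φ x)‖) univ_mem
    (Eventually.of_forall fun u => hh.1.mul (hw u)) (bdd hh) ?_ ?_ ?_ ?_
  · unfold HasWirt
    refine key.congr_fderiv ?_
    unfold wirt
    rw [integral_add, integral_smul_const, integral_smul_const, ← integral_const_mul,
      ← integral_const_mul]
    · congr 3 <;> (ext x; ring)
    · refine Integrable.smul_const (((bdd hhφ).const_mul (-2 * π * Complex.I)).congr ?_) _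
      exact Eventually.of_forall fun x => by ring
    · refine Integrable.smul_const (((bdd hhφ').const_mul (-2 * π * Complex.I)).congr ?_) _
      exact Eventually.of_forall fun x => by ring
  · unfold wirt
    have h1 := (hh.1.mul (((aestronglyMeasurable_const (b := (-2 * π * Complex.I : ℂ))).mul hφ).mul
      (hw u))).smul_const (1 : ℂ →L[ℝ] ℂ)
    have h2 := (hh.1.mul (((aestronglyMeasurable_const (b := (-2 * π * Complex.I : ℂ))).mul
      (Complex.continuous_conj.comp_aestronglyMeasurable hφ)).mul
      (hw u))).smul_const (Complex.conjCLE : ℂ →L[ℝ] ℂ)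
    exact h1.add h2
  · refine Eventually.of_forall fun x v _ => ?_
    refine ContinuousLinearMap.opNorm_le_bound _ (norm_nonneg _) fun y => ?_
    rw [wirt_apply]
    refine (norm_add_le _ _).trans ?_
    have hpi : ‖(π : ℂ)‖ = π := by rw [Complex.norm_real, Real.norm_of_nonneg Real.pi_pos.le]
    simp only [norm_mul, norm_planeWave, RCLike.norm_conj, Complex.norm_I, norm_neg,
      Complex.norm_ofNat, hpi]
    linarith
  · exact (hhφ.const_mul (4 * π)).norm
  · exact Eventually.of_forall fun x v _ => (hasWirt_planeWave (φ x) v).const_mul (h x)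

/-! ### Integration over the cylinder `ℂ / 2πiℤ` -/

/-- The point `t + iφ` of the logarithmic plane with coordinates `(φ, t)`. -/
def cyl (p : ℝ × ℝ) : ℂ := p.2 + p.1 * Complex.I

lemma continuous_cyl : Continuous cyl := by unfold cyl; fun_prop

@[simp] lemma cyl_re (p : ℝ × ℝ) : (cyl p).re = p.2 := by simp [cyl]

@[simp] lemma cyl_im (p : ℝ × ℝ) : (cyl p).im = p.1 := by simp [cyl]

/-- Stokes' theorem on the cylinder. -/
lemma integral_cyl_wirt {F P Q : ℂ → ℂ} (hF : ∀ w, HasWirt F (P w) (Q w) w) (hP : Continuous P)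
    (hper : ∀ w, F (w + 2 * π * Complex.I) = F w) {T₁ T₂ : ℝ} (hT : T₁ ≤ T₂) :
    ∫ x in Ioc 0 (2 * π) ×ˢ Ioc T₁ T₂, P (cyl x) =
      2⁻¹ * ((∫ φ in (0 : ℝ)..(2 * π), F (cyl (φ, T₂))) -
        ∫ φ in (0 : ℝ)..(2 * π), F (cyl (φ, T₁))) := by
  have hFc : Continuous F := continuous_iff_continuousAt.2 fun w => (hF w).continuousAt
  have hcyl : ∀ x : ℝ × ℝ, HasFDerivAt cyl
      (Complex.ofRealCLM.comp (ContinuousLinearMap.snd ℝ ℝ ℝ) +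
        (Complex.ofRealCLM.comp (ContinuousLinearMap.fst ℝ ℝ ℝ)).smulRight Complex.I) x := by
    intro x
    have := (Complex.ofRealCLM.comp (ContinuousLinearMap.snd ℝ ℝ ℝ) +
      (Complex.ofRealCLM.comp (ContinuousLinearMap.fst ℝ ℝ ℝ)).smulRight
        Complex.I).hasFDerivAt (x := x)
    refine this.congr_of_eventuallyEq (Eventually.of_forall fun y => ?_)
    simp [cyl]
  have hg := fun x : ℝ × ℝ => HasFDerivAt.comp x (hF (cyl x)) (hcyl x)
  -- The vector field (-iF, F) in the coordinates (φ, t) has divergence (∂_t - i∂_φ)F = 2∂F.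
  have hf := fun x : ℝ × ℝ => (hg x).const_mul (-Complex.I)
  have hsum : ∀ x : ℝ × ℝ, ((-Complex.I) • ((wirt (P (cyl x)) (Q (cyl x))).comp
      (Complex.ofRealCLM.comp (ContinuousLinearMap.snd ℝ ℝ ℝ) +
        (Complex.ofRealCLM.comp (ContinuousLinearMap.fst ℝ ℝ ℝ)).smulRight Complex.I))) (1, 0) +
      ((wirt (P (cyl x)) (Q (cyl x))).comp
      (Complex.ofRealCLM.comp (ContinuousLinearMap.snd ℝ ℝ ℝ) +
        (Complex.ofRealCLM.comp (ContinuousLinearMap.fst ℝ ℝ ℝ)).smulRight Complex.I)) (0, 1) =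
      2 * P (cyl x) := by
    intro x
    simp
    linear_combination (Q (cyl x) - P (cyl x)) * Complex.I_sq
  have hcont : Continuous fun x : ℝ × ℝ => 2 * P (cyl x) :=
    continuous_const.mul (hP.comp continuous_cyl)
  have key := integral_divergence_prod_Icc_of_hasFDerivAt_of_le
    (fun x => -Complex.I * F (cyl x)) (fun x => F (cyl x)) _ _ ((0 : ℝ), T₁) (2 * π, T₂)
    ⟨Real.two_pi_pos.le, hT⟩
    (continuous_const.mul (hFc.comp continuous_cyl)).continuousOn
    (hFc.comp continuous_cyl).continuousOn (fun x _ => hf x) (fun x _ => hg x)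
    (by
      refine (hcont.continuousOn.integrableOn_compact isCompact_Icc).congr_fun (fun x _ => ?_)
        measurableSet_Icc
      exact (hsum x).symm)
  rw [setIntegral_congr_fun measurableSet_Icc (fun x _ => hsum x)] at key
  -- The sides φ = 0 and φ = 2π contribute equal and opposite amounts.
  have hp2 : ∀ y : ℝ, F (cyl (2 * π, y)) = F (cyl (0, y)) := by
    intro y
    rw [← hper (cyl (0, y))]
    congr 1
    simp [cyl]
  simp only [hp2] at key
  rw [integral_const_mul] at key
  have hset : ∫ x in Ioc 0 (2 * π) ×ˢ Ioc T₁ T₂, P (cyl x) =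
      ∫ x in Icc ((0 : ℝ), T₁) (2 * π, T₂), P (cyl x) := by
    rw [← Icc_prod_Icc]
    refine setIntegral_congr_set ?_
    rw [Measure.volume_eq_prod]
    exact Measure.set_prod_ae_eq Ioc_ae_eq_Icc Ioc_ae_eq_Icc
  rw [hset]
  linear_combination key / 2

/-! ### The Bessel function `𝑱` on the logarithmic plane -/

/-- For `h` vanishing at `0`, the quotient `h μ / sin (π μ)`, extended by continuity to `μ = 0`. -/
def divSin (h : ℂ → ℂ) (μ : ℂ) : ℂ := dslope h 0 μ / dslope (fun m => Complex.sin (π * m)) 0 μ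

lemma sin_pi_mul_ne_zero {μ : ℂ} (h0 : μ ≠ 0) (h1 : |μ.re| < 1) : Complex.sin (π * μ) ≠ 0 := by
  intro h
  obtain ⟨k, hk⟩ := Complex.sin_eq_zero_iff.1 h
  have hpi : (π : ℂ) ≠ 0 := Complex.ofReal_ne_zero.2 Real.pi_ne_zero
  have hk' : μ = k := mul_left_cancel₀ hpi (by rw [hk, mul_comm])
  rw [hk'] at h0 h1
  have h2 : |k| < 1 := by
    have : |(k : ℝ)| < 1 := by simpa using h1
    exact_mod_cast this
  rw [Int.abs_lt_one_iff] at h2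
  simp [h2] at h0

lemma differentiable_sin_pi_mul : Differentiable ℂ fun m : ℂ => Complex.sin (π * m) := by fun_prop

lemma dslope_sin_ne_zero {μ : ℂ} (h1 : |μ.re| < 1) :
    dslope (fun m => Complex.sin (π * m)) 0 μ ≠ 0 := by
  rcases eq_or_ne μ 0 with rfl | h0
  · rw [dslope_same]
    have : HasDerivAt (fun m : ℂ => Complex.sin (π * m)) (Complex.cos (π * 0) * (π * 1)) 0 :=
      ((hasDerivAt_id (0 : ℂ)).const_mul (π : ℂ)).csin
    rw [this.deriv]
    simp [Real.pi_ne_zero]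
  · rw [dslope_of_ne _ h0, slope_def_field]
    simpa using ⟨sin_pi_mul_ne_zero h0 h1, h0⟩

lemma divSin_of_ne {h : ℂ → ℂ} (hh : h 0 = 0) {μ : ℂ} (h0 : μ ≠ 0) :
    divSin h μ = h μ / Complex.sin (π * μ) := by
  unfold divSin
  rw [dslope_of_ne _ h0, dslope_of_ne _ h0, slope_def_field, slope_def_field, hh]
  simp only [mul_zero, Complex.sin_zero, sub_zero]
  rw [div_div_div_cancel_right₀ h0]

lemma continuousAt_divSin {h : ℂ → ℂ} (hd : Differentiable ℂ h) {μ : ℂ} (h1 : |μ.re| < 1) :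
    ContinuousAt (divSin h) μ := by
  have c1 : ∀ {k : ℂ → ℂ}, Differentiable ℂ k → Continuous (dslope k 0) := fun {k} hk =>
    continuousOn_univ.1 ((continuousOn_dslope univ_mem).2
      ⟨hk.continuous.continuousOn, hk.differentiableAt⟩)
  exact (c1 hd).continuousAt.div (c1 differentiable_sin_pi_mul).continuousAt (dslope_sin_ne_zero h1)

/-- Near μ = 0 the quotient h(μ)/μ is controlled by the Schwarz lemma on the disc of radius σ,
elsewhere by |μ| ≥ σ. The bound is uniform in h; the radius `max M 1` in the hypothesis on h ensures
that it covers the disc. -/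
lemma exists_bound_divSin {σ : ℝ} (hσ0 : 0 < σ) (hσ : σ < 1) (M : ℝ) : ∃ C : ℝ, 0 ≤ C ∧
    ∀ (h : ℂ → ℂ) (B : ℝ), Differentiable ℂ h → h 0 = 0 →
      (∀ m : ℂ, |m.re| ≤ σ → ‖m‖ ≤ max M 1 → ‖h m‖ ≤ B) →
      ∀ μ : ℂ, |μ.re| ≤ σ → ‖μ‖ ≤ M → ‖divSin h μ‖ ≤ C * B := by
  set K : Set ℂ := Metric.closedBall 0 M ∩ {m | |m.re| ≤ σ}
  have hK : IsCompact K := (isCompact_closedBall _ _).inter_right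
    (isClosed_le (Complex.continuous_re.abs) continuous_const)
  have hc : ContinuousOn (fun μ => (dslope (fun m => Complex.sin (π * m)) 0 μ)⁻¹) K := by
    refine ContinuousOn.inv₀ ?_ fun m hm => dslope_sin_ne_zero (lt_of_le_of_lt hm.2 hσ)
    refine Continuous.continuousOn (continuousOn_univ.1 ((continuousOn_dslope univ_mem).2
      ⟨differentiable_sin_pi_mul.continuous.continuousOn,
        differentiable_sin_pi_mul.differentiableAt⟩))
  obtain ⟨C, hC⟩ := hK.exists_bound_of_continuousOn hc
  refine ⟨|C| * σ⁻¹, by positivity, fun h B hd hh hB μ hμ hμM => ?_⟩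
  have hB0 : 0 ≤ B := (norm_nonneg _).trans (hB 0 (by simpa using hσ0.le) (by simp))
  have h1 : ‖dslope h 0 μ‖ ≤ B / σ := by
    rcases lt_or_ge ‖μ‖ σ with h2 | h2
    · refine Complex.norm_dslope_le_div_of_mapsTo_ball hd.differentiableOn ?_ (by simpa using h2)
      intro m hm
      have hm' : ‖m‖ < σ := by simpa using hm
      rw [hh, mem_closedBall_zero_iff]
      exact hB m ((Complex.abs_re_le_norm m).trans hm'.le)
        ((hm'.trans hσ).le.trans (le_max_right _ _))
    · have h0 : μ ≠ 0 := fun h => by rw [h, norm_zero] at h2; linarith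
      rw [dslope_of_ne _ h0, slope_def_field, hh, sub_zero, sub_zero, norm_div]
      exact div_le_div₀ hB0 (hB μ hμ (hμM.trans (le_max_left _ _))) hσ0 h2
  unfold divSin
  rw [div_eq_mul_inv, norm_mul]
  calc _ ≤ B / σ * |C| := mul_le_mul h1 ((hC μ ⟨by simpa using hμM, hμ⟩).trans (le_abs_self _))
        (norm_nonneg _) (by positivity)
    _ = _ := by ring

/-- The function `𝑱_{μ,d}` on the logarithmic plane. -/
def boldW (μ : ℂ) (d : ℤ) (w : ℂ) : ℂ :=
  divSin (fun m => besselP (m + d) (m - d) (w + Real.log (4 * π))) μ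

/-- The holomorphic derivative of `boldW`. -/
def boldW' (μ : ℂ) (d : ℤ) (w : ℂ) : ℂ :=
  divSin (fun m => besselP' (m + d) (m - d) (w + Real.log (4 * π))) μ

lemma besselJ'_neg_int (n : ℤ) (w : ℂ) : besselJ' (-n) w = (-1) ^ n * besselJ' n w := by
  have h1 : HasDerivAt (besselJ (-n)) (besselJ' (-n) w) w := hasDerivAt_besselJ _ _
  have h2 : HasDerivAt (besselJ n) (besselJ' n w) w := hasDerivAt_besselJ _ _
  refine h1.unique ((h2.const_mul ((-1 : ℂ) ^ n)).congr_of_eventuallyEq ?_)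
  exact Eventually.of_forall fun w => besselJ_neg_int n w

lemma besselP_int (d : ℤ) (s : ℂ) : besselP (0 + d) (0 - d) s = 0 := by
  unfold besselP
  have := besselJ_neg_int d
  simp only [zero_add, zero_sub, neg_neg, this]
  ring

lemma besselP'_int (d : ℤ) (s : ℂ) : besselP' (0 + d) (0 - d) s = 0 := by
  unfold besselP'
  have := besselJ_neg_int d
  have := besselJ'_neg_int d
  simp only [zero_add, zero_sub, neg_neg, *]
  ring

lemma differentiable_besselP_left (d : ℤ) (s : ℂ) :
    Differentiable ℂ fun m : ℂ => besselP (m + d) (m - d) s := by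
  have h := fun w => differentiable_besselJ_left w
  unfold besselP
  refine (((h s).comp ?_).mul ((h _).comp ?_)).sub (((h s).comp ?_).mul ((h _).comp ?_)) <;> fun_prop

lemma differentiable_besselP'_left (d : ℤ) (s : ℂ) :
    Differentiable ℂ fun m : ℂ => besselP' (m + d) (m - d) s := by
  have h := fun w => differentiable_besselJ_left w
  have h' := fun w => differentiable_besselJ'_left w
  unfold besselP'
  refine (((h' s).comp ?_).mul ((h _).comp ?_)).sub (((h' s).comp ?_).mul ((h _).comp ?_)) <;>
  fun_prop

lemma boldW_of_ne {μ : ℂ} (h0 : μ ≠ 0) (d : ℤ) (w : ℂ) : boldW μ d w =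
    besselP (μ + d) (μ - d) (w + Real.log (4 * π)) / Complex.sin (π * μ) :=
  divSin_of_ne (h := fun m => besselP (m + d) (m - d) (w + Real.log (4 * π)))
    (besselP_int d _) h0

lemma boldW'_of_ne {μ : ℂ} (h0 : μ ≠ 0) (d : ℤ) (w : ℂ) : boldW' μ d w =
    besselP' (μ + d) (μ - d) (w + Real.log (4 * π)) / Complex.sin (π * μ) :=
  divSin_of_ne (h := fun m => besselP' (m + d) (m - d) (w + Real.log (4 * π)))
    (besselP'_int d _) h0

lemma continuousAt_boldW_left {μ : ℂ} (h1 : |μ.re| < 1) (d : ℤ) (w : ℂ) :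
    ContinuousAt (fun m => boldW m d w) μ :=
  continuousAt_divSin (differentiable_besselP_left d _) h1

lemma order_diff (μ : ℂ) (d : ℤ) : (μ + d) - (μ - d) = 2 * d := by ring

lemma boldW_add_pi (μ : ℂ) (d : ℤ) (w : ℂ) : boldW μ d (w + π * Complex.I) = boldW μ d w := by
  unfold boldW
  congr 1; ext m
  rw [add_right_comm, besselP_add_pi (order_diff m d)]

lemma boldW'_add_pi (μ : ℂ) (d : ℤ) (w : ℂ) : boldW' μ d (w + π * Complex.I) = boldW' μ d w := by
  unfold boldW'
  congr 1; ext m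
  rw [add_right_comm, besselP'_add_pi (order_diff m d)]

lemma boldW_add_int_mul_pi (μ : ℂ) (d n : ℤ) (w : ℂ) :
    boldW μ d (w + n * (π * Complex.I)) = boldW μ d w :=
  Function.Periodic.int_mul (f := boldW μ d) (boldW_add_pi μ d) n w

lemma boldW_conj {μ : ℂ} (h0 : μ ≠ 0) (d : ℤ) (w : ℂ) :
    boldW μ d (starRingEnd ℂ w) = boldW μ (-d) w := by
  rw [boldW_of_ne h0, boldW_of_ne h0]
  congr 1
  unfold besselP
  simp only [map_add, Complex.conj_ofReal, Complex.conj_conj, Int.cast_neg, sub_neg_eq_add,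
    ← sub_eq_add_neg]
  ring

lemma boldW_neg {μ : ℂ} (h0 : μ ≠ 0) (d : ℤ) (w : ℂ) : boldW (-μ) (-d) w = boldW μ d w := by
  rw [boldW_of_ne h0, boldW_of_ne (neg_ne_zero.2 h0), mul_neg, Complex.sin_neg, div_neg, ← neg_div]
  congr 1
  unfold besselP
  rw [show -(-μ + ((-d : ℤ) : ℂ)) = μ + d by push_cast; ring,
    show -(-μ - ((-d : ℤ) : ℂ)) = μ - d by push_cast; ring,
    show (-μ + ((-d : ℤ) : ℂ)) = -(μ + d) by push_cast; ring,
    show (-μ - ((-d : ℤ) : ℂ)) = -(μ - d) by push_cast; ring]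
  ring

lemma hasWirt_besselP (ν₁ ν₂ s : ℂ) : HasWirt (besselP ν₁ ν₂) (besselP' ν₁ ν₂ s)
    (besselP' ν₂ ν₁ (starRingEnd ℂ s)) s := by
  have h1 := fun ν => hasWirt_of_hasDerivAt (hasDerivAt_besselJ ν s)
  have h2 := fun ν => hasWirt_conj_of_hasDerivAt (hasDerivAt_besselJ ν (starRingEnd ℂ s))
  refine (((h1 (-ν₁)).mul (h2 (-ν₂))).sub ((h1 ν₁).mul (h2 ν₂))).congr_wirt ?_ ?_
  · unfold besselP' besselJ'; ring
  · unfold besselP' besselJ'; simp only [Complex.conj_conj]; ring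

/-- Bessel's equation in z. The antiholomorphic derivative is left unspecified because Stokes'
theorem with P = ∂F uses only the holomorphic one. -/
lemma hasWirt_besselP' (ν₁ ν₂ s : ℂ) : ∃ q, HasWirt (besselP' ν₁ ν₂)
    ((ν₁ ^ 2 - Complex.exp s ^ 2) * besselP ν₁ ν₂ s) q s := by
  have h1 := fun ν => hasWirt_of_hasDerivAt (hasDerivAt_besselJ' ν s)
  have h2 := fun ν => hasWirt_conj_of_hasDerivAt (hasDerivAt_besselJ ν (starRingEnd ℂ s))
  refine ⟨_, (((h1 (-ν₁)).mul (h2 (-ν₂))).sub ((h1 ν₁).mul (h2 ν₂))).congr_wirt ?_ rfl⟩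
  unfold besselP; ring

lemma exp_log_four_pi : Complex.exp (Real.log (4 * π)) = 4 * π := by
  rw [← Complex.ofReal_exp, Real.exp_log (by positivity)]
  push_cast; rfl

lemma hasWirt_boldW {μ : ℂ} (h0 : μ ≠ 0) (d : ℤ) (w : ℂ) : HasWirt (boldW μ d) (boldW' μ d w)
    (boldW' μ (-d) (starRingEnd ℂ w)) w := by
  have h1 := HasWirt.comp_holo (g := fun w => w + Real.log (4 * π))
    (hasWirt_besselP (μ + d) (μ - d) (w + Real.log (4 * π)))
    ((hasDerivAt_id w).add_const (Real.log (4 * π) : ℂ))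
  refine (((h1.const_mul (Complex.sin (π * μ))⁻¹)).congr_fun ?_).congr_wirt ?_ ?_
  · exact Eventually.of_forall fun v => by rw [boldW_of_ne h0]; simp; ring
  · rw [boldW'_of_ne h0]; simp; ring
  · rw [boldW'_of_ne h0]; simp; ring

lemma hasWirt_boldW' {μ : ℂ} (h0 : μ ≠ 0) (d : ℤ) (w : ℂ) : ∃ q, HasWirt (boldW' μ d)
    (((μ + d) ^ 2 - 16 * π ^ 2 * Complex.exp w ^ 2) * boldW μ d w) q w := by
  obtain ⟨q, hq⟩ := hasWirt_besselP' (μ + d) (μ - d) (w + Real.log (4 * π))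
  have h1 := HasWirt.comp_holo (g := fun w => w + Real.log (4 * π)) hq
    ((hasDerivAt_id w).add_const (Real.log (4 * π) : ℂ))
  refine ⟨_, (((h1.const_mul (Complex.sin (π * μ))⁻¹)).congr_fun ?_).congr_wirt ?_ rfl⟩
  · exact Eventually.of_forall fun v => by rw [boldW'_of_ne h0]; simp; ring
  · rw [boldW_of_ne h0, Complex.exp_add, exp_log_four_pi]; simp; ring

lemma continuous_boldW {μ : ℂ} (h0 : μ ≠ 0) (d : ℤ) : Continuous (boldW μ d) :=
  continuous_iff_continuousAt.2 fun w => (hasWirt_boldW h0 d w).continuousAt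

lemma continuous_boldW' {μ : ℂ} (h0 : μ ≠ 0) (d : ℤ) : Continuous (boldW' μ d) :=
  continuous_iff_continuousAt.2 fun w => (hasWirt_boldW' h0 d w).choose_spec.continuousAt

/-- At μ = 0 the quotient formula is not available, and the function is obtained as a pointwise
limit of the continuous functions with μ = 1/(n+1). -/
lemma measurable_boldW (μ : ℂ) (d : ℤ) : Measurable (boldW μ d) := by
  rcases eq_or_ne μ 0 with rfl | h0
  · have hlim : Tendsto (fun n : ℕ => ((1 / ((n : ℝ) + 1) : ℝ) : ℂ)) atTop (𝓝 0) := by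
      have := (Complex.continuous_ofReal.tendsto 0).comp tendsto_one_div_add_atTop_nhds_zero_nat
      simpa [Function.comp_def] using this
    refine measurable_of_tendsto_metrizable (f := fun n : ℕ =>
      boldW ((1 / ((n : ℝ) + 1) : ℝ) : ℂ) d) (fun n => (continuous_boldW ?_ d).measurable) ?_
    · exact Complex.ofReal_ne_zero.2 (by positivity)
    · exact tendsto_pi_nhds.2 fun w =>
        (continuousAt_boldW_left (μ := 0) (by simp) d w).tendsto.comp hlim
  · exact (continuous_boldW h0 d).measurable

/-- The bounds for the products pass to the quotient by sin πμ through `exists_bound_divSin`,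
uniformly in μ on a neighbourhood of 0. The scaling by 4π is a shift by log 4π ≥ 0, hence Re w ≥ 0
stays in the region of decay. -/
lemma exists_bound_boldW {σ : ℝ} (hσ0 : 0 < σ) (hσ : σ < 1) (M : ℝ) (d : ℤ) : ∃ C : ℝ, 0 ≤ C ∧
    ∀ μ : ℂ, |μ.re| ≤ σ → ‖μ‖ ≤ M → ∀ w : ℂ,
      (0 ≤ w.re → ‖boldW μ d w‖ ≤ C * Real.exp (-w.re) ∧ ‖boldW' μ d w‖ ≤ C) ∧
      (w.re ≤ 0 → ‖boldW μ d w‖ ≤ C * Real.exp (-2 * σ * w.re) ∧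
        ‖boldW' μ d w‖ ≤ C * Real.exp (-2 * σ * w.re)) := by
  obtain ⟨C₀, hC₀, h₀⟩ := exists_bound_divSin hσ0 hσ M
  set M' : ℝ := max M 1 + |(d : ℝ)| with hM'
  obtain ⟨C₁, hC₁, h₁⟩ := exists_bound_besselP_of_nonneg M'
  obtain ⟨C₂, hC₂, h₂⟩ := exists_bound_besselP_of_le M' (Real.log (4 * π))
  have hn1 : ∀ m : ℂ, ‖m‖ ≤ max M 1 → ‖m + d‖ ≤ M' := fun m hm =>
    (norm_add_le _ _).trans (by rw [hM']; gcongr; simp)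
  have hn2 : ∀ m : ℂ, ‖m‖ ≤ max M 1 → ‖m - d‖ ≤ M' := fun m hm =>
    (norm_sub_le _ _).trans (by rw [hM']; gcongr; simp)
  have h4 : 0 ≤ Real.log (4 * π) := Real.log_nonneg (by linarith [Real.pi_gt_three])
  refine ⟨C₀ * C₁ + C₀ * C₂, by positivity, fun μ hμ hμM w => ⟨fun hw => ⟨?_, ?_⟩,
    fun hw => ⟨?_, ?_⟩⟩⟩
  · have := h₀ _ (C₁ * Real.exp (-w.re)) (differentiable_besselP_left d (w + Real.log (4 * π)))
      (besselP_int d _) (fun m _ hm => ?_) μ hμ hμM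
    · refine this.trans ?_
      rw [← mul_assoc]
      gcongr
      linarith [mul_nonneg hC₀ hC₂]
    · refine (h₁ _ _ d (order_diff m d) (hn1 m hm) (hn2 m hm) _ ?_).1.trans ?_
      · simp only [Complex.add_re, Complex.ofReal_re]; linarith
      · simp only [Complex.add_re, Complex.ofReal_re]
        gcongr
        linarith
  · have := h₀ _ C₁ (differentiable_besselP'_left d (w + Real.log (4 * π)))
      (besselP'_int d _) (fun m _ hm => ?_) μ hμ hμM
    · refine this.trans ?_
      linarith [mul_nonneg hC₀ hC₂]
    · refine (h₁ _ _ d (order_diff m d) (hn1 m hm) (hn2 m hm) _ ?_).2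
      simp only [Complex.add_re, Complex.ofReal_re]; linarith
  all_goals
    have key : ∀ m : ℂ, |m.re| ≤ σ → ‖m‖ ≤ max M 1 → _ := fun m hm1 hm =>
      h₂ (m + d) (m - d) σ (by simp) (by
        simp only [Complex.add_re, Complex.sub_re, Complex.intCast_re]
        rw [show m.re + d + (m.re - d) = 2 * m.re by ring, abs_mul, abs_two]
        linarith) (by
        have h5 : 1 ≤ max M 1 := le_max_right _ _
        have h6 := abs_nonneg (d : ℝ)
        rw [hM']; linarith) (hn1 m hm) (hn2 m hm) (w + Real.log (4 * π)) (by simpa using hw)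
    have hexp : Real.exp (-2 * σ * (w + Real.log (4 * π)).re) ≤ Real.exp (-2 * σ * w.re) := by
      simp only [Complex.add_re, Complex.ofReal_re]
      refine Real.exp_le_exp.2 ?_
      nlinarith
  · have := h₀ _ (C₂ * Real.exp (-2 * σ * w.re))
      (differentiable_besselP_left d (w + Real.log (4 * π)))
      (besselP_int d _) (fun m hm1 hm => (key m hm1 hm).1.trans (by gcongr)) μ hμ hμM
    refine this.trans ?_
    rw [← mul_assoc]
    gcongr
    linarith [mul_nonneg hC₀ hC₁]
  · have := h₀ _ (C₂ * Real.exp (-2 * σ * w.re))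
      (differentiable_besselP'_left d (w + Real.log (4 * π)))
      (besselP'_int d _) (fun m hm1 hm => (key m hm1 hm).2.trans (by gcongr)) μ hμ hμM
    refine this.trans ?_
    rw [← mul_assoc]
    gcongr
    linarith [mul_nonneg hC₀ hC₁]

/-- The principal logarithm differs from w + log 4π by a multiple of 2πi, to which the product is
insensitive. This is the independence of the choice of arg z. -/
lemma boldJGeneric_exp {μ : ℂ} (h0 : μ ≠ 0) (d : ℤ) (w : ℂ) :
    boldJGeneric μ d (Complex.exp w) = boldW μ d w := by
  set L := Complex.log (4 * π * Complex.exp w) with hL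
  have hne : (4 * π * Complex.exp w : ℂ) ≠ 0 :=
    mul_ne_zero (mul_ne_zero (by norm_num) (Complex.ofReal_ne_zero.2 Real.pi_ne_zero))
      (Complex.exp_ne_zero _)
  have h1 : Complex.exp (L - Real.log (4 * π)) = Complex.exp w := by
    rw [Complex.exp_sub, exp_log_four_pi, hL, Complex.exp_log hne]
    have : (4 * π : ℂ) ≠ 0 := mul_ne_zero (by norm_num) (Complex.ofReal_ne_zero.2 Real.pi_ne_zero)
    field_simp
  obtain ⟨n, hn⟩ := Complex.exp_eq_exp_iff_exists_int.1 h1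
  have h2 : boldW μ d (L - Real.log (4 * π)) = boldW μ d w := by
    rw [hn, ← boldW_add_int_mul_pi μ d (2 * n) w]
    congr 1; push_cast; ring
  rw [← h2, boldW_of_ne h0, boldJGeneric, besselJJ, besselJJ, ← hL, sub_add_cancel]
  congr 1
  unfold besselP
  push_cast
  rw [show -μ + -(d : ℂ) = -(μ + d) by ring, show -μ - -(d : ℂ) = -(μ - d) by ring]

lemma boldJ_exp {μ : ℂ} (h1 : |μ.re| < 1) (d : ℤ) (w : ℂ) :
    boldJ μ d (Complex.exp w) = boldW μ d w := by
  unfold boldJ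
  split_ifs with h
  · obtain ⟨m, rfl⟩ := h
    have h2 : |m| < 1 := by
      have : |(m : ℝ)| < 1 := by simpa using h1
      exact_mod_cast this
    rw [Int.abs_lt_one_iff] at h2
    subst h2
    -- The only integer in the strip |Re μ| < 1 is 0, where `divSin` is continuous, so the limit in
    -- the definition is its value.
    refine Tendsto.limUnder_eq ?_
    have := (continuousAt_boldW_left (μ := ((0 : ℤ) : ℂ)) (by simp) d w).tendsto.mono_left
      (nhdsWithin_le_nhds (s := {((0 : ℤ) : ℂ)}ᶜ))
    refine this.congr' ?_
    filter_upwards [self_mem_nhdsWithin] with m hm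
    exact (boldJGeneric_exp (by simpa using hm) d w).symm
  · exact boldJGeneric_exp (fun h0 => h ⟨0, by simpa using h0⟩) d w

/-! ### The integrals of `𝑱` against plane waves -/

/-- `𝑱(w)` times the power `exp ((ρ + j) w + (ρ + k) w̄)`. -/
def waveTerm (ρ μ : ℂ) (d j k : ℤ) (w : ℂ) : ℂ :=
  boldW μ d w * Complex.exp ((ρ + j) * w + (ρ + k) * starRingEnd ℂ w)

/-- The integral of `waveTerm` against a plane wave over the part of the cylinder above `A`. -/
def waveInt (A : Set ℝ) (ρ μ : ℂ) (d j k : ℤ) (u : ℂ) : ℂ :=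
  ∫ p in Ioc 0 (2 * π) ×ˢ A, waveTerm ρ μ d j k (cyl p) * planeWave (Complex.exp (cyl p)) u

lemma norm_exp_wave (ρ : ℂ) (j k : ℤ) (w : ℂ) :
    ‖Complex.exp ((ρ + j) * w + (ρ + k) * starRingEnd ℂ w)‖ =
      Real.exp ((2 * ρ.re + j + k) * w.re) := by
  rw [Complex.norm_exp]
  congr 1
  simp
  ring

lemma waveTerm_succ_left (ρ μ : ℂ) (d j k : ℤ) (w : ℂ) :
    waveTerm ρ μ d (j + 1) k w = waveTerm ρ μ d j k w * Complex.exp w := by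
  unfold waveTerm
  rw [mul_assoc, ← Complex.exp_add]
  congr 2; push_cast; ring

lemma waveTerm_succ_right (ρ μ : ℂ) (d j k : ℤ) (w : ℂ) :
    waveTerm ρ μ d j (k + 1) w = waveTerm ρ μ d j k w * starRingEnd ℂ (Complex.exp w) := by
  unfold waveTerm
  rw [mul_assoc, ← Complex.exp_conj, ← Complex.exp_add]
  congr 2; push_cast; ring

lemma measurable_waveTerm (ρ μ : ℂ) (d j k : ℤ) : Measurable (waveTerm ρ μ d j k) := by
  unfold waveTerm
  refine (measurable_boldW μ d).mul (Continuous.measurable ?_)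
  fun_prop

lemma continuous_waveTerm {μ : ℂ} (h0 : μ ≠ 0) (ρ : ℂ) (d j k : ℤ) :
    Continuous (waveTerm ρ μ d j k) := by
  unfold waveTerm
  exact (continuous_boldW h0 d).mul (by fun_prop)

/-- The size of `waveTerm` as a function of `t = Re w`. -/
def envelope (σ s t : ℝ) : ℝ := if t ≤ 0 then Real.exp ((s - 2 * σ) * t) else Real.exp ((s - 1) * t)

lemma integrableOn_envelope_Ioi {σ s : ℝ} (h : s < 1) : IntegrableOn (envelope σ s) (Ioi 0) := by
  refine (integrableOn_exp_mul_Ioi (by linarith : s - 1 < 0) 0).congr_fun (fun t ht => ?_)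
    measurableSet_Ioi
  simp only [envelope]
  rw [if_neg (not_le.2 ht)]

lemma integrableOn_envelope_Ioc (σ s : ℝ) (T : ℝ) : IntegrableOn (envelope σ s) (Ioc 0 T) := by
  have : IntegrableOn (fun t => Real.exp ((s - 1) * t)) (Ioc 0 T) :=
    (Continuous.integrableOn_Icc (by fun_prop)).mono_set Ioc_subset_Icc_self
  refine this.congr_fun (fun t ht => ?_) measurableSet_Ioc
  simp only [envelope]
  rw [if_neg (not_le.2 ht.1)]

lemma integrableOn_envelope_Iic {σ s : ℝ} (h : 2 * σ < s) (T : ℝ) :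
    IntegrableOn (envelope σ s) (Iic T) := by
  have h0 : IntegrableOn (envelope σ s) (Iic 0) := by
    refine (integrableOn_exp_mul_Iic (by linarith : 0 < s - 2 * σ) 0).congr_fun (fun t ht => ?_)
      measurableSet_Iic
    simp only [envelope]
    rw [if_pos (mem_Iic.1 ht)]
  refine (h0.union (integrableOn_envelope_Ioc σ s T)).mono_set fun t ht => ?_
  rcases le_or_gt t 0 with h | h
  exacts [Or.inl h, Or.inr ⟨h, ht⟩]

lemma exists_bound_waveTerm {σ : ℝ} (hσ0 : 0 < σ) (hσ : σ < 1) (M : ℝ) (ρ : ℂ) (d j k : ℤ) :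
    ∃ C : ℝ, 0 ≤ C ∧ ∀ μ : ℂ, |μ.re| ≤ σ → ‖μ‖ ≤ M → ∀ w : ℂ,
      ‖waveTerm ρ μ d j k w‖ ≤ C * envelope σ (2 * ρ.re + j + k) w.re := by
  obtain ⟨C, hC, h⟩ := exists_bound_boldW hσ0 hσ M d
  refine ⟨C, hC, fun μ h1 h2 w => ?_⟩
  unfold waveTerm envelope
  rw [norm_mul, norm_exp_wave]
  split_ifs with hw
  · refine (mul_le_mul_of_nonneg_right ((h μ h1 h2 w).2 hw).1 (Real.exp_pos _).le).trans_eq ?_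
    rw [mul_assoc, ← Real.exp_add]
    ring_nf
  · refine (mul_le_mul_of_nonneg_right ((h μ h1 h2 w).1 (not_le.1 hw).le).1
      (Real.exp_pos _).le).trans_eq ?_
    rw [mul_assoc, ← Real.exp_add]
    ring_nf

lemma integrableOn_cyl_of_snd {A : Set ℝ} {g : ℝ → ℝ} (hg : IntegrableOn g A) :
    IntegrableOn (fun p : ℝ × ℝ => g p.2) (Ioc 0 (2 * π) ×ˢ A) := by
  unfold IntegrableOn
  rw [Measure.volume_eq_prod, ← Measure.prod_restrict]
  exact Integrable.comp_snd hg _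

lemma integrableOn_waveTerm {A : Set ℝ} {σ : ℝ} (hσ0 : 0 < σ) (hσ : σ < 1)
    {ρ μ : ℂ} (hμ : |μ.re| ≤ σ) (d j k : ℤ)
    (hA : IntegrableOn (envelope σ (2 * ρ.re + j + k)) A) :
    IntegrableOn (fun p => waveTerm ρ μ d j k (cyl p)) (Ioc 0 (2 * π) ×ˢ A) := by
  obtain ⟨C, -, hC⟩ := exists_bound_waveTerm hσ0 hσ ‖μ‖ ρ d j k
  refine Integrable.mono' ((integrableOn_cyl_of_snd hA).const_mul C)
    ((measurable_waveTerm ρ μ d j k).comp continuous_cyl.measurable).aestronglyMeasurable ?_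
  refine Eventually.of_forall fun p => ?_
  simpa using hC μ hμ le_rfl (cyl p)

lemma continuous_planeWave_exp (u : ℂ) : Continuous fun w => planeWave (Complex.exp w) u :=
  continuous_planeWave.comp (f := fun w : ℂ => (Complex.exp w, u)) (by fun_prop)

lemma integrableOn_waveTerm_mul {A : Set ℝ} {ρ μ : ℂ} {d j k : ℤ}
    (h : IntegrableOn (fun p => waveTerm ρ μ d j k (cyl p)) (Ioc 0 (2 * π) ×ˢ A)) (u : ℂ) :
    IntegrableOn (fun p => waveTerm ρ μ d j k (cyl p) * planeWave (Complex.exp (cyl p)) u)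
      (Ioc 0 (2 * π) ×ˢ A) :=
  Integrable.mul_bdd (c := 1) h
    (((continuous_planeWave_exp u).comp continuous_cyl).aestronglyMeasurable)
    (Eventually.of_forall fun _ => (norm_planeWave _ _).le)

/-- The strict inequality |Re μ| < σ leaves room for one integrable envelope valid for all nearby μ,
and the characters have modulus 1. -/
lemma continuousAt_waveInt {A : Set ℝ} {σ : ℝ} (hσ : σ < 1)
    {ρ μ : ℂ} (hμ : |μ.re| < σ) (d j k : ℤ)
    (hA : IntegrableOn (envelope σ (2 * ρ.re + j + k)) A) (u : ℂ) :
    ContinuousAt (fun q : ℂ × ℂ => waveInt A ρ q.1 d j k q.2) (μ, u) := by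
  have hσ0 : 0 < σ := (abs_nonneg _).trans_lt hμ
  obtain ⟨C, -, hC⟩ := exists_bound_waveTerm hσ0 hσ (‖μ‖ + 1) ρ d j k
  unfold waveInt
  refine tendsto_integral_filter_of_dominated_convergence
    (fun p => C * envelope σ (2 * ρ.re + j + k) p.2) ?_ ?_
    ((integrableOn_cyl_of_snd hA).const_mul C) ?_
  · exact Eventually.of_forall fun q =>
      (((measurable_waveTerm ρ _ d j k).comp continuous_cyl.measurable).mul
        ((continuous_planeWave_exp _).comp continuous_cyl).measurable).aestronglyMeasurable
  · have h1 : ∀ᶠ q : ℂ × ℂ in 𝓝 (μ, u), |q.1.re| < σ :=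
      (by fun_prop : Continuous fun q : ℂ × ℂ => |q.1.re|).continuousAt.eventually_lt
        continuousAt_const hμ
    have h2 : ∀ᶠ q : ℂ × ℂ in 𝓝 (μ, u), ‖q.1‖ < ‖μ‖ + 1 :=
      (by fun_prop : Continuous fun q : ℂ × ℂ => ‖q.1‖).continuousAt.eventually_lt
        continuousAt_const (by simp)
    filter_upwards [h1, h2] with q hq1 hq2
    refine Eventually.of_forall fun p => ?_
    rw [norm_mul, norm_planeWave, mul_one]
    simpa using hC q.1 hq1.le hq2.le (cyl p)
  · refine Eventually.of_forall fun p => ?_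
    have hb := continuousAt_boldW_left (μ := μ) (hμ.trans hσ) d (cyl p)
    have h1 : Tendsto (fun q : ℂ × ℂ => boldW q.1 d (cyl p)) (𝓝 (μ, u))
        (𝓝 (boldW μ d (cyl p))) :=
      hb.tendsto.comp (continuous_fst.tendsto (μ, u))
    have h2 : Continuous fun q : ℂ × ℂ => planeWave (Complex.exp (cyl p)) q.2 :=
      continuous_planeWave.comp (f := fun q : ℂ × ℂ => (Complex.exp (cyl p), q.2)) (by fun_prop)
    exact (h1.mul_const _).mul (h2.tendsto (μ, u))

lemma hasWirt_waveInt {A : Set ℝ} {ρ μ : ℂ} {d j k : ℤ}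
    (h : IntegrableOn (fun p => waveTerm ρ μ d j k (cyl p)) (Ioc 0 (2 * π) ×ˢ A))
    (h' : IntegrableOn (fun p => waveTerm ρ μ d (j + 1) k (cyl p)) (Ioc 0 (2 * π) ×ˢ A)) (u : ℂ) :
    HasWirt (waveInt A ρ μ d j k) (-2 * π * Complex.I * waveInt A ρ μ d (j + 1) k u)
      (-2 * π * Complex.I * waveInt A ρ μ d j (k + 1) u) u := by
  simp only [waveTerm_succ_left] at h'
  have := hasWirt_integral_planeWave (φ := fun p => Complex.exp (cyl p)) h
    ((Complex.continuous_exp.comp continuous_cyl).aestronglyMeasurable) h' u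
  unfold waveInt
  simp only [waveTerm_succ_left, waveTerm_succ_right]
  exact this

/-- The function whose holomorphic derivative gives Bessel's equation for `waveTerm`. -/
def bdry (ρ μ : ℂ) (d j k : ℤ) (u w : ℂ) : ℂ :=
  (boldW' μ d w - boldW μ d w * ((ρ + j - 2) + -2 * π * Complex.I * Complex.exp w * u)) *
    Complex.exp ((ρ + j - 2) * w + (ρ + k) * starRingEnd ℂ w) * planeWave (Complex.exp w) u

/-- The integral of `bdry` over the circle `Re w = T` of the cylinder. -/
def bdryInt (ρ μ : ℂ) (d j k : ℤ) (u : ℂ) (T : ℝ) : ℂ :=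
  ∫ φ in (0 : ℝ)..(2 * π), bdry ρ μ d j k u (cyl (φ, T))

/-- The combination of moments produced by Bessel's equation. -/
def besselComb (ρ μ : ℂ) (d : ℤ) (u x y z : ℂ) (j : ℤ) : ℂ :=
  4 * π ^ 2 * (u ^ 2 - 4) * x + ((μ + d) ^ 2 - (ρ + j - 2) ^ 2) * y -
    (2 * (ρ + j) - 3) * (-2 * π * Complex.I) * u * z

/-- Let E be the exponential weight times the plane wave and m its logarithmic derivative. In ∂((W'
- W m) E) the terms in W' cancel and W'' - (∂m + m²) W remains; Bessel's equation replaces W'' by a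
multiple of W, leaving only shifted wave terms. -/
lemma hasWirt_bdry {μ : ℂ} (h0 : μ ≠ 0) (ρ : ℂ) (d j k : ℤ) (u w : ℂ) :
    ∃ q, HasWirt (bdry ρ μ d j k u) (besselComb ρ μ d u (waveTerm ρ μ d j k w)
      (waveTerm ρ μ d (j - 2) k w) (waveTerm ρ μ d (j - 1) k w) j * planeWave (Complex.exp w) u)
      q w := by
  obtain ⟨q₁, h1⟩ := hasWirt_boldW' h0 d w
  have h2 := hasWirt_boldW h0 d w
  have he := hasWirt_of_hasDerivAt (Complex.hasDerivAt_exp w)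
  have h3 := (hasWirt_const (ρ + j - 2) w).add
    ((he.const_mul (-2 * π * Complex.I)).mul (hasWirt_const u w))
  have h4 : HasWirt (fun w => Complex.exp ((ρ + j - 2) * w + (ρ + k) * starRingEnd ℂ w)) _ _ w :=
    HasWirt.holo_comp (f := Complex.exp) (Complex.hasDerivAt_exp _)
      (((hasWirt_id w).const_mul (ρ + j - 2)).add ((hasWirt_conj w).const_mul (ρ + k)))
  have h5 : HasWirt (fun w => planeWave (Complex.exp w) u)
      (-2 * π * Complex.I * u * planeWave (Complex.exp w) u * Complex.exp w)
      (-2 * π * Complex.I * starRingEnd ℂ u * planeWave (Complex.exp w) u *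
        starRingEnd ℂ (Complex.exp w)) w := by
    have := (hasWirt_planeWave u (Complex.exp w)).comp_holo (Complex.hasDerivAt_exp w)
    simp only [planeWave_comm u] at this
    exact this
  refine ⟨_, ((((h1.sub (h2.mul h3)).mul h4).mul h5)).congr_wirt ?_ rfl⟩
  have e1 : waveTerm ρ μ d (j - 2) k w = boldW μ d w *
      Complex.exp ((ρ + j - 2) * w + (ρ + k) * starRingEnd ℂ w) := by
    unfold waveTerm; congr 3; push_cast; ring
  have e2 : waveTerm ρ μ d (j - 1) k w = waveTerm ρ μ d (j - 2) k w * Complex.exp w := by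
    rw [← waveTerm_succ_left]; congr 1; ring
  have e3 : waveTerm ρ μ d j k w = waveTerm ρ μ d (j - 1) k w * Complex.exp w := by
    rw [← waveTerm_succ_left]; congr 1; ring
  rw [e3, e2, e1]
  unfold besselComb
  linear_combination (-(4 * π ^ 2 * Complex.exp w ^ 2 * u ^ 2 * boldW μ d w *
    Complex.exp ((ρ + j - 2) * w + (ρ + k) * starRingEnd ℂ w) * planeWave (Complex.exp w) u)) *
      Complex.I_sq

lemma exp_int_mul_two_pi_shift (a b w : ℂ) (n : ℤ) (h : a - b = n) :
    Complex.exp (a * (w + 2 * π * Complex.I) + b * starRingEnd ℂ (w + 2 * π * Complex.I)) =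
      Complex.exp (a * w + b * starRingEnd ℂ w) := by
  have h2 : starRingEnd ℂ (w + 2 * π * Complex.I) = starRingEnd ℂ w - 2 * π * Complex.I := by
    simp [map_ofNat]; ring
  rw [h2, show a * (w + 2 * π * Complex.I) + b * (starRingEnd ℂ w - 2 * π * Complex.I) =
    (a * w + b * starRingEnd ℂ w) + (a - b) * (2 * π * Complex.I) by ring, h, Complex.exp_add,
    Complex.exp_int_mul_two_pi_mul_I, mul_one]

lemma boldW_add_two_pi (μ : ℂ) (d : ℤ) (w : ℂ) :
    boldW μ d (w + 2 * π * Complex.I) = boldW μ d w := by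
  rw [show w + 2 * π * Complex.I = w + π * Complex.I + π * Complex.I by ring, boldW_add_pi,
    boldW_add_pi]

lemma boldW'_add_two_pi (μ : ℂ) (d : ℤ) (w : ℂ) :
    boldW' μ d (w + 2 * π * Complex.I) = boldW' μ d w := by
  rw [show w + 2 * π * Complex.I = w + π * Complex.I + π * Complex.I by ring, boldW'_add_pi,
    boldW'_add_pi]

lemma bdry_add_two_pi (ρ μ : ℂ) (d j k : ℤ) (u w : ℂ) :
    bdry ρ μ d j k u (w + 2 * π * Complex.I) = bdry ρ μ d j k u w := by
  unfold bdry
  rw [boldW_add_two_pi, boldW'_add_two_pi, Complex.exp_periodic,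
    exp_int_mul_two_pi_shift (ρ + j - 2) (ρ + k) w (j - 2 - k) (by push_cast; ring)]

lemma waveTerm_add_two_pi (ρ μ : ℂ) (d j k : ℤ) (w : ℂ) :
    waveTerm ρ μ d j k (w + 2 * π * Complex.I) = waveTerm ρ μ d j k w := by
  unfold waveTerm
  rw [boldW_add_two_pi, exp_int_mul_two_pi_shift (ρ + j) (ρ + k) w (j - k) (by push_cast; ring)]

lemma besselComb_waveInt_of_integrableOn {A : Set ℝ} {ρ μ : ℂ} {d j k : ℤ}
    (h : IntegrableOn (fun p => waveTerm ρ μ d j k (cyl p)) (Ioc 0 (2 * π) ×ˢ A))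
    (h1 : IntegrableOn (fun p => waveTerm ρ μ d (j - 1) k (cyl p)) (Ioc 0 (2 * π) ×ˢ A))
    (h2 : IntegrableOn (fun p => waveTerm ρ μ d (j - 2) k (cyl p)) (Ioc 0 (2 * π) ×ˢ A)) (u : ℂ) :
    besselComb ρ μ d u (waveInt A ρ μ d j k u) (waveInt A ρ μ d (j - 2) k u)
      (waveInt A ρ μ d (j - 1) k u) j = ∫ p in Ioc 0 (2 * π) ×ˢ A,
        besselComb ρ μ d u (waveTerm ρ μ d j k (cyl p)) (waveTerm ρ μ d (j - 2) k (cyl p))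
          (waveTerm ρ μ d (j - 1) k (cyl p)) j * planeWave (Complex.exp (cyl p)) u := by
  have i0 := integrableOn_waveTerm_mul h u
  have i1 := integrableOn_waveTerm_mul h1 u
  have i2 := integrableOn_waveTerm_mul h2 u
  unfold besselComb waveInt
  rw [← integral_const_mul, ← integral_const_mul, ← integral_const_mul, ← integral_add,
    ← integral_sub]
  · congr 1; ext p; ring
  · exact (i0.const_mul _).add (i2.const_mul _)
  · exact i1.const_mul _
  · exact i0.const_mul _
  · exact i2.const_mul _

lemma integrableOn_waveTerm_Ioc {μ : ℂ} (h0 : μ ≠ 0) (ρ : ℂ) (d j k : ℤ) (T₁ T₂ : ℝ) :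
    IntegrableOn (fun p => waveTerm ρ μ d j k (cyl p)) (Ioc 0 (2 * π) ×ˢ Ioc T₁ T₂) := by
  refine (((continuous_waveTerm h0 ρ d j k).comp continuous_cyl).continuousOn.integrableOn_compact
    (isCompact_Icc.prod isCompact_Icc)).mono_set
    (Set.prod_mono Ioc_subset_Icc_self Ioc_subset_Icc_self)

lemma besselComb_waveInt_Ioc {μ : ℂ} (h0 : μ ≠ 0) (ρ : ℂ) (d j k : ℤ) (u : ℂ) {T₁ T₂ : ℝ}
    (hT : T₁ ≤ T₂) :
    besselComb ρ μ d u (waveInt (Ioc T₁ T₂) ρ μ d j k u) (waveInt (Ioc T₁ T₂) ρ μ d (j - 2) k u)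
      (waveInt (Ioc T₁ T₂) ρ μ d (j - 1) k u) j =
      2⁻¹ * (bdryInt ρ μ d j k u T₂ - bdryInt ρ μ d j k u T₁) := by
  rw [besselComb_waveInt_of_integrableOn (integrableOn_waveTerm_Ioc h0 _ _ _ _ _ _)
    (integrableOn_waveTerm_Ioc h0 _ _ _ _ _ _) (integrableOn_waveTerm_Ioc h0 _ _ _ _ _ _)]
  choose q hq using hasWirt_bdry h0 ρ d j k u
  refine integral_cyl_wirt hq ?_ (bdry_add_two_pi ρ μ d j k u) hT
  unfold besselComb
  have hw := fun i => continuous_waveTerm h0 ρ d i k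
  exact (((continuous_const.mul (hw _)).add (continuous_const.mul (hw _))).sub
    (continuous_const.mul (hw _))).mul (continuous_planeWave_exp u)

/-- For T ≥ 0 the factor e^T in the logarithmic derivative is compensated by the decay e^{-T} of 𝑱,
so only the weight |z|^{2ρ+j+k-2} matters: the boundary term is two powers smaller than the moment
weight. -/
lemma exists_bound_bdryInt {σ : ℝ} (hσ0 : 0 < σ) (hσ : σ < 1) (M : ℝ) (ρ : ℂ) (d j k : ℤ) :
    ∃ C : ℝ, 0 ≤ C ∧ ∀ μ : ℂ, |μ.re| ≤ σ → ‖μ‖ ≤ M → ∀ (u : ℂ) (T : ℝ),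
      (0 ≤ T → ‖bdryInt ρ μ d j k u T‖ ≤
        C * (1 + ‖u‖) * Real.exp ((2 * ρ.re + j + k - 2) * T)) ∧
      (T ≤ 0 → ‖bdryInt ρ μ d j k u T‖ ≤
        C * (1 + ‖u‖) * Real.exp ((2 * ρ.re + j + k - 2 - 2 * σ) * T)) := by
  obtain ⟨C, hC, h⟩ := exists_bound_boldW hσ0 hσ M d
  set K : ℝ := 1 + ‖ρ + j - 2‖ + 2 * π with hK
  have hK0 : 0 < K := by have := Real.pi_pos; positivity
  refine ⟨C * K * (2 * π), by have := Real.pi_pos; positivity, fun μ h1 h2 u T => ?_⟩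
  have hexp : ∀ φ : ℝ, ‖Complex.exp ((ρ + j - 2) * cyl (φ, T) +
      (ρ + k) * starRingEnd ℂ (cyl (φ, T)))‖ = Real.exp ((2 * ρ.re + j + k - 2) * T) := by
    intro φ
    have := norm_exp_wave ρ (j - 2) k (cyl (φ, T))
    push_cast at this
    rw [← add_sub_assoc] at this
    rw [this]
    congr 1; rw [cyl_re]; ring
  have hin : ∀ φ : ℝ, ‖(ρ + j - 2) + -2 * π * Complex.I * Complex.exp (cyl (φ, T)) * u‖ ≤
      ‖ρ + j - 2‖ + 2 * π * Real.exp T * ‖u‖ := by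
    intro φ
    refine (norm_add_le _ _).trans ?_
    have hpi : ‖(π : ℂ)‖ = π := by rw [Complex.norm_real, Real.norm_of_nonneg Real.pi_pos.le]
    simp only [norm_mul, norm_neg, Complex.norm_ofNat, hpi, Complex.norm_I, mul_one,
      Complex.norm_exp, cyl_re]
    exact le_rfl
  have hpi := Real.pi_pos
  have hρ := norm_nonneg (ρ + j - 2)
  have hu := norm_nonneg u
  have fin : ∀ B : ℝ, (∀ φ : ℝ, ‖boldW' μ d (cyl (φ, T)) - boldW μ d (cyl (φ, T)) *
      ((ρ + j - 2) + -2 * π * Complex.I * Complex.exp (cyl (φ, T)) * u)‖ ≤ B) →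
      ‖bdryInt ρ μ d j k u T‖ ≤ B * Real.exp ((2 * ρ.re + j + k - 2) * T) * (2 * π) := by
    intro B hB
    have := intervalIntegral.norm_integral_le_of_norm_le_const (a := 0) (b := 2 * π)
      (f := fun φ => bdry ρ μ d j k u (cyl (φ, T)))
      (C := B * Real.exp ((2 * ρ.re + j + k - 2) * T)) (fun φ _ => ?_)
    · rwa [sub_zero, abs_of_pos Real.two_pi_pos] at this
    · unfold bdry
      rw [norm_mul, norm_mul, norm_planeWave, mul_one, hexp]
      gcongr
      exact hB φ
  constructor
  · intro hT
    have h3 := fun φ : ℝ => (h μ h1 h2 (cyl (φ, T))).1 (by simpa using hT)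
    simp only [cyl_re] at h3
    refine (fin (C * K * (1 + ‖u‖)) fun φ => ?_).trans_eq (by ring)
    refine (norm_sub_le _ _).trans ?_
    rw [norm_mul]
    have e1 : Real.exp (-T) * Real.exp T = 1 := by rw [← Real.exp_add]; simp
    have e2 : Real.exp (-T) ≤ 1 := Real.exp_le_one_iff.2 (by linarith)
    calc _ ≤ C + C * Real.exp (-T) * (‖ρ + j - 2‖ + 2 * π * Real.exp T * ‖u‖) := by
          gcongr
          exacts [(h3 φ).2, (h3 φ).1, hin φ]
      _ = C + C * (Real.exp (-T) * ‖ρ + j - 2‖ + 2 * π * (Real.exp (-T) * Real.exp T) * ‖u‖) := by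
          ring
      _ ≤ C + C * (1 * ‖ρ + j - 2‖ + 2 * π * 1 * ‖u‖) := by rw [e1]; gcongr
      _ = C * (1 + ‖ρ + j - 2‖ + 2 * π * ‖u‖) := by ring
      _ ≤ _ := by
        rw [mul_assoc C K]
        refine mul_le_mul_of_nonneg_left ?_ hC
        rw [hK]
        nlinarith [mul_nonneg hρ hu, mul_nonneg hpi.le hu]
  · intro hT
    have h3 := fun φ : ℝ => (h μ h1 h2 (cyl (φ, T))).2 (by simpa using hT)
    simp only [cyl_re] at h3
    refine (fin (C * K * (1 + ‖u‖) * Real.exp (-2 * σ * T)) fun φ => ?_).trans_eq ?_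
    · refine (norm_sub_le _ _).trans ?_
      rw [norm_mul]
      have e2 : Real.exp T ≤ 1 := Real.exp_le_one_iff.2 hT
      calc _ ≤ C * Real.exp (-2 * σ * T) + C * Real.exp (-2 * σ * T) *
              (‖ρ + j - 2‖ + 2 * π * 1 * ‖u‖) := by
            gcongr
            exacts [(h3 φ).2, (h3 φ).1, (hin φ).trans (by gcongr)]
        _ = C * Real.exp (-2 * σ * T) * (1 + ‖ρ + j - 2‖ + 2 * π * ‖u‖) := by ring
        _ ≤ C * Real.exp (-2 * σ * T) * (K * (1 + ‖u‖)) := by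
          rw [hK]
          gcongr
          nlinarith [mul_nonneg hρ hu, mul_nonneg hpi.le hu]
        _ = _ := by ring
    · rw [show (2 * ρ.re + j + k - 2 - 2 * σ) * T = -2 * σ * T + (2 * ρ.re + j + k - 2) * T by ring,
        Real.exp_add]
      ring

lemma waveInt_Ioc_tendsto_Ioi {ρ μ : ℂ} {d j k : ℤ}
    (h : IntegrableOn (fun p => waveTerm ρ μ d j k (cyl p)) (Ioc 0 (2 * π) ×ˢ Ioi 0)) (u : ℂ) :
    Tendsto (fun T => waveInt (Ioc 0 T) ρ μ d j k u) atTop (𝓝 (waveInt (Ioi 0) ρ μ d j k u)) := by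
  have hU : ⋃ T : ℝ, Ioc 0 (2 * π) ×ˢ Ioc 0 T = Ioc 0 (2 * π) ×ˢ Ioi 0 := by
    rw [← Set.prod_iUnion, iUnion_Ioc_right]
  have := tendsto_setIntegral_of_monotone (ι := ℝ)
    (f := fun p => waveTerm ρ μ d j k (cyl p) * planeWave (Complex.exp (cyl p)) u)
    (s := fun T : ℝ => Ioc 0 (2 * π) ×ˢ Ioc 0 T) (μ := volume)
    (fun T => measurableSet_Ioc.prod measurableSet_Ioc)
    (fun T₁ T₂ hT => Set.prod_mono le_rfl (Ioc_subset_Ioc_right hT))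
    (by rw [hU]; exact integrableOn_waveTerm_mul h u)
  rwa [hU] at this

lemma waveInt_Ioc_tendsto_Iic {ρ μ : ℂ} {d j k : ℤ}
    (h : IntegrableOn (fun p => waveTerm ρ μ d j k (cyl p)) (Ioc 0 (2 * π) ×ˢ Iic 0)) (u : ℂ) :
    Tendsto (fun T => waveInt (Ioc (-T) 0) ρ μ d j k u) atTop
      (𝓝 (waveInt (Iic 0) ρ μ d j k u)) := by
  have hU : ⋃ T : ℝ, Ioc 0 (2 * π) ×ˢ Ioc (-T) 0 = Ioc 0 (2 * π) ×ˢ Iic 0 := by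
    rw [← Set.prod_iUnion]
    congr 1
    ext x
    simp only [mem_iUnion, mem_Ioc, mem_Iic]
    exact ⟨fun ⟨_, h⟩ => h.2, fun h => ⟨-x + 1, by linarith, h⟩⟩
  have := tendsto_setIntegral_of_monotone (ι := ℝ)
    (f := fun p => waveTerm ρ μ d j k (cyl p) * planeWave (Complex.exp (cyl p)) u)
    (s := fun T : ℝ => Ioc 0 (2 * π) ×ˢ Ioc (-T) 0) (μ := volume)
    (fun T => measurableSet_Ioc.prod measurableSet_Ioc)
    (fun T₁ T₂ hT => Set.prod_mono le_rfl (Ioc_subset_Ioc_left (neg_le_neg hT)))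
    (by rw [hU]; exact integrableOn_waveTerm_mul h u)
  rwa [hU] at this

lemma tendsto_besselComb {ι : Type*} {l : Filter ι} {x y z : ι → ℂ} {X Y Z : ℂ}
    (hx : Tendsto x l (𝓝 X)) (hy : Tendsto y l (𝓝 Y)) (hz : Tendsto z l (𝓝 Z))
    (ρ μ : ℂ) (d : ℤ) (u : ℂ) (j : ℤ) :
    Tendsto (fun T => besselComb ρ μ d u (x T) (y T) (z T) j) l
      (𝓝 (besselComb ρ μ d u X Y Z j)) := by
  unfold besselComb
  exact ((hx.const_mul _).add (hy.const_mul _)).sub (hz.const_mul _)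

lemma tendsto_exp_mul_atTop {κ : ℝ} (h : κ < 0) : Tendsto (fun T => Real.exp (κ * T)) atTop (𝓝 0) :=
  Real.tendsto_exp_atBot.comp (tendsto_id.const_mul_atTop_of_neg h)

lemma integrableOn_waveTerm_Ioi {σ : ℝ} (hσ0 : 0 < σ) (hσ : σ < 1) {ρ μ : ℂ} (hμ : |μ.re| ≤ σ)
    (d : ℤ) {j k : ℤ} (hs : 2 * ρ.re + j + k < 1) :
    IntegrableOn (fun p => waveTerm ρ μ d j k (cyl p)) (Ioc 0 (2 * π) ×ˢ Ioi 0) :=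
  integrableOn_waveTerm hσ0 hσ hμ d j k (integrableOn_envelope_Ioi hs)

lemma integrableOn_waveTerm_Iic {σ : ℝ} (hσ0 : 0 < σ) (hσ : σ < 1) {ρ μ : ℂ} (hμ : |μ.re| ≤ σ)
    (d : ℤ) {j k : ℤ} (hs : 2 * σ < 2 * ρ.re + j + k) (T : ℝ) :
    IntegrableOn (fun p => waveTerm ρ μ d j k (cyl p)) (Ioc 0 (2 * π) ×ˢ Iic T) :=
  integrableOn_waveTerm hσ0 hσ hμ d j k (integrableOn_envelope_Iic hs T)

lemma besselComb_waveInt_Ioi {σ : ℝ} (hσ0 : 0 < σ) (hσ : σ < 1) {ρ μ : ℂ} (h0 : μ ≠ 0)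
    (hμ : |μ.re| ≤ σ) (d : ℤ) {j k : ℤ} (hs : 2 * ρ.re + j + k < 1) (u : ℂ) :
    besselComb ρ μ d u (waveInt (Ioi 0) ρ μ d j k u) (waveInt (Ioi 0) ρ μ d (j - 2) k u)
      (waveInt (Ioi 0) ρ μ d (j - 1) k u) j = -2⁻¹ * bdryInt ρ μ d j k u 0 := by
  have hi : ∀ i ≤ j, IntegrableOn (fun p => waveTerm ρ μ d i k (cyl p))
      (Ioc 0 (2 * π) ×ˢ Ioi 0) := fun i hi => integrableOn_waveTerm_Ioi hσ0 hσ hμ d (by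
    have : (i : ℝ) ≤ j := by exact_mod_cast hi
    linarith)
  have h1 := tendsto_besselComb (waveInt_Ioc_tendsto_Ioi (hi j le_rfl) u)
    (waveInt_Ioc_tendsto_Ioi (hi (j - 2) (by omega)) u)
    (waveInt_Ioc_tendsto_Ioi (hi (j - 1) (by omega)) u) ρ μ d u j
  obtain ⟨C, hC, hb⟩ := exists_bound_bdryInt hσ0 hσ ‖μ‖ ρ d j k
  have h2 : Tendsto (fun T => bdryInt ρ μ d j k u T) atTop (𝓝 0) := by
    refine squeeze_zero_norm' (a := fun T => C * (1 + ‖u‖) *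
      Real.exp ((2 * ρ.re + j + k - 2) * T)) ?_ ?_
    · filter_upwards [eventually_ge_atTop 0] with T hT using (hb μ hμ le_rfl u T).1 hT
    · simpa using (tendsto_exp_mul_atTop (by linarith : 2 * ρ.re + j + k - 2 < 0)).const_mul
        (C * (1 + ‖u‖))
  refine tendsto_nhds_unique h1 ?_
  have h3 := (h2.sub_const (bdryInt ρ μ d j k u 0)).const_mul 2⁻¹
  rw [zero_sub, mul_neg, ← neg_mul] at h3
  refine h3.congr' ?_
  filter_upwards [eventually_ge_atTop 0] with T hT
  exact (besselComb_waveInt_Ioc h0 ρ d j k u hT).symm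

/-- The boundary term at z → 0 vanishes under `hs`. What remains at |z| = 1 is opposite in sign to
the one for the exterior, so the sum of the two parts satisfies a homogeneous equation. -/
lemma besselComb_waveInt_Iic {σ : ℝ} (hσ0 : 0 < σ) (hσ : σ < 1) {ρ μ : ℂ} (h0 : μ ≠ 0)
    (hμ : |μ.re| ≤ σ) (d : ℤ) {j k : ℤ} (hs : 2 * σ < 2 * ρ.re + j + k - 2) (u : ℂ) :
    besselComb ρ μ d u (waveInt (Iic 0) ρ μ d j k u) (waveInt (Iic 0) ρ μ d (j - 2) k u)
      (waveInt (Iic 0) ρ μ d (j - 1) k u) j = 2⁻¹ * bdryInt ρ μ d j k u 0 := by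
  have hi : ∀ i, j - 2 ≤ i → IntegrableOn (fun p => waveTerm ρ μ d i k (cyl p))
      (Ioc 0 (2 * π) ×ˢ Iic 0) := fun i hi => integrableOn_waveTerm_Iic hσ0 hσ hμ d (by
    have : ((j - 2 : ℤ) : ℝ) ≤ i := by exact_mod_cast hi
    push_cast at this
    linarith) 0
  have h1 := tendsto_besselComb (waveInt_Ioc_tendsto_Iic (hi j (by omega)) u)
    (waveInt_Ioc_tendsto_Iic (hi (j - 2) le_rfl) u)
    (waveInt_Ioc_tendsto_Iic (hi (j - 1) (by omega)) u) ρ μ d u j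
  obtain ⟨C, hC, hb⟩ := exists_bound_bdryInt hσ0 hσ ‖μ‖ ρ d j k
  have h2 : Tendsto (fun T => bdryInt ρ μ d j k u (-T)) atTop (𝓝 0) := by
    refine squeeze_zero_norm' (a := fun T => C * (1 + ‖u‖) *
      Real.exp (-(2 * ρ.re + j + k - 2 - 2 * σ) * T)) ?_ ?_
    · filter_upwards [eventually_ge_atTop 0] with T hT
      have := (hb μ hμ le_rfl u (-T)).2 (by linarith)
      rwa [mul_neg, ← neg_mul] at this
    · simpa using (tendsto_exp_mul_atTop
        (by linarith : -(2 * ρ.re + j + k - 2 - 2 * σ) < 0)).const_mul (C * (1 + ‖u‖))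
  refine tendsto_nhds_unique h1 ?_
  have h3 := (h2.const_sub (bdryInt ρ μ d j k u 0)).const_mul 2⁻¹
  rw [sub_zero] at h3
  refine h3.congr' ?_
  filter_upwards [eventually_ge_atTop 0] with T hT
  exact (besselComb_waveInt_Ioc h0 ρ d j k u (by linarith)).symm

/-! ### Symmetries of the integrals -/

lemma integral_cyl_shift {A : Set ℝ} {G : ℂ → ℂ} (hper : ∀ w, G (w + 2 * π * Complex.I) = G w)
    (α : ℝ) (h : IntegrableOn (fun p => G (cyl p)) (Ioc 0 (2 * π) ×ˢ A))
    (h' : IntegrableOn (fun p => G (cyl p + α * Complex.I)) (Ioc 0 (2 * π) ×ˢ A)) :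
    ∫ p in Ioc 0 (2 * π) ×ˢ A, G (cyl p + α * Complex.I) =
      ∫ p in Ioc 0 (2 * π) ×ˢ A, G (cyl p) := by
  unfold IntegrableOn at h h'
  rw [Measure.volume_eq_prod, ← Measure.prod_restrict] at h h' ⊢
  rw [integral_prod_symm _ h, integral_prod_symm _ h']
  congr 1; ext t
  have hp : Function.Periodic (fun φ : ℝ => G (cyl (φ, t))) (2 * π) := fun φ => by
    simp only
    rw [← hper (cyl (φ, t))]
    congr 1
    simp [cyl]; ring
  rw [← intervalIntegral.integral_of_le Real.two_pi_pos.le,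
    ← intervalIntegral.integral_of_le Real.two_pi_pos.le]
  have h1 : ∀ φ : ℝ, G (cyl (φ, t) + α * Complex.I) = G (cyl (φ + α, t)) := fun φ => by
    congr 1; simp [cyl]; ring
  simp only [h1]
  rw [intervalIntegral.integral_comp_add_right (fun φ : ℝ => G (cyl (φ, t)))]
  have := hp.intervalIntegral_add_eq (0 + α) 0
  rw [zero_add (2 * π)] at this
  rw [← this]
  congr 1; ring

lemma integral_cyl_conj {A : Set ℝ} {G : ℂ → ℂ} (hper : ∀ w, G (w + 2 * π * Complex.I) = G w)
    (h : IntegrableOn (fun p => G (cyl p)) (Ioc 0 (2 * π) ×ˢ A))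
    (h' : IntegrableOn (fun p => G (starRingEnd ℂ (cyl p))) (Ioc 0 (2 * π) ×ˢ A)) :
    ∫ p in Ioc 0 (2 * π) ×ˢ A, G (starRingEnd ℂ (cyl p)) =
      ∫ p in Ioc 0 (2 * π) ×ˢ A, G (cyl p) := by
  unfold IntegrableOn at h h'
  rw [Measure.volume_eq_prod, ← Measure.prod_restrict] at h h' ⊢
  rw [integral_prod_symm _ h, integral_prod_symm _ h']
  congr 1; ext t
  have hp : Function.Periodic (fun φ : ℝ => G (cyl (φ, t))) (2 * π) := fun φ => by
    simp only
    rw [← hper (cyl (φ, t))]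
    congr 1
    simp [cyl]; ring
  rw [← intervalIntegral.integral_of_le Real.two_pi_pos.le,
    ← intervalIntegral.integral_of_le Real.two_pi_pos.le]
  have h1 : ∀ φ : ℝ, G (starRingEnd ℂ (cyl (φ, t))) = G (cyl (-φ, t)) := fun φ => by
    congr 1; simp [cyl]
  simp only [h1]
  rw [intervalIntegral.integral_comp_neg (fun φ : ℝ => G (cyl (φ, t)))]
  have := hp.intervalIntegral_add_eq (-(2 * π)) 0
  rw [zero_add] at this
  rw [← this]
  congr 1; ring

lemma waveTerm_conj {μ : ℂ} (h0 : μ ≠ 0) (ρ : ℂ) (d j k : ℤ) (w : ℂ) :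
    waveTerm ρ μ (-d) k j (starRingEnd ℂ w) = waveTerm ρ μ d j k w := by
  unfold waveTerm
  rw [boldW_conj h0, neg_neg, Complex.conj_conj, add_comm ((ρ + k) * _)]

lemma planeWave_exp_add_two_pi (u w : ℂ) :
    planeWave (Complex.exp (w + 2 * π * Complex.I)) u = planeWave (Complex.exp w) u := by
  rw [Complex.exp_periodic]

lemma waveInt_conj {A : Set ℝ} {ρ μ : ℂ} (h0 : μ ≠ 0) {d j k : ℤ}
    (h : IntegrableOn (fun p => waveTerm ρ μ d j k (cyl p)) (Ioc 0 (2 * π) ×ˢ A))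
    (h' : IntegrableOn (fun p => waveTerm ρ μ (-d) k j (cyl p)) (Ioc 0 (2 * π) ×ˢ A)) (u : ℂ) :
    waveInt A ρ μ (-d) k j (starRingEnd ℂ u) = waveInt A ρ μ d j k u := by
  have e : ∀ w, waveTerm ρ μ (-d) k j (starRingEnd ℂ w) *
      planeWave (Complex.exp (starRingEnd ℂ w)) (starRingEnd ℂ u) =
      waveTerm ρ μ d j k w * planeWave (Complex.exp w) u := fun w => by
    rw [waveTerm_conj h0, Complex.exp_conj, planeWave_conj]
  unfold waveInt
  have := integral_cyl_conj (G := fun w => waveTerm ρ μ (-d) k j w *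
    planeWave (Complex.exp w) (starRingEnd ℂ u)) (A := A)
    (fun w => by rw [waveTerm_add_two_pi, planeWave_exp_add_two_pi])
    (integrableOn_waveTerm_mul h' _) (by
      simp only [e]
      exact integrableOn_waveTerm_mul h u)
  rw [← this]
  simp only [e]

lemma waveInt_neg_order {μ : ℂ} (h0 : μ ≠ 0) (A : Set ℝ) (ρ : ℂ) (d j k : ℤ) (u : ℂ) :
    waveInt A ρ (-μ) (-d) j k u = waveInt A ρ μ d j k u := by
  unfold waveInt waveTerm
  simp only [boldW_neg h0]

/-- The rotation z ↦ -z leaves 𝑱 and the weight |z|^{2ρ} unchanged and replaces u by -u in the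
character. -/
lemma waveInt_even {A : Set ℝ} {ρ μ : ℂ} {d : ℤ}
    (h : IntegrableOn (fun p => waveTerm ρ μ d 0 0 (cyl p)) (Ioc 0 (2 * π) ×ˢ A)) (u : ℂ) :
    waveInt A ρ μ d 0 0 (-u) = waveInt A ρ μ d 0 0 u := by
  have e : ∀ w, waveTerm ρ μ d 0 0 (w + π * Complex.I) *
      planeWave (Complex.exp (w + π * Complex.I)) u =
      waveTerm ρ μ d 0 0 w * planeWave (Complex.exp w) (-u) := fun w => by
    have h1 : (ρ + (0 : ℤ)) * (w + π * Complex.I) +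
        (ρ + (0 : ℤ)) * starRingEnd ℂ (w + π * Complex.I) =
        (ρ + (0 : ℤ)) * w + (ρ + (0 : ℤ)) * starRingEnd ℂ w := by
      simp only [map_add, map_mul, Complex.conj_ofReal, Complex.conj_I]
      ring
    unfold waveTerm planeWave
    rw [boldW_add_pi, Complex.exp_add w, Complex.exp_pi_mul_I, h1, mul_neg_one, neg_mul (Complex.exp w), mul_neg (Complex.exp w)]
  unfold waveInt
  have := integral_cyl_shift (G := fun w => waveTerm ρ μ d 0 0 w *
    planeWave (Complex.exp w) u) (A := A)
    (fun w => by rw [waveTerm_add_two_pi, planeWave_exp_add_two_pi]) π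
    (integrableOn_waveTerm_mul h _) (by
      simp only [e]
      exact integrableOn_waveTerm_mul h (-u))
  rw [← this]
  simp only [e]

/-! ### Continuation of the outer moments -/

/-- The boundary terms obey the same rule as the moments, ∂ raising j and ∂̄ raising k, and do so
for every u. The explicit factor u in `bdry` is separated off as the integral of h₂. -/
lemma hasWirt_bdryInt {μ : ℂ} (h0 : μ ≠ 0) (ρ : ℂ) (d j k : ℤ) (T : ℝ) (u : ℂ) :
    HasWirt (fun u => bdryInt ρ μ d j k u T)
      (-2 * π * Complex.I * bdryInt ρ μ d (j + 1) k u T)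
      (-2 * π * Complex.I * bdryInt ρ μ d j (k + 1) u T) u := by
  set c : ℂ := -2 * π * Complex.I with hc
  set E : ℝ → ℂ := fun φ => Complex.exp ((ρ + j - 2) * cyl (φ, T) +
    (ρ + k) * starRingEnd ℂ (cyl (φ, T))) with hE
  set z : ℝ → ℂ := fun φ => Complex.exp (cyl (φ, T)) with hz
  set h₁ : ℝ → ℂ := fun φ => (boldW' μ d (cyl (φ, T)) - boldW μ d (cyl (φ, T)) * (ρ + j - 2)) * E φ
    with hh₁
  set h₂ : ℝ → ℂ := fun φ => boldW μ d (cyl (φ, T)) * z φ * E φ with hh₂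
  have hcyl : Continuous fun φ : ℝ => cyl (φ, T) := continuous_cyl.comp (by fun_prop)
  have cz : Continuous z := Complex.continuous_exp.comp hcyl
  have cE : Continuous E := by simp only [hE]; fun_prop
  have cb := (continuous_boldW h0 d).comp hcyl
  have cb' := (continuous_boldW' h0 d).comp hcyl
  have c1 : Continuous h₁ := (cb'.sub (cb.mul continuous_const)).mul cE
  have c2 : Continuous h₂ := (cb.mul cz).mul cE
  have cint : ∀ {f : ℝ → ℂ}, Continuous f → Integrable f (volume.restrict (Ioc 0 (2 * π))) :=
    fun {f} hf => hf.integrableOn_Ioc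
  have cpw : ∀ u, Continuous fun φ => planeWave (z φ) u := fun u =>
    (continuous_planeWave_exp u).comp hcyl
  have w1 := hasWirt_integral_planeWave (m := volume.restrict (Ioc 0 (2 * π))) (cint c1)
    cz.aestronglyMeasurable (cint (c1.mul cz)) u
  have w2 := hasWirt_integral_planeWave (m := volume.restrict (Ioc 0 (2 * π))) (cint c2)
    cz.aestronglyMeasurable (cint (c2.mul cz)) u
  have w := w1.sub (((hasWirt_id u).const_mul c).mul w2)
  have e0 : ∀ v, bdryInt ρ μ d j k v T = (∫ φ in Ioc 0 (2 * π), h₁ φ * planeWave (z φ) v) -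
      c * v * ∫ φ in Ioc 0 (2 * π), h₂ φ * planeWave (z φ) v := by
    intro v
    unfold bdryInt bdry
    rw [intervalIntegral.integral_of_le Real.two_pi_pos.le, ← integral_const_mul, ← integral_sub]
    · congr 1; ext φ
      simp only [hh₁, hh₂, hE, hz]
      ring
    · exact cint (c1.mul (cpw v))
    · exact (cint (c2.mul (cpw v))).const_mul _
  refine (w.congr_fun (Eventually.of_forall e0)).congr_wirt ?_ ?_
  · unfold bdryInt bdry
    rw [intervalIntegral.integral_of_le Real.two_pi_pos.le, ← hc, ← integral_const_mul,
      ← integral_const_mul, ← integral_const_mul, ← integral_const_mul, ← integral_const_mul,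
      ← integral_add, ← integral_sub]
    · congr 1; ext φ
      have : Complex.exp ((ρ + ((j + 1 : ℤ) : ℂ) - 2) * cyl (φ, T) +
          (ρ + k) * starRingEnd ℂ (cyl (φ, T))) = E φ * z φ := by
        simp only [hE, hz]
        rw [← Complex.exp_add]
        congr 1; push_cast; ring
      rw [this]
      simp only [hh₁, hh₂, hz]
      push_cast
      ring
    · exact ((cint (c1.mul cz |>.mul (cpw u)))).const_mul _
    · exact ((cint (c2.mul (cpw u))).const_mul _).add
        (((cint (c2.mul cz |>.mul (cpw u))).const_mul _).const_mul _)
    · exact ((cint (c2.mul (cpw u))).const_mul _)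
    · exact (((cint (c2.mul cz |>.mul (cpw u))).const_mul _).const_mul _)
  · have czc : Continuous fun φ => starRingEnd ℂ (z φ) := Complex.continuous_conj.comp cz
    unfold bdryInt bdry
    rw [intervalIntegral.integral_of_le Real.two_pi_pos.le, ← hc, mul_zero, zero_mul, zero_add,
      ← integral_const_mul, ← integral_const_mul, ← integral_const_mul,
      ← integral_const_mul, ← integral_sub]
    · congr 1; ext φ
      have : Complex.exp ((ρ + j - 2) * cyl (φ, T) +
          (ρ + ((k + 1 : ℤ) : ℂ)) * starRingEnd ℂ (cyl (φ, T))) = E φ * starRingEnd ℂ (z φ) := by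
        simp only [hE, hz]
        rw [← Complex.exp_conj, ← Complex.exp_add]
        congr 1; push_cast; ring
      rw [this]
      simp only [hh₁, hh₂, hz]
      ring
    · exact ((cint (c1.mul czc |>.mul (cpw u)))).const_mul _
    · exact ((cint (c2.mul czc |>.mul (cpw u))).const_mul _).const_mul _

/-- `V j k` for `j + k ≤ n` behave like the moments `waveInt (Ioi 0) ρ μ d j k`, which they are for
`j + k < 0`. -/
structure WaveFamily (ρ μ : ℂ) (d n : ℤ) (V : ℤ → ℤ → ℂ → ℂ) : Prop where
  low : ∀ j k, j + k ≤ -1 → V j k = waveInt (Ioi 0) ρ μ d j k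
  wirt : ∀ j k, j + k ≤ n - 1 → ∀ u : ℂ, u ^ 2 ≠ 4 → HasWirt (V j k)
    (-2 * π * Complex.I * V (j + 1) k u) (-2 * π * Complex.I * V j (k + 1) u) u
  eq : ∀ j k, j + k ≤ n → ∀ u : ℂ, u ^ 2 ≠ 4 →
    besselComb ρ μ d u (V j k u) (V (j - 2) k u) (V (j - 1) k u) j = -2⁻¹ * bdryInt ρ μ d j k u 0
  eq_conj : ∀ j k, j + k ≤ n → ∀ u : ℂ, u ^ 2 ≠ 4 →
    besselComb ρ μ (-d) (starRingEnd ℂ u) (V j k u) (V j (k - 2) u) (V j (k - 1) u) k =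
      -2⁻¹ * bdryInt ρ μ (-d) k j (starRingEnd ℂ u) 0

/-- For j + k ≤ -1 and Re ρ < 1 the total exponent 2 Re ρ + j + k is below 1, the threshold of
absolute convergence given the decay 1/|z|. -/
lemma waveFamily_waveInt {σ : ℝ} (hσ0 : 0 < σ) (hσ : σ < 1) {ρ μ : ℂ} (h0 : μ ≠ 0)
    (hμ : |μ.re| ≤ σ) (hρ : ρ.re < 1) (d : ℤ) :
    WaveFamily ρ μ d (-1) (waveInt (Ioi 0) ρ μ d) := by
  have hi : ∀ (d j k : ℤ), j + k ≤ -1 → IntegrableOn (fun p => waveTerm ρ μ d j k (cyl p))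
      (Ioc 0 (2 * π) ×ˢ Ioi 0) := fun d j k h => integrableOn_waveTerm_Ioi hσ0 hσ hμ d (by
    have : (j : ℝ) + k ≤ -1 := by exact_mod_cast h
    linarith)
  refine ⟨fun j k _ => rfl, fun j k h u _ => hasWirt_waveInt (hi _ _ _ (by omega))
    (hi _ _ _ (by omega)) u, fun j k h u _ => besselComb_waveInt_Ioi hσ0 hσ h0 hμ d (by
    have : (j : ℝ) + k ≤ -1 := by exact_mod_cast h
    linarith) u, fun j k h u _ => ?_⟩
  have hc : ∀ i ≤ k, waveInt (Ioi 0) ρ μ d j i u =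
      waveInt (Ioi 0) ρ μ (-d) i j (starRingEnd ℂ u) := fun i hik =>
    (waveInt_conj h0 (hi d j i (by omega)) (hi (-d) i j (by omega)) u).symm
  rw [hc k le_rfl, hc (k - 1) (by omega), hc (k - 2) (by omega)]
  exact besselComb_waveInt_Ioi hσ0 hσ h0 hμ (-d) (by
    have : (j : ℝ) + k ≤ -1 := by exact_mod_cast h
    linarith) _

lemma eventually_sq_ne_four {u : ℂ} (hu : u ^ 2 ≠ 4) : ∀ᶠ v in 𝓝 u, v ^ 2 ≠ 4 :=
  (by fun_prop : Continuous fun v : ℂ => v ^ 2).continuousAt.eventually_ne hu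

/-- The moment determined by Bessel's equation. -/
def nextMoment (ρ μ : ℂ) (d : ℤ) (V : ℤ → ℤ → ℂ → ℂ) (j k : ℤ) (u : ℂ) : ℂ :=
  (4 * π ^ 2 * (u ^ 2 - 4))⁻¹ * (-2⁻¹ * bdryInt ρ μ d j k u 0 -
    ((μ + d) ^ 2 - (ρ + j - 2) ^ 2) * V (j - 2) k u +
    (2 * (ρ + j) - 3) * (-2 * π * Complex.I) * u * V (j - 1) k u)

lemma four_pi_sq_mul_ne_zero {u : ℂ} (hu : u ^ 2 ≠ 4) : (4 * π ^ 2 * (u ^ 2 - 4) : ℂ) ≠ 0 :=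
  mul_ne_zero (mul_ne_zero (by norm_num) (pow_ne_zero _ (Complex.ofReal_ne_zero.2 Real.pi_ne_zero)))
    (sub_ne_zero.2 hu)

lemma besselComb_eq_iff {ρ μ : ℂ} {d : ℤ} {V : ℤ → ℤ → ℂ → ℂ} {j k : ℤ} {u x : ℂ}
    (hu : u ^ 2 ≠ 4) :
    besselComb ρ μ d u x (V (j - 2) k u) (V (j - 1) k u) j = -2⁻¹ * bdryInt ρ μ d j k u 0 ↔
      x = nextMoment ρ μ d V j k u := by
  have h := four_pi_sq_mul_ne_zero hu
  unfold besselComb nextMoment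
  rw [eq_inv_mul_iff_mul_eq₀ h]
  constructor <;> intro h <;> linear_combination h

lemma hasWirt_nextMoment {ρ μ : ℂ} (h0 : μ ≠ 0) {d : ℤ} {V : ℤ → ℤ → ℂ → ℂ} {j k : ℤ} {u : ℂ}
    (hu : u ^ 2 ≠ 4) {p₁ q₁ p₂ q₂ : ℂ} (h₁ : HasWirt (V (j - 1) k) p₁ q₁ u)
    (h₂ : HasWirt (V (j - 2) k) p₂ q₂ u) : HasWirt (nextMoment ρ μ d V j k)
      ((4 * π ^ 2 * (u ^ 2 - 4))⁻¹ * (-2⁻¹ * (-2 * π * Complex.I * bdryInt ρ μ d (j + 1) k u 0) -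
        ((μ + d) ^ 2 - (ρ + j - 2) ^ 2) * p₂ + (2 * (ρ + j) - 3) * (-2 * π * Complex.I) *
          (V (j - 1) k u + u * p₁) - 8 * π ^ 2 * u * nextMoment ρ μ d V j k u))
      ((4 * π ^ 2 * (u ^ 2 - 4))⁻¹ * (-2⁻¹ * (-2 * π * Complex.I * bdryInt ρ μ d j (k + 1) u 0) -
        ((μ + d) ^ 2 - (ρ + j - 2) ^ 2) * q₂ + (2 * (ρ + j) - 3) * (-2 * π * Complex.I) *
          (u * q₁))) u := by
  have hD := four_pi_sq_mul_ne_zero hu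
  have a1 : HasDerivAt (fun u : ℂ => 4 * π ^ 2 * (u ^ 2 - 4)) (8 * π ^ 2 * u) u := by
    refine ((((hasDerivAt_id u).pow 2).sub_const 4).const_mul (4 * π ^ 2 : ℂ)).congr_deriv ?_
    simp; ring
  have a2 := hasWirt_of_hasDerivAt (a1.inv hD)
  have a3 := (hasWirt_bdryInt h0 ρ d j k 0 u).const_mul (-2⁻¹)
  have a4 := ((hasWirt_id u).const_mul ((2 * (ρ + j) - 3) * (-2 * π * Complex.I))).mul h₁
  refine ((a2.mul ((a3.sub (h₂.const_mul ((μ + d) ^ 2 - (ρ + j - 2) ^ 2))).add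
    a4))).congr_wirt ?_ ?_
  · simp only [nextMoment, Pi.inv_apply]
    field_simp
    ring
  · simp only [Pi.inv_apply]
    ring

lemma hasWirt_besselComb {x y z : ℂ → ℂ} {u x₁ x₂ y₁ y₂ z₁ z₂ : ℂ} (hx : HasWirt x x₁ x₂ u)
    (hy : HasWirt y y₁ y₂ u) (hz : HasWirt z z₁ z₂ u) (ρ μ : ℂ) (d j : ℤ) :
    ∃ q, HasWirt (fun v => besselComb ρ μ d (starRingEnd ℂ v) (x v) (y v) (z v) j)
      (besselComb ρ μ d (starRingEnd ℂ u) x₁ y₁ z₁ j) q u := by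
  have hc := hasWirt_conj u
  have h4 := ((hc.mul hc).sub (hasWirt_const 4 u)).const_mul (4 * π ^ 2 : ℂ)
  refine ⟨_, ((((h4.mul hx).add (hy.const_mul ((μ + d) ^ 2 - (ρ + j - 2) ^ 2))).sub
    (((hc.const_mul ((2 * (ρ + j) - 3) * (-2 * π * Complex.I))).mul hz))).congr_fun ?_).congr_wirt
      ?_ rfl⟩
  · refine Eventually.of_forall fun v => ?_
    unfold besselComb; ring
  · unfold besselComb; ring

lemma besselComb_mul (ρ μ : ℂ) (d : ℤ) (u a x y z : ℂ) (j : ℤ) :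
    besselComb ρ μ d u (a * x) (a * y) (a * z) j = a * besselComb ρ μ d u x y z j := by
  unfold besselComb; ring

lemma two_pi_I_ne_zero' : (-2 * π * Complex.I : ℂ) ≠ 0 := by
  simp [Real.pi_ne_zero]

/-- Bessel's equation expresses the moment (j, k) through (j-1, k) and (j-2, k) after division by u²
- 4, and this serves as the definition on the next diagonal j + k = n + 1. The derivative rules
persist since the defining formula and its boundary term differentiate consistently. -/
lemma WaveFamily.step {ρ μ : ℂ} (h0 : μ ≠ 0) {d n : ℤ} (hn : -1 ≤ n) {V : ℤ → ℤ → ℂ → ℂ}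
    (hV : WaveFamily ρ μ d n V) : WaveFamily ρ μ d (n + 1)
      (fun j k => if j + k ≤ n then V j k else nextMoment ρ μ d V j k) := by
  set V' : ℤ → ℤ → ℂ → ℂ := fun j k => if j + k ≤ n then V j k else nextMoment ρ μ d V j k with hV'
  have old : ∀ {j k}, j + k ≤ n → V' j k = V j k := fun h => if_pos h
  -- The recursive formula holds on the old diagonals as well, as it is equivalent to the equation
  -- `eq` there; the old and new moments can therefore be treated alike.
  have formula : ∀ {j k}, j + k ≤ n + 1 → ∀ u : ℂ, u ^ 2 ≠ 4 →
      V' j k u = nextMoment ρ μ d V j k u := by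
    intro j k h u hu
    by_cases h' : j + k ≤ n
    · rw [old h']
      exact (besselComb_eq_iff hu).1 (hV.eq j k h' u hu)
    · simp only [hV', if_neg h']
  have wirt : ∀ j k, j + k ≤ n + 1 - 1 → ∀ u : ℂ, u ^ 2 ≠ 4 → HasWirt (V' j k)
      (-2 * π * Complex.I * V' (j + 1) k u) (-2 * π * Complex.I * V' j (k + 1) u) u := by
    intro j k h u hu
    have hD := four_pi_sq_mul_ne_zero hu
    have w := hasWirt_nextMoment (ρ := ρ) h0 (d := d) hu
      (hV.wirt (j - 1) k (by omega) u hu) (hV.wirt (j - 2) k (by omega) u hu)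
    have ev : V' j k =ᶠ[𝓝 u] nextMoment ρ μ d V j k := by
      filter_upwards [eventually_sq_ne_four hu] with v hv using formula (by omega) v hv
    refine (w.congr_fun ev).congr_wirt ?_ ?_
    · rw [formula (by omega : j + 1 + k ≤ n + 1) u hu, inv_mul_eq_iff_eq_mul₀ hD]
      have f : nextMoment ρ μ d V j k u = V j k u := by
        rw [← formula (by omega) u hu, old (by omega)]
      rw [f]
      have : 4 * π ^ 2 * (u ^ 2 - 4) * nextMoment ρ μ d V (j + 1) k u =
          -2⁻¹ * bdryInt ρ μ d (j + 1) k u 0 -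
          ((μ + d) ^ 2 - (ρ + (j + 1 : ℤ) - 2) ^ 2) * V (j + 1 - 2) k u +
          (2 * (ρ + (j + 1 : ℤ)) - 3) * (-2 * π * Complex.I) * u * V (j + 1 - 1) k u := by
        rw [nextMoment, mul_inv_cancel_left₀ hD]
      rw [show (4 * π ^ 2 * (u ^ 2 - 4) : ℂ) * (-2 * π * Complex.I *
        nextMoment ρ μ d V (j + 1) k u) = (-2 * π * Complex.I) * (4 * π ^ 2 * (u ^ 2 - 4) *
        nextMoment ρ μ d V (j + 1) k u) by ring, this]
      rw [show j - 1 + 1 = j by ring, show j - 2 + 1 = j - 1 by ring, show j + 1 - 1 = j by ring,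
        show j + 1 - 2 = j - 1 by ring]
      push_cast
      linear_combination (-(8 * π ^ 2 * u * V j k u)) * Complex.I_sq
    · rw [formula (by omega : j + (k + 1) ≤ n + 1) u hu, nextMoment]
      ring
  refine ⟨fun j k h => (old (by omega)).trans (hV.low j k h), wirt, ?_, ?_⟩
  · intro j k h u hu
    rw [formula h u hu, old (by omega : j - 2 + k ≤ n), old (by omega : j - 1 + k ≤ n)]
    exact (besselComb_eq_iff hu).2 rfl
  · intro j k h u hu
    -- The equation in ū on the new diagonal is not part of the definition; it is the u-derivative
    -- of the known equation for (j-1, k), ū being constant for ∂.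
    have hw := fun i (hi : i ≤ k) => wirt (j - 1) i (by omega) u hu
    obtain ⟨q, hq⟩ := hasWirt_besselComb (hw k le_rfl) (hw (k - 2) (by omega))
      (hw (k - 1) (by omega)) ρ μ (-d) k
    have hb := ((hasWirt_bdryInt h0 ρ (-d) k (j - 1) 0 (starRingEnd ℂ u)).comp_conj).const_mul
      (-2⁻¹)
    have ev : (fun v => besselComb ρ μ (-d) (starRingEnd ℂ v) (V' (j - 1) k v)
        (V' (j - 1) (k - 2) v) (V' (j - 1) (k - 1) v) k) =ᶠ[𝓝 u]
        fun v => -2⁻¹ * bdryInt ρ μ (-d) k (j - 1) (starRingEnd ℂ v) 0 := by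
      filter_upwards [eventually_sq_ne_four hu] with v hv
      rw [old (by omega : j - 1 + k ≤ n), old (by omega : j - 1 + (k - 2) ≤ n),
        old (by omega : j - 1 + (k - 1) ≤ n)]
      exact hV.eq_conj (j - 1) k (by omega) v hv
    have := (hq.unique (hb.congr_fun ev)).1
    rw [besselComb_mul, show j - 1 + 1 = j by ring] at this
    refine mul_left_cancel₀ two_pi_I_ne_zero' (this.trans ?_)
    ring

lemma exists_waveFamily {σ : ℝ} (hσ0 : 0 < σ) (hσ : σ < 1) {ρ μ : ℂ} (h0 : μ ≠ 0)
    (hμ : |μ.re| ≤ σ) (hρ : ρ.re < 1) (d : ℤ) (n : ℕ) :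
    ∃ V, WaveFamily ρ μ d (n - 1) V := by
  induction n with
  | zero => exact ⟨_, by simpa using waveFamily_waveInt hσ0 hσ h0 hμ hρ d⟩
  | succ n ih =>
    obtain ⟨V, hV⟩ := ih
    have := hV.step h0 (by omega)
    rw [show (n : ℤ) - 1 + 1 = ((n + 1 : ℕ) : ℤ) - 1 by push_cast; ring] at this
    exact ⟨_, this⟩

/-! ### The improper integral -/

lemma waveInt_Iic_sub {ρ μ : ℂ} {d j k : ℤ} {T T' : ℝ} (hT : T ≤ T')
    (h : IntegrableOn (fun p => waveTerm ρ μ d j k (cyl p)) (Ioc 0 (2 * π) ×ˢ Iic T')) (u : ℂ) :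
    waveInt (Iic T') ρ μ d j k u = waveInt (Iic T) ρ μ d j k u +
      waveInt (Ioc T T') ρ μ d j k u := by
  unfold waveInt
  have hi := integrableOn_waveTerm_mul h u
  rw [← Iic_union_Ioc_eq_Iic hT, Set.prod_union, setIntegral_union]
  · refine Set.Disjoint.set_prod_right ?_ _ _
    exact Set.disjoint_left.2 fun x hx hx' => not_lt.2 hx hx'.1
  · exact measurableSet_Ioc.prod measurableSet_Ioc
  · exact hi.mono_set (Set.prod_mono le_rfl (Iic_subset_Iic.2 hT))
  · exact hi.mono_set (Set.prod_mono le_rfl fun x hx => hx.2)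

lemma norm_waveInt_le {A : Set ℝ} {ρ μ : ℂ} {d j k : ℤ} {g : ℝ → ℝ}
    (hA : MeasurableSet A) (hg : IntegrableOn g A)
    (hb : ∀ p : ℝ × ℝ, p.2 ∈ A → ‖waveTerm ρ μ d j k (cyl p)‖ ≤ g p.2) (u : ℂ) :
    ‖waveInt A ρ μ d j k u‖ ≤ 2 * π * ∫ t in A, g t := by
  unfold waveInt
  refine (norm_integral_le_of_norm_le (integrableOn_cyl_of_snd hg) ?_).trans_eq ?_
  · refine (ae_restrict_iff' (measurableSet_Ioc.prod hA)).2 (Eventually.of_forall fun p hp => ?_)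
    rw [norm_mul, norm_planeWave, mul_one]
    exact hb p hp.2
  · rw [Measure.volume_eq_prod, ← Measure.prod_restrict]
    have := integral_prod_mul (μ := volume.restrict (Ioc 0 (2 * π))) (ν := volume.restrict A)
      (fun _ : ℝ => (1 : ℝ)) g
    simp only [one_mul] at this
    rw [this]
    simp [Real.pi_pos.le]

lemma exists_bound_waveInt_Ioc {σ : ℝ} (hσ0 : 0 < σ) (hσ : σ < 1) (M : ℝ) (ρ : ℂ) (d j k : ℤ)
    (hs : 2 * ρ.re + j + k < 1) : ∃ C : ℝ, 0 ≤ C ∧ ∀ μ : ℂ, |μ.re| ≤ σ → ‖μ‖ ≤ M →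
      ∀ (u : ℂ) (T T' : ℝ), 0 ≤ T →
        ‖waveInt (Ioc T T') ρ μ d j k u‖ ≤ C * Real.exp ((2 * ρ.re + j + k - 1) * T) := by
  obtain ⟨C, hC, h⟩ := exists_bound_waveTerm hσ0 hσ M ρ d j k
  set s := 2 * ρ.re + j + k with hs'
  refine ⟨2 * π * (C * (1 - s)⁻¹), by have := Real.pi_pos; have : 0 < 1 - s := by linarith
                                      positivity, fun μ hμ hM u T T' hT => ?_⟩
  have hint := (integrableOn_exp_mul_Ioi (by linarith : s - 1 < 0) T)
  refine (norm_waveInt_le (g := fun t => C * Real.exp ((s - 1) * t)) measurableSet_Ioc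
    ((hint.mono_set Ioc_subset_Ioi_self).const_mul C) (fun p hp => ?_) u).trans ?_
  · have := h μ hμ hM (cyl p)
    rw [cyl_re, envelope, if_neg (not_le.2 (hT.trans_lt hp.1))] at this
    exact this
  · rw [integral_const_mul, mul_assoc (2 * π), mul_assoc C]
    refine mul_le_mul_of_nonneg_left (mul_le_mul_of_nonneg_left ?_ hC) Real.two_pi_pos.le
    refine (setIntegral_mono_set hint (Eventually.of_forall fun t => (Real.exp_pos _).le)
      (Ioc_subset_Ioi_self.eventuallyLE)).trans_eq ?_
    rw [integral_exp_mul_Ioi (by linarith)]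
    have : 1 - s ≠ 0 := by linarith
    have : s - 1 ≠ 0 := by linarith
    field_simp
    ring

/-- The integral over T < Re w ≤ T' is not absolutely small, but Bessel's equation writes (u² - 4)
times it through boundary terms and the moments with j = -1, -2, which converge absolutely; all are
O(e^{(2 Re ρ - 2)T}). This is integration by parts against the oscillation of 𝑱 and of the
character. -/
lemma exists_bound_tail {σ : ℝ} (hσ0 : 0 < σ) {ρ : ℂ} (hρσ : σ < ρ.re) (hρ : ρ.re < 1) (M : ℝ)
    (d : ℤ) : ∃ C : ℝ, 0 ≤ C ∧ ∀ μ : ℂ, |μ.re| < σ → ‖μ‖ < M → ∀ (u : ℂ) (T T' : ℝ), 0 ≤ T → T ≤ T' →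
      ‖(u ^ 2 - 4) * (waveInt (Iic T') ρ μ d 0 0 u - waveInt (Iic T) ρ μ d 0 0 u)‖ ≤
        C * (1 + ‖u‖) * Real.exp ((2 * ρ.re - 2) * T) := by
  have hσ : σ < 1 := hρσ.trans hρ
  obtain ⟨C₁, hC₁, h₁⟩ := exists_bound_waveInt_Ioc hσ0 hσ M ρ d (-1) 0 (by push_cast; linarith)
  obtain ⟨C₂, hC₂, h₂⟩ := exists_bound_waveInt_Ioc hσ0 hσ M ρ d (-2) 0 (by push_cast; linarith)
  obtain ⟨C₃, hC₃, h₃⟩ := exists_bound_bdryInt hσ0 hσ M ρ d 0 0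
  set A : ℝ := (|M| + ‖(d : ℂ)‖) ^ 2 + ‖ρ - 2‖ ^ 2 with hA
  set B : ℝ := ‖2 * ρ - 3‖ * (2 * π) with hB
  have hpi := Real.pi_pos
  refine ⟨C₃ + A * C₂ + B * C₁, by positivity, fun μ hμ hM u T T' hT hTT => ?_⟩
  have key : ∀ μ : ℂ, μ ≠ 0 → |μ.re| < σ → ‖μ‖ < M →
      ‖(u ^ 2 - 4) * (waveInt (Iic T') ρ μ d 0 0 u - waveInt (Iic T) ρ μ d 0 0 u)‖ ≤
        (C₃ + A * C₂ + B * C₁) * (1 + ‖u‖) * Real.exp ((2 * ρ.re - 2) * T) := by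
    intro μ h0 hμ hM
    have hi := integrableOn_waveTerm_Iic hσ0 hσ (ρ := ρ) hμ.le d (j := 0) (k := 0)
      (by push_cast; linarith) T'
    rw [waveInt_Iic_sub hTT hi, add_sub_cancel_left]
    have bp := besselComb_waveInt_Ioc h0 ρ d 0 0 u hTT
    unfold besselComb at bp
    norm_num at bp
    set E := Real.exp ((2 * ρ.re - 2) * T) with hE
    have hE0 : 0 < E := Real.exp_pos _
    have b1 : ‖waveInt (Ioc T T') ρ μ d (-1) 0 u‖ ≤ C₁ * E := by
      refine (h₁ μ hμ.le hM.le u T T' hT).trans_eq ?_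
      rw [hE]; congr 2; push_cast; ring
    have b2 : ‖waveInt (Ioc T T') ρ μ d (-2) 0 u‖ ≤ C₂ * E := by
      refine (h₂ μ hμ.le hM.le u T T' hT).trans ?_
      rw [hE]
      refine mul_le_mul_of_nonneg_left (Real.exp_le_exp.2 ?_) hC₂
      push_cast
      nlinarith
    have b3 : ‖bdryInt ρ μ d 0 0 u T‖ ≤ C₃ * (1 + ‖u‖) * E := by
      refine ((h₃ μ hμ.le hM.le u T).1 hT).trans_eq ?_
      rw [hE]; congr 2; push_cast; ring
    have b4 : ‖bdryInt ρ μ d 0 0 u T'‖ ≤ C₃ * (1 + ‖u‖) * E := by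
      refine ((h₃ μ hμ.le hM.le u T').1 (hT.trans hTT)).trans ?_
      rw [hE]
      refine mul_le_mul_of_nonneg_left (Real.exp_le_exp.2 ?_) (by positivity)
      push_cast
      nlinarith
    have bA : ‖(μ + d) ^ 2 - (ρ - 2) ^ 2‖ ≤ A := by
      refine (norm_sub_le _ _).trans ?_
      rw [norm_pow, norm_pow, hA]
      gcongr
      exact (norm_add_le _ _).trans (by gcongr; exact hM.le.trans (le_abs_self _))
    have bB : ‖(2 * ρ - 3) * (-2 * π * Complex.I)‖ = B := by
      rw [norm_mul, hB]
      simp [abs_of_pos hpi]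
    have e1 : (4 * π ^ 2 : ℂ) * ((u ^ 2 - 4) * waveInt (Ioc T T') ρ μ d 0 0 u) =
        2⁻¹ * (bdryInt ρ μ d 0 0 u T' - bdryInt ρ μ d 0 0 u T) -
        ((μ + d) ^ 2 - (ρ - 2) ^ 2) * waveInt (Ioc T T') ρ μ d (-2) 0 u +
        (2 * ρ - 3) * (-2 * π * Complex.I) * (u * waveInt (Ioc T T') ρ μ d (-1) 0 u) := by
      linear_combination bp
    have e2 : ‖(4 * π ^ 2 : ℂ)‖ = 4 * π ^ 2 := by simp [abs_of_pos hpi]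
    have e3 : ‖(4 * π ^ 2 : ℂ) * ((u ^ 2 - 4) * waveInt (Ioc T T') ρ μ d 0 0 u)‖ ≤
        2⁻¹ * (C₃ * (1 + ‖u‖) * E + C₃ * (1 + ‖u‖) * E) + A * (C₂ * E) + B * (‖u‖ * (C₁ * E)) := by
      rw [e1]
      refine (norm_add_le _ _).trans (add_le_add ((norm_sub_le _ _).trans (add_le_add ?_ ?_)) ?_)
      · rw [norm_mul]
        have : ‖(2⁻¹ : ℂ)‖ = 2⁻¹ := by simp
        rw [this]
        gcongr
        exact (norm_sub_le _ _).trans (add_le_add b4 b3)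
      · rw [norm_mul]
        gcongr
      · rw [norm_mul, bB, norm_mul]
        gcongr
    rw [norm_mul, e2] at e3
    have hu := norm_nonneg u
    have h4 : 1 ≤ 4 * π ^ 2 := by nlinarith [Real.pi_gt_three]
    have hA0 : 0 ≤ A * C₂ * E * ‖u‖ := by positivity
    have hB0 : 0 ≤ B * C₁ * E := by positivity
    have hn := norm_nonneg ((u ^ 2 - 4) * waveInt (Ioc T T') ρ μ d 0 0 u)
    calc _ ≤ 4 * π ^ 2 * ‖(u ^ 2 - 4) * waveInt (Ioc T T') ρ μ d 0 0 u‖ :=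
          le_mul_of_one_le_left hn h4
      _ ≤ _ := e3
      _ ≤ _ := by linarith
  -- Stokes' theorem was applied for μ ≠ 0; both sides are continuous in μ and the constant is
  -- uniform, so μ = 0 is a limit case.
  by_cases h0 : μ = 0
  · subst h0
    have hc := fun T => (continuousAt_waveInt hσ hμ d 0 0
      (integrableOn_envelope_Iic (by push_cast; linarith : 2 * σ < 2 * ρ.re + (0 : ℤ) + (0 : ℤ)) T)
      u).comp_of_eq (f := fun m : ℂ => (m, u)) (x := 0) (by fun_prop) rfl
    have hc' : ContinuousAt (fun m : ℂ => ‖(u ^ 2 - 4) * (waveInt (Iic T') ρ m d 0 0 u -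
        waveInt (Iic T) ρ m d 0 0 u)‖) 0 := (((hc T').sub (hc T)).const_mul (u ^ 2 - 4)).norm
    refine le_of_tendsto (hc'.tendsto.mono_left (nhdsWithin_le_nhds (s := {0}ᶜ))) ?_
    have e1 : ∀ᶠ m : ℂ in 𝓝 0, |m.re| < σ :=
      (by fun_prop : Continuous fun q : ℂ => |q.re|).continuousAt.eventually_lt
        continuousAt_const hμ
    have e2 : ∀ᶠ m : ℂ in 𝓝 0, ‖m‖ < M :=
      (by fun_prop : Continuous fun q : ℂ => ‖q‖).continuousAt.eventually_lt
        continuousAt_const hM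
    filter_upwards [self_mem_nhdsWithin, nhdsWithin_le_nhds e1, nhdsWithin_le_nhds e2] with m m0 m1 m2
    exact key m m0 m1 m2
  · exact key μ h0 hμ hM

/-- The integral of `𝑱` against a plane wave, as a limit of integrals over bounded domains. -/
def impInt (ρ μ : ℂ) (d : ℤ) (u : ℂ) : ℂ :=
  limUnder atTop fun T : ℝ => waveInt (Iic T) ρ μ d 0 0 u

lemma tendsto_impInt {ρ μ : ℂ} (hμ : |μ.re| < ρ.re) (hρ : ρ.re < 1) (d : ℤ) {u : ℂ}
    (hu : u ^ 2 ≠ 4) :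
    Tendsto (fun T : ℝ => waveInt (Iic T) ρ μ d 0 0 u) atTop (𝓝 (impInt ρ μ d u)) := by
  obtain ⟨σ, h1, h2⟩ := exists_between hμ
  obtain ⟨C, hC, h⟩ := exists_bound_tail ((abs_nonneg _).trans_lt h1) h2 hρ (‖μ‖ + 1) d
  refine tendsto_nhds_limUnder ?_
  have hu' : (u ^ 2 - 4) ≠ 0 := sub_ne_zero.2 hu
  have hc : CauchySeq fun T : ℝ => (u ^ 2 - 4) * waveInt (Iic T) ρ μ d 0 0 u := by
    have ht : Tendsto (fun T : ℝ => C * (1 + ‖u‖) * Real.exp ((2 * ρ.re - 2) * T)) atTop (𝓝 0) := by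
      simpa using (tendsto_exp_mul_atTop (by linarith : 2 * ρ.re - 2 < 0)).const_mul
        (C * (1 + ‖u‖))
    refine Metric.cauchySeq_iff'.2 fun ε hε => ?_
    obtain ⟨T, hT, hT0⟩ := ((ht.eventually_lt_const hε).and (eventually_ge_atTop 0)).exists
    refine ⟨T, fun T' hT' => ?_⟩
    rw [dist_eq_norm, ← mul_sub]
    exact (h μ h1 (by linarith) u T T' hT0 hT').trans_lt hT
  obtain ⟨L, hL⟩ := cauchySeq_tendsto_of_complete hc
  refine ⟨(u ^ 2 - 4)⁻¹ * L, (hL.const_mul (u ^ 2 - 4)⁻¹).congr fun T => ?_⟩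
  rw [inv_mul_cancel_left₀ hu']

lemma tendsto_mul_impInt {ρ μ : ℂ} (hμ : |μ.re| < ρ.re) (hρ : ρ.re < 1) (d : ℤ) (u : ℂ) :
    Tendsto (fun T : ℝ => (u ^ 2 - 4) * waveInt (Iic T) ρ μ d 0 0 u) atTop
      (𝓝 ((u ^ 2 - 4) * impInt ρ μ d u)) := by
  by_cases hu : u ^ 2 = 4
  · simp [hu]
  · exact (tendsto_impInt hμ hρ d hu).const_mul _

lemma exists_bound_impInt_sub {σ : ℝ} (hσ0 : 0 < σ) {ρ : ℂ} (hρσ : σ < ρ.re) (hρ : ρ.re < 1) (M : ℝ)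
    (d : ℤ) : ∃ C : ℝ, 0 ≤ C ∧ ∀ μ : ℂ, |μ.re| < σ → ‖μ‖ < M → ∀ (u : ℂ) (T : ℝ), 0 ≤ T →
      ‖(u ^ 2 - 4) * impInt ρ μ d u - (u ^ 2 - 4) * waveInt (Iic T) ρ μ d 0 0 u‖ ≤
        C * (1 + ‖u‖) * Real.exp ((2 * ρ.re - 2) * T) := by
  obtain ⟨C, hC, h⟩ := exists_bound_tail hσ0 hρσ hρ M d
  refine ⟨C, hC, fun μ hμ hM u T hT => ?_⟩
  refine le_of_tendsto ((tendsto_mul_impInt (hμ.trans hρσ) hρ d u).sub_const _).norm ?_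
  filter_upwards [eventually_ge_atTop T] with T' hT'
  rw [← mul_sub]
  exact h μ hμ hM u T T' hT hT'

/-- After multiplication by u² - 4 the truncated integrals converge locally uniformly in (μ, u),
including near u² = 4, and each of them is continuous. -/
lemma continuousAt_mul_impInt {ρ μ : ℂ} (hμ : |μ.re| < ρ.re) (hρ : ρ.re < 1) (d : ℤ) (u : ℂ) :
    ContinuousAt (fun q : ℂ × ℂ => (q.2 ^ 2 - 4) * impInt ρ q.1 d q.2) (μ, u) := by
  obtain ⟨σ, h1, h2⟩ := exists_between hμ
  obtain ⟨C, hC, h⟩ := exists_bound_impInt_sub ((abs_nonneg _).trans_lt h1) h2 hρ (‖μ‖ + 1) d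
  refine continuousAt_of_locally_uniform_approx_of_continuousAt fun V hV => ?_
  obtain ⟨ε, hε, hεV⟩ := Metric.mem_uniformity_dist.1 hV
  have ht : Tendsto (fun T : ℝ => C * (1 + (‖u‖ + 1)) * Real.exp ((2 * ρ.re - 2) * T)) atTop
      (𝓝 0) := by
    simpa using (tendsto_exp_mul_atTop (by linarith : 2 * ρ.re - 2 < 0)).const_mul
      (C * (1 + (‖u‖ + 1)))
  obtain ⟨T, hT, hT0⟩ := ((ht.eventually_lt_const hε).and (eventually_ge_atTop 0)).exists
  have e1 : ∀ᶠ q : ℂ × ℂ in 𝓝 (μ, u), |q.1.re| < σ :=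
    (by fun_prop : Continuous fun q : ℂ × ℂ => |q.1.re|).continuousAt.eventually_lt
      continuousAt_const h1
  have e2 : ∀ᶠ q : ℂ × ℂ in 𝓝 (μ, u), ‖q.1‖ < ‖μ‖ + 1 :=
    (by fun_prop : Continuous fun q : ℂ × ℂ => ‖q.1‖).continuousAt.eventually_lt
      continuousAt_const (by simp)
  have e3 : ∀ᶠ q : ℂ × ℂ in 𝓝 (μ, u), ‖q.2‖ < ‖u‖ + 1 :=
    (by fun_prop : Continuous fun q : ℂ × ℂ => ‖q.2‖).continuousAt.eventually_lt
      continuousAt_const (by simp)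
  refine ⟨_, (e1.and (e2.and e3)), fun q => (q.2 ^ 2 - 4) * waveInt (Iic T) ρ q.1 d 0 0 q.2, ?_, ?_⟩
  · refine ContinuousAt.mul (by fun_prop) ?_
    exact continuousAt_waveInt (h2.trans hρ) h1 d 0 0 (integrableOn_envelope_Iic
      (by push_cast; linarith) T) u
  · rintro q ⟨q1, q2, q3⟩
    refine hεV ?_
    rw [dist_eq_norm]
    refine (h q.1 q1 q2 q.2 T hT0).trans_lt (lt_of_le_of_lt ?_ hT)
    gcongr

lemma continuousAt_impInt {ρ μ : ℂ} (hμ : |μ.re| < ρ.re) (hρ : ρ.re < 1) (d : ℤ) {u : ℂ}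
    (hu : u ^ 2 ≠ 4) : ContinuousAt (fun q : ℂ × ℂ => impInt ρ q.1 d q.2) (μ, u) := by
  have hu' : (u ^ 2 - 4) ≠ 0 := sub_ne_zero.2 hu
  have h1 : ContinuousAt (fun q : ℂ × ℂ => (q.2 ^ 2 - 4)⁻¹ * ((q.2 ^ 2 - 4) * impInt ρ q.1 d q.2))
      (μ, u) :=
    (ContinuousAt.inv₀ (f := fun q : ℂ × ℂ => q.2 ^ 2 - 4) (by fun_prop) hu').mul
      (continuousAt_mul_impInt hμ hρ d u)
  refine h1.congr ?_
  have : ∀ᶠ q : ℂ × ℂ in 𝓝 (μ, u), q.2 ^ 2 - 4 ≠ 0 :=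
    (by fun_prop : Continuous fun q : ℂ × ℂ => q.2 ^ 2 - 4).continuousAt.eventually_ne hu'
  filter_upwards [this] with q hq
  rw [inv_mul_cancel_left₀ hq]

/-- Polynomial bounds independent of the truncation, to be used as a majorant when pairing with
Gaussians. -/
lemma exists_bound_mul_impInt {ρ μ : ℂ} (hμ : |μ.re| < ρ.re) (hρ : ρ.re < 1) (d : ℤ) :
    ∃ C : ℝ, 0 ≤ C ∧ ∀ (u : ℂ) (T : ℝ), 0 ≤ T →
      ‖(u ^ 2 - 4) * waveInt (Iic T) ρ μ d 0 0 u‖ ≤ C * (1 + ‖u‖) ^ 2 ∧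
      ‖(u ^ 2 - 4) * impInt ρ μ d u‖ ≤ C * (1 + ‖u‖) ^ 2 := by
  obtain ⟨σ, h1, h2⟩ := exists_between hμ
  have hσ0 := (abs_nonneg _).trans_lt h1
  obtain ⟨C, hC, h⟩ := exists_bound_tail hσ0 h2 hρ (‖μ‖ + 1) d
  obtain ⟨C', hC', h'⟩ := exists_bound_waveTerm hσ0 (h2.trans hρ) ‖μ‖ ρ d 0 0
  set K := 2 * π * ∫ t in Iic 0, C' * envelope σ (2 * ρ.re + (0 : ℤ) + (0 : ℤ)) t with hK
  have hK0 : ∀ u, ‖waveInt (Iic 0) ρ μ d 0 0 u‖ ≤ K := fun u =>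
    norm_waveInt_le measurableSet_Iic ((integrableOn_envelope_Iic
      (by push_cast; linarith) 0).const_mul C') (fun p _ => by
        simpa using h' μ h1.le le_rfl (cyl p)) u
  have hKn : 0 ≤ K := (norm_nonneg _).trans (hK0 0)
  have key : ∀ (u : ℂ) (T : ℝ), 0 ≤ T →
      ‖(u ^ 2 - 4) * waveInt (Iic T) ρ μ d 0 0 u‖ ≤ (4 * K + C) * (1 + ‖u‖) ^ 2 := by
    intro u T hT
    have hu := norm_nonneg u
    have e1 := h μ h1 (by linarith) u 0 T le_rfl hT
    rw [mul_zero, Real.exp_zero, mul_one] at e1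
    have e2 : ‖(u ^ 2 - 4) * waveInt (Iic 0) ρ μ d 0 0 u‖ ≤ (‖u‖ ^ 2 + 4) * K := by
      rw [norm_mul]
      gcongr
      · refine (norm_sub_le _ _).trans ?_
        rw [norm_pow]; simp
      · exact hK0 u
    have e3 : (u ^ 2 - 4) * waveInt (Iic T) ρ μ d 0 0 u = (u ^ 2 - 4) *
        (waveInt (Iic T) ρ μ d 0 0 u - waveInt (Iic 0) ρ μ d 0 0 u) +
        (u ^ 2 - 4) * waveInt (Iic 0) ρ μ d 0 0 u := by ring
    rw [e3]
    refine (norm_add_le _ _).trans ((add_le_add e1 e2).trans ?_)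
    nlinarith [mul_nonneg hC hu, mul_nonneg hKn hu, mul_nonneg (mul_nonneg hC hu) hu,
      mul_nonneg (mul_nonneg hKn hu) hu]
  refine ⟨4 * K + C, by positivity, fun u T hT => ⟨key u T hT, ?_⟩⟩
  refine le_of_tendsto (tendsto_mul_impInt hμ hρ d u).norm ?_
  filter_upwards [eventually_ge_atTop 0] with T' hT'
  exact key u T' hT'

lemma impInt_eq_waveInt_univ {ρ μ : ℂ} (hμ : |μ.re| < ρ.re) (hρ : ρ.re < 1 / 2) (d : ℤ) (u : ℂ) :
    IntegrableOn (fun p => waveTerm ρ μ d 0 0 (cyl p)) (Ioc 0 (2 * π) ×ˢ univ) ∧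
    impInt ρ μ d u = waveInt univ ρ μ d 0 0 u := by
  obtain ⟨σ, h1, h2⟩ := exists_between hμ
  have hσ0 := (abs_nonneg _).trans_lt h1
  have hi : IntegrableOn (fun p => waveTerm ρ μ d 0 0 (cyl p)) (Ioc 0 (2 * π) ×ˢ univ) := by
    rw [← Iic_union_Ioi (a := (0 : ℝ)), Set.prod_union]
    exact (integrableOn_waveTerm_Iic hσ0 (by linarith) h1.le d (by push_cast; linarith) 0).union
      (integrableOn_waveTerm_Ioi hσ0 (by linarith) h1.le d (by push_cast; linarith))
  refine ⟨hi, Tendsto.limUnder_eq ?_⟩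
  have hU : ⋃ T : ℝ, Ioc 0 (2 * π) ×ˢ Iic T = Ioc 0 (2 * π) ×ˢ (univ : Set ℝ) := by
    rw [← Set.prod_iUnion, iUnion_Iic]
  have := tendsto_setIntegral_of_monotone (ι := ℝ)
    (f := fun p => waveTerm ρ μ d 0 0 (cyl p) * planeWave (Complex.exp (cyl p)) u)
    (s := fun T : ℝ => Ioc 0 (2 * π) ×ˢ Iic T) (μ := volume)
    (fun T => measurableSet_Ioc.prod measurableSet_Iic)
    (fun T₁ T₂ hT => Set.prod_mono le_rfl (Iic_subset_Iic.2 hT))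
    (by rw [hU]; exact integrableOn_waveTerm_mul hi u)
  rwa [hU] at this

/-- Absolute convergence gives continuity at u² = 4 as well, which the oscillatory argument does not
reach. -/
lemma continuousAt_impInt_of_lt_half {ρ μ : ℂ} (hμ : |μ.re| < ρ.re) (hρ : ρ.re < 1 / 2) (d : ℤ)
    (u : ℂ) : ContinuousAt (fun q : ℂ × ℂ => impInt ρ q.1 d q.2) (μ, u) := by
  obtain ⟨σ, h1, h2⟩ := exists_between hμ
  have he : IntegrableOn (envelope σ (2 * ρ.re + (0 : ℤ) + (0 : ℤ))) univ := by
    rw [← Iic_union_Ioi (a := (0 : ℝ))]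
    exact (integrableOn_envelope_Iic (by push_cast; linarith) 0).union
      (integrableOn_envelope_Ioi (by push_cast; linarith))
  refine (continuousAt_waveInt (by linarith) h1 d 0 0 he u).congr ?_
  have : ∀ᶠ q : ℂ × ℂ in 𝓝 (μ, u), |q.1.re| < ρ.re :=
    (by fun_prop : Continuous fun q : ℂ × ℂ => |q.1.re|).continuousAt.eventually_lt
      continuousAt_const hμ
  filter_upwards [this] with q hq
  exact (impInt_eq_waveInt_univ hq hρ d q.2).2.symm

lemma impInt_even {ρ μ : ℂ} (hμ : |μ.re| < ρ.re) (hρ : ρ.re < 1) (d : ℤ) (u : ℂ) :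
    impInt ρ μ d (-u) = impInt ρ μ d u := by
  unfold impInt
  congr 2; ext T
  obtain ⟨σ, h1, h2⟩ := exists_between hμ
  exact waveInt_even (integrableOn_waveTerm_Iic ((abs_nonneg _).trans_lt h1) (h2.trans hρ)
    h1.le d (by push_cast; linarith) T) u

lemma impInt_conj {ρ μ : ℂ} (h0 : μ ≠ 0) (hμ : |μ.re| < ρ.re) (hρ : ρ.re < 1) (d : ℤ) (u : ℂ) :
    impInt ρ μ (-d) (starRingEnd ℂ u) = impInt ρ μ d u := by
  unfold impInt
  congr 2; ext T
  obtain ⟨σ, h1, h2⟩ := exists_between hμ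
  have hi := fun d => integrableOn_waveTerm_Iic (ρ := ρ) ((abs_nonneg _).trans_lt h1) (h2.trans hρ)
    h1.le d (j := 0) (k := 0) (by push_cast; linarith) T
  exact waveInt_conj h0 (hi d) (hi (-d)) u

lemma impInt_neg_order {μ : ℂ} (h0 : μ ≠ 0) (ρ : ℂ) (d : ℤ) (u : ℂ) :
    impInt ρ (-μ) (-d) u = impInt ρ μ d u := by
  unfold impInt
  simp only [waveInt_neg_order h0]

/-- The function `impInt` with the derivatives that enter its differential equations. -/
structure MomentFamily (ρ μ : ℂ) (d : ℤ) (I : ℤ → ℤ → ℂ → ℂ) : Prop where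
  zero : ∀ u : ℂ, u ^ 2 ≠ 4 → I 0 0 u = impInt ρ μ d u
  wirt : ∀ j k, 0 ≤ j → 0 ≤ k → j + k ≤ 2 → ∀ u : ℂ, u ^ 2 ≠ 4 → HasWirt (I j k)
    (-2 * π * Complex.I * I (j + 1) k u) (-2 * π * Complex.I * I j (k + 1) u) u
  eq : ∀ k, 0 ≤ k → k ≤ 1 → ∀ u : ℂ, u ^ 2 ≠ 4 →
    besselComb ρ μ d u (I 2 k u) (I 0 k u) (I 1 k u) 2 = 0
  eq_conj : ∀ j, 0 ≤ j → j ≤ 1 → ∀ u : ℂ, u ^ 2 ≠ 4 →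
    besselComb ρ μ (-d) (starRingEnd ℂ u) (I j 2 u) (I j 0 u) (I j 1 u) 2 = 0

lemma besselComb_add (ρ μ : ℂ) (d : ℤ) (u x y z x' y' z' : ℂ) (j : ℤ) :
    besselComb ρ μ d u (x + x') (y + y') (z + z') j =
      besselComb ρ μ d u x y z j + besselComb ρ μ d u x' y' z' j := by
  unfold besselComb; ring

/-- The family is the absolutely convergent part over |z| ≤ 1 plus the continued exterior moments;
the boundary integrals over |z| = 1 cancel in the sum. Diagonals up to j + k = 3 are needed, because
the equations are required for k, j ≤ 1 with a second derivative in the other variable. -/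
lemma exists_momentFamily {ρ μ : ℂ} (h0 : μ ≠ 0) (hμ : |μ.re| < ρ.re) (hρ : ρ.re < 1) (d : ℤ) :
    ∃ I, MomentFamily ρ μ d I := by
  obtain ⟨σ, h1, h2⟩ := exists_between hμ
  have hσ0 := (abs_nonneg _).trans_lt h1
  have hσ : σ < 1 := h2.trans hρ
  obtain ⟨V, hV⟩ := exists_waveFamily hσ0 hσ h0 h1.le hρ d 4
  have hi : ∀ (d : ℤ) {j k : ℤ}, 0 ≤ j → 0 ≤ k → IntegrableOn
      (fun p => waveTerm ρ μ d j k (cyl p)) (Ioc 0 (2 * π) ×ˢ Iic 0) := fun d j k hj hk =>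
    integrableOn_waveTerm_Iic hσ0 hσ h1.le d (by
      have : (0 : ℝ) ≤ j := by exact_mod_cast hj
      have : (0 : ℝ) ≤ k := by exact_mod_cast hk
      linarith) 0
  refine ⟨fun j k u => waveInt (Iic 0) ρ μ d j k u + V j k u, ?_, ?_, ?_, ?_⟩
  · intro u hu
    -- The continued exterior moment (0, 0) is the limit of the integrals over 0 < Re w ≤ T: in
    -- Stokes' formula for these, the boundary term at T tends to 0 and the lower moments converge.
    refine tendsto_nhds_unique ?_ (tendsto_impInt hμ hρ d hu)
    have hi' : ∀ i : ℤ, i ≤ -1 → IntegrableOn (fun p => waveTerm ρ μ d i 0 (cyl p))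
        (Ioc 0 (2 * π) ×ˢ Ioi 0) := fun i hi => integrableOn_waveTerm_Ioi hσ0 hσ h1.le d (by
      have : (i : ℝ) ≤ -1 := by exact_mod_cast hi
      push_cast
      linarith)
    have t1 := waveInt_Ioc_tendsto_Ioi (hi' (-1) le_rfl) u
    have t2 := waveInt_Ioc_tendsto_Ioi (hi' (-2) (by norm_num)) u
    obtain ⟨C, hC, hb⟩ := exists_bound_bdryInt hσ0 hσ ‖μ‖ ρ d 0 0
    have t3 : Tendsto (fun T => bdryInt ρ μ d 0 0 u T) atTop (𝓝 0) := by
      refine squeeze_zero_norm' (a := fun T => C * (1 + ‖u‖) *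
        Real.exp ((2 * ρ.re + (0 : ℤ) + (0 : ℤ) - 2) * T)) ?_ ?_
      · filter_upwards [eventually_ge_atTop 0] with T hT using (hb μ h1.le le_rfl u T).1 hT
      · simpa using (tendsto_exp_mul_atTop (by push_cast; linarith :
          2 * ρ.re + (0 : ℤ) + (0 : ℤ) - 2 < 0)).const_mul (C * (1 + ‖u‖))
    have hD := four_pi_sq_mul_ne_zero hu
    have hV0 := (besselComb_eq_iff hu).1 (hV.eq 0 0 (by norm_num) u hu)
    rw [hV0, nextMoment, hV.low (0 - 2) 0 (by norm_num), hV.low (0 - 1) 0 (by norm_num)]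
    have t4 := ((((t3.sub_const (bdryInt ρ μ d 0 0 u 0)).const_mul 2⁻¹).sub
      (t2.const_mul ((μ + d) ^ 2 - (ρ + (0 : ℤ) - 2) ^ 2))).add
      (t1.const_mul ((2 * (ρ + (0 : ℤ)) - 3) * (-2 * π * Complex.I) * u))).const_mul
      (4 * π ^ 2 * (u ^ 2 - 4) : ℂ)⁻¹
    have t5 := t4.const_add (waveInt (Iic 0) ρ μ d 0 0 u)
    convert t5.congr' ?_ using 2
    · congr 1
      rw [show (0 : ℤ) - 2 = -2 by norm_num, show (0 : ℤ) - 1 = -1 by norm_num]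
      ring
    · filter_upwards [eventually_ge_atTop 0] with T hT
      rw [waveInt_Iic_sub hT (integrableOn_waveTerm_Iic hσ0 hσ h1.le d (by push_cast; linarith) T)]
      congr 1
      rw [inv_mul_eq_iff_eq_mul₀ hD]
      have bp := besselComb_waveInt_Ioc h0 ρ d 0 0 u hT
      unfold besselComb at bp
      rw [show (0 : ℤ) - 2 = -2 by norm_num, show (0 : ℤ) - 1 = -1 by norm_num] at bp
      linear_combination -bp
  · intro j k hj hk hjk u hu
    refine ((hasWirt_waveInt (hi d hj hk) (hi d (by omega) hk) u).add
      (hV.wirt j k (by push_cast; omega) u hu)).congr_wirt ?_ ?_ <;> ring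
  · intro k hk hk1 u hu
    have hk' : (0 : ℝ) ≤ k := by exact_mod_cast hk
    have e1 := besselComb_waveInt_Iic hσ0 hσ h0 h1.le (ρ := ρ) d (j := 2) (k := k)
      (by push_cast; linarith) u
    have e2 := hV.eq 2 k (by push_cast; omega) u hu
    rw [show (2 : ℤ) - 2 = 0 by norm_num, show (2 : ℤ) - 1 = 1 by norm_num] at e1 e2
    rw [besselComb_add, e1, e2]
    ring
  · intro k hk hk1 u hu
    have hk' : (0 : ℝ) ≤ k := by exact_mod_cast hk
    have e1 := besselComb_waveInt_Iic hσ0 hσ h0 h1.le (ρ := ρ) (-d) (j := 2) (k := k)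
      (by push_cast; linarith) (starRingEnd ℂ u)
    have e2 := hV.eq_conj k 2 (by push_cast; omega) u hu
    rw [show (2 : ℤ) - 2 = 0 by norm_num, show (2 : ℤ) - 1 = 1 by norm_num] at e1 e2
    have hc : ∀ i, 0 ≤ i → waveInt (Iic 0) ρ μ (-d) i k (starRingEnd ℂ u) =
        waveInt (Iic 0) ρ μ d k i u := fun i hi0 => waveInt_conj h0 (hi d hk hi0) (hi (-d) hi0 hk) u
    rw [hc 2 (by norm_num), hc 1 (by norm_num), hc 0 le_rfl] at e1
    rw [besselComb_add, e1, e2]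
    ring

/-! ### The Gauss hypergeometric series -/

/-- The power series with coefficients `A` converges on the unit disc. -/
def UnitDiscSummable (A : ℕ → ℂ) : Prop :=
  ∀ r : ℝ, 0 ≤ r → r < 1 → Summable fun n => ‖A n‖ * r ^ n

lemma UnitDiscSummable.summable {A : ℕ → ℂ} (hA : UnitDiscSummable A) {z : ℂ} (hz : ‖z‖ < 1) :
    Summable fun n => A n * z ^ n := by
  refine Summable.of_norm ?_
  simpa [norm_mul, norm_pow] using hA ‖z‖ (norm_nonneg _) hz

lemma UnitDiscSummable.deriv {A : ℕ → ℂ} (hA : UnitDiscSummable A) :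
    UnitDiscSummable fun n => (n + 1) * A (n + 1) := by
  intro r hr hr1
  obtain ⟨s, hs, hs1⟩ := exists_between hr1
  have hs0 : 0 < s := hr.trans_lt hs
  have h1 : Summable fun n => ‖A (n + 1)‖ * s ^ (n + 1) :=
    (summable_nat_add_iff (f := fun n => ‖A n‖ * s ^ n) 1).2 (hA s hs0.le hs1)
  have h2 : Tendsto (fun n : ℕ => ((n : ℝ) + 1) * (r / s) ^ n) atTop (𝓝 0) := by
    have hrs : |r / s| < 1 := by
      rw [abs_of_nonneg (by positivity), div_lt_one hs0]; exact hs
    have e1 := tendsto_self_mul_const_pow_of_abs_lt_one hrs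
    have e2 := tendsto_pow_atTop_nhds_zero_of_abs_lt_one hrs
    have e3 := e1.add e2
    rw [add_zero] at e3
    exact e3.congr fun n => by ring
  obtain ⟨K, hK⟩ := h2.bddAbove_range
  refine Summable.of_nonneg_of_le (fun n => by positivity) (fun n => ?_) (h1.mul_left (K / s))
  have h3 : ((n : ℝ) + 1) * (r / s) ^ n ≤ K := hK ⟨n, rfl⟩
  have h4 : ‖((n : ℂ) + 1)‖ = (n : ℝ) + 1 := by
    rw [show ((n : ℂ) + 1) = ((n + 1 : ℕ) : ℂ) by push_cast; rfl, Complex.norm_natCast]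
    push_cast; rfl
  rw [norm_mul, h4]
  calc ((n : ℝ) + 1) * ‖A (n + 1)‖ * r ^ n = ‖A (n + 1)‖ * s ^ n * (((n : ℝ) + 1) * (r / s) ^ n) := by
        rw [div_pow]; field_simp
    _ ≤ ‖A (n + 1)‖ * s ^ n * K := by gcongr
    _ = _ := by rw [pow_succ]; field_simp

lemma UnitDiscSummable.hasDerivAt {A : ℕ → ℂ} (hA : UnitDiscSummable A) {z : ℂ} (hz : ‖z‖ < 1) :
    HasDerivAt (fun z => ∑' n, A n * z ^ n) (∑' n : ℕ, (n + 1) * A (n + 1) * z ^ n) z := by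
  obtain ⟨r, hr, hr1⟩ := exists_between hz
  have hr0 := (norm_nonneg z).trans hr.le
  have hd : ∀ i : ℕ, DifferentiableOn ℂ (fun w : ℂ => A i * w ^ i) (Metric.ball 0 r) := fun i =>
    (by fun_prop : Differentiable ℂ fun w : ℂ => A i * w ^ i).differentiableOn
  have hle : ∀ (i : ℕ) (w : ℂ), w ∈ Metric.ball (0 : ℂ) r → ‖A i * w ^ i‖ ≤ ‖A i‖ * r ^ i := by
    intro i w hw
    rw [norm_mul, norm_pow]
    have := (mem_ball_zero_iff.1 hw).le
    gcongr
  have hzr : z ∈ Metric.ball (0 : ℂ) r := mem_ball_zero_iff.2 hr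
  have h1 := Complex.hasSum_deriv_of_summable_norm (hA r hr0 hr1) hd Metric.isOpen_ball hle hzr
  have h2 := (Complex.differentiableOn_tsum_of_summable_norm (hA r hr0 hr1) hd Metric.isOpen_ball
    hle).differentiableAt (Metric.isOpen_ball.mem_nhds hzr)
  refine h2.hasDerivAt.congr_deriv ?_
  rw [← h1.tsum_eq]
  have h3 : ∀ i : ℕ, _root_.deriv (fun w : ℂ => A i * w ^ i) z = i * A i * z ^ (i - 1) := by
    intro i
    rw [((hasDerivAt_pow i z).const_mul (A i)).deriv]; ring
  simp only [h3]
  have h4 : Summable fun i : ℕ => (i : ℂ) * A i * z ^ (i - 1) := by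
    refine (h1.summable.congr fun i => ?_)
    exact h3 i
  rw [h4.tsum_eq_zero_add]
  simp

lemma UnitDiscSummable.hasSum_mul_succ {B : ℕ → ℂ} {S z : ℂ}
    (h : HasSum (fun n => B (n + 1) * z ^ n) S) (h0 : B 0 = 0) :
    HasSum (fun n => B n * z ^ n) (z * S) := by
  have h1 : HasSum (fun n => B (n + 1) * z ^ (n + 1)) (z * S) := by
    refine (h.mul_left z).congr_fun fun n => ?_
    rw [pow_succ]; ring
  have h2 := (hasSum_nat_add_iff (f := fun n => B n * z ^ n) 1).1 h1
  simpa [h0] using h2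

lemma tendsto_norm_add_nat (c : ℂ) : Tendsto (fun n : ℕ => ‖c + n‖) atTop atTop := by
  refine tendsto_atTop_mono (f := fun n : ℕ => (n : ℝ) - ‖c‖) (fun n => ?_) ?_
  · have := norm_sub_le (c + n) c
    simp at this
    linarith
  · exact tendsto_atTop_add_const_right _ _ tendsto_natCast_atTop_atTop

lemma tendsto_add_nat_div (a c : ℂ) :
    Tendsto (fun n : ℕ => (a + n) / (c + n)) atTop (𝓝 1) := by
  have h1 : Tendsto (fun n : ℕ => (c + n)⁻¹) atTop (𝓝 0) :=
    tendsto_inv₀_cobounded.comp (tendsto_norm_atTop_iff_cobounded.1 (tendsto_norm_add_nat c))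
  have h2 := (h1.const_mul (a - c)).const_add 1
  rw [mul_zero, add_zero] at h2
  refine h2.congr' ?_
  filter_upwards [(tendsto_norm_add_nat c).eventually_gt_atTop 0] with n hn
  have : c + n ≠ 0 := norm_pos_iff.1 hn
  field_simp
  ring

/-- The coefficients of the Gauss series. -/
abbrev gaussCoeff (a b c : ℂ) (n : ℕ) : ℂ := ordinaryHypergeometricCoefficient a b c n

lemma gaussCoeff_succ' (a b c : ℂ) (n : ℕ) : gaussCoeff a b c (n + 1) =
    ((a + n) / (c + n)) * ((b + n) / (1 + n)) * gaussCoeff a b c n := by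
  unfold gaussCoeff ordinaryHypergeometricCoefficient
  rw [ascPochhammer_succ_eval, ascPochhammer_succ_eval, ascPochhammer_succ_eval, Nat.factorial_succ]
  push_cast
  rw [mul_inv, mul_inv, div_eq_mul_inv, div_eq_mul_inv, add_comm (n : ℂ) 1]
  ring

lemma gaussCoeff_succ (a b : ℂ) {c : ℂ} (hc : ∀ n : ℕ, c ≠ -n) (n : ℕ) :
    (n + 1) * (n + c) * gaussCoeff a b c (n + 1) = (a + n) * (b + n) * gaussCoeff a b c n := by
  have h1 : c + n ≠ 0 := fun h => hc n (eq_neg_of_add_eq_zero_left h)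
  have h2 : (1 + n : ℂ) ≠ 0 := by
    rw [add_comm]; exact Nat.cast_add_one_ne_zero n
  rw [gaussCoeff_succ']
  field_simp
  ring

lemma unitDiscSummable_gaussCoeff (a b c : ℂ) : UnitDiscSummable (gaussCoeff a b c) := by
  intro r hr hr1
  obtain ⟨s, hs, hs1⟩ := exists_between hr1
  have h1 := ((tendsto_add_nat_div a c).mul (tendsto_add_nat_div b 1)).norm.mul_const r
  rw [mul_one, norm_one, one_mul] at h1
  refine summable_of_ratio_norm_eventually_le hs1 ?_
  filter_upwards [h1.eventually_lt_const hs] with n hn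
  rw [gaussCoeff_succ']
  generalize gaussCoeff a b c n = g
  rw [Real.norm_of_nonneg (by positivity), Real.norm_of_nonneg (by positivity),
    norm_mul _ g, pow_succ]
  calc _ = ‖(a + n) / (c + n) * ((b + n) / (1 + n))‖ * r * (‖g‖ * r ^ n) := by ring
    _ ≤ _ := by gcongr

lemma gauss_eq_tsum (a b c z : ℂ) : ₂F₁ a b c z = ∑' n, gaussCoeff a b c n * z ^ n := by
  rw [ordinaryHypergeometric_eq_tsum]
  simp [smul_eq_mul]

/-- The derivative of the Gauss series. -/
def gauss' (a b c z : ℂ) : ℂ := ∑' n : ℕ, (n + 1) * gaussCoeff a b c (n + 1) * z ^ n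

/-- The second derivative of the Gauss series. -/
def gauss'' (a b c z : ℂ) : ℂ :=
  ∑' n : ℕ, (n + 1) * (((n + 1 : ℕ) + 1) * gaussCoeff a b c (n + 1 + 1)) * z ^ n

lemma hasDerivAt_gauss (a b c : ℂ) {z : ℂ} (hz : ‖z‖ < 1) :
    HasDerivAt (₂F₁ a b c : ℂ → ℂ) (gauss' a b c z) z := by
  have := (unitDiscSummable_gaussCoeff a b c).hasDerivAt hz
  exact this.congr_of_eventuallyEq (Eventually.of_forall fun w => gauss_eq_tsum a b c w)

lemma hasDerivAt_gauss' (a b c : ℂ) {z : ℂ} (hz : ‖z‖ < 1) :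
    HasDerivAt (gauss' a b c) (gauss'' a b c z) z :=
  (unitDiscSummable_gaussCoeff a b c).deriv.hasDerivAt hz

/-- Gauss's differential equation. -/
lemma gauss_ode (a b : ℂ) {c : ℂ} (hc : ∀ n : ℕ, c ≠ -n) {z : ℂ} (hz : ‖z‖ < 1) :
    z * (1 - z) * gauss'' a b c z + (c - (a + b + 1) * z) * gauss' a b c z -
      a * b * ₂F₁ a b c z = 0 := by
  have hA := unitDiscSummable_gaussCoeff a b c
  have s0 := (hA.summable hz).hasSum
  have s1 := (hA.deriv.summable hz).hasSum
  have s2 := (hA.deriv.deriv.summable hz).hasSum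
  rw [← gauss_eq_tsum] at s0
  have t1 := UnitDiscSummable.hasSum_mul_succ (B := fun n : ℕ => n * gaussCoeff a b c n) (z := z)
    (S := gauss' a b c z) (s1.congr_fun fun n => by push_cast; rfl) (by simp)
  have t2 := UnitDiscSummable.hasSum_mul_succ (B := fun n : ℕ => n * ((n + 1) *
    gaussCoeff a b c (n + 1))) (z := z)
    (S := gauss'' a b c z) (s2.congr_fun fun n => by push_cast; rfl) (by simp)
  have t3 := UnitDiscSummable.hasSum_mul_succ (B := fun n : ℕ => n * ((n - 1) *
    gaussCoeff a b c n)) (z := z) (S := z * gauss'' a b c z)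
    (t2.congr_fun fun n => by push_cast; ring) (by simp)
  have tot := (((t2.sub t3).add ((s1.mul_left c).sub (t1.mul_left (a + b + 1)))).sub
    (s0.mul_left (a * b)))
  have hz : (fun n : ℕ => ((n : ℂ) * ((n + 1) * gaussCoeff a b c (n + 1)) * z ^ n -
      n * ((n - 1) * gaussCoeff a b c n) * z ^ n) +
      (c * ((n + 1) * gaussCoeff a b c (n + 1) * z ^ n) -
        (a + b + 1) * (n * gaussCoeff a b c n * z ^ n)) -
      a * b * (gaussCoeff a b c n * z ^ n)) = fun _ => 0 := by
    ext n
    linear_combination z ^ n * gaussCoeff_succ a b hc n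
  rw [hz] at tot
  have := tot.unique hasSum_zero
  unfold gauss' at *
  linear_combination this

lemma analyticAt_gauss (a b c : ℂ) {z : ℂ} (hz : ‖z‖ < 1) : AnalyticAt ℂ (₂F₁ a b c : ℂ → ℂ) z := by
  refine DifferentiableOn.analyticAt (s := Metric.ball 0 1) (fun w hw => ?_)
    (Metric.isOpen_ball.mem_nhds (by simpa using hz))
  exact (hasDerivAt_gauss a b c (by simpa using hw)).differentiableAt.differentiableWithinAt

/-- The Gauss series is the only solution of Gauss's equation analytic at `0` with value `1`. -/
lemma eventuallyEq_gauss_of_ode (a b : ℂ) {c : ℂ} (hc : ∀ n : ℕ, c ≠ -n) {G G' G'' : ℂ → ℂ}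
    (h1 : ∀ᶠ z in 𝓝 0, HasDerivAt G (G' z) z) (h2 : ∀ᶠ z in 𝓝 0, HasDerivAt G' (G'' z) z)
    (hG0 : G 0 = 1)
    (hode : ∀ᶠ z in 𝓝 0, z * (1 - z) * G'' z + (c - (a + b + 1) * z) * G' z - a * b * G z = 0) :
    G =ᶠ[𝓝 0] ₂F₁ a b c := by
  have hball : ∀ᶠ z : ℂ in 𝓝 0, ‖z‖ < 1 :=
    continuous_norm.continuousAt.eventually_lt continuousAt_const (by simp)
  set W : ℂ → ℂ := fun z => ₂F₁ a b c z * G' z - gauss' a b c z * G z with hW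
  have hWd : ∀ᶠ z in 𝓝 0, HasDerivAt W (₂F₁ a b c z * G'' z - gauss'' a b c z * G z) z := by
    filter_upwards [h1, h2, hball] with z z1 z2 z3
    refine (((hasDerivAt_gauss a b c z3).mul z2).sub
      ((hasDerivAt_gauss' a b c z3).mul z1)).congr_deriv ?_
    ring
  have hWan : AnalyticAt ℂ W 0 := by
    rw [Complex.analyticAt_iff_eventually_differentiableAt]
    filter_upwards [hWd] with z hz using hz.differentiableAt
  have hWode : ∀ᶠ z in 𝓝 0, z * (1 - z) * deriv W z + (c - (a + b + 1) * z) * W z = 0 := by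
    filter_upwards [hWd, hode, hball] with z z1 z2 z3
    rw [z1.deriv]
    linear_combination ₂F₁ a b c z * z2 - G z * gauss_ode a b hc z3
  -- If W vanished to exact order k at 0, the lowest order term of its equation would force k + c =
  -- 0, which `hc` excludes.
  have hW0 : ∀ᶠ z in 𝓝 0, W z = 0 := by
    by_contra hne
    obtain ⟨k, h, han, hne0, hev⟩ := hWan.exists_eventuallyEq_pow_smul_nonzero_iff.2 hne
    simp only [sub_zero, smul_eq_mul] at hev
    have hd : ∀ᶠ z in 𝓝 0, deriv W z = k * z ^ (k - 1) * h z + z ^ k * deriv h z := by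
      filter_upwards [hev.eventually_nhds, han.eventually_analyticAt] with z hz hz'
      have := ((hasDerivAt_pow k z).mul hz'.differentiableAt.hasDerivAt).congr_of_eventuallyEq hz
      exact this.deriv
    have hk : ∀ z : ℂ, z * (k * z ^ (k - 1)) = k * z ^ k := by
      intro z
      rcases Nat.eq_zero_or_pos k with h0 | h0
      · simp [h0]
      · obtain ⟨m, rfl⟩ : ∃ m, k = m + 1 := ⟨k - 1, by omega⟩
        rw [Nat.add_sub_cancel, pow_succ]; ring
    set B : ℂ → ℂ := fun z => (1 - z) * (k * h z + z * deriv h z) + (c - (a + b + 1) * z) * h z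
    have hB : ∀ᶠ z in 𝓝[≠] 0, B z = 0 := by
      filter_upwards [nhdsWithin_le_nhds hd, nhdsWithin_le_nhds hWode, nhdsWithin_le_nhds hev,
        self_mem_nhdsWithin] with z z1 z2 z3 z4
      rw [z1, z3] at z2
      have : z ^ k * B z = 0 := by
        simp only [B]
        linear_combination z2 - (1 - z) * h z * hk z
      exact (mul_eq_zero.1 this).resolve_left (pow_ne_zero _ z4)
    have hBc : ContinuousAt B 0 := by
      have c1 := han.continuousAt
      have c2 := han.deriv.continuousAt
      fun_prop
    have hB0 : B 0 = 0 := by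
      refine tendsto_nhds_unique
        (hBc.tendsto.mono_left (nhdsWithin_le_nhds (s := {(0 : ℂ)}ᶜ))) ?_
      exact (tendsto_const_nhds (x := (0 : ℂ))).congr' (hB.mono fun z hz => hz.symm)
    have : (k + c) * h 0 = 0 := by
      simp only [B] at hB0
      linear_combination hB0
    rcases mul_eq_zero.1 this with h | h
    · exact hc k (by linear_combination h)
    · exact hne0 h
  have hF0 : (₂F₁ a b c (0 : ℂ)) = 1 := ordinaryHypergeometric_zero a b c
  have hFne : ∀ᶠ z : ℂ in 𝓝 0, ₂F₁ a b c z ≠ 0 :=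
    (analyticAt_gauss a b c (by simp)).continuousAt.eventually_ne (by rw [hF0]; exact one_ne_zero)
  obtain ⟨ε, hε, hball'⟩ := Metric.eventually_nhds_iff_ball.1
    (((hW0.and hFne).and (hball.and h1)))
  have hconst : ∀ z ∈ Metric.ball (0 : ℂ) ε, G z / ₂F₁ a b c z = G 0 / ₂F₁ a b c 0 := by
    intro z hz
    have hder : ∀ w ∈ Metric.ball (0 : ℂ) ε, HasDerivAt (fun z => G z / ₂F₁ a b c z) 0 w := by
      intro w hw
      obtain ⟨⟨w1, w2⟩, w3, w4⟩ := hball' w hw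
      refine (w4.div (hasDerivAt_gauss a b c w3) w2).congr_deriv ?_
      rw [div_eq_zero_iff]
      left
      linear_combination w1
    exact Metric.isOpen_ball.is_const_of_deriv_eq_zero (convex_ball 0 ε).isPreconnected
      (fun w hw => (hder w hw).differentiableAt.differentiableWithinAt)
      (fun w hw => (hder w hw).deriv) hz (Metric.mem_ball_self hε)
  filter_upwards [Metric.ball_mem_nhds 0 hε] with z hz
  have := hconst z hz
  rw [hG0, hF0, div_one, div_eq_one_iff_eq (hball' z hz).1.2] at this
  exact this

/-! ### The quadratic transformation -/

lemma mem_cutPlane_iff {z : ℂ} : z ∈ cutPlane ↔ 1 - z ∈ Complex.slitPlane := by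
  unfold cutPlane
  rw [Complex.mem_slitPlane_iff, Set.mem_ofPred_eq, Complex.sub_re, Complex.sub_im, Complex.one_re,
    Complex.one_im]
  constructor
  · intro h
    by_cases h0 : z.im = 0
    · left
      by_contra h1
      exact h ⟨h0, by linarith⟩
    · right
      simpa using h0
  · rintro (h | h) ⟨h1, h2⟩
    · linarith
    · exact h (by simp [h1])

lemma isOpen_cutPlane : IsOpen cutPlane := by
  have : cutPlane = (fun z : ℂ => 1 - z) ⁻¹' Complex.slitPlane := by
    ext z; exact mem_cutPlane_iff
  rw [this]
  exact Complex.isOpen_slitPlane.preimage (by fun_prop)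

lemma mem_cutPlane_of_norm_lt {z : ℂ} (hz : ‖z‖ < 1) : z ∈ cutPlane := fun h => by
  have := (Complex.re_le_norm z)
  linarith [h.2]

lemma isPreconnected_cutPlane : IsPreconnected cutPlane := by
  have h0 : (0 : ℂ) ∈ cutPlane := mem_cutPlane_of_norm_lt (by simp)
  refine (StarConvex.isPathConnected (a := (0 : ℂ)) ?_ h0).isConnected.isPreconnected
  rw [starConvex_zero_iff]
  intro z hz t ht0 ht1 h
  simp only [Complex.real_smul, Complex.mul_im, Complex.mul_re, Complex.ofReal_re,
    Complex.ofReal_im, zero_mul, add_zero, sub_zero] at h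
  have ht : 0 < t := by
    rcases ht0.lt_or_eq with h' | h'
    · exact h'
    · rw [← h'] at h; linarith [h.2]
  refine hz ⟨(mul_eq_zero.1 h.1).resolve_left ht.ne', ?_⟩
  by_contra hlt
  nlinarith [h.2]

/-- The definition selects an unspecified continuation; the identity theorem on the connected cut
plane makes it equal to any explicit one. -/
lemma hyp2F1_eq_of_isGaussContinuation {a b c : ℂ} {f : ℂ → ℂ} (hf : IsGaussContinuation a b c f)
    {z : ℂ} (hz : z ∈ cutPlane) : hyp2F1 a b c z = f z := by
  have h : z ∈ cutPlane ∧ ∃ f : ℂ → ℂ, IsGaussContinuation a b c f := ⟨hz, f, hf⟩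
  unfold hyp2F1
  rw [dif_pos h]
  obtain ⟨hg1, hg2⟩ := h.2.choose_spec
  have h1 := hg1.analyticOnNhd isOpen_cutPlane
  have h2 := hf.1.analyticOnNhd isOpen_cutPlane
  refine h1.eqOn_of_preconnected_of_eventuallyEq h2 isPreconnected_cutPlane
    (mem_cutPlane_of_norm_lt (z := 0) (by simp)) ?_ hz
  filter_upwards [Metric.ball_mem_nhds (0 : ℂ) one_pos] with w hw
  rw [hg2 w (by simpa using hw), hf.2 w (by simpa using hw)]

lemma hyp2F1_of_notMem {a b c z : ℂ} (hz : z ∉ cutPlane) : hyp2F1 a b c z = ₂F₁ a b c z := by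
  unfold hyp2F1
  rw [dif_neg fun h => hz h.1]

/-- The inverse of `w ↦ 4w / (1 + w)²` on the cut plane. -/
def quadInv (z : ℂ) : ℂ :=
  (1 - Complex.exp (Complex.log (1 - z) / 2)) / (1 + Complex.exp (Complex.log (1 - z) / 2))

lemma re_exp_half_log_pos {x : ℂ} (hx : x ∈ Complex.slitPlane) :
    0 < (Complex.exp (Complex.log x / 2)).re := by
  rw [Complex.exp_re]
  refine mul_pos (Real.exp_pos _) (Real.cos_pos_of_mem_Ioo ?_)
  have h1 : (Complex.log x / 2).im = x.arg / 2 := by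
    rw [Complex.div_ofNat_im, Complex.log_im]
  rw [h1]
  have h2 := Complex.neg_pi_lt_arg x
  have h3 : x.arg < π := lt_of_le_of_ne (Complex.arg_le_pi x)
    (Complex.mem_slitPlane_iff_arg.1 hx).1
  constructor <;> linarith

lemma exp_half_log_sq {x : ℂ} (hx : x ≠ 0) : Complex.exp (Complex.log x / 2) ^ 2 = x := by
  rw [← Complex.exp_nat_mul]
  push_cast
  rw [mul_div_cancel₀ _ (two_ne_zero), Complex.exp_log hx]

lemma norm_div_lt_one_of_re_pos {s : ℂ} (hs : 0 < s.re) : ‖(1 - s) / (1 + s)‖ < 1 := by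
  have h1 : 1 + s ≠ 0 := fun h => by
    have := congrArg Complex.re h
    simp at this; linarith
  rw [norm_div, div_lt_one (norm_pos_iff.2 h1)]
  rw [← sq_lt_sq₀ (norm_nonneg _) (norm_nonneg _), ← Complex.normSq_eq_norm_sq,
    ← Complex.normSq_eq_norm_sq, Complex.normSq_apply, Complex.normSq_apply]
  simp
  nlinarith

lemma one_add_ne_zero_of_norm_lt {w : ℂ} (hw : ‖w‖ < 1) : 1 + w ≠ 0 := fun h => by
  have : w = -1 := by linear_combination h
  rw [this] at hw; simp at hw

lemma one_add_mem_slitPlane {w : ℂ} (hw : ‖w‖ < 1) : 1 + w ∈ Complex.slitPlane := by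
  left
  have := Complex.abs_re_le_norm w
  have := (abs_le.1 this).1
  simp; linarith

lemma norm_quadInv_lt {z : ℂ} (hz : z ∈ cutPlane) : ‖quadInv z‖ < 1 :=
  norm_div_lt_one_of_re_pos (re_exp_half_log_pos (mem_cutPlane_iff.1 hz))

lemma quadInv_spec {z : ℂ} (hz : z ∈ cutPlane) :
    4 * quadInv z / (1 + quadInv z) ^ 2 = z := by
  have hx := mem_cutPlane_iff.1 hz
  have h1 := re_exp_half_log_pos hx
  have h2 := exp_half_log_sq (Complex.slitPlane_ne_zero hx)
  unfold quadInv
  set s := Complex.exp (Complex.log (1 - z) / 2)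
  have h3 : 1 + s ≠ 0 := fun h => by
    have := congrArg Complex.re h
    simp at this; linarith
  have h4 : 1 + (1 - s) / (1 + s) = 2 / (1 + s) := by field_simp; ring
  rw [h4]
  field_simp
  linear_combination -4 * h2

/-- The Cayley transform s = (1 - w)/(1 + w) maps the unit disc to the right half plane, and
squaring maps that to the slit plane. Hence w ↦ 4w/(1+w)² maps the disc bijectively onto the cut
plane, with inverse `quadInv`. -/
lemma one_sub_quad {w : ℂ} (hw : ‖w‖ < 1) :
    1 - 4 * w / (1 + w) ^ 2 = ((1 - w) / (1 + w)) ^ 2 := by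
  have := one_add_ne_zero_of_norm_lt hw
  field_simp
  ring

lemma re_pos_of_norm_lt {w : ℂ} (hw : ‖w‖ < 1) : 0 < ((1 - w) / (1 + w)).re := by
  have h := one_add_ne_zero_of_norm_lt hw
  rw [Complex.div_re, ← add_div]
  refine div_pos ?_ (Complex.normSq_pos.2 h)
  have : w.re * w.re + w.im * w.im < 1 := by
    rw [← Complex.normSq_apply, Complex.normSq_eq_norm_sq]
    nlinarith [norm_nonneg w]
  simp
  nlinarith

lemma sq_mem_slitPlane_of_re_pos {s : ℂ} (hs : 0 < s.re) : s ^ 2 ∈ Complex.slitPlane := by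
  rw [Complex.mem_slitPlane_iff, sq, Complex.mul_re, Complex.mul_im]
  by_cases h : s.im = 0
  · left; rw [h]; nlinarith
  · right
    rw [show s.re * s.im + s.im * s.re = 2 * (s.re * s.im) by ring]
    exact mul_ne_zero two_ne_zero (mul_ne_zero hs.ne' h)

lemma quad_mem_cutPlane {w : ℂ} (hw : ‖w‖ < 1) : 4 * w / (1 + w) ^ 2 ∈ cutPlane := by
  rw [mem_cutPlane_iff, one_sub_quad hw]
  exact sq_mem_slitPlane_of_re_pos (re_pos_of_norm_lt hw)

lemma quadInv_quad {w : ℂ} (hw : ‖w‖ < 1) : quadInv (4 * w / (1 + w) ^ 2) = w := by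
  have hz := quad_mem_cutPlane hw
  have h := one_add_ne_zero_of_norm_lt hw
  have h1 := re_exp_half_log_pos (mem_cutPlane_iff.1 hz)
  have h2 := exp_half_log_sq (Complex.slitPlane_ne_zero (mem_cutPlane_iff.1 hz))
  have h3 := re_pos_of_norm_lt hw
  unfold quadInv
  set s := Complex.exp (Complex.log (1 - 4 * w / (1 + w) ^ 2) / 2)
  rw [one_sub_quad hw] at h2
  have hs : s = (1 - w) / (1 + w) := by
    rcases sq_eq_sq_iff_eq_or_eq_neg.1 h2 with h4 | h4
    · exact h4
    · rw [h4, Complex.neg_re] at h1; linarith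
  rw [hs]
  have : 1 + (1 - w) / (1 + w) = 2 / (1 + w) := by field_simp; ring
  rw [this]
  field_simp
  ring

lemma differentiableOn_quadInv : DifferentiableOn ℂ quadInv cutPlane := by
  intro z hz
  have hx := mem_cutPlane_iff.1 hz
  have h1 := re_exp_half_log_pos hx
  have h3 : 1 + Complex.exp (Complex.log (1 - z) / 2) ≠ 0 := fun h => by
    have := congrArg Complex.re h
    simp only [Complex.add_re, Complex.one_re, Complex.zero_re] at this; linarith
  have hl : DifferentiableAt ℂ (fun z : ℂ => Complex.log (1 - z)) z :=
    (by fun_prop : DifferentiableAt ℂ (fun z : ℂ => 1 - z) z).clog hx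
  have he : DifferentiableAt ℂ (fun z : ℂ => Complex.exp (Complex.log (1 - z) / 2)) z :=
    (hl.div_const 2).cexp
  refine DifferentiableAt.differentiableWithinAt ?_
  unfold quadInv
  exact ((differentiableAt_const 1).sub he).div ((differentiableAt_const 1).add he) h3

lemma hasDerivAt_exp_mul_log (k : ℂ) {w : ℂ} (hw : ‖w‖ < 1) :
    HasDerivAt (fun w => Complex.exp (k * Complex.log (1 + w)))
      (Complex.exp (k * Complex.log (1 + w)) * (k * (1 + w)⁻¹)) w := by
  have h1 : HasDerivAt (fun w : ℂ => 1 + w) 1 w := (hasDerivAt_id w).const_add 1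
  have h2 := (h1.clog (one_add_mem_slitPlane hw)).const_mul k
  refine h2.cexp.congr_deriv ?_
  rw [one_div]

/-- The left side is shown to satisfy Gauss's equation with parameters 2a, 2a - c + 1, c; the
solution analytic at 0 with value 1 is unique. -/
lemma eventuallyEq_quadratic (a : ℂ) {c : ℂ} (hc : ∀ n : ℕ, c ≠ -n) :
    (fun w => Complex.exp (-2 * a * Complex.log (1 + w)) *
      ₂F₁ a (a + 1 / 2) c (4 * w / (1 + w) ^ 2)) =ᶠ[𝓝 0] ₂F₁ (2 * a) (2 * a - c + 1) c := by
  have hball : ∀ᶠ z : ℂ in 𝓝 0, ‖z‖ < 1 :=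
    continuous_norm.continuousAt.eventually_lt continuousAt_const (by simp)
  have hball' : ∀ᶠ w : ℂ in 𝓝 0, ‖4 * w / (1 + w) ^ 2‖ < 1 := by
    have : ContinuousAt (fun w : ℂ => ‖4 * w / (1 + w) ^ 2‖) 0 := by
      refine (ContinuousAt.div (by fun_prop) (by fun_prop) (by simp)).norm
    exact this.eventually_lt continuousAt_const (by simp)
  set b : ℂ := a + 1 / 2 with hb
  set Z : ℂ → ℂ := fun w => 4 * w / (1 + w) ^ 2 with hZ
  set Z' : ℂ → ℂ := fun w => 4 * (1 - w) / (1 + w) ^ 3 with hZ'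
  set P : ℂ → ℂ := fun w => Complex.exp (-2 * a * Complex.log (1 + w)) with hP
  have dZ : ∀ w, ‖w‖ < 1 → HasDerivAt Z (Z' w) w := by
    intro w hw
    have h := one_add_ne_zero_of_norm_lt hw
    refine (((hasDerivAt_id w).const_mul 4).div (((hasDerivAt_id w).const_add 1).pow 2)
      (pow_ne_zero 2 h)).congr_deriv ?_
    simp only [hZ', id, Pi.pow_apply]
    field_simp
    ring
  have dZ' : ∀ w, ‖w‖ < 1 → HasDerivAt Z' ((8 * w - 16) / (1 + w) ^ 4) w := by
    intro w hw
    have h := one_add_ne_zero_of_norm_lt hw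
    refine ((((hasDerivAt_id w).const_sub 1).const_mul 4).div
      (((hasDerivAt_id w).const_add 1).pow 3) (pow_ne_zero 3 h)).congr_deriv ?_
    simp only [id, Pi.pow_apply]
    field_simp
    ring
  have dP : ∀ w, ‖w‖ < 1 → HasDerivAt P (P w * (-2 * a * (1 + w)⁻¹)) w := fun w hw =>
    hasDerivAt_exp_mul_log (-2 * a) hw
  have dI : ∀ w : ℂ, ‖w‖ < 1 → HasDerivAt (fun w : ℂ => (1 + w)⁻¹) (-1 / (1 + w) ^ 2) w :=
    fun w hw => ((hasDerivAt_id w).const_add 1).inv (one_add_ne_zero_of_norm_lt hw)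
  refine eventuallyEq_gauss_of_ode (2 * a) (2 * a - c + 1) hc
    (G' := fun w => P w * (gauss' a b c (Z w) * Z' w - 2 * a * (1 + w)⁻¹ * ₂F₁ a b c (Z w)))
    (G'' := fun w => P w * (-2 * a * (1 + w)⁻¹) *
      (gauss' a b c (Z w) * Z' w - 2 * a * (1 + w)⁻¹ * ₂F₁ a b c (Z w)) +
      P w * (gauss'' a b c (Z w) * Z' w * Z' w + gauss' a b c (Z w) * ((8 * w - 16) / (1 + w) ^ 4) -
        (2 * a * (-1 / (1 + w) ^ 2) * ₂F₁ a b c (Z w) +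
          2 * a * (1 + w)⁻¹ * (gauss' a b c (Z w) * Z' w)))) ?_ ?_ ?_ ?_
  · filter_upwards [hball, hball'] with w h1 h2
    have d1 : HasDerivAt (fun w => ₂F₁ a b c (Z w)) (gauss' a b c (Z w) * Z' w) w :=
      (hasDerivAt_gauss a b c h2).comp w (dZ w h1)
    refine ((dP w h1).mul d1).congr_deriv ?_
    ring
  · filter_upwards [hball, hball'] with w h1 h2
    have d1 : HasDerivAt (fun w => ₂F₁ a b c (Z w)) (gauss' a b c (Z w) * Z' w) w :=
      (hasDerivAt_gauss a b c h2).comp w (dZ w h1)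
    have d2 : HasDerivAt (fun w => gauss' a b c (Z w)) (gauss'' a b c (Z w) * Z' w) w :=
      HasDerivAt.comp (h₂ := gauss' a b c) (h := Z) w (hasDerivAt_gauss' a b c h2) (dZ w h1)
    exact (dP w h1).mul ((d2.mul (dZ' w h1)).sub (((dI w h1).const_mul (2 * a)).mul d1))
  · simp only [add_zero, Complex.log_one, mul_zero, Complex.exp_zero, one_mul, zero_div]
    exact ordinaryHypergeometric_zero a b c
  · filter_upwards [hball, hball'] with w h1 h2
    have h := one_add_ne_zero_of_norm_lt h1
    have ode := gauss_ode a b hc h2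
    change Z w * (1 - Z w) * gauss'' a b c (Z w) + (c - (a + b + 1) * Z w) * gauss' a b c (Z w) -
      a * b * ₂F₁ a b c (Z w) = 0 at ode
    change w * (1 - w) * (P w * (-2 * a * (1 + w)⁻¹) *
      (gauss' a b c (Z w) * Z' w - 2 * a * (1 + w)⁻¹ * ₂F₁ a b c (Z w)) +
      P w * (gauss'' a b c (Z w) * Z' w * Z' w + gauss' a b c (Z w) * ((8 * w - 16) / (1 + w) ^ 4) -
        (2 * a * (-1 / (1 + w) ^ 2) * ₂F₁ a b c (Z w) +
          2 * a * (1 + w)⁻¹ * (gauss' a b c (Z w) * Z' w)))) +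
      (c - (2 * a + (2 * a - c + 1) + 1) * w) *
        (P w * (gauss' a b c (Z w) * Z' w - 2 * a * (1 + w)⁻¹ * ₂F₁ a b c (Z w))) -
      2 * a * (2 * a - c + 1) * (P w * ₂F₁ a b c (Z w)) = 0
    generalize gauss'' a b c (Z w) = F2 at ode ⊢
    generalize gauss' a b c (Z w) = F1 at ode ⊢
    generalize ₂F₁ a b c (Z w) = F0 at ode ⊢
    generalize P w = p
    simp only [hZ, hZ', hb] at ode ⊢
    -- The transformed equation is the original one at 4w/(1+w)² multiplied by an explicit factor.
    have e : ∀ X Y : ℂ, X = 4 * (1 - w) / (1 + w) ^ 2 * p * Y → Y = 0 → X = 0 := by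
      rintro X Y h rfl; rw [h, mul_zero]
    refine e _ _ ?_ ode
    field_simp
    ring

/-- The series on the right of the quadratic transformation is evaluated at `quadInv z`, of modulus
below 1 on the whole cut plane. This furnishes the existence of the continuation required by
`hyp2F1` for the parameters a, a + 1/2 that occur here. -/
lemma isGaussContinuation_quadratic (a : ℂ) {c : ℂ} (hc : ∀ n : ℕ, c ≠ -n) :
    IsGaussContinuation a (a + 1 / 2) c fun z =>
      Complex.exp (2 * a * Complex.log (1 + quadInv z)) *
        ₂F₁ (2 * a) (2 * a - c + 1) c (quadInv z) := by
  have hd : DifferentiableOn ℂ (fun z => Complex.exp (2 * a * Complex.log (1 + quadInv z)) *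
      ₂F₁ (2 * a) (2 * a - c + 1) c (quadInv z)) cutPlane := by
    intro z hz
    have h1 := norm_quadInv_lt hz
    have h2 := (differentiableOn_quadInv z hz).differentiableAt (isOpen_cutPlane.mem_nhds hz)
    have h3 := (hasDerivAt_exp_mul_log (2 * a) h1).differentiableAt.comp z h2
    have h4 := (hasDerivAt_gauss (2 * a) (2 * a - c + 1) c h1).differentiableAt.comp z h2
    exact (h3.mul h4).differentiableWithinAt
  refine ⟨hd, fun z hz => ?_⟩
  have hsub : Metric.ball (0 : ℂ) 1 ⊆ cutPlane := fun z hz =>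
    mem_cutPlane_of_norm_lt (by simpa using hz)
  have h1 := (hd.mono hsub).analyticOnNhd Metric.isOpen_ball
  have h2 : AnalyticOnNhd ℂ (₂F₁ a (a + 1 / 2) c : ℂ → ℂ) (Metric.ball 0 1) := fun w hw =>
    analyticAt_gauss _ _ _ (by simpa using hw)
  refine h1.eqOn_of_preconnected_of_eventuallyEq h2 (convex_ball 0 1).isPreconnected
    (Metric.mem_ball_self one_pos) ?_ (by simpa using hz : z ∈ Metric.ball (0 : ℂ) 1)
  have hq0 : quadInv 0 = 0 := by simp [quadInv]
  have hqc : Tendsto quadInv (𝓝 0) (𝓝 0) := by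
    have h0 : (0 : ℂ) ∈ cutPlane := mem_cutPlane_of_norm_lt (by simp)
    have := ((differentiableOn_quadInv 0 h0).differentiableAt
      (isOpen_cutPlane.mem_nhds h0)).continuousAt.tendsto
    rwa [hq0] at this
  filter_upwards [hqc.eventually (eventuallyEq_quadratic a hc),
    Metric.ball_mem_nhds (0 : ℂ) one_pos] with w hw hw1
  have hw' := hsub hw1
  rw [← hw, quadInv_spec hw', ← mul_assoc, ← Complex.exp_add]
  rw [show 2 * a * Complex.log (1 + quadInv w) + -2 * a * Complex.log (1 + quadInv w) = 0 by ring,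
    Complex.exp_zero, one_mul]

/-- The quadratic transformation of Gauss's function. -/
lemma hyp2F1_quad (a : ℂ) {c : ℂ} (hc : ∀ n : ℕ, c ≠ -n) {w : ℂ} (hw : ‖w‖ < 1) :
    hyp2F1 a (a + 1 / 2) c (4 * w / (1 + w) ^ 2) =
      Complex.exp (2 * a * Complex.log (1 + w)) * ₂F₁ (2 * a) (2 * a - c + 1) c w := by
  rw [hyp2F1_eq_of_isGaussContinuation (isGaussContinuation_quadratic a hc) (quad_mem_cutPlane hw),
    quadInv_quad hw]

lemma hyp2F1_eq_gauss (a : ℂ) {c : ℂ} (hc : ∀ n : ℕ, c ≠ -n) {z : ℂ} (hz : ‖z‖ < 1) :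
    hyp2F1 a (a + 1 / 2) c z = ₂F₁ a (a + 1 / 2) c z := by
  have h := isGaussContinuation_quadratic a hc
  rw [hyp2F1_eq_of_isGaussContinuation h (mem_cutPlane_of_norm_lt hz)]
  exact h.2 z hz

/-! ### Jacobi's equation -/

/-- The weight of Jacobi's equation. -/
def jacobiWeight (ρ ζ : ℂ) : ℂ :=
  Complex.exp (2 * ρ * (Complex.log (1 - Complex.exp (2 * ζ)) - ζ))

/-- The hyperbolic cotangent. -/
def coth (ζ : ℂ) : ℂ :=
  (Complex.exp ζ + Complex.exp (-ζ)) / (Complex.exp ζ - Complex.exp (-ζ))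

/-- The solution of `f'' + 2ρ coth ζ f' + (ρ² - ν²) f = 0` on `Re ζ < 0` that behaves like
`exp ((ρ + ν) ζ)`. -/
def jacobiSol (ρ ν ζ : ℂ) : ℂ :=
  Complex.exp ((ρ + ν) * ζ) * ₂F₁ (ρ + ν) ρ (1 + ν) (Complex.exp (2 * ζ))

/-- The derivative of `jacobiSol`. -/
def jacobiSol' (ρ ν ζ : ℂ) : ℂ :=
  Complex.exp ((ρ + ν) * ζ) * ((ρ + ν) * ₂F₁ (ρ + ν) ρ (1 + ν) (Complex.exp (2 * ζ)) +
    2 * Complex.exp (2 * ζ) * gauss' (ρ + ν) ρ (1 + ν) (Complex.exp (2 * ζ)))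

/-- The left half plane. -/
def leftHalf : Set ℂ := {ζ | ζ.re < 0}

lemma isOpen_leftHalf : IsOpen leftHalf := isOpen_lt Complex.continuous_re continuous_const

lemma convex_leftHalf : Convex ℝ leftHalf := convex_halfSpace_re_lt 0

lemma conj_mem_leftHalf {ζ : ℂ} (h : ζ ∈ leftHalf) : starRingEnd ℂ ζ ∈ leftHalf := by
  change (starRingEnd ℂ ζ).re < 0
  rw [Complex.conj_re]; exact h

lemma norm_exp_two_mul_lt {ζ : ℂ} (h : ζ ∈ leftHalf) : ‖Complex.exp (2 * ζ)‖ < 1 := by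
  have h : ζ.re < 0 := h
  rw [Complex.norm_exp, Real.exp_lt_one_iff]
  simp
  linarith

lemma exp_sub_exp_neg_ne_zero {ζ : ℂ} (h : ζ ∈ leftHalf) :
    Complex.exp ζ - Complex.exp (-ζ) ≠ 0 := fun h0 => by
  have h1 := norm_exp_two_mul_lt h
  have : Complex.exp (2 * ζ) = 1 := by
    rw [two_mul, Complex.exp_add]
    nth_rw 2 [sub_eq_zero.1 h0]
    rw [← Complex.exp_add, add_neg_cancel, Complex.exp_zero]
  rw [this] at h1; simp at h1

lemma one_sub_exp_two_mul_ne_zero {ζ : ℂ} (h : ζ ∈ leftHalf) :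
    1 - Complex.exp (2 * ζ) ≠ 0 := fun h0 => by
  have h1 := norm_exp_two_mul_lt h
  rw [← sub_eq_zero.1 h0] at h1; simp at h1

lemma coth_eq {ζ : ℂ} (h : ζ ∈ leftHalf) :
    coth ζ = -(1 + Complex.exp (2 * ζ)) / (1 - Complex.exp (2 * ζ)) := by
  have h1 := exp_sub_exp_neg_ne_zero h
  have h2 := one_sub_exp_two_mul_ne_zero h
  unfold coth
  rw [div_eq_div_iff h1 h2, two_mul, Complex.exp_add, Complex.exp_neg]
  have := Complex.exp_ne_zero ζ
  field_simp
  ring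

lemma hasDerivAt_exp_two_mul (ζ : ℂ) :
    HasDerivAt (fun ζ => Complex.exp (2 * ζ)) (2 * Complex.exp (2 * ζ)) ζ := by
  refine ((hasDerivAt_id ζ).const_mul 2).cexp.congr_deriv ?_
  simp; ring

lemma hasDerivAt_jacobiWeight (ρ : ℂ) {ζ : ℂ} (h : ζ ∈ leftHalf) :
    HasDerivAt (jacobiWeight ρ) (2 * ρ * coth ζ * jacobiWeight ρ ζ) ζ := by
  have h0 := norm_exp_two_mul_lt h
  have h1 : 1 - Complex.exp (2 * ζ) ∈ Complex.slitPlane :=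
    mem_cutPlane_iff.1 (mem_cutPlane_of_norm_lt h0)
  have h2 := (((hasDerivAt_exp_two_mul ζ).const_sub 1).clog h1).sub (hasDerivAt_id ζ)
  refine (h2.const_mul (2 * ρ)).cexp.congr_deriv ?_
  rw [coth_eq h]
  have := one_sub_exp_two_mul_ne_zero h
  unfold jacobiWeight
  simp only [id, Pi.sub_apply]
  field_simp
  ring

lemma hasDerivAt_jacobiSol (ρ ν : ℂ) {ζ : ℂ} (h : ζ ∈ leftHalf) :
    HasDerivAt (jacobiSol ρ ν) (jacobiSol' ρ ν ζ) ζ := by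
  have h1 : HasDerivAt (fun ζ => ₂F₁ (ρ + ν) ρ (1 + ν) (Complex.exp (2 * ζ))) _ ζ :=
    HasDerivAt.comp (h := fun ζ => Complex.exp (2 * ζ)) ζ
      (hasDerivAt_gauss (ρ + ν) ρ (1 + ν) (norm_exp_two_mul_lt h)) (hasDerivAt_exp_two_mul ζ)
  refine (((hasDerivAt_id ζ).const_mul (ρ + ν)).cexp.mul h1).congr_deriv ?_
  unfold jacobiSol'
  simp only [id]
  ring

lemma hasDerivAt_jacobiSol' (ρ : ℂ) {ν : ℂ} (hν : ∀ n : ℕ, 1 + ν ≠ -n) {ζ : ℂ} (h : ζ ∈ leftHalf) :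
    HasDerivAt (jacobiSol' ρ ν)
      (-(2 * ρ * coth ζ * jacobiSol' ρ ν ζ + (ρ ^ 2 - ν ^ 2) * jacobiSol ρ ν ζ)) ζ := by
  have hq := norm_exp_two_mul_lt h
  have h1 : HasDerivAt (fun ζ => ₂F₁ (ρ + ν) ρ (1 + ν) (Complex.exp (2 * ζ))) _ ζ :=
    HasDerivAt.comp (h := fun ζ => Complex.exp (2 * ζ)) ζ
      (hasDerivAt_gauss (ρ + ν) ρ (1 + ν) hq) (hasDerivAt_exp_two_mul ζ)
  have h2 : HasDerivAt (fun ζ => gauss' (ρ + ν) ρ (1 + ν) (Complex.exp (2 * ζ))) _ ζ :=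
    HasDerivAt.comp (h₂ := gauss' (ρ + ν) ρ (1 + ν)) (h := fun ζ => Complex.exp (2 * ζ)) ζ
      (hasDerivAt_gauss' (ρ + ν) ρ (1 + ν) hq) (hasDerivAt_exp_two_mul ζ)
  refine (((hasDerivAt_id ζ).const_mul (ρ + ν)).cexp.mul ((h1.const_mul (ρ + ν)).add
    (((hasDerivAt_exp_two_mul ζ).const_mul 2).mul h2))).congr_deriv ?_
  have ode := gauss_ode (ρ + ν) ρ hν hq
  have h3 := one_sub_exp_two_mul_ne_zero h
  unfold jacobiSol' jacobiSol
  rw [coth_eq h]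
  simp only [id, Pi.add_apply, Pi.mul_apply]
  generalize gauss'' (ρ + ν) ρ (1 + ν) (Complex.exp (2 * ζ)) = F2 at ode ⊢
  generalize gauss' (ρ + ν) ρ (1 + ν) (Complex.exp (2 * ζ)) = F1 at ode ⊢
  generalize ₂F₁ (ρ + ν) ρ (1 + ν) (Complex.exp (2 * ζ)) = F0 at ode ⊢
  generalize Complex.exp (2 * ζ) = q at *
  generalize Complex.exp ((ρ + ν) * ζ) = p at *
  field_simp
  linear_combination 4 * q * p * ode

/-- The Wronskian of `jacobiSol ρ ν` and `jacobiSol ρ (-ν)`, times the weight, is a nonzero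
constant. -/
lemma exists_jacobi_wronskian (ρ : ℂ) {ν : ℂ} (h0 : ν ≠ 0) (h1 : ∀ n : ℕ, 1 + ν ≠ -n)
    (h2 : ∀ n : ℕ, 1 + -ν ≠ -n) : ∃ k : ℂ, k ≠ 0 ∧ ∀ ζ ∈ leftHalf,
      (jacobiSol ρ ν ζ * jacobiSol' ρ (-ν) ζ - jacobiSol' ρ ν ζ * jacobiSol ρ (-ν) ζ) *
        jacobiWeight ρ ζ = k := by
  set W : ℂ → ℂ := fun ζ =>
    (jacobiSol ρ ν ζ * jacobiSol' ρ (-ν) ζ - jacobiSol' ρ ν ζ * jacobiSol ρ (-ν) ζ) *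
      jacobiWeight ρ ζ with hW
  have hconst : ∀ x ∈ leftHalf, ∀ y ∈ leftHalf, W x = W y := by
    intro x hx y hy
    refine eq_of_hasWirt_zero isOpen_leftHalf convex_leftHalf (fun z hz => ?_) hx hy
    refine hasWirt_of_hasDerivAt (((((hasDerivAt_jacobiSol ρ ν hz).mul
      (hasDerivAt_jacobiSol' ρ h2 hz)).sub ((hasDerivAt_jacobiSol' ρ h1 hz).mul
      (hasDerivAt_jacobiSol ρ (-ν) hz))).mul (hasDerivAt_jacobiWeight ρ hz)).congr_deriv ?_)
    simp only [Pi.sub_apply, Pi.mul_apply]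
    ring
  -- The exponentials in the Wronskian and the weight combine so that only q = e^{2ζ} enters; the
  -- constant is then the value -2ν at q = 0, approached as Re ζ → -∞.
  set B : ℂ → ℂ := fun q => Complex.exp (2 * ρ * Complex.log (1 - q)) *
    (₂F₁ (ρ + ν) ρ (1 + ν) q * ((ρ + -ν) * ₂F₁ (ρ + -ν) ρ (1 + -ν) q +
      2 * q * gauss' (ρ + -ν) ρ (1 + -ν) q) -
      ((ρ + ν) * ₂F₁ (ρ + ν) ρ (1 + ν) q + 2 * q * gauss' (ρ + ν) ρ (1 + ν) q) *
        ₂F₁ (ρ + -ν) ρ (1 + -ν) q) with hB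
  have hWB : ∀ ζ, W ζ = B (Complex.exp (2 * ζ)) := by
    intro ζ
    simp only [hW, hB, jacobiSol, jacobiSol', jacobiWeight]
    have e : Complex.exp ((ρ + ν) * ζ) * Complex.exp ((ρ + -ν) * ζ) *
        Complex.exp (2 * ρ * (Complex.log (1 - Complex.exp (2 * ζ)) - ζ)) =
        Complex.exp (2 * ρ * Complex.log (1 - Complex.exp (2 * ζ))) := by
      rw [← Complex.exp_add, ← Complex.exp_add]
      congr 1; ring
    rw [← e]; ring
  have hBc : ContinuousAt B 0 := by
    have c0 : ∀ a b c : ℂ, ContinuousAt (₂F₁ a b c : ℂ → ℂ) 0 := fun a b c =>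
      (hasDerivAt_gauss a b c (by simp)).continuousAt
    have c1 : ∀ a b c : ℂ, ContinuousAt (gauss' a b c) 0 := fun a b c =>
      (hasDerivAt_gauss' a b c (by simp)).continuousAt
    have cl : ContinuousAt (fun q : ℂ => Complex.log (1 - q)) 0 :=
      ContinuousAt.clog (f := fun q : ℂ => 1 - q) (by fun_prop) (by simp)
    exact (cl.const_mul (2 * ρ)).cexp.mul (((c0 _ _ _).mul (((c0 _ _ _).const_mul _).add
      ((by fun_prop : ContinuousAt (fun q : ℂ => 2 * q) 0).mul (c1 _ _ _)))).sub
      ((((c0 _ _ _).const_mul _).add ((by fun_prop : ContinuousAt (fun q : ℂ => 2 * q) 0).mul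
        (c1 _ _ _))).mul (c0 _ _ _)))
  have hB0 : B 0 = -2 * ν := by
    simp only [hB, sub_zero, Complex.log_one, mul_zero, Complex.exp_zero, zero_mul, add_zero,
      ordinaryHypergeometric_zero]
    ring
  have hmem : (-1 : ℂ) ∈ leftHalf := by change (-1 : ℂ).re < 0; simp
  refine ⟨W (-1), ?_, fun ζ hζ => hconst ζ hζ _ hmem⟩
  have ht : Tendsto (fun t : ℝ => Complex.exp (2 * ((-t : ℝ) : ℂ))) atTop (𝓝 0) := by
    rw [tendsto_zero_iff_norm_tendsto_zero]
    have : ∀ t : ℝ, ‖Complex.exp (2 * ((-t : ℝ) : ℂ))‖ = Real.exp (-(2 * t)) := fun t => by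
      rw [Complex.norm_exp]; congr 1; simp
    simp only [this]
    exact Real.tendsto_exp_neg_atTop_nhds_zero.comp (tendsto_id.const_mul_atTop two_pos)
  have h3 := (hBc.tendsto.comp ht)
  have h4 : Tendsto (fun _ : ℝ => W (-1)) atTop (𝓝 (B 0)) := by
    refine h3.congr' ?_
    filter_upwards [eventually_gt_atTop 0] with t ht
    rw [Function.comp, ← hWB]
    refine hconst _ ?_ _ hmem
    change ((-t : ℝ) : ℂ).re < 0
    simpa using ht
  rw [tendsto_nhds_unique tendsto_const_nhds h4, hB0]
  exact mul_ne_zero (by norm_num) h0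

lemma exp_two_mul_add_pi (ζ : ℂ) : Complex.exp (2 * (ζ + π * Complex.I)) = Complex.exp (2 * ζ) := by
  rw [mul_add, ← mul_assoc, Complex.exp_add, Complex.exp_two_pi_mul_I, mul_one]

lemma exp_two_mul_sub_pi (ζ : ℂ) : Complex.exp (2 * (ζ - π * Complex.I)) = Complex.exp (2 * ζ) := by
  rw [← exp_two_mul_add_pi, sub_add_cancel]

lemma jacobiSol_add_pi (ρ ν ζ : ℂ) : jacobiSol ρ ν (ζ + π * Complex.I) =
    Complex.exp ((ρ + ν) * (π * Complex.I)) * jacobiSol ρ ν ζ := by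
  unfold jacobiSol
  rw [exp_two_mul_add_pi, mul_add, Complex.exp_add]; ring

lemma jacobiSol'_add_pi (ρ ν ζ : ℂ) : jacobiSol' ρ ν (ζ + π * Complex.I) =
    Complex.exp ((ρ + ν) * (π * Complex.I)) * jacobiSol' ρ ν ζ := by
  unfold jacobiSol'
  rw [exp_two_mul_add_pi, mul_add (ρ + ν), Complex.exp_add]; ring

lemma jacobiSol_sub_pi (ρ ν ζ : ℂ) : jacobiSol ρ ν (ζ - π * Complex.I) =
    Complex.exp (-((ρ + ν) * (π * Complex.I))) * jacobiSol ρ ν ζ := by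
  unfold jacobiSol
  rw [exp_two_mul_sub_pi, mul_sub, sub_eq_add_neg, Complex.exp_add]; ring

lemma jacobiSol'_sub_pi (ρ ν ζ : ℂ) : jacobiSol' ρ ν (ζ - π * Complex.I) =
    Complex.exp (-((ρ + ν) * (π * Complex.I))) * jacobiSol' ρ ν ζ := by
  unfold jacobiSol'
  rw [exp_two_mul_sub_pi, mul_sub (ρ + ν), sub_eq_add_neg, Complex.exp_add]; ring

lemma jacobiWeight_add_pi (ρ ζ : ℂ) : jacobiWeight ρ (ζ + π * Complex.I) =
    Complex.exp (-(2 * ρ * (π * Complex.I))) * jacobiWeight ρ ζ := by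
  unfold jacobiWeight
  rw [exp_two_mul_add_pi, ← Complex.exp_add]; congr 1; ring

lemma jacobiWeight_sub_pi (ρ ζ : ℂ) : jacobiWeight ρ (ζ - π * Complex.I) =
    Complex.exp (2 * ρ * (π * Complex.I)) * jacobiWeight ρ ζ := by
  unfold jacobiWeight
  rw [exp_two_mul_sub_pi, ← Complex.exp_add]; congr 1; ring

/-- A solution of Jacobi's equations in `ζ` and in `ζ̄`, with its derivatives. -/
structure JacobiPair (ρ ν₁ ν₂ : ℂ) (E E₁ E₂ E₁₂ : ℂ → ℂ) : Prop where
  zero : ∀ ζ ∈ leftHalf, HasWirt E (E₁ ζ) (E₂ ζ) ζ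
  one : ∀ ζ ∈ leftHalf, HasWirt E₁ (-(2 * ρ * coth ζ * E₁ ζ + (ρ ^ 2 - ν₁ ^ 2) * E ζ)) (E₁₂ ζ) ζ
  two : ∀ ζ ∈ leftHalf, HasWirt E₂ (E₁₂ ζ)
    (-(2 * ρ * coth (starRingEnd ℂ ζ) * E₂ ζ + (ρ ^ 2 - ν₂ ^ 2) * E ζ)) ζ
  onetwo : ∀ ζ ∈ leftHalf, HasWirt E₁₂ (-(2 * ρ * coth ζ * E₁₂ ζ + (ρ ^ 2 - ν₁ ^ 2) * E₂ ζ))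
    (-(2 * ρ * coth (starRingEnd ℂ ζ) * E₁₂ ζ + (ρ ^ 2 - ν₂ ^ 2) * E₁ ζ)) ζ

/-- The two-variable Wronskian of `E` with `f(ζ) g(ζ̄)`, times the weights. -/
def biWronskian (ρ a b : ℂ) (E E₁ E₂ E₁₂ : ℂ → ℂ) (ζ : ℂ) : ℂ :=
  ((E ζ * jacobiSol' ρ a ζ - E₁ ζ * jacobiSol ρ a ζ) * jacobiSol' ρ b (starRingEnd ℂ ζ) -
    (E₂ ζ * jacobiSol' ρ a ζ - E₁₂ ζ * jacobiSol ρ a ζ) * jacobiSol ρ b (starRingEnd ℂ ζ)) *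
    (jacobiWeight ρ ζ * jacobiWeight ρ (starRingEnd ℂ ζ))

/-- Abel's identity in ζ and in ζ̄ separately: the weight cancels the first order term of each
equation. Only the squares of the orders enter the equations, so any choice of signs for a and b is
allowed. -/
lemma JacobiPair.biWronskian_const {ρ ν₁ ν₂ : ℂ} {E E₁ E₂ E₁₂ : ℂ → ℂ}
    (h : JacobiPair ρ ν₁ ν₂ E E₁ E₂ E₁₂) {a b : ℂ} (ha : a ^ 2 = ν₁ ^ 2) (hb : b ^ 2 = ν₂ ^ 2)
    (ha' : ∀ n : ℕ, 1 + a ≠ -n) (hb' : ∀ n : ℕ, 1 + b ≠ -n) {x y : ℂ} (hx : x ∈ leftHalf)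
    (hy : y ∈ leftHalf) :
    biWronskian ρ a b E E₁ E₂ E₁₂ x = biWronskian ρ a b E E₁ E₂ E₁₂ y := by
  refine eq_of_hasWirt_zero isOpen_leftHalf convex_leftHalf (fun z hz => ?_) hx hy
  have hz' := conj_mem_leftHalf hz
  have f0 := hasWirt_of_hasDerivAt (hasDerivAt_jacobiSol ρ a hz)
  have f1 := hasWirt_of_hasDerivAt (hasDerivAt_jacobiSol' ρ ha' hz)
  have g0 := hasWirt_conj_of_hasDerivAt (hasDerivAt_jacobiSol ρ b hz')
  have g1 := hasWirt_conj_of_hasDerivAt (hasDerivAt_jacobiSol' ρ hb' hz')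
  have w0 := hasWirt_of_hasDerivAt (hasDerivAt_jacobiWeight ρ hz)
  have w1 := hasWirt_conj_of_hasDerivAt (hasDerivAt_jacobiWeight ρ hz')
  refine ((((((h.zero z hz).mul f1).sub ((h.one z hz).mul f0)).mul g1).sub
    ((((h.two z hz).mul f1).sub ((h.onetwo z hz).mul f0)).mul g0)).mul (w0.mul w1)).congr_wirt
    ?_ ?_
  · rw [ha]; ring
  · rw [hb]; ring

/-- Under ζ ↦ ζ + πi the solutions in ζ and ζ̄ acquire opposite phases, so the bi-Wronskian is
multiplied by e^{(a-b)πi}. It is also constant, hence zero when that factor is not 1. -/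
lemma JacobiPair.biWronskian_eq_zero {ρ ν₁ ν₂ : ℂ} {E E₁ E₂ E₁₂ : ℂ → ℂ}
    (h : JacobiPair ρ ν₁ ν₂ E E₁ E₂ E₁₂) {a b : ℂ} (ha : a ^ 2 = ν₁ ^ 2) (hb : b ^ 2 = ν₂ ^ 2)
    (ha' : ∀ n : ℕ, 1 + a ≠ -n) (hb' : ∀ n : ℕ, 1 + b ≠ -n)
    (hper : ∀ ζ ∈ leftHalf, E (ζ + π * Complex.I) = E ζ ∧ E₁ (ζ + π * Complex.I) = E₁ ζ ∧
      E₂ (ζ + π * Complex.I) = E₂ ζ ∧ E₁₂ (ζ + π * Complex.I) = E₁₂ ζ)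
    (hab : Complex.exp ((a - b) * (π * Complex.I)) ≠ 1) {ζ : ℂ} (hζ : ζ ∈ leftHalf) :
    biWronskian ρ a b E E₁ E₂ E₁₂ ζ = 0 := by
  have hζ' : ζ + π * Complex.I ∈ leftHalf := by
    have : ζ.re < 0 := hζ
    change (ζ + π * Complex.I).re < 0
    simpa using this
  have h1 := h.biWronskian_const ha hb ha' hb' hζ' hζ
  obtain ⟨p0, p1, p2, p3⟩ := hper ζ hζ
  have h2 : biWronskian ρ a b E E₁ E₂ E₁₂ (ζ + π * Complex.I) =
      Complex.exp ((a - b) * (π * Complex.I)) * biWronskian ρ a b E E₁ E₂ E₁₂ ζ := by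
    have hc : starRingEnd ℂ (ζ + π * Complex.I) = starRingEnd ℂ ζ - π * Complex.I := by
      simp [sub_eq_add_neg]
    have e : Complex.exp ((ρ + a) * (π * Complex.I)) * Complex.exp (-((ρ + b) * (π * Complex.I))) =
        Complex.exp ((a - b) * (π * Complex.I)) := by
      rw [← Complex.exp_add]; congr 1; ring
    have e' : Complex.exp (-(2 * ρ * (π * Complex.I))) * Complex.exp (2 * ρ * (π * Complex.I)) =
        1 := by
      rw [← Complex.exp_add, neg_add_cancel, Complex.exp_zero]
    have e3 : biWronskian ρ a b E E₁ E₂ E₁₂ (ζ + π * Complex.I) =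
        (Complex.exp ((ρ + a) * (π * Complex.I)) * Complex.exp (-((ρ + b) * (π * Complex.I)))) *
        (Complex.exp (-(2 * ρ * (π * Complex.I))) * Complex.exp (2 * ρ * (π * Complex.I))) *
        biWronskian ρ a b E E₁ E₂ E₁₂ ζ := by
      unfold biWronskian
      rw [hc, p0, p1, p2, p3, jacobiSol_add_pi, jacobiSol'_add_pi, jacobiSol_sub_pi,
        jacobiSol'_sub_pi, jacobiWeight_add_pi, jacobiWeight_sub_pi]
      ring
    rw [e3, e, e', mul_one]
  rw [h2] at h1
  have h3 : (Complex.exp ((a - b) * (π * Complex.I)) - 1) * biWronskian ρ a b E E₁ E₂ E₁₂ ζ = 0 := by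
    linear_combination h1
  exact (mul_eq_zero.1 h3).resolve_left (sub_ne_zero.2 hab)

/-- Cramer's rule in both variables recovers E from its four bi-Wronskians with signs (±ν₁, ±ν₂).
The two of mixed sign are multiplied by e^{±(ν₁+ν₂)πi} ≠ 1 under the period and vanish. -/
lemma JacobiPair.eq_combination {ρ ν₁ ν₂ : ℂ} {E E₁ E₂ E₁₂ : ℂ → ℂ}
    (h : JacobiPair ρ ν₁ ν₂ E E₁ E₂ E₁₂) (h1 : ∀ n : ℤ, ν₁ ≠ n) (h2 : ∀ n : ℤ, ν₂ ≠ n)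
    (hper : ∀ ζ ∈ leftHalf, E (ζ + π * Complex.I) = E ζ ∧ E₁ (ζ + π * Complex.I) = E₁ ζ ∧
      E₂ (ζ + π * Complex.I) = E₂ ζ ∧ E₁₂ (ζ + π * Complex.I) = E₁₂ ζ)
    (hab : Complex.exp ((ν₁ + ν₂) * (π * Complex.I)) ≠ 1) :
    ∃ c₁ c₂ : ℂ, ∀ ζ ∈ leftHalf, E ζ =
      c₁ * (jacobiSol ρ ν₁ ζ * jacobiSol ρ ν₂ (starRingEnd ℂ ζ)) +
      c₂ * (jacobiSol ρ (-ν₁) ζ * jacobiSol ρ (-ν₂) (starRingEnd ℂ ζ)) := by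
  have n1 : ∀ {ν : ℂ}, (∀ n : ℤ, ν ≠ n) → (∀ n : ℕ, 1 + ν ≠ -n) := fun h n h' =>
    h (-n - 1) (by push_cast; linear_combination h')
  have n2 : ∀ {ν : ℂ}, (∀ n : ℤ, ν ≠ n) → (∀ n : ℕ, 1 + -ν ≠ -n) := fun h n h' =>
    h (n + 1) (by push_cast; linear_combination -h')
  obtain ⟨k1, hk1, w1⟩ := exists_jacobi_wronskian ρ (by simpa using h1 0) (n1 h1) (n2 h1)
  obtain ⟨k2, hk2, w2⟩ := exists_jacobi_wronskian ρ (by simpa using h2 0) (n1 h2) (n2 h2)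
  have hab' : Complex.exp ((-ν₁ - ν₂) * (π * Complex.I)) ≠ 1 := by
    rw [show (-ν₁ - ν₂) * (π * Complex.I) = -((ν₁ + ν₂) * (π * Complex.I)) by ring, Complex.exp_neg]
    simpa using hab
  have hmem : (-1 : ℂ) ∈ leftHalf := by change (-1 : ℂ).re < 0; simp
  refine ⟨biWronskian ρ (-ν₁) (-ν₂) E E₁ E₂ E₁₂ (-1) / (k1 * k2),
    biWronskian ρ ν₁ ν₂ E E₁ E₂ E₁₂ (-1) / (k1 * k2), fun ζ hζ => ?_⟩
  have d1 := h.biWronskian_const rfl rfl (n1 h1) (n1 h2) hmem hζ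
  have d2 := h.biWronskian_const (neg_sq _) (neg_sq _) (n2 h1) (n2 h2) hmem hζ
  have d3 := h.biWronskian_eq_zero rfl (neg_sq ν₂) (n1 h1) (n2 h2) hper (by simpa using hab) hζ
  have d4 := h.biWronskian_eq_zero (neg_sq ν₁) rfl (n2 h1) (n1 h2) hper hab' hζ
  have e1 := w1 ζ hζ
  have e2 := w2 _ (conj_mem_leftHalf hζ)
  rw [d1, d2]
  have key : E ζ * (k1 * k2) =
      biWronskian ρ (-ν₁) (-ν₂) E E₁ E₂ E₁₂ ζ *
        (jacobiSol ρ ν₁ ζ * jacobiSol ρ ν₂ (starRingEnd ℂ ζ)) +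
      biWronskian ρ ν₁ ν₂ E E₁ E₂ E₁₂ ζ *
        (jacobiSol ρ (-ν₁) ζ * jacobiSol ρ (-ν₂) (starRingEnd ℂ ζ)) -
      biWronskian ρ ν₁ (-ν₂) E E₁ E₂ E₁₂ ζ *
        (jacobiSol ρ (-ν₁) ζ * jacobiSol ρ ν₂ (starRingEnd ℂ ζ)) -
      biWronskian ρ (-ν₁) ν₂ E E₁ E₂ E₁₂ ζ *
        (jacobiSol ρ ν₁ ζ * jacobiSol ρ (-ν₂) (starRingEnd ℂ ζ)) := by
    rw [← e1, ← e2]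
    unfold biWronskian
    ring
  rw [d3, d4] at key
  field_simp
  linear_combination key

/-! ### The integral as a combination of hypergeometric products -/

/-- The term `u^(-ρ-ν) F⁽¹⁾_{ρ,ν}(4 / u²)` at `u = exp v`. -/
def hypTerm (ρ ν v : ℂ) : ℂ := Complex.exp (-((ρ + ν) * v)) * F1 ρ ν (4 * Complex.exp (-2 * v))

lemma four_mul_exp_conj (v : ℂ) : 4 * Complex.exp (-2 * starRingEnd ℂ v) =
    starRingEnd ℂ (4 * Complex.exp (-2 * v)) := by
  rw [map_mul, ← Complex.exp_conj, map_mul, map_neg, map_ofNat, map_ofNat]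

lemma conj_mem_cutPlane {z : ℂ} (h : z ∈ cutPlane) : starRingEnd ℂ z ∈ cutPlane := by
  intro h'
  rw [Complex.conj_re, Complex.conj_im, neg_eq_zero] at h'
  exact h h'

lemma conj_quadInv {z : ℂ} (hz : z ∈ cutPlane) :
    starRingEnd ℂ (quadInv z) = quadInv (starRingEnd ℂ z) := by
  have h := norm_quadInv_lt hz
  have h' : ‖starRingEnd ℂ (quadInv z)‖ < 1 := by rwa [RCLike.norm_conj]
  rw [← quadInv_quad h']
  congr 1
  conv_rhs => rw [← quadInv_spec hz]
  simp [map_ofNat]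

/-- The variable `ζ` with `2 cosh ζ = exp v`. -/
def jacobiVar (v : ℂ) : ℂ := Complex.log (1 + quadInv (4 * Complex.exp (-2 * v))) - v

lemma exp_two_mul_jacobiVar {v : ℂ} (hv : 4 * Complex.exp (-2 * v) ∈ cutPlane) :
    Complex.exp (2 * jacobiVar v) = quadInv (4 * Complex.exp (-2 * v)) := by
  have h1 := norm_quadInv_lt hv
  have h2 := quadInv_spec hv
  unfold jacobiVar
  set w := quadInv (4 * Complex.exp (-2 * v))
  have h3 := one_add_ne_zero_of_norm_lt h1
  rw [mul_sub, sub_eq_add_neg, Complex.exp_add, two_mul, Complex.exp_add, Complex.exp_log h3,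
    ← neg_mul]
  rw [div_eq_iff (pow_ne_zero 2 h3)] at h2
  linear_combination -h2 / 4

lemma jacobiVar_mem {v : ℂ} (hv : 4 * Complex.exp (-2 * v) ∈ cutPlane) : jacobiVar v ∈ leftHalf := by
  have h1 := norm_quadInv_lt hv
  rw [← exp_two_mul_jacobiVar hv, Complex.norm_exp, Real.exp_lt_one_iff] at h1
  change (jacobiVar v).re < 0
  simp at h1
  linarith

lemma exp_jacobiVar_add {v : ℂ} (hv : 4 * Complex.exp (-2 * v) ∈ cutPlane) :
    Complex.exp (jacobiVar v) + Complex.exp (-jacobiVar v) = Complex.exp v := by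
  have h1 := norm_quadInv_lt hv
  have h2 := quadInv_spec hv
  unfold jacobiVar
  set w := quadInv (4 * Complex.exp (-2 * v))
  have h3 := one_add_ne_zero_of_norm_lt h1
  have h4 := Complex.exp_ne_zero v
  rw [neg_sub, Complex.exp_sub, Complex.exp_sub, Complex.exp_log h3]
  rw [neg_mul, Complex.exp_neg, two_mul, Complex.exp_add] at h2
  field_simp at h2 ⊢
  linear_combination -h2

lemma jacobiVar_conj {v : ℂ} (hv : 4 * Complex.exp (-2 * v) ∈ cutPlane) :
    jacobiVar (starRingEnd ℂ v) = starRingEnd ℂ (jacobiVar v) := by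
  have h1 := norm_quadInv_lt hv
  unfold jacobiVar
  rw [four_mul_exp_conj, ← conj_quadInv hv, map_sub, ← Complex.log_conj, map_add, map_one]
  exact (Complex.mem_slitPlane_iff_arg.1 (one_add_mem_slitPlane h1)).1

/-- The quadratic transformation with 2a = ρ + ν and c = 1 + ν, so that 2a - c + 1 = ρ. The
prefactor (1 + w)^{ρ+ν} accounts for the difference between ζ and -v. -/
lemma jacobiSol_jacobiVar (ρ : ℂ) {ν : ℂ} (hν : ∀ n : ℕ, 1 + ν ≠ -n) {v : ℂ}
    (hv : 4 * Complex.exp (-2 * v) ∈ cutPlane) : jacobiSol ρ ν (jacobiVar v) = hypTerm ρ ν v := by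
  unfold jacobiSol hypTerm F1
  rw [exp_two_mul_jacobiVar hv]
  have h := hyp2F1_quad ((ρ + ν) / 2) hν (norm_quadInv_lt hv)
  rw [quadInv_spec hv] at h
  rw [show (1 + ρ + ν) / 2 = (ρ + ν) / 2 + 1 / 2 by ring, h,
    show 2 * ((ρ + ν) / 2) - (1 + ν) + 1 = ρ by ring, show 2 * ((ρ + ν) / 2) = ρ + ν by ring,
    ← mul_assoc, ← Complex.exp_add]
  unfold jacobiVar
  congr 2; ring

lemma sq_exp_add_ne_four {ζ : ℂ} (h : ζ ∈ leftHalf) :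
    (Complex.exp ζ + Complex.exp (-ζ)) ^ 2 ≠ 4 := fun h0 => by
  have h1 : (Complex.exp ζ - Complex.exp (-ζ)) ^ 2 = 0 := by
    have : Complex.exp ζ * Complex.exp (-ζ) = 1 := by
      rw [← Complex.exp_add, add_neg_cancel, Complex.exp_zero]
    linear_combination h0 - 4 * this
  exact exp_sub_exp_neg_ne_zero h (pow_eq_zero_iff two_ne_zero |>.1 h1)

lemma HasWirt.comp_two_cosh {V : ℂ → ℂ} {p q ζ : ℂ}
    (h : HasWirt V p q (Complex.exp ζ + Complex.exp (-ζ))) :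
    HasWirt (fun ζ => V (Complex.exp ζ + Complex.exp (-ζ)))
      (p * (Complex.exp ζ - Complex.exp (-ζ)))
      (q * starRingEnd ℂ (Complex.exp ζ - Complex.exp (-ζ))) ζ := by
  refine HasWirt.comp_holo (f := V) h ?_
  refine ((Complex.hasDerivAt_exp ζ).add ((hasDerivAt_id ζ).neg.cexp)).congr_deriv ?_
  simp [sub_eq_add_neg]

lemma hasDerivAt_two_sinh (ζ : ℂ) : HasDerivAt (fun ζ => Complex.exp ζ - Complex.exp (-ζ))
    (Complex.exp ζ + Complex.exp (-ζ)) ζ := by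
  refine ((Complex.hasDerivAt_exp ζ).sub ((hasDerivAt_id ζ).neg.cexp)).congr_deriv ?_
  simp

/-- For u = 2 cosh ζ one has ∂_ζ = 2 sinh ζ ∂_u and (2 sinh ζ)² = u² - 4, which removes the singular
coefficient and turns the moment equations into Jacobi's. The moments (0,0), (1,0), (0,1), (1,1)
supply the function and its mixed derivatives. -/
lemma exists_jacobiPair {ρ μ : ℂ} (h0 : μ ≠ 0) (hμ : |μ.re| < ρ.re) (hρ : ρ.re < 1) (d : ℤ) :
    ∃ E E₁ E₂ E₁₂ : ℂ → ℂ, JacobiPair ρ (μ + d) (μ - d) E E₁ E₂ E₁₂ ∧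
      ∀ ζ ∈ leftHalf, E ζ = impInt ρ μ d (Complex.exp ζ + Complex.exp (-ζ)) := by
  obtain ⟨I, hI⟩ := exists_momentFamily h0 hμ hρ d
  set u : ℂ → ℂ := fun ζ => Complex.exp ζ + Complex.exp (-ζ) with hu
  set s : ℂ → ℂ := fun ζ => Complex.exp ζ - Complex.exp (-ζ) with hs
  set c : ℂ := -2 * π * Complex.I with hc
  have hc2 : c ^ 2 = -(4 * π ^ 2) := by
    rw [hc, mul_pow, Complex.I_sq]; ring
  have hsu : ∀ ζ, s ζ ^ 2 = u ζ ^ 2 - 4 := fun ζ => by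
    have : Complex.exp ζ * Complex.exp (-ζ) = 1 := by
      rw [← Complex.exp_add, add_neg_cancel, Complex.exp_zero]
    simp only [hu, hs]
    linear_combination -4 * this
  have huc : ∀ ζ, starRingEnd ℂ (u ζ) = u (starRingEnd ℂ ζ) := fun ζ => by
    simp only [hu, map_add, ← Complex.exp_conj, map_neg]
  have hsc : ∀ ζ, starRingEnd ℂ (s ζ) = s (starRingEnd ℂ ζ) := fun ζ => by
    simp only [hs, map_sub, ← Complex.exp_conj, map_neg]
  have hd : ∀ j k, 0 ≤ j → 0 ≤ k → j + k ≤ 2 → ∀ ζ ∈ leftHalf, HasWirt (fun ζ => I j k (u ζ))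
      (c * I (j + 1) k (u ζ) * s ζ) (c * I j (k + 1) (u ζ) * s (starRingEnd ℂ ζ)) ζ := by
    intro j k hj hk hjk ζ hζ
    have := (hI.wirt j k hj hk hjk _ (sq_exp_add_ne_four hζ)).comp_two_cosh
    exact this.congr_wirt rfl (by rw [← hsc])
  have hs0 : ∀ ζ : ℂ, HasWirt s (u ζ) 0 ζ := fun ζ => hasWirt_of_hasDerivAt (hasDerivAt_two_sinh ζ)
  have hs1 : ∀ ζ : ℂ, HasWirt (fun ζ => s (starRingEnd ℂ ζ)) 0 (u (starRingEnd ℂ ζ)) ζ := fun ζ =>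
    hasWirt_conj_of_hasDerivAt (hasDerivAt_two_sinh _)
  have hcoth : ∀ ζ ∈ leftHalf, coth ζ * s ζ = u ζ := fun ζ hζ =>
    div_mul_cancel₀ _ (exp_sub_exp_neg_ne_zero hζ)
  have ode1 : ∀ k, 0 ≤ k → k ≤ 1 → ∀ ζ ∈ leftHalf, s ζ ^ 2 * c ^ 2 * I 2 k (u ζ) =
      ((μ + d) ^ 2 - ρ ^ 2) * I 0 k (u ζ) - (2 * ρ + 1) * c * u ζ * I 1 k (u ζ) := by
    intro k hk hk1 ζ hζ
    have := hI.eq k hk hk1 _ (sq_exp_add_ne_four hζ)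
    unfold besselComb at this
    push_cast at this
    rw [hsu, hc2, hc]
    linear_combination -this
  have ode2 : ∀ j, 0 ≤ j → j ≤ 1 → ∀ ζ ∈ leftHalf, s (starRingEnd ℂ ζ) ^ 2 * c ^ 2 * I j 2 (u ζ) =
      ((μ - d) ^ 2 - ρ ^ 2) * I j 0 (u ζ) -
        (2 * ρ + 1) * c * u (starRingEnd ℂ ζ) * I j 1 (u ζ) := by
    intro k hk hk1 ζ hζ
    have := hI.eq_conj k hk hk1 _ (sq_exp_add_ne_four hζ)
    unfold besselComb at this
    push_cast at this
    change 4 * π ^ 2 * (starRingEnd ℂ (u ζ) ^ 2 - 4) * I k 2 (u ζ) + _ * I k 0 (u ζ) -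
      _ * starRingEnd ℂ (u ζ) * I k 1 (u ζ) = 0 at this
    rw [huc] at this
    rw [hsu, hc2, hc]
    linear_combination -this
  refine ⟨fun ζ => I 0 0 (u ζ), fun ζ => c * I 1 0 (u ζ) * s ζ,
    fun ζ => c * I 0 1 (u ζ) * s (starRingEnd ℂ ζ),
    fun ζ => c ^ 2 * I 1 1 (u ζ) * s ζ * s (starRingEnd ℂ ζ), ⟨?_, ?_, ?_, ?_⟩, ?_⟩
  · intro ζ hζ
    exact hd 0 0 le_rfl le_rfl (by norm_num) ζ hζ
  · intro ζ hζ
    refine (((hd 1 0 zero_le_one le_rfl (by norm_num) ζ hζ).const_mul c).mul (hs0 ζ)).congr_wirt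
      ?_ ?_
    · have h1 := ode1 0 le_rfl zero_le_one ζ hζ
      have h2 := hcoth ζ hζ
      norm_num
      linear_combination h1 + 2 * ρ * c * I 1 0 (u ζ) * h2
    · norm_num
      ring
  · intro ζ hζ
    refine (((hd 0 1 le_rfl zero_le_one (by norm_num) ζ hζ).const_mul c).mul (hs1 ζ)).congr_wirt
      ?_ ?_
    · norm_num
      left; ring
    · have h1 := ode2 0 le_rfl zero_le_one ζ hζ
      have h2 := hcoth _ (conj_mem_leftHalf hζ)
      norm_num
      linear_combination h1 + 2 * ρ * c * I 0 1 (u ζ) * h2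
  · intro ζ hζ
    refine ((((hd 1 1 zero_le_one zero_le_one (by norm_num) ζ hζ).const_mul (c ^ 2)).mul
      (hs0 ζ)).mul (hs1 ζ)).congr_wirt ?_ ?_
    · have h1 := ode1 1 zero_le_one le_rfl ζ hζ
      have h2 := hcoth ζ hζ
      norm_num
      linear_combination (c * s (starRingEnd ℂ ζ)) *
        (h1 + 2 * ρ * c * I 1 1 (u ζ) * h2)
    · have h1 := ode2 1 zero_le_one le_rfl ζ hζ
      have h2 := hcoth _ (conj_mem_leftHalf hζ)
      norm_num
      linear_combination (c * s ζ) * (h1 + 2 * ρ * c * I 1 1 (u ζ) * h2)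
  · intro ζ hζ
    exact hI.zero _ (sq_exp_add_ne_four hζ)

lemma ne_intCast_of_abs_re_lt_one {μ : ℂ} (h0 : μ ≠ 0) (h1 : |μ.re| < 1) (n : ℤ) : μ ≠ n := by
  rintro rfl
  rw [Complex.intCast_re, ← Int.cast_abs] at h1
  have h2 : |n| < 1 := by exact_mod_cast h1
  exact h0 (by rw [Int.abs_lt_one_iff.1 h2, Int.cast_zero])

/-- The functions `impInt` and the products of Gauss functions. -/
lemma exists_impInt_eq {ρ μ : ℂ} (h0 : μ ≠ 0) (hμ : |μ.re| < ρ.re) (hρ : ρ.re < 1) (d : ℤ) :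
    ∃ c₁ c₂ : ℂ, ∀ v : ℂ, 4 * Complex.exp (-2 * v) ∈ cutPlane → impInt ρ μ d (Complex.exp v) =
      c₁ * (hypTerm ρ (μ + d) v * hypTerm ρ (μ - d) (starRingEnd ℂ v)) +
      c₂ * (hypTerm ρ (-(μ + d)) v * hypTerm ρ (-(μ - d)) (starRingEnd ℂ v)) := by
  have hint := ne_intCast_of_abs_re_lt_one h0 (hμ.trans hρ)
  have n1 : ∀ n : ℤ, μ + d ≠ n := fun n h => hint (n - d) (by push_cast; linear_combination h)
  have n2 : ∀ n : ℤ, μ - d ≠ n := fun n h => hint (n + d) (by push_cast; linear_combination h)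
  have m1 : ∀ {ν : ℂ}, (∀ n : ℤ, ν ≠ n) → (∀ n : ℕ, 1 + ν ≠ -n) := fun h n h' =>
    h (-n - 1) (by push_cast; linear_combination h')
  have m2 : ∀ {ν : ℂ}, (∀ n : ℤ, ν ≠ n) → (∀ n : ℕ, 1 + -ν ≠ -n) := fun h n h' =>
    h (n + 1) (by push_cast; linear_combination -h')
  obtain ⟨E, E₁, E₂, E₁₂, hE, hEI⟩ := exists_jacobiPair h0 hμ hρ d
  have hab : Complex.exp ((μ + d + (μ - d)) * (π * Complex.I)) ≠ 1 := by
    intro h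
    obtain ⟨n, hn⟩ := Complex.exp_eq_one_iff.1 h
    refine hint n (mul_right_cancel₀ Complex.two_pi_I_ne_zero ?_)
    linear_combination hn
  have hmem : ∀ ζ ∈ leftHalf, ζ + π * Complex.I ∈ leftHalf := fun ζ hζ => by
    have : ζ.re < 0 := hζ
    change (ζ + π * Complex.I).re < 0
    simpa using this
  -- Wirtinger derivatives are unique, so those of a periodic function are periodic.
  have hadd : ∀ {V V₁ V₂ : ℂ → ℂ},
      (∀ ζ ∈ leftHalf, V (ζ + π * Complex.I) = V ζ) →
      (∀ ζ ∈ leftHalf, HasWirt V (V₁ ζ) (V₂ ζ) ζ) →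
      ∀ ζ ∈ leftHalf, V₁ (ζ + π * Complex.I) = V₁ ζ ∧ V₂ (ζ + π * Complex.I) = V₂ ζ := by
    intro V V₁ V₂ hp hV ζ hζ
    have h1 := HasWirt.comp_holo (f := V) (g := fun ζ => ζ + π * Complex.I)
      (hV _ (hmem ζ hζ)) ((hasDerivAt_id ζ).add_const (π * Complex.I))
    have h2 := h1.congr_fun (g := V) (by
      filter_upwards [isOpen_leftHalf.mem_nhds hζ] with z hz using (hp z hz).symm)
    have h3 := h2.unique (hV ζ hζ)
    simpa using h3
  -- The shift ζ + πi replaces u by -u, and the integral is even in u.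
  have p0 : ∀ ζ ∈ leftHalf, E (ζ + π * Complex.I) = E ζ := fun ζ hζ => by
    rw [hEI _ (hmem ζ hζ), hEI ζ hζ, neg_add, Complex.exp_add, Complex.exp_add, Complex.exp_neg
      (π * Complex.I), Complex.exp_pi_mul_I, ← impInt_even hμ hρ]
    congr 1; norm_num; ring
  have p1 := hadd p0 hE.zero
  have p2 := hadd (fun ζ hζ => (p1 ζ hζ).1) hE.one
  obtain ⟨c₁, c₂, hc⟩ := hE.eq_combination n1 n2
    (fun ζ hζ => ⟨p0 ζ hζ, (p1 ζ hζ).1, (p1 ζ hζ).2, (p2 ζ hζ).2⟩) hab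
  refine ⟨c₁, c₂, fun v hv => ?_⟩
  have hv' : 4 * Complex.exp (-2 * starRingEnd ℂ v) ∈ cutPlane := by
    rw [four_mul_exp_conj]; exact conj_mem_cutPlane hv
  have h := hc _ (jacobiVar_mem hv)
  rw [hEI _ (jacobiVar_mem hv), exp_jacobiVar_add hv, ← jacobiVar_conj hv,
    jacobiSol_jacobiVar ρ (m1 n1) hv, jacobiSol_jacobiVar ρ (m1 n2) hv',
    jacobiSol_jacobiVar ρ (m2 n1) hv, jacobiSol_jacobiVar ρ (m2 n2) hv'] at h
  exact h

/-! ### Logarithmic polar coordinates and Gaussian integrals -/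

lemma measurePreserving_cyl : MeasurePreserving cyl volume volume := by
  have h1 : MeasurePreserving (Prod.swap : ℝ × ℝ → ℝ × ℝ) volume volume :=
    Measure.measurePreserving_swap
  have h2 := Complex.volume_preserving_equiv_real_prod.symm.comp h1
  have h3 : (⇑Complex.measurableEquivRealProd.symm ∘ Prod.swap) = cyl := by
    funext p
    simp [cyl, Complex.measurableEquivRealProd_symm_apply, Complex.mk_eq_add_mul_I]
  rwa [h3] at h2

lemma measurableEmbedding_cyl : MeasurableEmbedding cyl := by
  have h3 : (⇑Complex.measurableEquivRealProd.symm ∘ Prod.swap) = cyl := by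
    funext p
    simp [cyl, Complex.measurableEquivRealProd_symm_apply, Complex.mk_eq_add_mul_I]
  rw [← h3]
  exact Complex.measurableEquivRealProd.symm.measurableEmbedding.comp
    MeasurableEquiv.prodComm.measurableEmbedding

/-- The horizontal strip `0 < Im w ≤ 2π`. -/
def expStrip : Set ℂ := {w | w.im ∈ Ioc 0 (2 * π)}

lemma measurableSet_expStrip : MeasurableSet expStrip := Complex.measurable_im measurableSet_Ioc

lemma preimage_cyl_expStrip : cyl ⁻¹' expStrip = Ioc 0 (2 * π) ×ˢ univ := by
  ext p
  simp [expStrip]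

lemma injOn_exp_expStrip : InjOn Complex.exp expStrip := by
  intro x hx y hy h
  obtain ⟨n, hn⟩ := Complex.exp_eq_exp_iff_exists_int.1 h
  have h1 := congrArg Complex.im hn
  simp at h1
  obtain ⟨hx1, hx2⟩ : 0 < x.im ∧ x.im ≤ 2 * π := hx
  obtain ⟨hy1, hy2⟩ : 0 < y.im ∧ y.im ≤ 2 * π := hy
  have hpi := Real.pi_pos
  have h2 : (n : ℝ) < 1 := by
    by_contra h; push Not at h; nlinarith
  have h3 : (-1 : ℝ) < n := by
    by_contra h; push Not at h; nlinarith
  have h4 : n < 1 := by exact_mod_cast h2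
  have h5 : -1 < n := by exact_mod_cast h3
  have : n = 0 := by omega
  rw [hn, this]; simp

lemma image_exp_expStrip : Complex.exp '' expStrip = {0}ᶜ := by
  ext z
  constructor
  · rintro ⟨w, -, rfl⟩
    exact Complex.exp_ne_zero w
  · intro hz
    have hz : z ≠ 0 := hz
    have h1 := Complex.neg_pi_lt_arg z
    have h2 := Complex.arg_le_pi z
    rcases lt_or_ge 0 z.arg with h | h
    · refine ⟨Complex.log z, ⟨?_, ?_⟩, Complex.exp_log hz⟩
      · rwa [Complex.log_im]
      · rw [Complex.log_im]; linarith
    · refine ⟨Complex.log z + 2 * π * Complex.I, ⟨?_, ?_⟩, ?_⟩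
      · simp [Complex.log_im]; linarith
      · simpa [Complex.log_im] using h
      · rw [Complex.exp_add, Complex.exp_two_pi_mul_I, mul_one, Complex.exp_log hz]

lemma abs_det_exp (w : ℂ) : |((ContinuousLinearMap.toSpanSingleton ℂ
    (Complex.exp w)).restrictScalars ℝ).det| = Real.exp (2 * w.re) := by
  simp [ContinuousLinearMap.det, LinearMap.det_restrictScalars, Algebra.norm_complex_eq,
    Complex.normSq_eq_norm_sq, Complex.norm_exp, ← Real.exp_nat_mul]

lemma hasFDerivWithinAt_exp_real (s : Set ℂ) (w : ℂ) : HasFDerivWithinAt Complex.exp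
    ((ContinuousLinearMap.toSpanSingleton ℂ (Complex.exp w)).restrictScalars ℝ) s w :=
  ((Complex.hasDerivAt_exp w).hasFDerivAt.restrictScalars ℝ).hasFDerivWithinAt

lemma ae_ne_zero_complex : ({0}ᶜ : Set ℂ) =ᵐ[volume] univ :=
  ae_eq_univ.2 (by rw [compl_compl]; exact measure_singleton 0)

lemma integrable_iff_cyl (F : ℂ → ℂ) : Integrable F ↔ IntegrableOn
    (fun p => Real.exp (2 * p.2) • F (Complex.exp (cyl p))) (Ioc 0 (2 * π) ×ˢ univ) := by
  rw [← integrableOn_univ, ← integrableOn_congr_set_ae ae_ne_zero_complex, ← image_exp_expStrip,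
    integrableOn_image_iff_integrableOn_abs_det_fderiv_smul volume measurableSet_expStrip
    (fun x _ => hasFDerivWithinAt_exp_real _ x) injOn_exp_expStrip,
    ← measurePreserving_cyl.integrableOn_comp_preimage measurableEmbedding_cyl,
    preimage_cyl_expStrip]
  refine integrableOn_congr_fun (fun p _ => ?_) (measurableSet_Ioc.prod MeasurableSet.univ)
  simp only [Function.comp, abs_det_exp, cyl_re]

lemma integral_eq_cyl (F : ℂ → ℂ) : ∫ u, F u =
    ∫ p in Ioc 0 (2 * π) ×ˢ univ, Real.exp (2 * p.2) • F (Complex.exp (cyl p)) := by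
  rw [← setIntegral_univ, ← setIntegral_congr_set ae_ne_zero_complex, ← image_exp_expStrip,
    integral_image_eq_integral_abs_det_fderiv_smul volume measurableSet_expStrip
    (fun x _ => hasFDerivWithinAt_exp_real _ x) injOn_exp_expStrip,
    ← measurePreserving_cyl.setIntegral_preimage_emb measurableEmbedding_cyl,
    preimage_cyl_expStrip]
  refine setIntegral_congr_fun (measurableSet_Ioc.prod MeasurableSet.univ) (fun p _ => ?_)
  simp only [abs_det_exp, cyl_re]

/-! ### Gaussian monomials and their Fourier transforms. -/

lemma integrable_norm_rpow_mul_gauss {b : ℝ} (hb : 0 < b) {s : ℝ} (hs : -2 < s) :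
    Integrable fun u : ℂ => ‖u‖ ^ s * Real.exp (-b * ‖u‖ ^ 2) := by
  rw [integrable_fun_norm_addHaar volume (f := fun y => y ^ s * Real.exp (-b * y ^ 2))]
  refine (integrableOn_rpow_mul_exp_neg_mul_sq hb (s := s + 1) (by linarith)).congr_fun
    (fun y hy => ?_) measurableSet_Ioi
  have hy : 0 < y := hy
  simp only [Complex.finrank_real_complex, smul_eq_mul]
  rw [Real.rpow_add hy, Real.rpow_one, show 2 - 1 = 1 from rfl, pow_one]
  ring

lemma integrable_norm_pow_mul_gauss {b : ℝ} (hb : 0 < b) (n : ℕ) :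
    Integrable fun u : ℂ => ‖u‖ ^ n * Real.exp (-b * ‖u‖ ^ 2) := by
  have := integrable_norm_rpow_mul_gauss hb (s := n) (by
    have : (0 : ℝ) ≤ n := n.cast_nonneg
    linarith)
  simpa only [Real.rpow_natCast] using this

/-- A monomial in `u` and `ū` times a Gaussian. -/
def gaussMon (b : ℝ) (j k : ℕ) (u : ℂ) : ℂ :=
  u ^ j * starRingEnd ℂ u ^ k * Real.exp (-b * ‖u‖ ^ 2)

lemma continuous_gaussMon (b : ℝ) (j k : ℕ) : Continuous (gaussMon b j k) := by
  unfold gaussMon; fun_prop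

lemma norm_gaussMon (b : ℝ) (j k : ℕ) (u : ℂ) :
    ‖gaussMon b j k u‖ = ‖u‖ ^ (j + k) * Real.exp (-b * ‖u‖ ^ 2) := by
  unfold gaussMon
  rw [norm_mul, norm_mul, norm_pow, norm_pow, RCLike.norm_conj, Complex.norm_real,
    Real.norm_of_nonneg (Real.exp_pos _).le, pow_add]

lemma integrable_gaussMon {b : ℝ} (hb : 0 < b) (j k : ℕ) : Integrable (gaussMon b j k) :=
  (integrable_norm_pow_mul_gauss hb (j + k)).mono'
    (continuous_gaussMon b j k).aestronglyMeasurable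
    (Eventually.of_forall fun u => (norm_gaussMon b j k u).le)

/-- The Fourier transform of `gaussMon`. -/
def gaussFT (b : ℝ) (j k : ℕ) (z : ℂ) : ℂ := ∫ u, gaussMon b j k u * planeWave u z

lemma hasWirt_gaussFT {b : ℝ} (hb : 0 < b) (j k : ℕ) (z : ℂ) : HasWirt (gaussFT b j k)
    (-2 * π * Complex.I * gaussFT b (j + 1) k z) (-2 * π * Complex.I * gaussFT b j (k + 1) z) z := by
  have e1 : ∀ u, gaussMon b j k u * u = gaussMon b (j + 1) k u := fun u => by
    unfold gaussMon; ring
  have e2 : ∀ u, gaussMon b j k u * starRingEnd ℂ u = gaussMon b j (k + 1) u := fun u => by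
    unfold gaussMon; ring
  have h := hasWirt_integral_planeWave (h := gaussMon b j k) (φ := fun u => u) (m := volume)
    (integrable_gaussMon hb j k) (by fun_prop) (by
      simp only [e1]; exact integrable_gaussMon hb (j + 1) k) z
  simp only [e1, e2] at h
  exact h

lemma gaussFT_zero {b : ℝ} (hb : 0 < b) (z : ℂ) :
    gaussFT b 0 0 z = π / b * Complex.exp (-(4 * π ^ 2 / b) * (z * starRingEnd ℂ z)) := by
  -- The real inner product of u with z̄ is Re(zu), so the frequency -4πi along z̄ reproduces
  -- `planeWave`.
  have h := GaussianFourier.integral_cexp_neg_mul_sq_norm_add (V := ℂ) (b := (b : ℂ))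
    (by simpa using hb) (-4 * π * Complex.I) (starRingEnd ℂ z)
  unfold gaussFT gaussMon planeWave
  rw [Complex.finrank_real_complex] at h
  have e1 : ((2 : ℕ) : ℂ) / 2 = 1 := by norm_num
  rw [e1, Complex.cpow_one, RCLike.norm_conj] at h
  convert h using 2
  · ext u
    rw [pow_zero, pow_zero, one_mul, one_mul, Complex.ofReal_exp, ← Complex.exp_add]
    congr 1
    rw [Complex.inner, Complex.conj_conj, Complex.add_conj]
    push_cast
    rw [mul_comm u z]
    ring
  · congr 1
    rw [Complex.mul_conj, Complex.normSq_eq_norm_sq]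
    have hb' : (b : ℂ) ≠ 0 := Complex.ofReal_ne_zero.2 hb.ne'
    push_cast
    field_simp
    rw [Complex.I_sq]
    ring

lemma hasWirt_gauss (a : ℂ) (z : ℂ) :
    HasWirt (fun z => Complex.exp (-a * (z * starRingEnd ℂ z)))
      (-a * starRingEnd ℂ z * Complex.exp (-a * (z * starRingEnd ℂ z)))
      (-a * z * Complex.exp (-a * (z * starRingEnd ℂ z))) z := by
  have h := HasWirt.holo_comp (f := Complex.exp) (Complex.hasDerivAt_exp _)
    (((hasWirt_id z).mul (hasWirt_conj z)).const_mul (-a))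
  refine h.congr_wirt ?_ ?_ <;> ring

/-- Each derivative ∂ of the transform inserts a factor u, and on exp(-a z z̄) it acts as
multiplication by -a z̄. -/
lemma gaussFT_left {b : ℝ} (hb : 0 < b) (m : ℕ) (z : ℂ) :
    gaussFT b m 0 z = π / b * (-2 * π * Complex.I / b) ^ m * starRingEnd ℂ z ^ m *
      Complex.exp (-(4 * π ^ 2 / b) * (z * starRingEnd ℂ z)) := by
  have hb' : (b : ℂ) ≠ 0 := Complex.ofReal_ne_zero.2 hb.ne'
  have hpi : (π : ℂ) ≠ 0 := Complex.ofReal_ne_zero.2 Real.pi_ne_zero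
  induction m generalizing z with
  | zero => rw [gaussFT_zero hb]; ring
  | succ m ih =>
    have h1 := hasWirt_gaussFT hb m 0 z
    have h2 := (hasWirt_conj_of_hasDerivAt (hasDerivAt_pow m (starRingEnd ℂ z))).mul
      (hasWirt_gauss (4 * π ^ 2 / b) z)
    have h3 := (h2.const_mul (π / b * (-2 * π * Complex.I / b) ^ m)).congr_fun
      (g := gaussFT b m 0) (Eventually.of_forall fun z => by rw [ih]; ring)
    have h4 := (h1.unique h3).1
    have e : -(4 * π ^ 2 / b : ℂ) = -2 * π * Complex.I * (-2 * π * Complex.I / b) := by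
      field_simp
      rw [Complex.I_sq]; ring
    refine mul_left_cancel₀ two_pi_I_ne_zero' (h4.trans ?_)
    rw [e]
    ring

/-- Two antiholomorphic derivatives are applied to z̄^{2n+2} exp(-a z z̄); they leave z̄^{2n} times
a quadratic polynomial of Laguerre type in a|z|². -/
lemma gaussFT_two {b : ℝ} (hb : 0 < b) (n : ℕ) (z : ℂ) :
    gaussFT b (2 * n + 2) 2 z = (π : ℂ) ^ (2 * n + 1) * (-4) ^ n / (b : ℂ) ^ (2 * n + 3) *
      starRingEnd ℂ z ^ (2 * n) * ((4 * π ^ 2 / b * (z * starRingEnd ℂ z)) ^ 2 -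
        2 * (2 * n + 2) * (4 * π ^ 2 / b * (z * starRingEnd ℂ z)) + (2 * n + 2) * (2 * n + 1)) *
      Complex.exp (-(4 * π ^ 2 / b) * (z * starRingEnd ℂ z)) := by
  have hb' : (b : ℂ) ≠ 0 := Complex.ofReal_ne_zero.2 hb.ne'
  have hpi : (π : ℂ) ≠ 0 := Complex.ofReal_ne_zero.2 Real.pi_ne_zero
  set a : ℂ := 4 * π ^ 2 / b with ha
  set c : ℂ := π / b * (-2 * π * Complex.I / b) ^ (2 * n + 2) with hc
  have one : ∀ z, gaussFT b (2 * n + 2) 1 z = c / (-2 * π * Complex.I) *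
      (starRingEnd ℂ z ^ (2 * n + 1) * (((2 * n + 2) - a * (z * starRingEnd ℂ z)) *
        Complex.exp (-a * (z * starRingEnd ℂ z)))) := by
    intro z
    have h1 := hasWirt_gaussFT hb (2 * n + 2) 0 z
    have h2 := (hasWirt_conj_of_hasDerivAt (hasDerivAt_pow (2 * n + 2) (starRingEnd ℂ z))).mul
      (hasWirt_gauss a z)
    have h3 := (h2.const_mul c).congr_fun (g := gaussFT b (2 * n + 2) 0)
      (Eventually.of_forall fun z => by rw [gaussFT_left hb]; ring)
    have h4 := (h1.unique h3).2
    refine mul_left_cancel₀ two_pi_I_ne_zero' (h4.trans ?_)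
    rw [← mul_assoc (-2 * π * Complex.I), mul_div_cancel₀ _ two_pi_I_ne_zero',
      Nat.add_succ_sub_one]
    push_cast
    ring
  have h1 := hasWirt_gaussFT hb (2 * n + 2) 1 z
  have h2 : HasWirt (fun z : ℂ => (2 * n + 2) - a * (z * starRingEnd ℂ z))
      (-a * starRingEnd ℂ z) (-a * z) z := by
    refine ((hasWirt_const (2 * n + 2) z).sub
      (((hasWirt_id z).mul (hasWirt_conj z)).const_mul a)).congr_wirt ?_ ?_ <;> ring
  have h3 := (hasWirt_conj_of_hasDerivAt (hasDerivAt_pow (2 * n + 1) (starRingEnd ℂ z))).mul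
    (h2.mul (hasWirt_gauss a z))
  have h4 := ((h3.const_mul (c / (-2 * π * Complex.I))).congr_fun (g := gaussFT b (2 * n + 2) 1)
      (Eventually.of_forall one))
  have h5 := (h1.unique h4).2
  refine mul_left_cancel₀ two_pi_I_ne_zero' (h5.trans ?_)
  have e : c / (-2 * π * Complex.I) = (-2 * π * Complex.I) *
      ((π : ℂ) ^ (2 * n + 1) * (-4) ^ n / (b : ℂ) ^ (2 * n + 3)) := by
    have e1 : (-2 * π * Complex.I) ^ (2 * n + 2) = (-2 * π * Complex.I) ^ 2 * ((-4) ^ n * π ^ (2 * n)) := by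
      rw [pow_add, pow_mul, show (-2 * π * Complex.I) ^ 2 = -4 * π ^ 2 by
        rw [mul_pow, Complex.I_sq]; ring, mul_pow, ← pow_mul]
      ring
    rw [hc, div_pow, e1, div_eq_iff two_pi_I_ne_zero']
    field_simp
    ring
  rw [e, Nat.add_sub_cancel]
  push_cast
  ring

lemma integral_gauss_exp {a : ℂ} (ha : 0 < a.re) (y : ℝ) :
    ∫ t : ℝ, Complex.exp (2 * a * t) * Real.exp (-Real.exp (2 * t + y)) =
      2⁻¹ * Complex.exp (-a * y) * Complex.Gamma a := by
  have e : ∀ t : ℝ, Complex.exp (2 * a * t) * Real.exp (-Real.exp (2 * t + y)) =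
      Complex.exp (-a * y) * Complex.exp (-Real.exp (2 * t + y) + a * ((2 * t + y : ℝ) : ℂ)) := by
    intro t
    rw [Complex.ofReal_exp, ← Complex.exp_add, ← Complex.exp_add]
    congr 1
    push_cast; ring
  simp only [e]
  rw [integral_const_mul, Measure.integral_comp_mul_left
    (fun s : ℝ => Complex.exp (-Real.exp (s + y) + a * ((s + y : ℝ) : ℂ))) 2,
    integral_add_right_eq_self (fun s : ℝ => Complex.exp (-Real.exp s + a * s)) y,
    integral_cexp_neg_exp ha, abs_of_pos (by norm_num), Complex.real_smul]
  push_cast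
  ring

lemma integrable_gauss_exp {a : ℝ} (ha : 0 < a) (y : ℝ) :
    Integrable fun t : ℝ => Real.exp (2 * a * t) * Real.exp (-Real.exp (2 * t + y)) := by
  have h := (((integrable_exp_neg_exp ha).comp_add_right y).comp_mul_left'
    (two_ne_zero)).const_mul (Real.exp (-a * y))
  refine h.congr (Eventually.of_forall fun t => ?_)
  simp only [← Real.exp_add]
  congr 1; ring

/-! ### Angular modes and expansions -/

lemma norm_exp_pair {a a' : ℂ} (h : a.im = a'.im) (w : ℂ) :
    ‖Complex.exp (a * w + a' * starRingEnd ℂ w)‖ = Real.exp ((a.re + a'.re) * w.re) := by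
  rw [Complex.norm_exp]
  congr 1
  simp [h]; ring

lemma integrable_cyl_of_bound {G : ℝ × ℝ → ℂ} {g : ℝ → ℝ}
    (hG : AEStronglyMeasurable G (volume.restrict (Ioc 0 (2 * π) ×ˢ univ)))
    (hg : Integrable g) (hb : ∀ p, ‖G p‖ ≤ g p.2) :
    IntegrableOn G (Ioc 0 (2 * π) ×ˢ univ) :=
  Integrable.mono' (integrableOn_cyl_of_snd hg.integrableOn) hG (Eventually.of_forall hb)

lemma norm_integral_cyl_le {G : ℝ × ℝ → ℂ} {g : ℝ → ℝ} {A : Set ℝ} (hA : MeasurableSet A)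
    (hg : IntegrableOn g A) (hb : ∀ p : ℝ × ℝ, p.2 ∈ A → ‖G p‖ ≤ g p.2) :
    ‖∫ p in Ioc 0 (2 * π) ×ˢ A, G p‖ ≤ 2 * π * ∫ t in A, g t := by
  refine (norm_integral_le_of_norm_le (integrableOn_cyl_of_snd hg)
    (ae_restrict_of_forall_mem (measurableSet_Ioc.prod hA) fun p hp => hb p hp.2)).trans ?_
  have h := setIntegral_prod_mul (μ := volume) (ν := volume) (fun _ : ℝ => (1 : ℝ)) g
    (Ioc 0 (2 * π)) A
  simp only [one_mul] at h
  rw [Measure.volume_eq_prod, h]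
  simp [Real.volume_real_Ioc, Real.pi_pos.le]

lemma integral_exp_int_mul_I (n : ℤ) :
    ∫ φ in Ioc 0 (2 * π), Complex.exp (n * (φ : ℂ) * Complex.I) =
      if n = 0 then 2 * (π : ℂ) else 0 := by
  rw [← intervalIntegral.integral_of_le Real.two_pi_pos.le]
  split_ifs with h
  · simp [h]
  · have hn : (n * Complex.I : ℂ) ≠ 0 := mul_ne_zero (Int.cast_ne_zero.2 h) Complex.I_ne_zero
    have h1 := integral_exp_mul_complex (a := 0) (b := 2 * π) hn
    simp only [show ∀ φ : ℝ, (n : ℂ) * φ * Complex.I = n * Complex.I * φ from fun φ => by ring]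
    rw [h1]
    have : (n * Complex.I * ((2 * π : ℝ) : ℂ)) = n * (2 * π * Complex.I) := by push_cast; ring
    rw [this, Complex.exp_int_mul_two_pi_mul_I]
    simp

lemma integral_cyl_mode {a a' : ℂ} {n : ℤ} (h : a - a' = n) (g : ℝ → ℂ) :
    ∫ p in Ioc 0 (2 * π) ×ˢ univ, Complex.exp (a * cyl p + a' * starRingEnd ℂ (cyl p)) * g p.2 =
      if n = 0 then 2 * π * ∫ t : ℝ, Complex.exp (2 * a * t) * g t else 0 := by
  have e : ∀ p : ℝ × ℝ, Complex.exp (a * cyl p + a' * starRingEnd ℂ (cyl p)) * g p.2 =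
      Complex.exp (n * (p.1 : ℂ) * Complex.I) * (Complex.exp ((a + a') * p.2) * g p.2) := by
    intro p
    rw [← mul_assoc, ← Complex.exp_add, ← h]
    congr 2
    simp [cyl]; ring
  simp only [e]
  rw [Measure.volume_eq_prod, setIntegral_prod_mul (μ := volume) (ν := volume)
    (fun φ : ℝ => Complex.exp (n * (φ : ℂ) * Complex.I))
    (fun t : ℝ => Complex.exp ((a + a') * t) * g t) (Ioc 0 (2 * π)) univ, integral_exp_int_mul_I]
  split_ifs with h0
  · have : a' = a := by rw [h0, Int.cast_zero] at h; linear_combination -h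
    rw [this, Measure.restrict_univ, two_mul a]
  · rw [zero_mul]

/-- The first terms of the expansion of a product of a holomorphic and an antiholomorphic
function, in the logarithmic variable. -/
def twoTerm (a a' k α β : ℂ) (ε : ℤ) (w : ℂ) : ℂ :=
  Complex.exp (a * w + a' * starRingEnd ℂ w) *
    (k + α * Complex.exp (ε * w) + β * Complex.exp (ε * starRingEnd ℂ w))

lemma norm_twoTerm_le {a a' : ℂ} (h : a.im = a'.im) (k α β : ℂ) (ε : ℤ) (w : ℂ) :
    ‖twoTerm a a' k α β ε w‖ ≤ ‖k‖ * Real.exp ((a.re + a'.re) * w.re) +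
      (‖α‖ + ‖β‖) * Real.exp ((a.re + a'.re + ε) * w.re) := by
  unfold twoTerm
  rw [norm_mul, norm_exp_pair h, add_mul _ (ε : ℝ), Real.exp_add]
  have e1 : ‖Complex.exp (ε * w)‖ = Real.exp (ε * w.re) := by
    rw [Complex.norm_exp]; simp
  have e2 : ‖Complex.exp (ε * starRingEnd ℂ w)‖ = Real.exp (ε * w.re) := by
    rw [Complex.norm_exp]; simp
  have h1 : ‖k + α * Complex.exp (ε * w) + β * Complex.exp (ε * starRingEnd ℂ w)‖ ≤
      ‖k‖ + ‖α‖ * Real.exp (ε * w.re) + ‖β‖ * Real.exp (ε * w.re) := by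
    refine (norm_add₃_le).trans ?_
    rw [norm_mul, norm_mul, e1, e2]
  refine (mul_le_mul_of_nonneg_left h1 (Real.exp_pos _).le).trans (le_of_eq ?_)
  ring

/-- The leading term has angular frequency 4n and the two corrections 4n ± 2, which is never 0. The
corrections therefore integrate to 0, and the leading one survives only for n = 0. -/
lemma integral_cyl_twoTerm {a a' : ℂ} {n : ℤ} (h : a - a' = 4 * n) (k α β : ℂ) {ε : ℤ}
    (hε : ε = 2 ∨ ε = -2) {g : ℝ → ℝ} (h1 : Integrable fun t => Real.exp ((a.re + a'.re) * t) * g t)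
    (h2 : Integrable fun t => Real.exp ((a.re + a'.re + ε) * t) * g t) :
    IntegrableOn (fun p => twoTerm a a' k α β ε (cyl p) * g p.2) (Ioc 0 (2 * π) ×ˢ univ) ∧
    ∫ p in Ioc 0 (2 * π) ×ˢ univ, twoTerm a a' k α β ε (cyl p) * g p.2 =
      if n = 0 then 2 * π * k * ∫ t : ℝ, Complex.exp (2 * a * t) * g t else 0 := by
  have him : a.im = a'.im := by
    have := congrArg Complex.im h
    simp at this
    linarith
  have key : ∀ {b b' : ℂ}, b.im = b'.im → (Integrable fun t => Real.exp ((b.re + b'.re) * t) * g t) →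
      IntegrableOn (fun p => Complex.exp (b * cyl p + b' * starRingEnd ℂ (cyl p)) * (g p.2 : ℂ))
        (Ioc 0 (2 * π) ×ˢ univ) := by
    intro b b' hb hi
    have hi' : Integrable fun t => ((Real.exp ((b.re + b'.re) * t) * g t : ℝ) : ℂ) := hi.ofReal
    have hgm : AEStronglyMeasurable (fun t => (g t : ℂ)) volume := by
      have := (Continuous.aestronglyMeasurable (by fun_prop :
        Continuous fun t : ℝ => ((Real.exp (-((b.re + b'.re) * t)) : ℝ) : ℂ))).mul (μ := volume) hi'.1
      refine this.congr (Eventually.of_forall fun t => ?_)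
      simp only [Pi.mul_apply]
      rw [← Complex.ofReal_mul, ← mul_assoc, ← Real.exp_add, neg_add_cancel, Real.exp_zero, one_mul]
    refine integrable_cyl_of_bound (AEStronglyMeasurable.mul (Continuous.aestronglyMeasurable
      (by have := continuous_cyl; fun_prop)) ?_) hi.norm fun p => ?_
    · rw [Measure.volume_eq_prod, ← Measure.prod_restrict, Measure.restrict_univ]
      exact hgm.comp_snd
    · rw [norm_mul, norm_exp_pair hb, cyl_re, norm_mul, Complex.norm_real,
        Real.norm_of_nonneg (Real.exp_pos _).le]
  have e : ∀ p : ℝ × ℝ, twoTerm a a' k α β ε (cyl p) * g p.2 =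
      k * (Complex.exp (a * cyl p + a' * starRingEnd ℂ (cyl p)) * (g p.2 : ℂ)) +
      (α * (Complex.exp ((a + ε) * cyl p + a' * starRingEnd ℂ (cyl p)) * (g p.2 : ℂ)) +
      β * (Complex.exp (a * cyl p + (a' + ε) * starRingEnd ℂ (cyl p)) * (g p.2 : ℂ))) := by
    intro p
    unfold twoTerm
    rw [show (a + ε) * cyl p + a' * starRingEnd ℂ (cyl p) =
      (a * cyl p + a' * starRingEnd ℂ (cyl p)) + ε * cyl p by ring,
      show a * cyl p + (a' + ε) * starRingEnd ℂ (cyl p) =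
      (a * cyl p + a' * starRingEnd ℂ (cyl p)) + ε * starRingEnd ℂ (cyl p) by ring,
      Complex.exp_add _ (ε * cyl p), Complex.exp_add _ (ε * starRingEnd ℂ (cyl p))]
    ring
  have i1 := (key him h1).const_mul k
  have i2 := (key (b := a + ε) (b' := a') (by simpa using him) (by
    rw [show (a + ε).re + a'.re = a.re + a'.re + ε by simp; ring]; exact h2)).const_mul α
  have i3 := (key (b := a) (b' := a' + ε) (by simpa using him) (by
    rw [show a.re + (a' + ε).re = a.re + a'.re + ε by simp; ring]; exact h2)).const_mul β
  simp only [e]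
  refine ⟨i1.add (i2.add i3), ?_⟩
  refine ((integral_add i1 (i2.add i3)).trans (congrArg _ (integral_add i2 i3))).trans ?_
  rw [integral_const_mul, integral_const_mul, integral_const_mul, integral_cyl_mode (n := 4 * n) (by push_cast; exact h) (fun t => (g t : ℂ)),
    integral_cyl_mode (n := 4 * n + ε) (by push_cast; linear_combination h) (fun t => (g t : ℂ)),
    integral_cyl_mode (n := 4 * n - ε) (by push_cast; linear_combination h) (fun t => (g t : ℂ)),
    if_neg (by omega : ¬ 4 * n + ε = 0), if_neg (by omega : ¬ 4 * n - ε = 0)]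
  by_cases hn : n = 0
  · rw [if_pos hn, if_pos (by omega)]; ring
  · rw [if_neg hn, if_neg (by omega)]; ring

lemma exists_taylor_bound {f : ℂ → ℂ} (hf : AnalyticAt ℂ f 0) : ∃ f₁ : ℂ, ∃ C r : ℝ, 0 ≤ C ∧ 0 < r ∧
    ∀ x : ℂ, ‖x‖ ≤ r → ‖f x - (f 0 + f₁ * x)‖ ≤ C * ‖x‖ ^ 2 := by
  obtain ⟨p, hp⟩ := hf
  have h := hp.isBigO_sub_partialSum_pow 2
  obtain ⟨C, hC⟩ := h.bound
  obtain ⟨r, hr, hb⟩ := Metric.eventually_nhds_iff.1 hC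
  refine ⟨p.coeff 1, max C 0, r / 2, le_max_right _ _, half_pos hr, fun x hx => ?_⟩
  have h1 := @hb x (by rw [dist_zero_right]; linarith)
  have h2 : p.partialSum 2 x = f 0 + p.coeff 1 * x := by
    rw [FormalMultilinearSeries.partialSum, Finset.sum_range_succ, Finset.sum_range_one,
      ← hp.coeff_zero (fun _ => x)]
    congr 1
    rw [FormalMultilinearSeries.apply_eq_pow_smul_coeff, pow_one, smul_eq_mul, mul_comm]
  rw [zero_add, h2, norm_pow, norm_norm] at h1
  exact h1.trans (mul_le_mul_of_nonneg_right (le_max_left _ _) (by positivity))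

/-- First-order expansion of `f(x) g(x̄)` at `x = 0`. -/
lemma exists_expansion {f g : ℂ → ℂ} (hf : AnalyticAt ℂ f 0) (hg : AnalyticAt ℂ g 0) :
    ∃ α β : ℂ, ∃ C r : ℝ, 0 ≤ C ∧ 0 < r ∧ ∀ x : ℂ, ‖x‖ ≤ r →
      ‖f x * g (starRingEnd ℂ x) - (f 0 * g 0 + α * x + β * starRingEnd ℂ x)‖ ≤ C * ‖x‖ ^ 2 := by
  obtain ⟨f₁, C₁, r₁, hC₁, hr₁, h₁⟩ := exists_taylor_bound hf
  obtain ⟨g₁, C₂, r₂, hC₂, hr₂, h₂⟩ := exists_taylor_bound hg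
  refine ⟨f₁ * g 0, f 0 * g₁, C₁ * (‖g 0‖ + ‖g₁‖ + C₂) + (‖f 0‖ + ‖f₁‖) * C₂ + ‖f₁‖ * ‖g₁‖,
    min 1 (min r₁ r₂), by positivity, by positivity, fun x hx => ?_⟩
  have hx1 : ‖x‖ ≤ 1 := hx.trans (min_le_left _ _)
  have a1 := h₁ x (hx.trans ((min_le_right _ _).trans (min_le_left _ _)))
  have a2 := h₂ (starRingEnd ℂ x) (by
    rw [RCLike.norm_conj]; exact hx.trans ((min_le_right _ _).trans (min_le_right _ _)))
  rw [RCLike.norm_conj] at a2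
  set X := starRingEnd ℂ x with hX
  have hXn : ‖X‖ = ‖x‖ := RCLike.norm_conj x
  set A := f x - (f 0 + f₁ * x) with hA
  set B := g X - (g 0 + g₁ * X) with hB
  have hx2 : ‖x‖ ^ 2 ≤ 1 := pow_le_one₀ (norm_nonneg _) hx1
  have e : f x * g X - (f 0 * g 0 + f₁ * g 0 * x + f 0 * g₁ * X) =
      A * (g 0 + g₁ * X + B) + (f 0 + f₁ * x) * B + f₁ * g₁ * (x * X) := by
    rw [hA, hB]; ring
  rw [e]
  have b1 : ‖g 0 + g₁ * X + B‖ ≤ ‖g 0‖ + ‖g₁‖ + C₂ := by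
    refine norm_add₃_le.trans (add_le_add (add_le_add le_rfl ?_) ?_)
    · rw [norm_mul, hXn]; exact mul_le_of_le_one_right (norm_nonneg _) hx1
    · exact a2.trans (mul_le_of_le_one_right hC₂ hx2)
  have b2 : ‖f 0 + f₁ * x‖ ≤ ‖f 0‖ + ‖f₁‖ := by
    refine (norm_add_le _ _).trans (add_le_add le_rfl ?_)
    rw [norm_mul]; exact mul_le_of_le_one_right (norm_nonneg _) hx1
  refine norm_add₃_le.trans ?_
  rw [norm_mul, norm_mul, norm_mul, norm_mul, norm_mul, hXn]
  have c1 := mul_le_mul a1 b1 (norm_nonneg _) (by positivity)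
  have c2 := mul_le_mul b2 a2 (norm_nonneg _) (by positivity)
  refine (add_le_add (add_le_add c1 c2) le_rfl).trans (le_of_eq ?_)
  ring

/-- A finite difference with step s eliminates κ₂. What remains of κ₁ has size at least a multiple
of e^{-|Re μ| x} and is O(e^{-x}), with |Re μ| < 1. -/
lemma eq_zero_of_exp_bound {μ κ₁ κ₂ : ℂ} {K : ℝ} (h0 : μ ≠ 0) (h1 : |μ.re| < 1)
    (h : ∀ x : ℝ, 0 ≤ x → ‖κ₁ * Complex.exp (-μ * x) + κ₂ * Complex.exp (μ * x)‖ ≤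
      K * Real.exp (-x)) : κ₁ = 0 := by
  -- With this step |2μs| = 2 < 2π, so e^{2μs} ≠ 1 and the difference D below is nonzero.
  set s : ℝ := ‖μ‖⁻¹ with hs
  have hμ : 0 < ‖μ‖ := norm_pos_iff.2 h0
  have hs0 : 0 < s := inv_pos.2 hμ
  set D : ℂ := Complex.exp (-μ * s) - Complex.exp (μ * s) with hD
  have hD0 : D ≠ 0 := by
    intro h'
    have h2 : Complex.exp (2 * μ * s) = 1 := by
      have : Complex.exp (2 * μ * s) = Complex.exp (μ * s) / Complex.exp (-μ * s) := by
        rw [← Complex.exp_sub]; congr 1; ring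
      rw [this, ← sub_eq_zero.1 h', div_self (Complex.exp_ne_zero _)]
    obtain ⟨n, hn⟩ := Complex.exp_eq_one_iff.1 h2
    have h3 : ‖2 * μ * s‖ = 2 := by
      rw [norm_mul, norm_mul, Complex.norm_real, Real.norm_of_nonneg hs0.le, hs, mul_assoc,
        mul_inv_cancel₀ hμ.ne']
      simp
    rw [hn] at h3
    have h4 : |(n : ℝ)| * (2 * π) = 2 := by
      rw [norm_mul, norm_mul, norm_mul, Complex.norm_I, Complex.norm_intCast,
        Complex.norm_real, Real.norm_of_nonneg Real.pi_pos.le, mul_one, Complex.norm_ofNat] at h3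
      exact h3
    have h5 : |(n : ℝ)| < 1 := by nlinarith [Real.pi_gt_three, abs_nonneg (n : ℝ)]
    have h6 : |n| < 1 := by exact_mod_cast h5
    rw [Int.abs_lt_one_iff.1 h6] at h4
    simp at h4
  have key : ∀ x : ℝ, 0 ≤ x → ‖κ₁‖ * ‖D‖ ≤
      (K + ‖Complex.exp (μ * s)‖ * K) * Real.exp (-((1 - |μ.re|) * x)) := by
    intro x hx
    have e : κ₁ * Complex.exp (-μ * x) * D =
        (κ₁ * Complex.exp (-μ * (x + s : ℝ)) + κ₂ * Complex.exp (μ * (x + s : ℝ))) -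
        Complex.exp (μ * s) * (κ₁ * Complex.exp (-μ * x) + κ₂ * Complex.exp (μ * x)) := by
      have e1 : Complex.exp (-μ * (x + s : ℝ)) = Complex.exp (-μ * x) * Complex.exp (-μ * s) := by
        rw [← Complex.exp_add]; congr 1; push_cast; ring
      have e2 : Complex.exp (μ * (x + s : ℝ)) = Complex.exp (μ * x) * Complex.exp (μ * s) := by
        rw [← Complex.exp_add]; congr 1; push_cast; ring
      rw [e1, e2, hD]; ring
    have b1 := h (x + s) (by positivity)
    have b2 := h x hx
    have hK : 0 ≤ K := nonneg_of_mul_nonneg_left ((norm_nonneg _).trans b2) (Real.exp_pos _)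
    have b3 : ‖κ₁ * Complex.exp (-μ * x) * D‖ ≤
        (K + ‖Complex.exp (μ * s)‖ * K) * Real.exp (-x) := by
      rw [e]
      refine (norm_sub_le _ _).trans ?_
      rw [norm_mul, add_mul, mul_assoc ‖Complex.exp (μ * s)‖]
      refine add_le_add (b1.trans ?_) (mul_le_mul_of_nonneg_left b2 (norm_nonneg _))
      refine mul_le_mul_of_nonneg_left (Real.exp_le_exp.2 (by linarith)) hK
    have b4 : Real.exp (-(|μ.re| * x)) ≤ ‖Complex.exp (-μ * x)‖ := by
      rw [Complex.norm_exp]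
      refine Real.exp_le_exp.2 ?_
      have : (-μ * x).re = -(μ.re * x) := by simp
      rw [this]
      nlinarith [le_abs_self μ.re]
    rw [norm_mul, norm_mul] at b3
    have b5 : ‖κ₁‖ * Real.exp (-(|μ.re| * x)) * ‖D‖ ≤
        (K + ‖Complex.exp (μ * s)‖ * K) * Real.exp (-x) :=
      (by gcongr : _ ≤ ‖κ₁‖ * ‖Complex.exp (-μ * x)‖ * ‖D‖).trans b3
    have e3 : Real.exp (-x) = Real.exp (-(|μ.re| * x)) * Real.exp (-((1 - |μ.re|) * x)) := by
      rw [← Real.exp_add]; congr 1; ring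
    rw [e3] at b5
    refine le_of_mul_le_mul_left ?_ (Real.exp_pos (-(|μ.re| * x)))
    linarith
  have hlim : Tendsto (fun x : ℝ => (K + ‖Complex.exp (μ * s)‖ * K) *
      Real.exp (-((1 - |μ.re|) * x))) atTop (𝓝 0) := by
    have := (Real.tendsto_exp_neg_atTop_nhds_zero.comp
      (tendsto_id.const_mul_atTop (sub_pos.2 h1))).const_mul (K + ‖Complex.exp (μ * s)‖ * K)
    simpa [Function.comp_def] using this
  have hle := ge_of_tendsto hlim (by
    filter_upwards [eventually_ge_atTop 0] with x hx using key x hx)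
  have hD1 : 0 < ‖D‖ := norm_pos_iff.2 hD0
  have : ‖κ₁‖ ≤ 0 := by
    by_contra h'
    push Not at h'
    nlinarith [mul_pos h' hD1]
  exact norm_le_zero_iff.1 this

/-- The radial weight in the Fourier transform of `gaussMon b (2n+2) 2`. -/
def lagWeight (n : ℕ) (y t : ℝ) : ℝ :=
  (Real.exp (2 * t + y) ^ 2 - 2 * (2 * n + 2) * Real.exp (2 * t + y) + (2 * n + 2) * (2 * n + 1)) *
    Real.exp (-Real.exp (2 * t + y))

lemma exp_mul_lagWeight (n : ℕ) (y t a : ℝ) : Real.exp (2 * a * t) * lagWeight n y t =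
    Real.exp (2 * y) * (Real.exp (2 * (a + 2) * t) * Real.exp (-Real.exp (2 * t + y))) -
    2 * (2 * n + 2) * Real.exp y *
      (Real.exp (2 * (a + 1) * t) * Real.exp (-Real.exp (2 * t + y))) +
    (2 * n + 2) * (2 * n + 1) * (Real.exp (2 * a * t) * Real.exp (-Real.exp (2 * t + y))) := by
  have e1 : Real.exp (2 * (a + 2) * t) * Real.exp (2 * y) =
      Real.exp (2 * a * t) * Real.exp (2 * t + y) ^ 2 := by
    rw [← Real.exp_nat_mul, ← Real.exp_add, ← Real.exp_add]; congr 1; push_cast; ring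
  have e2 : Real.exp (2 * (a + 1) * t) * Real.exp y =
      Real.exp (2 * a * t) * Real.exp (2 * t + y) := by
    rw [← Real.exp_add, ← Real.exp_add]; congr 1; ring
  unfold lagWeight
  linear_combination -Real.exp (-Real.exp (2 * t + y)) * e1 +
    2 * (2 * n + 2) * Real.exp (-Real.exp (2 * t + y)) * e2

lemma integrable_exp_mul_lagWeight {a : ℝ} (ha : 0 < a) (n : ℕ) (y : ℝ) :
    Integrable fun t => Real.exp (2 * a * t) * lagWeight n y t := by
  simp only [exp_mul_lagWeight]
  exact (((integrable_gauss_exp (by linarith) y).const_mul _).sub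
    ((integrable_gauss_exp (by linarith) y).const_mul _)).add
    ((integrable_gauss_exp ha y).const_mul _)

lemma integral_gauss_exp_real {a : ℝ} (ha : 0 < a) (y : ℝ) :
    ∫ t : ℝ, Real.exp (2 * a * t) * Real.exp (-Real.exp (2 * t + y)) =
      2⁻¹ * Real.exp (-a * y) * Real.Gamma a := by
  have h := integral_gauss_exp (a := (a : ℂ)) (by simpa using ha) y
  have e : ∀ t : ℝ, Complex.exp (2 * a * t) * Real.exp (-Real.exp (2 * t + y)) =
      ((Real.exp (2 * a * t) * Real.exp (-Real.exp (2 * t + y)) : ℝ) : ℂ) := fun t => by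
    push_cast; rfl
  simp only [e] at h
  rw [integral_complex_ofReal, Complex.Gamma_ofReal] at h
  apply Complex.ofReal_injective
  rw [h]; push_cast; rfl

/-- The shift y is a translation of t, so it only scales the integral by e^{-ay}; the polynomial is
bounded by taking all its coefficients positive. -/
lemma exists_integral_abs_lagWeight_le {a : ℝ} (ha : 0 < a) (n : ℕ) : ∃ K : ℝ, ∀ y : ℝ,
    ∫ t : ℝ, Real.exp (2 * a * t) * |lagWeight n y t| ≤ K * Real.exp (-a * y) := by
  refine ⟨2⁻¹ * Real.Gamma (a + 2) + 2 * (2 * n + 2) * (2⁻¹ * Real.Gamma (a + 1)) +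
    (2 * n + 2) * (2 * n + 1) * (2⁻¹ * Real.Gamma a), fun y => ?_⟩
  have i1 := (integrable_gauss_exp (a := a + 2) (by linarith) y).const_mul (Real.exp (2 * y))
  have i2 := (integrable_gauss_exp (a := a + 1) (by linarith) y).const_mul
    (2 * (2 * n + 2) * Real.exp y)
  have i3 := (integrable_gauss_exp ha y).const_mul ((2 * n + 2) * (2 * n + 1) : ℝ)
  have hb : ∀ t : ℝ, Real.exp (2 * a * t) * |lagWeight n y t| ≤
      Real.exp (2 * y) * (Real.exp (2 * (a + 2) * t) * Real.exp (-Real.exp (2 * t + y))) +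
      2 * (2 * n + 2) * Real.exp y *
        (Real.exp (2 * (a + 1) * t) * Real.exp (-Real.exp (2 * t + y))) +
      (2 * n + 2) * (2 * n + 1) * (Real.exp (2 * a * t) * Real.exp (-Real.exp (2 * t + y))) := by
    intro t
    rw [← abs_of_pos (Real.exp_pos (2 * a * t)), ← abs_mul, exp_mul_lagWeight]
    refine abs_le.2 ⟨?_, ?_⟩
    all_goals
      have p1 : 0 ≤ Real.exp (2 * y) *
        (Real.exp (2 * (a + 2) * t) * Real.exp (-Real.exp (2 * t + y))) := by positivity
      have p2 : 0 ≤ 2 * (2 * n + 2) * Real.exp y *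
        (Real.exp (2 * (a + 1) * t) * Real.exp (-Real.exp (2 * t + y))) := by positivity
      have p3 : 0 ≤ (2 * n + 2) * (2 * n + 1) *
        (Real.exp (2 * a * t) * Real.exp (-Real.exp (2 * t + y))) := by positivity
      rw [abs_of_pos (Real.exp_pos (2 * a * t))]
      linarith
  have hm : ∫ t : ℝ, Real.exp (2 * a * t) * |lagWeight n y t| ≤ _ :=
    integral_mono_of_nonneg (Eventually.of_forall fun t => by positivity)
    ((i1.add i2).add i3) (Eventually.of_forall hb)
  refine hm.trans (le_of_eq ?_)
  refine ((integral_add (i1.add i2) i3).trans (congrArg (· + _) (integral_add i1 i2))).trans ?_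
  rw [integral_const_mul, integral_const_mul,
    integral_const_mul, integral_gauss_exp_real (by linarith), integral_gauss_exp_real (by linarith),
    integral_gauss_exp_real ha]
  have e1 : Real.exp (2 * y) * Real.exp (-(a + 2) * y) = Real.exp (-a * y) := by
    rw [← Real.exp_add]; congr 1; ring
  have e2 : Real.exp y * Real.exp (-(a + 1) * y) = Real.exp (-a * y) := by
    rw [← Real.exp_add]; congr 1; ring
  linear_combination 2⁻¹ * Real.Gamma (a + 2) * e1 + (2 * n + 2) * Real.Gamma (a + 1) * e2

/-- The three powers give Γ(a+2), Γ(a+1) and Γ(a), and a(a+1) - 2(2n+2)a + (2n+2)(2n+1) factors as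
(a - (2n+1))(a - (2n+2)). -/
lemma integral_lagWeight {a : ℂ} (ha : 0 < a.re) (n : ℕ) (y : ℝ) :
    ∫ t : ℝ, Complex.exp (2 * a * t) * lagWeight n y t =
      2⁻¹ * Complex.exp (-a * y) * Complex.Gamma a * ((a - (2 * n + 1)) * (a - (2 * n + 2))) := by
  have hi : ∀ {c : ℂ}, 0 < c.re → Integrable fun t : ℝ =>
      Complex.exp (2 * c * t) * Real.exp (-Real.exp (2 * t + y)) := by
    intro c hc
    refine (integrable_gauss_exp hc y).mono' (by fun_prop) (Eventually.of_forall fun t => ?_)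
    rw [norm_mul, Complex.norm_exp, Complex.norm_real, Real.norm_of_nonneg (Real.exp_pos _).le]
    simp
  have h1 : 0 < (a + 1).re := by simp; linarith
  have h2 : 0 < (a + 2).re := by simp; linarith
  have i1 := (hi h2).const_mul (Complex.exp (2 * y))
  have i2 := (hi h1).const_mul (2 * (2 * n + 2) * Complex.exp y)
  have i3 := (hi ha).const_mul ((2 * n + 2) * (2 * n + 1))
  have e : ∀ t : ℝ, Complex.exp (2 * a * t) * lagWeight n y t =
      Complex.exp (2 * y) * (Complex.exp (2 * (a + 2) * t) * Real.exp (-Real.exp (2 * t + y))) -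
      2 * (2 * n + 2) * Complex.exp y *
        (Complex.exp (2 * (a + 1) * t) * Real.exp (-Real.exp (2 * t + y))) +
      (2 * n + 2) * (2 * n + 1) *
        (Complex.exp (2 * a * t) * Real.exp (-Real.exp (2 * t + y))) := by
    intro t
    have e1 : Complex.exp (2 * (a + 2) * t) * Complex.exp (2 * y) =
        Complex.exp (2 * a * t) * Complex.exp (2 * t + y) ^ 2 := by
      rw [← Complex.exp_nat_mul, ← Complex.exp_add, ← Complex.exp_add]; congr 1; push_cast; ring
    have e2 : Complex.exp (2 * (a + 1) * t) * Complex.exp y =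
        Complex.exp (2 * a * t) * Complex.exp (2 * t + y) := by
      rw [← Complex.exp_add, ← Complex.exp_add]; congr 1; ring
    unfold lagWeight
    push_cast
    linear_combination -Complex.exp (-Complex.exp (2 * t + y)) * e1 +
      2 * (2 * n + 2) * Complex.exp (-Complex.exp (2 * t + y)) * e2
  simp only [e]
  refine ((integral_add (i1.sub i2) i3).trans (congrArg (· + _) (integral_sub i1 i2))).trans ?_
  rw [integral_const_mul, integral_const_mul,
    integral_const_mul, integral_gauss_exp h2, integral_gauss_exp h1, integral_gauss_exp ha]
  have ha0 : a ≠ 0 := fun h => by rw [h] at ha; simp at ha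
  have ha1 : a + 1 ≠ 0 := fun h => by rw [h] at h1; simp at h1
  rw [show a + 2 = a + 1 + 1 by ring, Complex.Gamma_add_one _ ha1, Complex.Gamma_add_one _ ha0]
  have e1 : Complex.exp (2 * y) * Complex.exp (-(a + 1 + 1) * y) = Complex.exp (-a * y) := by
    rw [← Complex.exp_add]; congr 1; ring
  have e2 : Complex.exp y * Complex.exp (-(a + 1) * y) = Complex.exp (-a * y) := by
    rw [← Complex.exp_add]; congr 1; ring
  linear_combination 2⁻¹ * Complex.Gamma a * a * (a + 1) * e1 -
    (2 * n + 2) * a * Complex.Gamma a * e2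

/-! ### Testing against Gaussians -/

/-- 1/|u - a| is locally integrable in the plane, and partial fractions separate the two
singularities u = ±2. This is the majorant for the pairing with `impInt`. -/
lemma integrable_gauss_div {b : ℝ} (hb : 0 < b) (N : ℕ) : Integrable fun u : ℂ =>
    (1 + ‖u‖) ^ 2 * ‖u‖ ^ N * Real.exp (-b * ‖u‖ ^ 2) / ‖u ^ 2 - 4‖ := by
  have hg : Integrable fun u : ℂ => (1 + ‖u‖) ^ 2 * ‖u‖ ^ N * Real.exp (-b * ‖u‖ ^ 2) := by
    have h := ((integrable_norm_pow_mul_gauss hb N).add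
      ((integrable_norm_pow_mul_gauss hb (N + 1)).const_mul 2)).add
      (integrable_norm_pow_mul_gauss hb (N + 2))
    refine h.congr (Eventually.of_forall fun u => ?_)
    simp only [Pi.add_apply]
    ring
  have hs : Integrable fun u : ℂ => ‖u‖ ^ (-1 : ℝ) * Real.exp (-b * ‖u‖ ^ 2) :=
    integrable_norm_rpow_mul_gauss hb (by norm_num)
  -- Within distance 1 of ±2 one has |u| ≤ 3, so the numerator is at most 16 · 3^N; the factor e^b
  -- undoes the Gaussian centred at ±2, which is at least e^{-b} there.
  set M : ℝ := 16 * 3 ^ N * Real.exp b with hM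
  have key : ∀ u a : ℂ, ‖a‖ = 2 → (1 + ‖u‖) ^ 2 * ‖u‖ ^ N * Real.exp (-b * ‖u‖ ^ 2) / ‖u - a‖ ≤
      (1 + ‖u‖) ^ 2 * ‖u‖ ^ N * Real.exp (-b * ‖u‖ ^ 2) +
      M * (‖u - a‖ ^ (-1 : ℝ) * Real.exp (-b * ‖u - a‖ ^ 2)) := by
    intro u a ha
    rw [Real.rpow_neg_one]
    rcases le_or_gt 1 ‖u - a‖ with h | h
    · have h1 : (1 + ‖u‖) ^ 2 * ‖u‖ ^ N * Real.exp (-b * ‖u‖ ^ 2) / ‖u - a‖ ≤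
          (1 + ‖u‖) ^ 2 * ‖u‖ ^ N * Real.exp (-b * ‖u‖ ^ 2) := div_le_self (by positivity) h
      have h2 : 0 ≤ M * (‖u - a‖⁻¹ * Real.exp (-b * ‖u - a‖ ^ 2)) := by positivity
      linarith
    · have hu : ‖u‖ ≤ 3 := by
        have := norm_le_norm_add_norm_sub' u a
        linarith
      have h1 : (1 + ‖u‖) ^ 2 * ‖u‖ ^ N * Real.exp (-b * ‖u‖ ^ 2) ≤ 16 * 3 ^ N := by
        have e1 : Real.exp (-b * ‖u‖ ^ 2) ≤ 1 := by
          rw [Real.exp_le_one_iff]; nlinarith [sq_nonneg ‖u‖]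
        have e2 : (1 + ‖u‖) ^ 2 ≤ 16 := by nlinarith [norm_nonneg u]
        have e3 : ‖u‖ ^ N ≤ 3 ^ N := pow_le_pow_left₀ (norm_nonneg _) hu N
        calc (1 + ‖u‖) ^ 2 * ‖u‖ ^ N * Real.exp (-b * ‖u‖ ^ 2) ≤ 16 * 3 ^ N * 1 := by gcongr
          _ = _ := mul_one _
      have h2 : 16 * 3 ^ N ≤ M * Real.exp (-b * ‖u - a‖ ^ 2) := by
        rw [hM, mul_assoc, ← Real.exp_add]
        refine le_mul_of_one_le_right (by positivity) (Real.one_le_exp ?_)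
        have : ‖u - a‖ ^ 2 ≤ 1 := pow_le_one₀ (norm_nonneg _) h.le
        nlinarith
      have h3 : (1 + ‖u‖) ^ 2 * ‖u‖ ^ N * Real.exp (-b * ‖u‖ ^ 2) / ‖u - a‖ ≤
          M * Real.exp (-b * ‖u - a‖ ^ 2) / ‖u - a‖ :=
        div_le_div_of_nonneg_right (h1.trans h2) (norm_nonneg _)
      have h4 : 0 ≤ (1 + ‖u‖) ^ 2 * ‖u‖ ^ N * Real.exp (-b * ‖u‖ ^ 2) := by positivity
      have h5 : M * Real.exp (-b * ‖u - a‖ ^ 2) / ‖u - a‖ =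
        M * (‖u - a‖⁻¹ * Real.exp (-b * ‖u - a‖ ^ 2)) := by ring
      linarith
  refine ((hg.add ((hs.comp_sub_right 2).const_mul M)).add
    (hg.add ((hs.comp_sub_right (-2)).const_mul M))).mono' ?_ (Eventually.of_forall fun u => ?_)
  · exact Measurable.aestronglyMeasurable (by fun_prop)
  · rw [Real.norm_of_nonneg (by positivity)]
    refine le_trans ?_ (add_le_add (key u 2 (by simp)) (key u (-2) (by simp)))
    by_cases hu : u ^ 2 = 4
    · rw [hu, sub_self, norm_zero, div_zero]
      positivity
    have h1 : u - 2 ≠ 0 := fun h => hu (by rw [sub_eq_zero.1 h]; norm_num)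
    have h2 : u - -2 ≠ 0 := fun h => hu (by rw [sub_eq_zero.1 h]; norm_num)
    have h3 : ‖u ^ 2 - 4‖⁻¹ ≤ ‖u - 2‖⁻¹ + ‖u - -2‖⁻¹ := by
      have e : (u ^ 2 - 4)⁻¹ = ((u - 2)⁻¹ - (u - -2)⁻¹) * 4⁻¹ := by
        have : u ^ 2 - 4 = (u - 2) * (u - -2) := by ring
        rw [this]
        field_simp
        ring
      rw [← norm_inv, e, norm_mul, ← norm_inv, ← norm_inv]
      refine (mul_le_of_le_one_right (norm_nonneg _) (by norm_num)).trans (norm_sub_le _ _)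
    rw [div_eq_mul_inv, div_eq_mul_inv, div_eq_mul_inv, ← mul_add]
    exact mul_le_mul_of_nonneg_left h3 (by positivity)

lemma ae_sq_ne_four : ∀ᵐ u : ℂ, u ^ 2 ≠ 4 := by
  have h : {u : ℂ | ¬ u ^ 2 ≠ 4} ⊆ {2, -2} := by
    intro u hu
    have hu : u ^ 2 = 2 ^ 2 := by
      have := not_not.1 hu
      rw [this]; norm_num
    rcases sq_eq_sq_iff_eq_or_eq_neg.1 hu with h | h <;> simp [h]
  exact measure_mono_null h ((Set.toFinite _).measure_zero _)

/-- With b = e^{-x}, the quantity 4π²|z|²/b is exp(2 Re w + x + log 4π²): a change of b is a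
translation along the cylinder. -/
lemma gaussFT_exp (x : ℝ) (n : ℕ) (w : ℂ) : gaussFT (Real.exp (-x)) (2 * n + 2) 2 (Complex.exp w) =
    (π : ℂ) ^ (2 * n + 1) * (-4) ^ n * Complex.exp ((2 * n + 3) * x) *
      Complex.exp (2 * n * starRingEnd ℂ w) *
      lagWeight n (x + Real.log (4 * π ^ 2)) w.re := by
  have hX : (4 * π ^ 2 / (Real.exp (-x) : ℝ) * (Complex.exp w * starRingEnd ℂ (Complex.exp w)) : ℂ) =
      (Real.exp (2 * w.re + (x + Real.log (4 * π ^ 2))) : ℝ) := by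
    rw [Complex.mul_conj, Complex.normSq_eq_norm_sq, Complex.norm_exp, Real.exp_add, Real.exp_add,
      Real.exp_log (by positivity), Real.exp_neg, ← Real.exp_nat_mul]
    push_cast
    field_simp
  have hX' : (-(4 * π ^ 2 / (Real.exp (-x) : ℝ)) *
      (Complex.exp w * starRingEnd ℂ (Complex.exp w)) : ℂ) =
      (-Real.exp (2 * w.re + (x + Real.log (4 * π ^ 2))) : ℝ) := by
    rw [neg_mul, hX]; push_cast; rfl
  rw [gaussFT_two (Real.exp_pos _), hX, hX']
  have e1 : ((Real.exp (-x) : ℝ) : ℂ) ^ (2 * n + 3) = (Complex.exp ((2 * n + 3) * x))⁻¹ := by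
    rw [← Complex.exp_neg, Complex.ofReal_exp, ← Complex.exp_nat_mul]
    congr 1; push_cast; ring
  have e2 : starRingEnd ℂ (Complex.exp w) ^ (2 * n) = Complex.exp (2 * n * starRingEnd ℂ w) := by
    rw [← Complex.exp_conj, ← Complex.exp_nat_mul]; push_cast; rfl
  rw [e1, e2, div_inv_eq_mul]
  unfold lagWeight
  push_cast
  ring

lemma continuous_gaussFT {b : ℝ} (hb : 0 < b) (j k : ℕ) : Continuous (gaussFT b j k) :=
  continuous_iff_continuousAt.2 fun z => (hasWirt_gaussFT hb j k z).continuousAt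

lemma exists_bound_boldW_two {σ : ℝ} (hσ0 : 0 < σ) (hσ : σ < 1) {μ : ℂ} (hμ : |μ.re| ≤ σ) (d : ℤ) :
    ∃ C : ℝ, 0 ≤ C ∧ ∀ w : ℂ, ‖boldW μ d w‖ ≤ C * (Real.exp (-2 * σ * w.re) + 1) := by
  obtain ⟨C, hC, h⟩ := exists_bound_boldW hσ0 hσ ‖μ‖ d
  refine ⟨C, hC, fun w => ?_⟩
  rcases le_total 0 w.re with hw | hw
  · refine ((h μ hμ le_rfl w).1 hw).1.trans (mul_le_mul_of_nonneg_left ?_ hC)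
    have := Real.exp_le_one_iff.2 (neg_nonpos.2 hw)
    linarith [Real.exp_pos (-2 * σ * w.re)]
  · exact ((h μ hμ le_rfl w).2 hw).1.trans (mul_le_mul_of_nonneg_left (by linarith) hC)

/-- The transformed Gaussian supplies decay at |z| → ∞, and Re ρ > σ gives convergence at z → 0; the
pairing is absolutely convergent although the original integral need not be. -/
lemma integrableOn_waveTerm_mul_gaussFT {ρ μ : ℂ} (h0 : μ ≠ 0) (hμ : |μ.re| < ρ.re)
    (hρ : ρ.re < 1) (n : ℕ) (x : ℝ) :
    IntegrableOn (fun p => waveTerm ρ μ n 0 0 (cyl p) *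
      gaussFT (Real.exp (-x)) (2 * n + 2) 2 (Complex.exp (cyl p))) (Ioc 0 (2 * π) ×ˢ univ) := by
  obtain ⟨σ, h1, h2⟩ := exists_between hμ
  have hσ0 := (abs_nonneg _).trans_lt h1
  obtain ⟨C, hC, hb⟩ := exists_bound_boldW_two hσ0 (h2.trans hρ) h1.le n
  set k : ℝ := ‖(π : ℂ) ^ (2 * n + 1) * (-4) ^ n * Complex.exp ((2 * n + 3) * x)‖ with hk
  set y : ℝ := x + Real.log (4 * π ^ 2) with hy
  have hn : (0 : ℝ) ≤ n := n.cast_nonneg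
  have i1 := (integrable_exp_mul_lagWeight (a := ρ.re - σ + n) (by linarith) n y).norm
  have i2 := (integrable_exp_mul_lagWeight (a := ρ.re + n) (by linarith) n y).norm
  refine integrable_cyl_of_bound ?_ ((i1.add i2).const_mul (C * k)) fun p => ?_
  · refine Continuous.aestronglyMeasurable ?_
    have := (continuous_waveTerm h0 ρ n 0 0).comp continuous_cyl
    have := ((continuous_gaussFT (Real.exp_pos (-x)) (2 * n + 2) 2).comp Complex.continuous_exp).comp
      continuous_cyl
    fun_prop
  · unfold waveTerm
    have e1 : ‖Complex.exp (2 * n * starRingEnd ℂ (cyl p))‖ = Real.exp (2 * n * p.2) := by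
      rw [Complex.norm_exp]; simp
    rw [gaussFT_exp, norm_mul, norm_mul, norm_exp_wave, norm_mul, norm_mul, e1, Complex.norm_real,
      cyl_re, ← hk, ← hy]
    have hb' := hb (cyl p)
    rw [cyl_re] at hb'
    simp only [Pi.add_apply, norm_mul, Real.norm_of_nonneg (Real.exp_pos _).le]
    have e2 : Real.exp (2 * (ρ.re - σ + n) * p.2) = Real.exp (-2 * σ * p.2) *
        Real.exp ((2 * ρ.re + (0 : ℤ) + (0 : ℤ)) * p.2) * Real.exp (2 * n * p.2) := by
      rw [← Real.exp_add, ← Real.exp_add]; congr 1; push_cast; ring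
    have e3 : Real.exp (2 * (ρ.re + n) * p.2) =
        Real.exp ((2 * ρ.re + (0 : ℤ) + (0 : ℤ)) * p.2) * Real.exp (2 * n * p.2) := by
      rw [← Real.exp_add]; congr 1; push_cast; ring
    rw [e2, e3]
    have hk0 : 0 ≤ k := norm_nonneg _
    calc _ ≤ C * (Real.exp (-2 * σ * p.2) + 1) * Real.exp ((2 * ρ.re + (0 : ℤ) + (0 : ℤ)) * p.2) *
          (k * Real.exp (2 * n * p.2) * ‖lagWeight n y p.2‖) := by gcongr
      _ = _ := by ring

lemma integral_waveInt_mul_gaussMon {A : Set ℝ} {ρ μ : ℂ} {d : ℤ}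
    (hi : IntegrableOn (fun p => waveTerm ρ μ d 0 0 (cyl p)) (Ioc 0 (2 * π) ×ˢ A)) {b : ℝ}
    (hb : 0 < b) (j k : ℕ) :
    ∫ u, waveInt A ρ μ d 0 0 u * gaussMon b j k u =
      ∫ p in Ioc 0 (2 * π) ×ˢ A, waveTerm ρ μ d 0 0 (cyl p) *
        gaussFT b j k (Complex.exp (cyl p)) := by
  have hprod : Integrable (fun q : ℂ × (ℝ × ℝ) => gaussMon b j k q.1 *
      waveTerm ρ μ d 0 0 (cyl q.2) * planeWave (Complex.exp (cyl q.2)) q.1)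
      (volume.prod (volume.restrict (Ioc 0 (2 * π) ×ˢ A))) := by
    refine ((integrable_gaussMon hb j k).mul_prod hi).mul_bdd (c := 1) ?_
      (Eventually.of_forall fun q => (norm_planeWave _ _).le)
    refine Continuous.aestronglyMeasurable ?_
    exact continuous_planeWave.comp (f := fun q : ℂ × (ℝ × ℝ) => (Complex.exp (cyl q.2), q.1))
      (by have := continuous_cyl; fun_prop)
  have h := integral_integral_swap (f := fun u p => gaussMon b j k u *
    waveTerm ρ μ d 0 0 (cyl p) * planeWave (Complex.exp (cyl p)) u) hprod
  calc _ = ∫ u, ∫ p in Ioc 0 (2 * π) ×ˢ A, gaussMon b j k u *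
      waveTerm ρ μ d 0 0 (cyl p) * planeWave (Complex.exp (cyl p)) u := by
        congr 1; ext u
        unfold waveInt
        rw [← integral_mul_const]
        congr 1; ext p; ring
    _ = _ := h
    _ = _ := by
        congr 1; ext p
        unfold gaussFT
        rw [← integral_const_mul]
        congr 1; ext u
        rw [planeWave_comm u]; ring

/-- Pairing the integral with a Gaussian. -/
lemma integral_impInt_mul_gaussMon {ρ μ : ℂ} (h0 : μ ≠ 0) (hμ : |μ.re| < ρ.re) (hρ : ρ.re < 1)
    (n : ℕ) (x : ℝ) :
    Integrable (fun u => impInt ρ μ n u * gaussMon (Real.exp (-x)) (2 * n + 2) 2 u) ∧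
    ∫ u, impInt ρ μ n u * gaussMon (Real.exp (-x)) (2 * n + 2) 2 u =
      ∫ p in Ioc 0 (2 * π) ×ˢ univ, waveTerm ρ μ n 0 0 (cyl p) *
        gaussFT (Real.exp (-x)) (2 * n + 2) 2 (Complex.exp (cyl p)) := by
  obtain ⟨σ, h1, h2⟩ := exists_between hμ
  have hσ0 := (abs_nonneg _).trans_lt h1
  obtain ⟨C, hC, hb⟩ := exists_bound_mul_impInt hμ hρ n
  have hb0 := Real.exp_pos (-x)
  have hi : ∀ T, IntegrableOn (fun p => waveTerm ρ μ n 0 0 (cyl p)) (Ioc 0 (2 * π) ×ˢ Iic T) :=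
    fun T => integrableOn_waveTerm_Iic hσ0 (h2.trans hρ) h1.le n (by push_cast; linarith) T
  have hgi := (integrable_gauss_div hb0 (2 * n + 2 + 2)).const_mul C
  set g : ℂ → ℝ := fun u => C * ((1 + ‖u‖) ^ 2 * ‖u‖ ^ (2 * n + 2 + 2) *
    Real.exp (-Real.exp (-x) * ‖u‖ ^ 2) / ‖u ^ 2 - 4‖) with hg
  have hbound : ∀ {u V : ℂ}, u ^ 2 ≠ 4 → ‖(u ^ 2 - 4) * V‖ ≤ C * (1 + ‖u‖) ^ 2 →
      ‖V * gaussMon (Real.exp (-x)) (2 * n + 2) 2 u‖ ≤ g u := by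
    intro u V hu hV
    have hpos : 0 < ‖u ^ 2 - 4‖ := norm_pos_iff.2 (sub_ne_zero.2 hu)
    rw [norm_mul, norm_gaussMon, hg]
    rw [norm_mul, mul_comm, ← le_div_iff₀ hpos] at hV
    refine (mul_le_mul_of_nonneg_right hV (by positivity)).trans (le_of_eq ?_)
    ring
  have hm : ∀ m : ℕ, AEStronglyMeasurable (fun u => waveInt (Iic (m : ℝ)) ρ μ n 0 0 u *
      gaussMon (Real.exp (-x)) (2 * n + 2) 2 u) volume := by
    intro m
    refine AEStronglyMeasurable.mul (StronglyMeasurable.aestronglyMeasurable ?_)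
      (continuous_gaussMon _ _ _).aestronglyMeasurable
    unfold waveInt
    refine StronglyMeasurable.integral_prod_right' (f := fun q : ℂ × (ℝ × ℝ) =>
      waveTerm ρ μ n 0 0 (cyl q.2) * planeWave (Complex.exp (cyl q.2)) q.1) ?_
    refine Continuous.stronglyMeasurable (Continuous.mul ?_ ?_)
    · exact (continuous_waveTerm h0 ρ n 0 0).comp (by have := continuous_cyl; fun_prop)
    · exact continuous_planeWave.comp (f := fun q : ℂ × (ℝ × ℝ) => (Complex.exp (cyl q.2), q.1))
        (by have := continuous_cyl; fun_prop)
  have hlim : ∀ᵐ u : ℂ, Tendsto (fun m : ℕ => waveInt (Iic (m : ℝ)) ρ μ n 0 0 u *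
      gaussMon (Real.exp (-x)) (2 * n + 2) 2 u) atTop
      (𝓝 (impInt ρ μ n u * gaussMon (Real.exp (-x)) (2 * n + 2) 2 u)) := by
    filter_upwards [ae_sq_ne_four] with u hu
    exact ((tendsto_impInt hμ hρ n hu).comp tendsto_natCast_atTop_atTop).mul_const _
  refine ⟨hgi.mono' (aestronglyMeasurable_of_tendsto_ae atTop hm hlim) ?_, ?_⟩
  · filter_upwards [ae_sq_ne_four] with u hu using hbound hu (hb u 0 le_rfl).2
  -- Fubini holds for each truncation Re w ≤ m. On the u side m → ∞ is dominated by means of the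
  -- uniform tail bound, on the z side by absolute convergence.
  have t1 := tendsto_integral_of_dominated_convergence g hm hgi (fun m => by
    filter_upwards [ae_sq_ne_four] with u hu using hbound hu (hb u m m.cast_nonneg).1) hlim
  have hU : (⋃ m : ℕ, Ioc 0 (2 * π) ×ˢ Iic (m : ℝ)) = Ioc 0 (2 * π) ×ˢ univ := by
    ext p
    simp only [mem_iUnion, mem_prod, mem_Iic, mem_univ, and_true]
    constructor
    · rintro ⟨m, h, -⟩; exact h
    · intro h
      obtain ⟨m, hm⟩ := exists_nat_ge p.2
      exact ⟨m, h, hm⟩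
  have t2 := tendsto_setIntegral_of_monotone (μ := volume) (f := fun p => waveTerm ρ μ n 0 0 (cyl p) *
    gaussFT (Real.exp (-x)) (2 * n + 2) 2 (Complex.exp (cyl p)))
    (s := fun m : ℕ => Ioc 0 (2 * π) ×ˢ Iic (m : ℝ))
    (fun m => measurableSet_Ioc.prod measurableSet_Iic)
    (fun m m' h => Set.prod_mono le_rfl (Iic_subset_Iic.2 (by exact_mod_cast h)))
    (by rw [hU]; exact integrableOn_waveTerm_mul_gaussFT h0 hμ hρ n x)
  rw [hU] at t2
  refine tendsto_nhds_unique t1 (t2.congr fun m => ?_)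
  exact (integral_waveInt_mul_gaussMon (hi m) hb0 (2 * n + 2) 2).symm

/-! ### Asymptotics of the two sides of the pairing -/

lemma exists_twoTerm_bound {f g : ℂ → ℂ} (hf : AnalyticAt ℂ f 0) (hg : AnalyticAt ℂ g 0) {a a' : ℂ}
    (h : a.im = a'.im) (ε : ℤ) : ∃ α β : ℂ, ∃ C r : ℝ, 0 ≤ C ∧ 0 < r ∧ ∀ w : ℂ,
      Real.exp (ε * w.re) ≤ r →
      ‖Complex.exp (a * w + a' * starRingEnd ℂ w) * (f (Complex.exp (ε * w)) *
        g (Complex.exp (ε * starRingEnd ℂ w))) - twoTerm a a' (f 0 * g 0) α β ε w‖ ≤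
      C * Real.exp ((a.re + a'.re + 2 * ε) * w.re) := by
  obtain ⟨α, β, C, r, hC, hr, hb⟩ := exists_expansion hf hg
  refine ⟨α, β, C, r, hC, hr, fun w hw => ?_⟩
  have e1 : ‖Complex.exp (ε * w)‖ = Real.exp (ε * w.re) := by
    rw [Complex.norm_exp]; simp
  have e2 : starRingEnd ℂ (Complex.exp (ε * w)) = Complex.exp (ε * starRingEnd ℂ w) := by
    rw [← Complex.exp_conj]; simp
  have h1 := hb (Complex.exp (ε * w)) (by rw [e1]; exact hw)
  rw [e2, e1] at h1
  unfold twoTerm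
  rw [← mul_sub, norm_mul, norm_exp_pair h]
  refine (mul_le_mul_of_nonneg_left h1 (Real.exp_pos _).le).trans (le_of_eq ?_)
  rw [← Real.exp_nat_mul, mul_left_comm, ← Real.exp_add]
  congr 2; push_cast; ring

lemma analyticAt_F1 (ρ : ℂ) {ν : ℂ} (hν : ∀ n : ℕ, 1 + ν ≠ -n) :
    AnalyticAt ℂ (fun x => F1 ρ ν (4 * x)) 0 := by
  have h1 : AnalyticAt ℂ (fun x : ℂ => ₂F₁ ((ρ + ν) / 2) ((ρ + ν) / 2 + 1 / 2) (1 + ν) (4 * x)) 0 :=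
    AnalyticAt.fun_comp (g := (₂F₁ ((ρ + ν) / 2) ((ρ + ν) / 2 + 1 / 2) (1 + ν) : ℂ → ℂ))
      (f := fun x : ℂ => 4 * x) (analyticAt_gauss _ _ _ (by simp))
      (analyticAt_const.mul analyticAt_id)
  refine h1.congr ?_
  have hc : ∀ᶠ x : ℂ in 𝓝 0, ‖4 * x‖ < 1 :=
    (by fun_prop : Continuous fun x : ℂ => ‖4 * x‖).continuousAt.eventually_lt continuousAt_const
      (by simp)
  filter_upwards [hc] with x hx
  unfold F1
  rw [show (1 + ρ + ν) / 2 = (ρ + ν) / 2 + 1 / 2 by ring, hyp2F1_eq_gauss _ hν hx]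

lemma F1_zero (ρ : ℂ) {ν : ℂ} (hν : ∀ n : ℕ, 1 + ν ≠ -n) : F1 ρ ν (4 * 0) = 1 := by
  unfold F1
  rw [show (1 + ρ + ν) / 2 = (ρ + ν) / 2 + 1 / 2 by ring, hyp2F1_eq_gauss _ hν (by simp), mul_zero]
  exact ordinaryHypergeometric_zero _ _ _

lemma exp_mul_le_exp_mul {c c' T t : ℝ} (hc : c ≤ c') (ht : T ≤ t) :
    Real.exp (c * t) ≤ Real.exp ((c - c') * T) * Real.exp (c' * t) := by
  rw [← Real.exp_add]
  refine Real.exp_le_exp.2 ?_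
  nlinarith [mul_nonneg (sub_nonneg.2 hc) (sub_nonneg.2 ht)]

/-- The product of Gauss functions attached to `(μ, d)`. -/
def hypProd (ρ μ : ℂ) (d : ℤ) (v : ℂ) : ℂ :=
  hypTerm ρ (μ + d) v * hypTerm ρ (μ - d) (starRingEnd ℂ v)

/-- Expansion at u → ∞, with 4/u² as the small parameter, to first order in u^{-2} and ū^{-2}. The
first order terms are kept because they disappear after angular integration, and so the effective
error is O(|u|^{-4}). -/
lemma exists_hypProd_bound (ρ : ℂ) {μ : ℂ} (hμ : ∀ n : ℤ, μ ≠ n) (d : ℤ) (c c' : ℝ) :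
    ∃ α β : ℂ, ∃ C T : ℝ, 0 ≤ C ∧ 0 ≤ T ∧ ∀ v : ℂ, T ≤ v.re →
      4 * Complex.exp (-2 * v) ∈ cutPlane ∧
      ‖Complex.exp (c * v + c' * starRingEnd ℂ v) * hypProd ρ μ d v -
        twoTerm (c - (ρ + μ + d)) (c' - (ρ + μ - d)) 1 α β (-2) v‖ ≤
      C * Real.exp ((c + c' - 2 * ρ.re - 2 * μ.re - 4) * v.re) := by
  have n1 : ∀ n : ℕ, 1 + (μ + d) ≠ -n := fun n h =>
    hμ (-n - 1 - d) (by push_cast; linear_combination h)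
  have n2 : ∀ n : ℕ, 1 + (μ - d) ≠ -n := fun n h =>
    hμ (-n - 1 + d) (by push_cast; linear_combination h)
  obtain ⟨α, β, C, r, hC, hr, hb⟩ := exists_twoTerm_bound (analyticAt_F1 ρ n1) (analyticAt_F1 ρ n2)
    (a := c - (ρ + μ + d)) (a' := c' - (ρ + μ - d)) (by simp) (-2)
  rw [F1_zero ρ n1, F1_zero ρ n2, one_mul] at hb
  -- For Re v ≥ 1 one has e^{2 Re v} ≥ 1 + 2 + 2 > 4, hence |4e^{-2v}| < 1; the second entry puts
  -- e^{-2v} in the disc where the expansion holds.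
  refine ⟨α, β, C, max 1 (-(Real.log r) / 2), hC, zero_le_one.trans (le_max_left _ _),
    fun v hv => ?_⟩
  have hv1 := (le_max_left _ _).trans hv
  have hv2 := (le_max_right _ _).trans hv
  constructor
  · refine mem_cutPlane_of_norm_lt ?_
    rw [norm_mul, Complex.norm_exp]
    have e1 : (-2 * v).re = -(2 * v.re) := by simp
    have e2 : 1 + 2 * v.re + (2 * v.re) ^ 2 / 2 ≤ Real.exp (2 * v.re) :=
      Real.quadratic_le_exp_of_nonneg (by linarith)
    have e3 : (4 : ℝ) < Real.exp (2 * v.re) := by nlinarith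
    rw [e1, Real.exp_neg, Complex.norm_ofNat, ← div_eq_mul_inv, div_lt_one (Real.exp_pos _)]
    exact e3
  · have h := hb v (by
      rw [← Real.log_le_log_iff (Real.exp_pos _) hr, Real.log_exp]
      push_cast
      linarith)
    have e1 : Complex.exp (c * v + c' * starRingEnd ℂ v) * hypProd ρ μ d v =
        Complex.exp ((c - (ρ + μ + d)) * v + (c' - (ρ + μ - d)) * starRingEnd ℂ v) *
        (F1 ρ (μ + d) (4 * Complex.exp ((-2 : ℤ) * v)) *
          F1 ρ (μ - d) (4 * Complex.exp ((-2 : ℤ) * starRingEnd ℂ v))) := by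
      unfold hypProd hypTerm
      have : Complex.exp ((c - (ρ + μ + d)) * v + (c' - (ρ + μ - d)) * starRingEnd ℂ v) =
          Complex.exp (c * v + c' * starRingEnd ℂ v) * Complex.exp (-((ρ + (μ + d)) * v)) *
          Complex.exp (-((ρ + (μ - d)) * starRingEnd ℂ v)) := by
        rw [← Complex.exp_add, ← Complex.exp_add]; congr 1; ring
      rw [this]
      push_cast
      ring
    rw [e1]
    refine h.trans (le_of_eq ?_)
    congr 3
    simp
    ring

lemma exp_mul_gaussMon (x : ℝ) (n : ℕ) (w : ℂ) (V : ℂ) :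
    Real.exp (2 * w.re) • (V * gaussMon (Real.exp (-x)) (2 * n + 2) 2 (Complex.exp w)) =
      Complex.exp ((2 * n + 3 : ℝ) * w + (3 : ℝ) * starRingEnd ℂ w) * V *
        (Real.exp (-Real.exp (2 * w.re + -x)) : ℝ) := by
  unfold gaussMon
  have e1 : -Real.exp (-x) * ‖Complex.exp w‖ ^ 2 = -Real.exp (2 * w.re + -x) := by
    rw [Complex.norm_exp, ← Real.exp_nat_mul, Real.exp_add]; push_cast; ring
  have e2 : ((Real.exp (2 * w.re) : ℝ) : ℂ) * (Complex.exp w ^ (2 * n + 2) *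
      starRingEnd ℂ (Complex.exp w) ^ 2) =
      Complex.exp ((2 * n + 3 : ℝ) * w + (3 : ℝ) * starRingEnd ℂ w) := by
    rw [← Complex.exp_conj, ← Complex.exp_nat_mul, ← Complex.exp_nat_mul, Complex.ofReal_exp,
      ← Complex.exp_add, ← Complex.exp_add]
    congr 1
    have := Complex.add_conj w
    push_cast at this ⊢
    linear_combination -this
  rw [e1, ← e2, Complex.real_smul]
  ring

/-- As b = e^{-x} → 0 the wide Gaussian sees `impInt` at infinity. The monomial u^{2n+2} ū² has the
angular frequency opposite to the first product, whose leading term gives Γ(n+3-ρ-μ); the second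
product contributes to leading order only if n = 0. The extra factor |u|⁴ makes the expansion terms,
though valid only near infinity, integrable also at u = 0. -/
lemma exists_asymptotics_left {ρ μ : ℂ} (h0 : μ ≠ 0) (hμ : |μ.re| < ρ.re) (hρ : ρ.re < 1) (n : ℕ)
    {c₁ c₂ : ℂ} (hc : ∀ v : ℂ, 4 * Complex.exp (-2 * v) ∈ cutPlane → impInt ρ μ n (Complex.exp v) =
      c₁ * hypProd ρ μ n v + c₂ * hypProd ρ (-μ) (-n) v) :
    ∃ κ K : ℂ, ∃ K' : ℝ, K = c₁ * (π * Complex.Gamma (n + 3 - ρ - μ)) ∧ ∀ x : ℝ, 0 ≤ x →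
      ‖Complex.exp (-((n + 3 - ρ) * x)) *
        (∫ u, impInt ρ μ n u * gaussMon (Real.exp (-x)) (2 * n + 2) 2 u) -
        (K * Complex.exp (-μ * x) + κ * Complex.exp (μ * x))‖ ≤ K' * Real.exp (-x) := by
  have hμ1 := hμ.trans hρ
  have hμ2 := abs_lt.1 hμ1
  have hint := ne_intCast_of_abs_re_lt_one h0 hμ1
  have hint' : ∀ m : ℤ, -μ ≠ m := fun m h => hint (-m) (by push_cast; rw [← h, neg_neg])
  obtain ⟨α₁, β₁, C₁, T₁, hC₁, hT₁, hb₁⟩ := exists_hypProd_bound ρ hint n (2 * n + 3) 3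
  obtain ⟨α₂, β₂, C₂, T₂, hC₂, hT₂, hb₂⟩ := exists_hypProd_bound ρ hint' (-n) (2 * n + 3) 3
  set T := max T₁ T₂ with hT
  have hT0 : 0 ≤ T := hT₁.trans (le_max_left _ _)
  set W : ℝ → ℝ → ℝ := fun x t => Real.exp (-Real.exp (2 * t + -x)) with hW
  set a₁ : ℂ := ((2 * n + 3 : ℝ) : ℂ) - (ρ + μ + (n : ℤ)) with ha₁
  set a₁' : ℂ := ((3 : ℝ) : ℂ) - (ρ + μ - (n : ℤ)) with ha₁'
  set a₂ : ℂ := ((2 * n + 3 : ℝ) : ℂ) - (ρ + -μ + (-n : ℤ)) with ha₂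
  set a₂' : ℂ := ((3 : ℝ) : ℂ) - (ρ + -μ - (-n : ℤ)) with ha₂'
  have hn0 : (0 : ℝ) ≤ n := n.cast_nonneg
  have r1 : a₁.re + a₁'.re = 2 * (n + 3 - ρ.re - μ.re) := by simp [ha₁, ha₁']; ring
  have r2 : a₂.re + a₂'.re = 2 * (n + 3 - ρ.re + μ.re) := by simp [ha₂, ha₂']; ring
  have iW : ∀ x : ℝ, ∀ {s : ℝ}, 0 < s → Integrable fun t => Real.exp (s * t) * W x t := by
    intro x s hs
    have := integrable_gauss_exp (a := s / 2) (by linarith) (-x)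
    simpa only [mul_div_cancel₀ s (two_ne_zero' ℝ)] using this
  have m1 := fun x : ℝ => integral_cyl_twoTerm (a := a₁) (a' := a₁') (n := 0)
    (by simp [ha₁, ha₁']; ring) 1 α₁ β₁ (ε := -2) (Or.inr rfl)
    (iW x (by rw [r1]; linarith)) (iW x (by rw [r1]; push_cast; linarith))
  have m2 := fun x : ℝ => integral_cyl_twoTerm (a := a₂) (a' := a₂') (n := n)
    (by simp [ha₂, ha₂']; ring) 1 α₂ β₂ (ε := -2) (Or.inr rfl)
    (iW x (by rw [r2]; linarith)) (iW x (by rw [r2]; push_cast; linarith))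
  set M₁ : ℂ → ℂ := twoTerm a₁ a₁' 1 α₁ β₁ (-2) with hM₁
  set M₂ : ℂ → ℂ := twoTerm a₂ a₂' 1 α₂ β₂ (-2) with hM₂
  set G : ℂ → ℂ := fun v => Complex.exp ((2 * n + 3 : ℝ) * v + (3 : ℝ) * starRingEnd ℂ v) *
    impInt ρ μ n (Complex.exp v) with hG
  set R : ℂ → ℂ := fun v => G v - (c₁ * M₁ v + c₂ * M₂ v) with hR
  have iG : ∀ x, IntegrableOn (fun p => G (cyl p) * (W x p.2 : ℂ)) (Ioc 0 (2 * π) ×ˢ univ) := by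
    intro x
    have := (integrable_iff_cyl _).1 (integral_impInt_mul_gaussMon h0 hμ hρ n x).1
    refine this.congr_fun (fun p _ => ?_) (measurableSet_Ioc.prod MeasurableSet.univ)
    have := exp_mul_gaussMon x n (cyl p) (impInt ρ μ n (Complex.exp (cyl p)))
    rw [cyl_re] at this
    exact this
  have iR : ∀ x, IntegrableOn (fun p => R (cyl p) * (W x p.2 : ℂ)) (Ioc 0 (2 * π) ×ˢ univ) := by
    intro x
    have := (iG x).sub (((m1 x).1.const_mul c₁).add ((m2 x).1.const_mul c₂))
    refine Integrable.congr this (Eventually.of_forall fun p => ?_)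
    simp only [Pi.sub_apply, Pi.add_apply, hR]
    ring
  have hL : ∀ x, ∫ u, impInt ρ μ n u * gaussMon (Real.exp (-x)) (2 * n + 2) 2 u =
      c₁ * (∫ p in Ioc 0 (2 * π) ×ˢ univ, M₁ (cyl p) * (W x p.2 : ℂ)) +
      c₂ * (∫ p in Ioc 0 (2 * π) ×ˢ univ, M₂ (cyl p) * (W x p.2 : ℂ)) +
      ∫ p in Ioc 0 (2 * π) ×ˢ univ, R (cyl p) * (W x p.2 : ℂ) := by
    intro x
    rw [integral_eq_cyl, ← integral_const_mul, ← integral_const_mul,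
      ← integral_add ((m1 x).1.const_mul c₁) ((m2 x).1.const_mul c₂)]
    refine Eq.trans ?_ (integral_add (((m1 x).1.const_mul c₁).add ((m2 x).1.const_mul c₂)) (iR x))
    congr 1; ext p
    have := exp_mul_gaussMon x n (cyl p) (impInt ρ μ n (Complex.exp (cyl p)))
    rw [cyl_re] at this
    simp only [hR]
    refine this.trans ?_
    simp only [hG, hW]
    ring
  have hRb : ∀ v : ℂ, T ≤ v.re → ‖R v‖ ≤ (‖c₁‖ * C₁ + ‖c₂‖ * C₂) *
      Real.exp (2 * (n + 2 - ρ.re) * v.re) := by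
    intro v hv
    have hv0 : 0 ≤ v.re := hT0.trans hv
    obtain ⟨hcut, b1⟩ := hb₁ v ((le_max_left _ _).trans hv)
    obtain ⟨-, b2⟩ := hb₂ v ((le_max_right _ _).trans hv)
    have e : R v = c₁ * (Complex.exp ((2 * n + 3 : ℝ) * v + (3 : ℝ) * starRingEnd ℂ v) *
        hypProd ρ μ n v - M₁ v) + c₂ * (Complex.exp ((2 * n + 3 : ℝ) * v +
        (3 : ℝ) * starRingEnd ℂ v) * hypProd ρ (-μ) (-n) v - M₂ v) := by
      simp only [hR, hG]
      rw [hc v hcut]; ring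
    rw [e]
    refine (norm_add_le _ _).trans ?_
    rw [norm_mul, norm_mul, add_mul, mul_assoc ‖c₁‖, mul_assoc ‖c₂‖]
    refine add_le_add (mul_le_mul_of_nonneg_left (b1.trans ?_) (norm_nonneg _))
      (mul_le_mul_of_nonneg_left (b2.trans ?_) (norm_nonneg _))
    · refine mul_le_mul_of_nonneg_left (Real.exp_le_exp.2 ?_) hC₁
      refine mul_le_mul_of_nonneg_right ?_ hv0
      linarith
    · refine mul_le_mul_of_nonneg_left (Real.exp_le_exp.2 ?_) hC₂
      refine mul_le_mul_of_nonneg_right ?_ hv0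
      simp only [Complex.neg_re]
      linarith
  -- Below T the weight at x = 0 is bounded away from 0, so it can be divided out. The bounded part
  -- then contributes a constant independent of x.
  have iR0 : IntegrableOn (fun p => R (cyl p)) (Ioc 0 (2 * π) ×ˢ Iic T) := by
    have h1 := (iR 0).mono_set (Set.prod_mono (le_refl (Ioc 0 (2 * π))) (subset_univ (Iic T)))
    have h2 : IntegrableOn (fun p => R (cyl p) * (W 0 p.2 : ℂ) *
        (Real.exp (Real.exp (2 * p.2)) : ℝ)) (Ioc 0 (2 * π) ×ˢ Iic T) := by
      refine Integrable.mul_bdd (c := Real.exp (Real.exp (2 * T))) h1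
        (Continuous.aestronglyMeasurable (by fun_prop)) ?_
      refine ae_restrict_of_forall_mem (measurableSet_Ioc.prod measurableSet_Iic) fun p hp => ?_
      have hp2 : p.2 ≤ T := hp.2
      rw [Complex.norm_real, Real.norm_of_nonneg (Real.exp_pos _).le]
      gcongr
    refine h2.congr_fun (fun p _ => ?_) (measurableSet_Ioc.prod measurableSet_Iic)
    simp only [hW]
    rw [mul_assoc, ← Complex.ofReal_mul, ← Real.exp_add]
    simp
  set K₀ : ℝ := ∫ p in Ioc 0 (2 * π) ×ˢ Iic T, ‖R (cyl p)‖ with hK₀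
  have hK₀0 : 0 ≤ K₀ := integral_nonneg fun p => norm_nonneg _
  set K₁ : ℝ := 2 * π * ((‖c₁‖ * C₁ + ‖c₂‖ * C₂) * (2⁻¹ * Real.Gamma (n + 2 - ρ.re))) with hK₁
  have ha0 : 0 < (n : ℝ) + 2 - ρ.re := by linarith
  have hRI : ∀ x : ℝ, ‖∫ p in Ioc 0 (2 * π) ×ˢ univ, R (cyl p) * (W x p.2 : ℂ)‖ ≤
      K₀ + K₁ * Real.exp ((n + 2 - ρ.re) * x) := by
    intro x
    have hsplit : Ioc 0 (2 * π) ×ˢ (univ : Set ℝ) =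
        Ioc 0 (2 * π) ×ˢ Iic T ∪ Ioc 0 (2 * π) ×ˢ Ioi T := by
      rw [← Set.prod_union, Iic_union_Ioi]
    have hdisj : Disjoint (Ioc 0 (2 * π) ×ˢ Iic T) (Ioc 0 (2 * π) ×ˢ Ioi T) :=
      Set.Disjoint.set_prod_right (Set.Iic_disjoint_Ioi le_rfl) _ _
    have hi := iR x
    rw [hsplit] at hi
    rw [hsplit, setIntegral_union hdisj (measurableSet_Ioc.prod measurableSet_Ioi)
      hi.left_of_union hi.right_of_union]
    refine (norm_add_le _ _).trans (add_le_add ?_ ?_)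
    · refine norm_integral_le_of_norm_le iR0.norm (Eventually.of_forall fun p => ?_)
      rw [norm_mul, Complex.norm_real, Real.norm_of_nonneg (Real.exp_pos _).le]
      refine mul_le_of_le_one_right (norm_nonneg _) (Real.exp_le_one_iff.2 ?_)
      exact neg_nonpos.2 (Real.exp_pos _).le
    · have hg := (integrable_gauss_exp ha0 (-x)).const_mul (‖c₁‖ * C₁ + ‖c₂‖ * C₂)
      have hn := norm_integral_cyl_le (G := fun p => R (cyl p) * (W x p.2 : ℂ)) measurableSet_Ioi
        (hg.integrableOn (s := Ioi T)) (fun p hp => by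
          have hp : T < p.2 := hp
          have h1 := hRb (cyl p) (by rw [cyl_re]; exact hp.le)
          rw [cyl_re] at h1
          rw [norm_mul, Complex.norm_real, Real.norm_of_nonneg (Real.exp_pos _).le, ← mul_assoc]
          exact mul_le_mul_of_nonneg_right h1 (Real.exp_pos _).le)
      refine hn.trans ?_
      rw [hK₁, mul_assoc (2 * π)]
      refine mul_le_mul_of_nonneg_left ?_ Real.two_pi_pos.le
      refine (setIntegral_le_integral hg (Eventually.of_forall fun t => by positivity)).trans ?_
      rw [integral_const_mul, integral_gauss_exp_real ha0]
      refine le_of_eq ?_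
      rw [show -((n : ℝ) + 2 - ρ.re) * -x = (n + 2 - ρ.re) * x by ring]
      ring
  have hre : 0 < (n + 3 - ρ - μ : ℂ).re := by simp; linarith
  have hre2 : 0 < (3 - ρ + μ : ℂ).re := by simp; linarith
  refine ⟨if n = 0 then c₂ * (π * Complex.Gamma (3 - ρ + μ)) else 0, _, K₀ + K₁, rfl,
    fun x hx => ?_⟩
  have v1 : Complex.exp (-((n + 3 - ρ) * x)) *
      ∫ p in Ioc 0 (2 * π) ×ˢ univ, M₁ (cyl p) * (W x p.2 : ℂ) =
      π * Complex.Gamma (n + 3 - ρ - μ) * Complex.exp (-μ * x) := by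
    rw [(m1 x).2, if_pos rfl]
    have e1 : a₁ = n + 3 - ρ - μ := by simp [ha₁]; ring
    have := integral_gauss_exp (a := a₁) (by rw [e1]; exact hre) (-x)
    rw [this, e1]
    have e2 : Complex.exp (-((n + 3 - ρ) * x)) * Complex.exp (-(n + 3 - ρ - μ) * (-x : ℝ)) =
        Complex.exp (-μ * x) := by
      rw [← Complex.exp_add]; congr 1; push_cast; ring
    rw [← e2]; ring
  have v2 : Complex.exp (-((n + 3 - ρ) * x)) *
      (c₂ * ∫ p in Ioc 0 (2 * π) ×ˢ univ, M₂ (cyl p) * (W x p.2 : ℂ)) =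
      (if n = 0 then c₂ * (π * Complex.Gamma (3 - ρ + μ)) else 0) * Complex.exp (μ * x) := by
    rw [(m2 x).2]
    by_cases hn : n = 0
    · rw [if_pos hn, if_pos (by exact_mod_cast hn)]
      have e1 : a₂ = 3 - ρ + μ := by simp [ha₂, hn]; ring
      have := integral_gauss_exp (a := a₂) (by rw [e1]; exact hre2) (-x)
      rw [this, e1]
      have e2 : Complex.exp (-((n + 3 - ρ) * x)) * Complex.exp (-(3 - ρ + μ) * (-x : ℝ)) =
          Complex.exp (μ * x) := by
        rw [← Complex.exp_add]; congr 1; push_cast; rw [hn]; push_cast; ring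
      rw [← e2]; ring
    · rw [if_neg hn, if_neg (by exact_mod_cast hn), mul_zero, mul_zero, zero_mul]
  rw [hL x]
  have e : Complex.exp (-((n + 3 - ρ) * x)) *
      (c₁ * (∫ p in Ioc 0 (2 * π) ×ˢ univ, M₁ (cyl p) * (W x p.2 : ℂ)) +
      c₂ * (∫ p in Ioc 0 (2 * π) ×ˢ univ, M₂ (cyl p) * (W x p.2 : ℂ)) +
      ∫ p in Ioc 0 (2 * π) ×ˢ univ, R (cyl p) * (W x p.2 : ℂ)) -
      (c₁ * (π * Complex.Gamma (n + 3 - ρ - μ)) * Complex.exp (-μ * x) +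
        (if n = 0 then c₂ * (π * Complex.Gamma (3 - ρ + μ)) else 0) * Complex.exp (μ * x)) =
      Complex.exp (-((n + 3 - ρ) * x)) *
        ∫ p in Ioc 0 (2 * π) ×ˢ univ, R (cyl p) * (W x p.2 : ℂ) := by
    linear_combination c₁ * v1 + v2
  rw [e, norm_mul]
  have e2 : ‖Complex.exp (-((n + 3 - ρ) * x))‖ = Real.exp (-((n + 3 - ρ.re) * x)) := by
    rw [Complex.norm_exp]; simp
  rw [e2]
  refine (mul_le_mul_of_nonneg_left (hRI x) (Real.exp_pos _).le).trans ?_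
  rw [mul_add, add_mul]
  refine add_le_add ?_ (le_of_eq ?_)
  · rw [mul_comm]
    refine mul_le_mul_of_nonneg_left (Real.exp_le_exp.2 ?_) hK₀0
    nlinarith
  · rw [mul_left_comm, ← Real.exp_add]
    congr 2; ring

/-! ### Asymptotics on the Bessel side and the connection constant -/

lemma besselS_zero (ν : ℂ) : besselS ν 0 = (Complex.Gamma (ν + 1))⁻¹ := by
  unfold besselS
  rw [tsum_eq_single 0 fun n hn => by simp [besselTerm, hn]]
  simp [besselTerm]

lemma besselJ_add_log (ν w : ℂ) : besselJ ν (w + Real.log (4 * π)) =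
    Complex.exp (ν * Real.log (2 * π)) * Complex.exp (ν * w) *
      besselS ν (4 * π ^ 2 * Complex.exp ((2 : ℤ) * w)) := by
  have e : (Real.log (4 * π) : ℂ) = Real.log (2 * π) + Real.log 2 := by
    rw [← Complex.ofReal_add, ← Real.log_mul (by positivity) (by norm_num)]; ring_nf
  have e2 : Complex.exp (2 * Real.log (2 * π)) = 4 * π ^ 2 := by
    rw [two_mul, Complex.exp_add, ← Complex.ofReal_exp, Real.exp_log (by positivity)]
    push_cast; ring
  rw [besselJ_eq, ← e2, ← Complex.exp_add, ← Complex.exp_add, e]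
  congr 2
  · ring
  · congr 1; push_cast; ring

lemma exists_besselJ_mul_bound {ν₁ ν₂ c c' : ℂ} (h : (c + ν₁).im = (c' + ν₂).im) :
    ∃ α β : ℂ, ∃ K r : ℝ, 0 ≤ K ∧ 0 < r ∧ ∀ w : ℂ, Real.exp (2 * w.re) ≤ r →
      ‖Complex.exp (c * w + c' * starRingEnd ℂ w) * (besselJ ν₁ (w + Real.log (4 * π)) *
        besselJ ν₂ (starRingEnd ℂ (w + Real.log (4 * π)))) -
        twoTerm (c + ν₁) (c' + ν₂) (Complex.exp ((ν₁ + ν₂) * Real.log (2 * π)) *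
          ((Complex.Gamma (ν₁ + 1))⁻¹ * (Complex.Gamma (ν₂ + 1))⁻¹)) α β 2 w‖ ≤
      K * Real.exp ((c.re + c'.re + ν₁.re + ν₂.re + 4) * w.re) := by
  have ha : ∀ ν : ℂ, AnalyticAt ℂ (fun x => besselS ν (4 * π ^ 2 * x)) 0 := fun ν => by
    have : Differentiable ℂ (besselS ν) := fun q => (hasDerivAt_besselS ν q).differentiableAt
    exact Differentiable.analyticAt (this.comp (by fun_prop)) 0
  obtain ⟨α, β, K, r, hK, hr, hb⟩ := exists_twoTerm_bound
    ((analyticAt_const (v := Complex.exp ((ν₁ + ν₂) * Real.log (2 * π)))).mul (ha ν₁)) (ha ν₂) h 2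
  refine ⟨α, β, K, r, hK, hr, fun w hw => ?_⟩
  have h1 := hb w (by exact_mod_cast hw)
  simp only [mul_zero, besselS_zero, Pi.mul_apply] at h1
  have e1 : starRingEnd ℂ (w + Real.log (4 * π)) = starRingEnd ℂ w + Real.log (4 * π) := by
    rw [map_add, Complex.conj_ofReal]
  have e2 : Complex.exp ((c + ν₁) * w + (c' + ν₂) * starRingEnd ℂ w) =
      Complex.exp (c * w + c' * starRingEnd ℂ w) * Complex.exp (ν₁ * w) *
        Complex.exp (ν₂ * starRingEnd ℂ w) := by
    rw [← Complex.exp_add, ← Complex.exp_add]; ring_nf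
  have e3 : Complex.exp ((ν₁ + ν₂) * Real.log (2 * π)) =
      Complex.exp (ν₁ * Real.log (2 * π)) * Complex.exp (ν₂ * Real.log (2 * π)) := by
    rw [← Complex.exp_add]; ring_nf
  rw [e1, besselJ_add_log, besselJ_add_log]
  rw [mul_assoc (Complex.exp ((ν₁ + ν₂) * _)) (Complex.Gamma (ν₁ + 1))⁻¹] at h1
  refine le_trans (le_of_eq ?_) (h1.trans (le_of_eq ?_))
  · congr 2
    rw [e2, e3]; ring
  · congr 3
    simp; ring

/-- The coefficient of `exp (-μ x)` in the asymptotics of the pairing of `waveTerm ρ μ n 0 0` with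
`gaussFT (exp (-x)) (2n+2) 2`. -/
def pairingCoeff (ρ μ : ℂ) (n : ℕ) : ℂ :=
  -((Complex.sin (π * μ))⁻¹ * (π * ((π : ℂ) ^ (2 * n + 1) * (-4) ^ n) *
    (Complex.exp (2 * μ * Real.log (2 * π)) *
      ((Complex.Gamma (μ + n + 1))⁻¹ * (Complex.Gamma (μ - n + 1))⁻¹)) *
    Complex.exp (-(ρ + μ + n) * Real.log (4 * π ^ 2)) * Complex.Gamma (ρ + μ + n) *
    ((ρ + μ - n - 1) * (ρ + μ - n - 2))))

/-- As x → ∞ the transformed Gaussian concentrates at z = 0, where 𝑱 is expanded from the two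
products of Bessel series. The factor z̄^{2n} cancels the angular frequency of the product with
J_{μ±n}; the other one survives only for n = 0, giving e^{μx}. -/
lemma exists_asymptotics_right {ρ μ : ℂ} (h0 : μ ≠ 0) (hμ : |μ.re| < ρ.re) (hρ : ρ.re < 1) (n : ℕ) :
    ∃ κ : ℂ, ∃ K' : ℝ, ∀ x : ℝ, 0 ≤ x → ‖Complex.exp (-((n + 3 - ρ) * x)) *
        (∫ p in Ioc 0 (2 * π) ×ˢ univ, waveTerm ρ μ n 0 0 (cyl p) *
          gaussFT (Real.exp (-x)) (2 * n + 2) 2 (Complex.exp (cyl p))) -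
        (pairingCoeff ρ μ n * Complex.exp (-μ * x) + κ * Complex.exp (μ * x))‖ ≤
      K' * Real.exp (-x) := by
  obtain ⟨hm1, hm2⟩ := abs_lt.1 hμ
  have hn0 : (0 : ℝ) ≤ n := n.cast_nonneg
  obtain ⟨σ, hσ1, hσ2⟩ := exists_between hμ
  have hσ0 := (abs_nonneg _).trans_lt hσ1
  set lam : ℝ := Real.log (4 * π ^ 2) with hlam
  set k : ℂ := (π : ℂ) ^ (2 * n + 1) * (-4) ^ n with hk
  set S : ℂ := (Complex.sin (π * μ))⁻¹ with hS
  obtain ⟨α₁, β₁, C₁, r₁, hC₁, hr₁, hb₁⟩ := exists_besselJ_mul_bound (ν₁ := μ + (n : ℤ))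
    (ν₂ := μ - (n : ℤ)) (c := ρ) (c' := ρ + 2 * n) (by simp)
  obtain ⟨α₂, β₂, C₂, r₂, hC₂, hr₂, hb₂⟩ := exists_besselJ_mul_bound (ν₁ := -(μ + (n : ℤ)))
    (ν₂ := -(μ - (n : ℤ))) (c := ρ) (c' := ρ + 2 * n) (by simp)
  obtain ⟨C₃, hC₃, hb₃⟩ := exists_bound_boldW_two hσ0 (hσ2.trans hρ) hσ1.le n
  set k₁ : ℂ := Complex.exp ((μ + (n : ℤ) + (μ - (n : ℤ))) * Real.log (2 * π)) *
    ((Complex.Gamma (μ + (n : ℤ) + 1))⁻¹ * (Complex.Gamma (μ - (n : ℤ) + 1))⁻¹) with hk₁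
  set k₂ : ℂ := Complex.exp ((-(μ + (n : ℤ)) + -(μ - (n : ℤ))) * Real.log (2 * π)) *
    ((Complex.Gamma (-(μ + (n : ℤ)) + 1))⁻¹ * (Complex.Gamma (-(μ - (n : ℤ)) + 1))⁻¹) with hk₂
  set a₁ : ℂ := ρ + (μ + (n : ℤ)) with ha₁
  set a₁' : ℂ := ρ + 2 * n + (μ - (n : ℤ)) with ha₁'
  set a₂ : ℂ := ρ + -(μ + (n : ℤ)) with ha₂
  set a₂' : ℂ := ρ + 2 * n + -(μ - (n : ℤ)) with ha₂'
  have i1 : a₁.im = a₁'.im := by simp [ha₁, ha₁']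
  have i2 : a₂.im = a₂'.im := by simp [ha₂, ha₂']
  have r1 : a₁.re + a₁'.re = 2 * (ρ.re + μ.re + n) := by simp [ha₁, ha₁']; ring
  have r2 : a₂.re + a₂'.re = 2 * (ρ.re - μ.re + n) := by simp [ha₂, ha₂']; ring
  set M₁ : ℂ → ℂ := twoTerm a₁ a₁' k₁ α₁ β₁ 2 with hM₁
  set M₂ : ℂ → ℂ := twoTerm a₂ a₂' k₂ α₂ β₂ 2 with hM₂
  set G : ℂ → ℂ := fun w => boldW μ n w * Complex.exp (ρ * w + (ρ + 2 * n) * starRingEnd ℂ w)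
    with hG
  set W : ℝ → ℝ → ℝ := fun x t => lagWeight n (x + lam) t with hW
  set R : ℂ → ℂ := fun w => G w - S * (M₂ w - M₁ w) with hR
  have iW : ∀ x : ℝ, ∀ {s : ℝ}, 0 < s → Integrable fun t => Real.exp (s * t) * W x t := by
    intro x s hs
    have := integrable_exp_mul_lagWeight (a := s / 2) (by linarith) n (x + lam)
    simpa only [mul_div_cancel₀ s (two_ne_zero' ℝ)] using this
  have m1 := fun x : ℝ => integral_cyl_twoTerm (a := a₁) (a' := a₁') (n := 0)
    (by simp [ha₁, ha₁']; ring) k₁ α₁ β₁ (ε := 2) (Or.inl rfl)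
    (iW x (by rw [r1]; linarith)) (iW x (by rw [r1]; push_cast; linarith))
  have m2 := fun x : ℝ => integral_cyl_twoTerm (a := a₂) (a' := a₂') (n := -n)
    (by simp [ha₂, ha₂']; ring) k₂ α₂ β₂ (ε := 2) (Or.inl rfl)
    (iW x (by rw [r2]; linarith)) (iW x (by rw [r2]; push_cast; linarith))
  have hGJ : ∀ x : ℝ, ∀ w : ℂ, waveTerm ρ μ n 0 0 w *
      gaussFT (Real.exp (-x)) (2 * n + 2) 2 (Complex.exp w) =
      k * Complex.exp ((2 * n + 3) * x) * (G w * (W x w.re : ℂ)) := by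
    intro x w
    rw [gaussFT_exp]
    simp only [hG, hW, waveTerm]
    have : Complex.exp (ρ * w + (ρ + 2 * n) * starRingEnd ℂ w) =
        Complex.exp ((ρ + (0 : ℤ)) * w + (ρ + (0 : ℤ)) * starRingEnd ℂ w) *
          Complex.exp (2 * n * starRingEnd ℂ w) := by
      rw [← Complex.exp_add]; push_cast; ring_nf
    rw [this]; ring
  have hkx : ∀ x : ℝ, k * Complex.exp ((2 * n + 3) * x) ≠ 0 := fun x =>
    mul_ne_zero (mul_ne_zero (pow_ne_zero _ (Complex.ofReal_ne_zero.2 Real.pi_ne_zero))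
      (pow_ne_zero _ (by norm_num))) (Complex.exp_ne_zero _)
  have iG : ∀ x, IntegrableOn (fun p => G (cyl p) * (W x p.2 : ℂ)) (Ioc 0 (2 * π) ×ˢ univ) := by
    intro x
    refine Integrable.congr ((integrableOn_waveTerm_mul_gaussFT h0 hμ hρ n x).const_mul
      (k * Complex.exp ((2 * n + 3) * x))⁻¹) (Eventually.of_forall fun p => ?_)
    simp only [hGJ, cyl_re]
    rw [inv_mul_cancel_left₀ (hkx x)]
  have iR : ∀ x, IntegrableOn (fun p => R (cyl p) * (W x p.2 : ℂ)) (Ioc 0 (2 * π) ×ˢ univ) := by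
    intro x
    refine Integrable.congr ((iG x).sub (((m2 x).1.sub (m1 x).1).const_mul S))
      (Eventually.of_forall fun p => ?_)
    simp only [Pi.sub_apply, hR]
    ring
  have hL : ∀ x, (∫ p in Ioc 0 (2 * π) ×ˢ univ, waveTerm ρ μ n 0 0 (cyl p) *
      gaussFT (Real.exp (-x)) (2 * n + 2) 2 (Complex.exp (cyl p))) =
      k * Complex.exp ((2 * n + 3) * x) *
      (S * ((∫ p in Ioc 0 (2 * π) ×ˢ univ, M₂ (cyl p) * (W x p.2 : ℂ)) -
        ∫ p in Ioc 0 (2 * π) ×ˢ univ, M₁ (cyl p) * (W x p.2 : ℂ)) +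
      ∫ p in Ioc 0 (2 * π) ×ˢ univ, R (cyl p) * (W x p.2 : ℂ)) := by
    intro x
    rw [← integral_sub (m2 x).1 (m1 x).1, ← integral_const_mul]
    simp only [hGJ, cyl_re]
    rw [integral_const_mul]
    congr 1
    refine Eq.trans ?_ (integral_add (((m2 x).1.sub (m1 x).1).const_mul S) (iR x))
    congr 1; ext p
    simp only [hR]
    ring
  -- the remainder is small at both ends of the cylinder
  obtain ⟨K, hK, hRb⟩ : ∃ K : ℝ, 0 ≤ K ∧ ∀ w : ℂ, ‖R w‖ ≤
      K * (Real.exp (2 * (ρ.re + n + 1) * w.re) + Real.exp (2 * (ρ.re + n + 2) * w.re)) := by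
    set r : ℝ := min 1 (min r₁ r₂) with hr
    have hr0 : 0 < r := lt_min one_pos (lt_min hr₁ hr₂)
    set T : ℝ := Real.log r / 2 with hT
    have hT0 : T ≤ 0 := by
      have := Real.log_nonpos hr0.le (min_le_left _ _)
      rw [hT]; linarith
    set E : ℝ → ℝ := fun c => Real.exp ((c - 2 * (ρ.re + n + 2)) * T) with hE
    have hE0 : ∀ c, 0 < E c := fun c => Real.exp_pos _
    set D : ℝ := C₃ * (E (2 * (ρ.re + n) - 2 * σ) + E (2 * (ρ.re + n))) + ‖S‖ *
      ((‖k₂‖ * E (a₂.re + a₂'.re) + (‖α₂‖ + ‖β₂‖) * E (a₂.re + a₂'.re + (2 : ℤ))) +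
       (‖k₁‖ * E (a₁.re + a₁'.re) + (‖α₁‖ + ‖β₁‖) * E (a₁.re + a₁'.re + (2 : ℤ)))) with hD
    have hD0 : 0 ≤ D := by positivity
    refine ⟨‖S‖ * (C₂ + C₁) + D, by positivity, fun w => ?_⟩
    rcases le_total w.re T with hw | hw
    · have hw0 : w.re ≤ 0 := hw.trans hT0
      have hwr : Real.exp (2 * w.re) ≤ r := by
        rw [← Real.log_le_log_iff (Real.exp_pos _) hr0, Real.log_exp]; linarith
      have b1 := hb₁ w (hwr.trans ((min_le_right _ _).trans (min_le_left _ _)))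
      have b2 := hb₂ w (hwr.trans ((min_le_right _ _).trans (min_le_right _ _)))
      have e : R w = S * ((Complex.exp (ρ * w + (ρ + 2 * n) * starRingEnd ℂ w) *
          (besselJ (-(μ + (n : ℤ))) (w + Real.log (4 * π)) *
          besselJ (-(μ - (n : ℤ))) (starRingEnd ℂ (w + Real.log (4 * π)))) - M₂ w) -
          (Complex.exp (ρ * w + (ρ + 2 * n) * starRingEnd ℂ w) *
          (besselJ (μ + (n : ℤ)) (w + Real.log (4 * π)) *
          besselJ (μ - (n : ℤ)) (starRingEnd ℂ (w + Real.log (4 * π)))) - M₁ w)) := by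
        simp only [hR, hG]
        rw [boldW_of_ne h0, besselP, div_eq_mul_inv, ← hS]; ring
      have small : ∀ {c : ℝ}, 2 * (ρ.re + n + 1) ≤ c → Real.exp (c * w.re) ≤
          Real.exp (2 * (ρ.re + n + 1) * w.re) + Real.exp (2 * (ρ.re + n + 2) * w.re) := by
        intro c hc
        exact (Real.exp_le_exp.2 (mul_le_mul_of_nonpos_right hc hw0)).trans
          (le_add_of_nonneg_right (Real.exp_pos _).le)
      rw [e, norm_mul, add_mul (‖S‖ * (C₂ + C₁)) D, mul_assoc ‖S‖ (C₂ + C₁)]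
      refine le_add_of_le_of_nonneg (mul_le_mul_of_nonneg_left
        ((norm_sub_le _ _).trans ?_) (norm_nonneg _)) (mul_nonneg hD0 (by positivity))
      rw [add_mul C₂ C₁]
      refine add_le_add (b2.trans (mul_le_mul_of_nonneg_left (small ?_) hC₂))
        (b1.trans (mul_le_mul_of_nonneg_left (small ?_) hC₁))
      · simp; linarith
      · simp; linarith
    · have big : ∀ {c : ℝ}, c ≤ 2 * (ρ.re + n + 2) →
          Real.exp (c * w.re) ≤ E c * Real.exp (2 * (ρ.re + n + 2) * w.re) := fun hc =>
        exp_mul_le_exp_mul hc hw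
      have bG : ‖G w‖ ≤ C₃ * (E (2 * (ρ.re + n) - 2 * σ) + E (2 * (ρ.re + n))) *
          Real.exp (2 * (ρ.re + n + 2) * w.re) := by
        simp only [hG]
        rw [norm_mul, norm_exp_pair (by simp)]
        refine (mul_le_mul_of_nonneg_right (hb₃ w) (Real.exp_pos _).le).trans ?_
        rw [mul_assoc C₃, mul_assoc C₃]
        refine mul_le_mul_of_nonneg_left ?_ hC₃
        rw [add_mul _ 1, add_mul (E _), one_mul, ← Real.exp_add]
        refine add_le_add (le_trans (le_of_eq ?_) (big (c := 2 * (ρ.re + n) - 2 * σ) (by linarith)))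
          (le_trans (le_of_eq ?_) (big (c := 2 * (ρ.re + n)) (by linarith)))
        · congr 1; simp; ring
        · rw [show ρ.re + (ρ + 2 * (n : ℂ)).re = 2 * (ρ.re + n) by simp; ring]
      have bM : ∀ {a a' k α β : ℂ}, a.im = a'.im → a.re + a'.re + 2 ≤ 2 * (ρ.re + n + 2) →
          ‖twoTerm a a' k α β 2 w‖ ≤ (‖k‖ * E (a.re + a'.re) +
            (‖α‖ + ‖β‖) * E (a.re + a'.re + (2 : ℤ))) * Real.exp (2 * (ρ.re + n + 2) * w.re) := by
        intro a a' k α β h h'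
        refine (norm_twoTerm_le h k α β 2 w).trans ?_
        rw [add_mul (‖k‖ * E _), mul_assoc ‖k‖, mul_assoc (‖α‖ + ‖β‖)]
        exact add_le_add (mul_le_mul_of_nonneg_left (big (by linarith)) (norm_nonneg _))
          (mul_le_mul_of_nonneg_left (big (by push_cast; linarith)) (by positivity))
      have b1 := bM (k := k₁) (α := α₁) (β := β₁) i1 (by rw [r1]; linarith)
      have b2 := bM (k := k₂) (α := α₂) (β := β₂) i2 (by rw [r2]; linarith)
      have key : ‖R w‖ ≤ D * Real.exp (2 * (ρ.re + n + 2) * w.re) := by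
        simp only [hR]
        refine (norm_sub_le _ _).trans ?_
        rw [hD, add_mul (C₃ * _), norm_mul S, mul_assoc ‖S‖, add_mul (‖k₂‖ * _ + _)]
        exact add_le_add bG (mul_le_mul_of_nonneg_left ((norm_sub_le _ _).trans
          (add_le_add b2 b1)) (norm_nonneg _))
      refine key.trans (mul_le_mul ?_ (le_add_of_nonneg_left (Real.exp_pos _).le)
        (Real.exp_pos _).le (by positivity))
      exact le_add_of_nonneg_left (by positivity)
  have hp1 : 0 < ρ.re + n + 1 := by linarith
  have hp2 : 0 < ρ.re + n + 2 := by linarith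
  obtain ⟨L₁, hL₁⟩ := exists_integral_abs_lagWeight_le hp1 n
  obtain ⟨L₂, hL₂⟩ := exists_integral_abs_lagWeight_le hp2 n
  have hRI : ∀ x : ℝ, 0 ≤ x → ‖∫ p in Ioc 0 (2 * π) ×ˢ univ, R (cyl p) * (W x p.2 : ℂ)‖ ≤
      2 * π * (K * (|L₁| * Real.exp (-(ρ.re + n + 1) * lam) +
        |L₂| * Real.exp (-(ρ.re + n + 2) * lam))) * Real.exp (-(ρ.re + n + 1) * x) := by
    intro x hx
    have j1 := (integrable_exp_mul_lagWeight hp1 n (x + lam)).norm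
    have j2 := (integrable_exp_mul_lagWeight hp2 n (x + lam)).norm
    simp only [norm_mul, Real.norm_eq_abs, Real.abs_exp] at j1 j2
    have hn := norm_integral_cyl_le (G := fun p => R (cyl p) * (W x p.2 : ℂ)) MeasurableSet.univ
      ((j1.add j2).const_mul K).integrableOn (fun p _ => by
        have h1 := hRb (cyl p)
        rw [cyl_re] at h1
        rw [norm_mul, Complex.norm_real, Real.norm_eq_abs]
        refine (mul_le_mul_of_nonneg_right h1 (abs_nonneg _)).trans (le_of_eq ?_)
        simp only [Pi.add_apply, hW]
        ring)
    refine hn.trans ?_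
    rw [mul_assoc (2 * π)]
    refine mul_le_mul_of_nonneg_left ?_ Real.two_pi_pos.le
    rw [setIntegral_univ, integral_const_mul, mul_assoc K]
    refine mul_le_mul_of_nonneg_left ?_ hK
    refine (integral_add j1 j2).le.trans ?_
    rw [add_mul, mul_assoc, mul_assoc, ← Real.exp_add, ← Real.exp_add]
    refine add_le_add ((hL₁ (x + lam)).trans (mul_le_mul (le_abs_self _) (le_of_eq ?_)
      (Real.exp_pos _).le (abs_nonneg _))) ((hL₂ (x + lam)).trans (mul_le_mul (le_abs_self _)
        (Real.exp_le_exp.2 ?_) (Real.exp_pos _).le (abs_nonneg _)))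
    · congr 1; ring
    · linarith
  have v1 : ∀ x : ℝ, Complex.exp (-((n + 3 - ρ) * x)) * (k * Complex.exp ((2 * n + 3) * x) *
      (S * ∫ p in Ioc 0 (2 * π) ×ˢ univ, M₁ (cyl p) * (W x p.2 : ℂ))) =
      -pairingCoeff ρ μ n * Complex.exp (-μ * x) := by
    intro x
    have e1 : a₁ = ρ + μ + n := by simp [ha₁]; ring
    have e2 : k₁ = Complex.exp (2 * μ * Real.log (2 * π)) *
        ((Complex.Gamma (μ + n + 1))⁻¹ * (Complex.Gamma (μ - n + 1))⁻¹) := by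
      rw [hk₁]; push_cast; ring_nf
    have h1 := integral_lagWeight (a := a₁) (by rw [e1]; simp; linarith) n (x + lam)
    rw [(m1 x).2, if_pos rfl, h1, e2, e1]
    have e3 : Complex.exp (-((n + 3 - ρ) * x)) * Complex.exp ((2 * n + 3) * x) *
        Complex.exp (-(ρ + μ + n) * (x + lam : ℝ)) =
        Complex.exp (-(ρ + μ + n) * lam) * Complex.exp (-μ * x) := by
      rw [← Complex.exp_add, ← Complex.exp_add, ← Complex.exp_add]; congr 1; push_cast; ring
    unfold pairingCoeff
    rw [← hk, ← hS, ← hlam]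
    linear_combination (k * S * π * (Complex.exp (2 * μ * Real.log (2 * π)) *
        ((Complex.Gamma (μ + n + 1))⁻¹ * (Complex.Gamma (μ - n + 1))⁻¹)) *
        Complex.Gamma (ρ + μ + n) * ((ρ + μ - n - 1) * (ρ + μ - n - 2))) * e3
  -- The value of κ is irrelevant: only the coefficient of e^{-μx} is compared later.
  obtain ⟨κ, v2⟩ : ∃ κ : ℂ, ∀ x : ℝ, Complex.exp (-((n + 3 - ρ) * x)) *
      (k * Complex.exp ((2 * n + 3) * x) *
      (S * ∫ p in Ioc 0 (2 * π) ×ˢ univ, M₂ (cyl p) * (W x p.2 : ℂ))) =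
      κ * Complex.exp (μ * x) := by
    by_cases hn : n = 0
    · refine ⟨k * S * (2 * π * k₂) * (2⁻¹ * Complex.exp (-a₂ * lam) * Complex.Gamma a₂ *
        ((a₂ - (2 * n + 1)) * (a₂ - (2 * n + 2)))), fun x => ?_⟩
      have h1 := integral_lagWeight (a := a₂) (by rw [ha₂, hn]; simp; linarith) n (x + lam)
      rw [(m2 x).2, if_pos (by simp [hn]), h1]
      have e3 : Complex.exp (-((n + 3 - ρ) * x)) * Complex.exp ((2 * n + 3) * x) *
          Complex.exp (-a₂ * (x + lam : ℝ)) = Complex.exp (-a₂ * lam) * Complex.exp (μ * x) := by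
        rw [← Complex.exp_add, ← Complex.exp_add, ← Complex.exp_add]; congr 1
        rw [ha₂, hn]; push_cast; ring
      linear_combination (k * S * (2 * π * k₂) * 2⁻¹ * Complex.Gamma a₂ *
        ((a₂ - (2 * n + 1)) * (a₂ - (2 * n + 2)))) * e3
    · refine ⟨0, fun x => ?_⟩
      rw [(m2 x).2, if_neg (by simpa using hn)]
      ring
  refine ⟨κ, ‖k‖ * (2 * π * (K * (|L₁| * Real.exp (-(ρ.re + n + 1) * lam) +
        |L₂| * Real.exp (-(ρ.re + n + 2) * lam)))), fun x hx => ?_⟩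
  have e : Complex.exp (-((n + 3 - ρ) * x)) * (∫ p in Ioc 0 (2 * π) ×ˢ univ,
      waveTerm ρ μ n 0 0 (cyl p) * gaussFT (Real.exp (-x)) (2 * n + 2) 2 (Complex.exp (cyl p))) -
      (pairingCoeff ρ μ n * Complex.exp (-μ * x) + κ * Complex.exp (μ * x)) =
      Complex.exp (-((n + 3 - ρ) * x)) * (k * Complex.exp ((2 * n + 3) * x)) *
      ∫ p in Ioc 0 (2 * π) ×ˢ univ, R (cyl p) * (W x p.2 : ℂ) := by
    rw [hL x]
    linear_combination v2 x - v1 x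
  have e2 : ‖Complex.exp (-((n + 3 - ρ) * x)) * (k * Complex.exp ((2 * n + 3) * x))‖ =
      ‖k‖ * Real.exp ((ρ.re + n) * x) := by
    rw [norm_mul, norm_mul, Complex.norm_exp, Complex.norm_exp, mul_left_comm, ← Real.exp_add]
    congr 2
    simp; ring
  rw [e, norm_mul, e2]
  refine (mul_le_mul_of_nonneg_left (hRI x hx) (by positivity)).trans (le_of_eq ?_)
  have e3 : Real.exp (-x) = Real.exp ((ρ.re + n) * x) * Real.exp (-(ρ.re + n + 1) * x) := by
    rw [← Real.exp_add]; congr 1; ring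
  rw [e3]; ring

/-- The reflection formula at s - n, after two steps of the functional equation for Γ(n+3-s). At s =
1 with n = 0 both sides are 0; at s = 1 with n ≥ 1 the factor Γ(s-n) is at a pole, which the
hypothesis excludes. -/
lemma sin_mul_Gamma_mul_Gamma {s : ℂ} (h0 : 0 < s.re) (h2 : s.re < 2) (n : ℕ)
    (h : n = 0 ∨ s ≠ 1) : Complex.sin (π * s) * (Complex.Gamma (s - n) * Complex.Gamma (n + 3 - s)) =
    (-1) ^ n * π * ((s - n - 1) * (s - n - 2)) := by
  by_cases h1 : s = 1
  · obtain rfl : n = 0 := h.resolve_right fun h => h h1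
    simp [h1]
  have hn0 : (0 : ℝ) ≤ n := n.cast_nonneg
  have hsin : Complex.sin (π * s) ≠ 0 := by
    intro hs
    obtain ⟨m, hm⟩ := Complex.sin_eq_zero_iff.1 hs
    have hm : s = m := by
      have hpi : (π : ℂ) ≠ 0 := Complex.ofReal_ne_zero.2 Real.pi_ne_zero
      refine mul_left_cancel₀ hpi (hm.trans (mul_comm _ _))
    rw [hm, Complex.intCast_re] at h0 h2
    have : m = 1 := by
      have a : (0 : ℤ) < m := by exact_mod_cast h0
      have b : m < (2 : ℤ) := by exact_mod_cast h2
      omega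
    exact h1 (by rw [hm, this]; simp)
  have g1 : (n : ℂ) + 1 - s ≠ 0 := fun h' => by
    have hs : s = n + 1 := (sub_eq_zero.1 h').symm
    have := congrArg Complex.re hs
    simp at this
    have hn : n = 0 := by
      have : (n : ℝ) < 1 := by linarith
      exact_mod_cast Nat.lt_one_iff.1 (by exact_mod_cast this)
    exact h1 (by rw [hs, hn]; simp)
  have g2 : (n : ℂ) + 2 - s ≠ 0 := fun h' => by
    have := congrArg Complex.re h'
    simp at this
    linarith
  have e1 : Complex.Gamma (n + 3 - s) = (n + 2 - s) * ((n + 1 - s) * Complex.Gamma (n + 1 - s)) := by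
    rw [← Complex.Gamma_add_one _ g1, show (n : ℂ) + 1 - s + 1 = n + 2 - s by ring,
      ← Complex.Gamma_add_one _ g2]
    congr 1; ring
  have sin_sub_nat : Complex.sin (π * s - n * π) = (-1) ^ n * Complex.sin (π * s) := by
    simpa using Complex.sin_antiperiodic.sub_nat_mul_eq (x := π * s) n
  have e2 := Complex.Gamma_mul_Gamma_one_sub (s - n)
  rw [show 1 - (s - n) = (n : ℂ) + 1 - s by ring, mul_sub, mul_comm (π : ℂ) n,
    sin_sub_nat, eq_div_iff (mul_ne_zero (by simp) hsin)] at e2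
  have e3 : ((-1 : ℂ) ^ n) * (-1) ^ n = 1 := by rw [← mul_pow]; simp
  rw [e1]
  linear_combination ((n + 2 - s) * (n + 1 - s) * (-1) ^ n) * e2 -
    Complex.sin (π * s) * (Complex.Gamma (s - n) * Complex.Gamma (n + 1 - s)) *
      ((n + 2 - s) * (n + 1 - s)) * e3

/-- The powers of 2π collect to (2π)^{-2ρ}, and `sin_mul_Gamma_mul_Gamma` converts the quadratic
factor from `integral_lagWeight` into the sine and the second Gamma factor of `C`. -/
lemma pairingCoeff_eq {ρ μ : ℂ} (hμ : |μ.re| < ρ.re) (hρ : ρ.re < 1) (n : ℕ)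
    (h : n = 0 ∨ ρ + μ ≠ 1) :
    pairingCoeff ρ μ n = C ρ μ n * (π * Complex.Gamma (n + 3 - ρ - μ)) := by
  obtain ⟨hm1, hm2⟩ := abs_lt.1 hμ
  have e1 := sin_mul_Gamma_mul_Gamma (s := ρ + μ) (by simp; linarith) (by simp; linarith) n h
  have hpos : (0 : ℝ) < 2 * π := Real.two_pi_pos
  have hpc : ((2 * π : ℝ) : ℂ) ≠ 0 := Complex.ofReal_ne_zero.2 hpos.ne'
  have hpi : (π : ℂ) ≠ 0 := Complex.ofReal_ne_zero.2 Real.pi_ne_zero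
  have e2 : Real.log (4 * π ^ 2) = 2 * Real.log (2 * π) := by
    rw [show 4 * π ^ 2 = (2 * π) ^ 2 by ring, Real.log_pow]; push_cast; rfl
  have e3 : Complex.exp (2 * μ * Real.log (2 * π)) *
      Complex.exp (-(ρ + μ + n) * Real.log (4 * π ^ 2)) =
      (((2 * π : ℝ) : ℂ) ^ (2 * ρ))⁻¹ * ((4 * (π : ℂ) ^ 2) ^ n)⁻¹ := by
    have a1 : ((2 * π : ℝ) : ℂ) ^ (2 * ρ) = Complex.exp (2 * ρ * Real.log (2 * π)) := by
      rw [Complex.cpow_def_of_ne_zero hpc, Complex.ofReal_log hpos.le, mul_comm]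
    have a2 : (4 * (π : ℂ) ^ 2) ^ n = Complex.exp (2 * n * Real.log (2 * π)) := by
      rw [show 2 * (n : ℂ) * Real.log (2 * π) = n * ((2 : ℕ) * Real.log (2 * π)) by push_cast; ring,
        Complex.exp_nat_mul, Complex.exp_nat_mul, ← Complex.ofReal_exp, Real.exp_log hpos]
      push_cast; ring
    rw [a1, a2, ← Complex.exp_neg, ← Complex.exp_neg, ← Complex.exp_add, ← Complex.exp_add, e2]
    congr 1; push_cast; ring
  have e4 : (π : ℂ) ^ (2 * n + 1) * (-4) ^ n * ((4 * (π : ℂ) ^ 2) ^ n)⁻¹ = π * (-1) ^ n := by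
    rw [mul_pow, show (-4 : ℂ) = (-1) * 4 by norm_num, mul_pow, pow_succ, pow_mul]
    field_simp
  unfold pairingCoeff C
  rw [show (n : ℂ) + 3 - ρ - μ = n + 3 - (ρ + μ) by ring, show 1 + μ + ((n : ℤ) : ℂ) = μ + n + 1 by
    push_cast; ring, show 1 + μ - ((n : ℤ) : ℂ) = μ - n + 1 by push_cast; ring,
    Int.cast_natCast, div_eq_mul_inv, div_eq_mul_inv, mul_inv, mul_inv]
  have e5 : (π : ℂ) ^ (2 * n + 1) * (-4) ^ n * (Complex.exp (2 * μ * Real.log (2 * π)) *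
      Complex.exp (-(ρ + μ + n) * Real.log (4 * π ^ 2))) =
      (((2 * π : ℝ) : ℂ) ^ (2 * ρ))⁻¹ * (π * (-1) ^ n) := by
    rw [e3, ← e4]; ring
  set s := ρ + μ
  linear_combination (-((Complex.sin (π * μ))⁻¹ * π * ((Complex.Gamma (μ + n + 1))⁻¹ *
    (Complex.Gamma (μ - n + 1))⁻¹) * Complex.Gamma (s + n) *
    ((s - n - 1) * (s - n - 2)))) * e5 + ((Complex.sin (π * μ))⁻¹ *
    (((2 * π : ℝ) : ℂ) ^ (2 * ρ))⁻¹ * π * ((Complex.Gamma (μ + n + 1))⁻¹ *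
    (Complex.Gamma (μ - n + 1))⁻¹) * Complex.Gamma (s + n)) * e1

/-- The two asymptotics describe the same quantity, so the coefficients of e^{-μx} agree up to
O(e^{-x}), hence exactly. The common factor Γ(n+3-ρ-μ) is nonzero, its argument having positive real
part. -/
lemma coeff_eq_C_of_nat {ρ μ : ℂ} (h0 : μ ≠ 0) (hμ : |μ.re| < ρ.re) (hρ : ρ.re < 1) (n : ℕ)
    (h : n = 0 ∨ ρ + μ ≠ 1) {c₁ c₂ : ℂ} (hc : ∀ v : ℂ, 4 * Complex.exp (-2 * v) ∈ cutPlane →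
      impInt ρ μ n (Complex.exp v) = c₁ * hypProd ρ μ n v + c₂ * hypProd ρ (-μ) (-n) v) :
    c₁ = C ρ μ n := by
  obtain ⟨hm1, hm2⟩ := abs_lt.1 hμ
  obtain ⟨κ₁, K, K₁, hK, h1⟩ := exists_asymptotics_left h0 hμ hρ n hc
  obtain ⟨κ₂, K₂, h2⟩ := exists_asymptotics_right h0 hμ hρ n
  have hz : K - pairingCoeff ρ μ n = 0 := by
    refine eq_zero_of_exp_bound (κ₂ := κ₁ - κ₂) (K := K₂ + K₁) h0 (hμ.trans hρ) fun x hx => ?_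
    have e := (norm_sub_le _ _).trans (add_le_add (h2 x hx) (h1 x hx))
    rw [(integral_impInt_mul_gaussMon h0 hμ hρ n x).2, sub_sub_sub_cancel_left, ← add_mul] at e
    refine le_trans (le_of_eq ?_) e
    congr 1; ring
  have hG : (π : ℂ) * Complex.Gamma (n + 3 - ρ - μ) ≠ 0 := by
    refine mul_ne_zero (Complex.ofReal_ne_zero.2 Real.pi_ne_zero)
      (Complex.Gamma_ne_zero_of_re_pos ?_)
    have hn0 : (0 : ℝ) ≤ n := n.cast_nonneg
    simp; linarith
  refine mul_right_cancel₀ hG ?_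
  rw [← hK, ← pairingCoeff_eq hμ hρ n h]
  exact sub_eq_zero.1 hz

lemma hypProd_neg_conj (ρ μ : ℂ) (d : ℤ) (v : ℂ) :
    hypProd ρ μ (-d) (starRingEnd ℂ v) = hypProd ρ μ d v := by
  unfold hypProd
  rw [Complex.conj_conj, mul_comm]
  push_cast
  rw [sub_neg_eq_add, ← sub_eq_add_neg]

lemma C_neg (ρ μ : ℂ) (d : ℤ) : C ρ μ (-d) = C ρ μ d := by
  unfold C
  push_cast
  rw [sub_neg_eq_add, sub_neg_eq_add, ← sub_eq_add_neg, ← sub_eq_add_neg,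
    mul_comm (Complex.Gamma (ρ + μ - d)), mul_comm (Complex.Gamma (1 + μ - d))]

/-- Negative d reduces to positive d by complex conjugation of u, which exchanges the two variables.
-/
lemma coeff_eq_C {ρ μ : ℂ} (h0 : μ ≠ 0) (hμ : |μ.re| < ρ.re) (hρ : ρ.re < 1) (d : ℤ)
    (h : d = 0 ∨ ρ + μ ≠ 1) {c₁ c₂ : ℂ} (hc : ∀ v : ℂ, 4 * Complex.exp (-2 * v) ∈ cutPlane →
      impInt ρ μ d (Complex.exp v) = c₁ * hypProd ρ μ d v + c₂ * hypProd ρ (-μ) (-d) v) :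
    c₁ = C ρ μ d := by
  obtain ⟨n, rfl | rfl⟩ := d.eq_nat_or_neg
  · exact coeff_eq_C_of_nat h0 hμ hρ n (h.imp_left fun h => by exact_mod_cast h) hc
  · rw [C_neg]
    refine coeff_eq_C_of_nat h0 hμ hρ n (h.imp_left fun h => by simpa using h)
      (c₂ := c₂) fun v hv => ?_
    have h1 := hc (starRingEnd ℂ v) (by rw [four_mul_exp_conj]; exact conj_mem_cutPlane hv)
    rw [hypProd_neg_conj, hypProd_neg_conj, Complex.exp_conj, impInt_conj h0 hμ hρ] at h1
    exact h1

/-- The integral in terms of Gauss functions off the branch cut. -/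
lemma impInt_eq {ρ μ : ℂ} (h0 : μ ≠ 0) (hμ : |μ.re| < ρ.re) (hρ : ρ.re < 1) (d : ℤ)
    (h : d = 0 ∨ (ρ + μ ≠ 1 ∧ ρ - μ ≠ 1)) {v : ℂ} (hv : 4 * Complex.exp (-2 * v) ∈ cutPlane) :
    impInt ρ μ d (Complex.exp v) =
      C ρ μ d * hypProd ρ μ d v + C ρ (-μ) (-d) * hypProd ρ (-μ) (-d) v := by
  obtain ⟨c₁, c₂, hc⟩ := exists_impInt_eq h0 hμ hρ d
  have hc' : ∀ v : ℂ, 4 * Complex.exp (-2 * v) ∈ cutPlane → impInt ρ μ d (Complex.exp v) =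
      c₁ * hypProd ρ μ d v + c₂ * hypProd ρ (-μ) (-d) v := fun v hv => by
    rw [hc v hv]
    unfold hypProd
    push_cast
    ring_nf
  -- The second constant is the first one for (-μ, -d), the integral being invariant under this
  -- change.
  rw [hc' v hv, coeff_eq_C h0 hμ hρ d (h.imp_right And.left) hc',
    coeff_eq_C (c₁ := c₂) (c₂ := c₁) (neg_ne_zero.2 h0) (by simpa using hμ) hρ (-d)
      (h.imp (fun h => by simpa using h) fun h => by rw [← sub_eq_add_neg]; exact h.2)
      fun v hv => by rw [impInt_neg_order h0, hc' v hv, neg_neg, neg_neg, add_comm]]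

/-! ### The Gauss series at the branch point -/

/-- Raabe's condition for the ratio of consecutive coefficients. In x = 1/n both sides, squared,
agree at x = 0, and the difference of their derivatives there is 2 Re(c-a-b) - 2δ, which is 2δ > 0
for δ = Re(c-a-b)/2. -/
lemma eventually_kummer {a b c : ℂ} (h : 0 < (c - a - b).re) : ∃ δ : ℝ, 0 < δ ∧ ∃ N : ℕ, ∀ n : ℕ,
    N ≤ n → (n + 1 + δ) * (‖a + n‖ * ‖b + n‖) ≤ n * (‖c + n‖ * ‖(1 : ℂ) + n‖) := by
  set δ : ℝ := (c - a - b).re / 2 with hδ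
  set q : ℂ → ℝ → ℝ := fun z x => 1 + 2 * z.re * x + Complex.normSq z * x ^ 2 with hq
  have hq0 : ∀ z, q z 0 = 1 := fun z => by simp [hq]
  have hqd : ∀ z, HasDerivAt (q z) (2 * z.re) 0 := fun z => by
    have h1 := (((hasDerivAt_id (0 : ℝ)).const_mul (2 * z.re)).const_add 1).add
      (((hasDerivAt_id (0 : ℝ)).pow 2).const_mul (Complex.normSq z))
    refine h1.congr_deriv ?_
    simp
  have hlin : HasDerivAt (fun x : ℝ => 1 + (1 + δ) * x) (1 + δ) 0 := by
    simpa using ((hasDerivAt_id (0 : ℝ)).const_mul (1 + δ)).const_add 1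
  have hf := ((hqd c).mul (hqd 1)).sub ((hlin.pow 2).mul ((hqd a).mul (hqd b)))
  have hpos : 0 < 2 * δ := by rw [hδ]; linarith
  have h2 : ∀ᶠ x : ℝ in 𝓝[>] 0, (1 + (1 + δ) * x) ^ 2 * (q a x * q b x) < q c x * q 1 x := by
    have hlim := hf.tendsto_slope_zero_right
    have hev := hlim.eventually_const_lt (u := 0) (by
      simp [hq0]
      have : δ + δ = c.re - a.re - b.re := by rw [hδ]; simp
      linarith)
    filter_upwards [hev, self_mem_nhdsWithin] with x hx hx0
    have hx0 : 0 < x := hx0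
    simp [hq0] at hx
    rw [mul_comm, mul_pos_iff_of_pos_right (inv_pos.2 hx0)] at hx
    linarith
  refine ⟨δ, by linarith, ?_⟩
  have h3 : Tendsto (fun n : ℕ => (n : ℝ)⁻¹) atTop (𝓝[>] 0) :=
    tendsto_inv_atTop_nhdsGT_zero.comp tendsto_natCast_atTop_atTop
  obtain ⟨N, hN⟩ := eventually_atTop.1 (h3.eventually h2)
  refine ⟨N + 1, fun n hn => ?_⟩
  have hn0 : (0 : ℝ) < n := by exact_mod_cast (Nat.succ_pos N).trans_le hn
  have hqn : ∀ z : ℂ, ‖z + n‖ ^ 2 = n ^ 2 * q z (n : ℝ)⁻¹ := fun z => by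
    rw [← Complex.normSq_eq_norm_sq]
    simp only [hq, Complex.normSq_apply, Complex.add_re, Complex.natCast_re, Complex.add_im,
      Complex.natCast_im]
    field_simp
    ring
  refine le_of_sq_le_sq ?_ (by positivity)
  have h4 := (hN n (by omega)).le
  calc ((n + 1 + δ) * (‖a + n‖ * ‖b + n‖)) ^ 2
      = (n : ℝ) ^ 6 * ((1 + (1 + δ) * (n : ℝ)⁻¹) ^ 2 * (q a (n : ℝ)⁻¹ * q b (n : ℝ)⁻¹)) := by
        rw [mul_pow, mul_pow, hqn, hqn]; field_simp; ring
    _ ≤ (n : ℝ) ^ 6 * (q c (n : ℝ)⁻¹ * q 1 (n : ℝ)⁻¹) := by gcongr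
    _ = (n * (‖c + n‖ * ‖(1 : ℂ) + n‖)) ^ 2 := by rw [mul_pow, mul_pow, hqn, hqn]; ring

/-- Raabe's condition gives δ g(n+1) ≤ n g(n) - (n+1) g(n+1), whose right side telescopes. -/
lemma summable_norm_gaussCoeff {a b c : ℂ} (hc : ∀ n : ℕ, c ≠ -n) (h : 0 < (c - a - b).re) :
    Summable fun n => ‖gaussCoeff a b c n‖ := by
  obtain ⟨δ, hδ, N, hN⟩ := eventually_kummer h
  set g : ℕ → ℝ := fun n => ‖gaussCoeff a b c n‖ with hg
  have step : ∀ n, N ≤ n → (n + 1 + δ) * g (n + 1) ≤ n * g n := by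
    intro n hn
    have h1 : ‖(1 : ℂ) + n‖ * ‖c + n‖ * g (n + 1) = ‖a + n‖ * ‖b + n‖ * g n := by
      simp only [hg, ← norm_mul]
      rw [add_comm 1, add_comm c, gaussCoeff_succ a b hc]
    have hp : 0 < ‖(1 : ℂ) + n‖ * ‖c + n‖ := by
      refine mul_pos (norm_pos_iff.2 ?_) (norm_pos_iff.2 ?_)
      · rw [add_comm]; exact Nat.cast_add_one_ne_zero n
      · exact fun h' => hc n (eq_neg_of_add_eq_zero_left h')
    refine le_of_mul_le_mul_left ?_ hp
    calc ‖(1 : ℂ) + n‖ * ‖c + n‖ * ((n + 1 + δ) * g (n + 1))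
        = (n + 1 + δ) * (‖a + n‖ * ‖b + n‖) * g n := by
          linear_combination (n + 1 + δ) * h1
      _ ≤ n * (‖c + n‖ * ‖(1 : ℂ) + n‖) * g n := by
          exact mul_le_mul_of_nonneg_right (hN n hn) (norm_nonneg _)
      _ = _ := by ring
  have hsum : ∀ m : ℕ, δ * ∑ i ∈ Finset.range m, g (i + (N + 1)) ≤
      N * g N - (N + m : ℕ) * g (N + m) := by
    intro m
    induction m with
    | zero => simp
    | succ m ih =>
      have h1 := step (N + m) (by omega)
      rw [Finset.sum_range_succ, mul_add, show m + (N + 1) = N + m + 1 by ring, ← add_assoc N m 1]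
      push_cast at ih h1 ⊢
      linarith
  refine (summable_nat_add_iff (N + 1)).1 (summable_of_sum_range_le (c := N * g N / δ)
    (fun n => norm_nonneg _) fun m => ?_)
  rw [le_div_iff₀' hδ]
  have : 0 ≤ ((N + m : ℕ) : ℝ) * g (N + m) := mul_nonneg (Nat.cast_nonneg _) (norm_nonneg _)
  linarith [hsum m]

/-- Here c - a - b = 1/2 - ρ has positive real part, so the series converges absolutely on the
closed disc. At the point 1, outside the cut plane, `hyp2F1` is by definition the sum of this
series. -/
lemma continuousWithinAt_F1_one {ρ ν : ℂ} (hρ : ρ.re < 1 / 2) (hν : ∀ n : ℕ, 1 + ν ≠ -n) :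
    ContinuousWithinAt (F1 ρ ν) ({z | ‖z‖ < 1} ∪ {1}) 1 := by
  set a := (ρ + ν) / 2 with ha
  have h : 0 < (1 + ν - a - (a + 1 / 2)).re := by
    have : 1 + ν - a - (a + 1 / 2) = 1 / 2 - ρ := by rw [ha]; ring
    rw [this, Complex.sub_re]
    norm_num
    linarith
  have hc : ContinuousOn (fun z : ℂ => ∑' n, gaussCoeff a (a + 1 / 2) (1 + ν) n * z ^ n)
      ({z | ‖z‖ < 1} ∪ {1}) := by
    refine continuousOn_tsum (fun n => by fun_prop) (summable_norm_gaussCoeff hν h)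
      fun n z hz => ?_
    rw [norm_mul, norm_pow]
    refine mul_le_of_le_one_right (norm_nonneg _) (pow_le_one₀ (norm_nonneg _) ?_)
    rcases hz with hz | hz
    · exact le_of_lt hz
    · rw [hz, norm_one]
  have e : ∀ z ∈ ({z | ‖z‖ < 1} ∪ {1} : Set ℂ), F1 ρ ν z =
      ∑' n, gaussCoeff a (a + 1 / 2) (1 + ν) n * z ^ n := by
    intro z hz
    unfold F1
    rw [show (1 + ρ + ν) / 2 = a + 1 / 2 by rw [ha]; ring, ← gauss_eq_tsum]
    rcases hz with hz | hz
    · exact hyp2F1_eq_gauss a hν hz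
    · rw [hz]
      exact hyp2F1_of_notMem fun h => h ⟨by simp, by simp⟩
  exact (hc.congr e) 1 (Or.inr rfl)

/-! ### The right hand side -/

/-- A logarithm of `y exp (iθ)`. -/
def logPolar (y θ : ℝ) : ℂ := Real.log y + θ * Complex.I

lemma exp_logPolar {y : ℝ} (hy : 0 < y) (θ : ℝ) :
    Complex.exp (logPolar y θ) = y * Complex.exp (θ * Complex.I) := by
  rw [logPolar, Complex.exp_add, ← Complex.ofReal_exp, Real.exp_log hy]

lemma F2_eq (ρ ν : ℂ) : F2 ρ ν = F1 ρ (-ν) := by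
  funext z
  unfold F2 F1
  rw [sub_eq_add_neg, sub_eq_add_neg, sub_eq_add_neg]

lemma hypProd_logPolar (ρ μ : ℂ) (d : ℤ) {y : ℝ} (hy : 0 < y) (θ : ℝ) :
    hypProd ρ μ d (logPolar y θ) = F1 ρ (μ + d) (4 / (y ^ 2 * Complex.exp (2 * θ * Complex.I))) *
      F1 ρ (μ - d) (4 * Complex.exp (2 * θ * Complex.I) / y ^ 2) /
      ((y : ℂ) ^ (2 * ρ + 2 * μ) * Complex.exp (2 * d * θ * Complex.I)) := by
  have hyc : (y : ℂ) ≠ 0 := Complex.ofReal_ne_zero.2 hy.ne'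
  have hl : Complex.exp (Real.log y) = y := by rw [← Complex.ofReal_exp, Real.exp_log hy]
  have hsq : Complex.exp (-2 * Real.log y) = ((y : ℂ) ^ 2)⁻¹ := by
    rw [neg_mul, Complex.exp_neg, two_mul, Complex.exp_add, hl, sq]
  have e1 : Complex.exp (-2 * logPolar y θ) = ((y : ℂ) ^ 2)⁻¹ *
      (Complex.exp (2 * θ * Complex.I))⁻¹ := by
    rw [← hsq, ← Complex.exp_neg, ← Complex.exp_add, logPolar]; ring_nf
  have hconj : starRingEnd ℂ (logPolar y θ) = Real.log y - θ * Complex.I := by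
    simp [logPolar, ← sub_eq_add_neg]
  have e2 : Complex.exp (-2 * starRingEnd ℂ (logPolar y θ)) = ((y : ℂ) ^ 2)⁻¹ *
      Complex.exp (2 * θ * Complex.I) := by
    rw [← hsq, ← Complex.exp_add, hconj]; ring_nf
  have e3 : Complex.exp (-((ρ + (μ + d)) * logPolar y θ)) *
      Complex.exp (-((ρ + (μ - d)) * starRingEnd ℂ (logPolar y θ))) =
      ((y : ℂ) ^ (2 * ρ + 2 * μ) * Complex.exp (2 * d * θ * Complex.I))⁻¹ := by
    rw [Complex.cpow_def_of_ne_zero hyc, ← Complex.ofReal_log hy.le, ← Complex.exp_add,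
      ← Complex.exp_add, ← Complex.exp_neg, hconj, logPolar]
    ring_nf
  unfold hypProd hypTerm
  rw [div_eq_mul_inv _ (_ * Complex.exp (2 * d * θ * Complex.I)), ← e3, e1, e2, ← mul_inv,
    div_eq_mul_inv, div_eq_mul_inv, mul_comm ((y : ℂ) ^ 2)⁻¹, mul_assoc 4]
  ring

lemma rhs_eq (ρ μ : ℂ) (d : ℤ) {y : ℝ} (hy : 0 < y) (θ : ℝ) : rhs ρ μ d y θ =
    C ρ μ d * hypProd ρ μ d (logPolar y θ) +
      C ρ (-μ) (-d) * hypProd ρ (-μ) (-d) (logPolar y θ) := by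
  rw [hypProd_logPolar ρ μ d hy, hypProd_logPolar ρ (-μ) (-d) hy, rhs, F2_eq, F2_eq]
  have e1 : -μ + ((-d : ℤ) : ℂ) = -(μ + d) := by push_cast; ring
  have e2 : -μ - ((-d : ℤ) : ℂ) = -(μ - d) := by push_cast; ring
  rw [e1, e2, mul_neg, ← sub_eq_add_neg]
  push_cast
  rw [mul_neg, neg_mul (2 : ℂ) (d : ℂ)]
  ring

lemma mem_cutPlane_logPolar {y θ : ℝ} (hy : 0 < y) (h : ¬ (y ≤ 2 ∧ Real.sin θ = 0)) :
    4 * Complex.exp (-2 * logPolar y θ) ∈ cutPlane := by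
  have e : 4 * Complex.exp (-2 * logPolar y θ) = ((4 * Real.exp (-2 * Real.log y) : ℝ) : ℂ) *
      Complex.exp ((-2 * θ : ℝ) * Complex.I) := by
    rw [logPolar, Complex.ofReal_mul, Complex.ofReal_exp, mul_assoc, Complex.ofReal_ofNat,
      ← Complex.exp_add]
    congr 2; push_cast; ring
  have hexp : Real.exp (-2 * Real.log y) = (y ^ 2)⁻¹ := by
    rw [neg_mul, Real.exp_neg, two_mul, Real.exp_add, Real.exp_log hy, sq]
  rintro ⟨h1, h2⟩
  rw [e, Complex.im_ofReal_mul, Complex.exp_ofReal_mul_I_im] at h1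
  rw [e, Complex.re_ofReal_mul, Complex.exp_ofReal_mul_I_re, hexp, neg_mul, Real.cos_neg,
    Real.cos_two_mul'] at h2
  have hp : 0 < 4 * Real.exp (-2 * Real.log y) := by positivity
  have h3 := (mul_eq_zero.1 h1).resolve_left hp.ne'
  rw [neg_mul, Real.sin_neg, Real.sin_two_mul, neg_eq_zero] at h3
  have hy2 : 0 < y ^ 2 := by positivity
  rcases mul_eq_zero.1 h3 with h4 | h4
  · have h4 : Real.sin θ = 0 := by linarith
    refine h ⟨?_, h4⟩
    have h5 := Real.sin_sq_add_cos_sq θ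
    rw [h4] at h5 h2
    rw [show Real.cos θ ^ 2 - 0 ^ 2 = 1 by linarith, mul_one, ← div_eq_mul_inv,
      one_le_div hy2] at h2
    nlinarith
  · rw [h4] at h2
    have : 0 ≤ 4 * (y ^ 2)⁻¹ * Real.sin θ ^ 2 := by positivity
    linarith

/-- For y > 2 the argument 4/u² lies in the open unit disc and tends to 1 as y → 2, so continuity of
the Gauss series up to 1 applies. -/
lemma tendsto_hypProd_two {ρ μ : ℂ} (hρ : ρ.re < 1 / 2) (hμ : ∀ n : ℤ, μ ≠ n) (d : ℤ) {θ : ℝ}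
    (hθ : Real.sin θ = 0) : Tendsto (fun y => hypProd ρ μ d (logPolar y θ)) (𝓝[>] 2)
      (𝓝 (hypProd ρ μ d (logPolar 2 θ))) := by
  have hv : ContinuousAt (fun y => logPolar y θ) 2 := by
    unfold logPolar
    exact (Complex.continuous_ofReal.continuousAt.comp
      (Real.continuousAt_log (by norm_num))).add continuousAt_const
  have hv' := hv.continuousWithinAt (s := Ioi 2)
  have e0 : 4 * Complex.exp (-2 * logPolar 2 θ) = 1 := by
    have e1 : Complex.exp (2 * logPolar 2 θ) = 4 := by
      have hI : Complex.exp (θ * Complex.I) ^ 2 = 1 := by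
        rw [Complex.exp_mul_I, ← Complex.ofReal_cos, ← Complex.ofReal_sin, hθ]
        have := Real.sin_sq_add_cos_sq θ
        rw [hθ] at this
        rw [Complex.ofReal_zero, zero_mul, add_zero]
        exact_mod_cast (by linarith : Real.cos θ ^ 2 = 1)
      rw [two_mul, Complex.exp_add, exp_logPolar two_pos]
      push_cast
      linear_combination 4 * hI
    rw [neg_mul, Complex.exp_neg, e1]; norm_num
  have e0' : 4 * Complex.exp (-2 * starRingEnd ℂ (logPolar 2 θ)) = 1 := by
    rw [four_mul_exp_conj, e0, map_one]
  have hlt : ∀ y ∈ Ioi (2 : ℝ), ‖4 * Complex.exp (-2 * logPolar y θ)‖ < 1 := by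
    intro y hy
    have hy : 2 < y := hy
    have hy0 : 0 < y := by linarith
    have : (-2 * logPolar y θ).re = -(2 * Real.log y) := by simp [logPolar]
    rw [norm_mul, Complex.norm_exp, this, Real.exp_neg, two_mul, Real.exp_add, Real.exp_log hy0,
      Complex.norm_ofNat, ← div_eq_mul_inv, div_lt_one (by positivity)]
    nlinarith
  have hF : ∀ {ν : ℂ}, (∀ n : ℕ, 1 + ν ≠ -n) → ∀ {f : ℝ → ℂ}, ContinuousWithinAt f (Ioi 2) 2 →
      4 * Complex.exp (-2 * f 2) = 1 → (∀ y ∈ Ioi (2 : ℝ), ‖4 * Complex.exp (-2 * f y)‖ < 1) →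
      ContinuousWithinAt (fun y => hypTerm ρ ν (f y)) (Ioi 2) 2 := by
    intro ν hν f hf h1 h2
    unfold hypTerm
    have hF := continuousWithinAt_F1_one hρ hν
    rw [← h1] at hF
    have hg : ContinuousWithinAt (fun y => 4 * Complex.exp (-2 * f y)) (Ioi 2) 2 := by fun_prop
    exact ContinuousWithinAt.mul (by fun_prop)
      (ContinuousWithinAt.comp (f := fun y => 4 * Complex.exp (-2 * f y)) hF hg
        fun y hy => Or.inl (h2 y hy))
  unfold hypProd
  refine ContinuousWithinAt.mul (hF (fun n h => ?_) hv' e0 hlt)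
    (hF (fun n h => ?_) (Complex.continuous_conj.continuousAt.comp_continuousWithinAt hv') e0'
      fun y hy => ?_)
  · exact hμ (-n - 1 - d) (by push_cast; linear_combination h)
  · exact hμ (-n - 1 + d) (by push_cast; linear_combination h)
  · have := hlt y hy
    rwa [← RCLike.norm_conj, ← four_mul_exp_conj] at this

lemma norm_polar {y : ℝ} (hy : 0 ≤ y) (θ : ℝ) : ‖(y * Complex.exp (θ * Complex.I) : ℂ)‖ = y := by
  rw [norm_mul, Complex.norm_exp_ofReal_mul_I, mul_one, Complex.norm_real, Real.norm_of_nonneg hy]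

lemma continuousAt_impInt_polar {ρ μ : ℂ} (hμ : |μ.re| < ρ.re) (hρ : ρ.re < 1) (d : ℤ) {y : ℝ}
    (θ : ℝ) (h : ρ.re < 1 / 2 ∨ 2 < y) :
    ContinuousAt (fun q : ℂ × ℂ => impInt ρ q.1 d q.2) (μ, y * Complex.exp (θ * Complex.I)) := by
  rcases h with h | h
  · exact continuousAt_impInt_of_lt_half hμ h d _
  · refine continuousAt_impInt hμ hρ d fun h' => ?_
    have := congrArg norm h'
    rw [norm_pow, norm_polar (by linarith), Complex.norm_ofNat] at this
    nlinarith

/-- Off the cut this is `impInt_eq`. The only meaningful points left have y = 2 and sin θ = 0; there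
Re ρ < 1/2, and both sides are limits from y > 2. -/
lemma rhs_eq_impInt {ρ μ : ℂ} (hμ : |μ.re| < ρ.re) (hρ : ρ.re < 1) {d : ℤ} {y θ : ℝ}
    (h : ρ.re < 1 / 2 ∨ 2 < y) (hm : RhsMeaningful ρ μ d y θ) :
    rhs ρ μ d y θ = impInt ρ μ d (y * Complex.exp (θ * Complex.I)) := by
  obtain ⟨hy, hcut, h0, hd⟩ := hm
  have off : ∀ {y : ℝ}, 0 < y → ¬ (y ≤ 2 ∧ Real.sin θ = 0) →
      rhs ρ μ d y θ = impInt ρ μ d (y * Complex.exp (θ * Complex.I)) := fun hy hc => by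
    rw [rhs_eq ρ μ d hy, ← exp_logPolar hy,
      impInt_eq h0 hμ hρ d hd (mem_cutPlane_logPolar hy hc)]
  by_cases hc : y ≤ 2 ∧ Real.sin θ = 0
  · obtain ⟨hy2, hs⟩ := hc
    have hy2 : y = 2 := le_antisymm hy2 (not_lt.1 fun h => hcut ⟨h, hs⟩)
    subst hy2
    have hρ2 := h.resolve_right (lt_irrefl _)
    have hint := ne_intCast_of_abs_re_lt_one h0 (hμ.trans hρ)
    have l1 := ((tendsto_hypProd_two hρ2 hint d hs).const_mul (C ρ μ d)).add
      ((tendsto_hypProd_two hρ2 (fun n h => hint (-n) (by push_cast; rw [← h, neg_neg])) (-d)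
        hs).const_mul (C ρ (-μ) (-d)))
    rw [← rhs_eq ρ μ d two_pos] at l1
    have l2 : Tendsto (fun y : ℝ => impInt ρ μ d (y * Complex.exp (θ * Complex.I))) (𝓝[>] 2)
        (𝓝 (impInt ρ μ d ((2 : ℝ) * Complex.exp (θ * Complex.I)))) := by
      refine Tendsto.mono_left ?_ nhdsWithin_le_nhds
      exact ContinuousAt.comp (g := fun q : ℂ × ℂ => impInt ρ q.1 d q.2)
        (f := fun y : ℝ => (μ, (y * Complex.exp (θ * Complex.I) : ℂ)))
        (continuousAt_impInt_polar hμ hρ d θ h) (by fun_prop)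
    refine tendsto_nhds_unique l1 (l2.congr' ?_)
    filter_upwards [self_mem_nhdsWithin] with y hy
    have hy : 2 < y := hy
    rw [← off (by linarith) fun h => not_lt.2 h.1 hy, rhs_eq ρ μ d (by linarith)]
  · exact off hy hc

/-- The right hand side equals the jointly continuous function `impInt` at all meaningful points
near (μ, y, θ), so its limit along them exists and is the value of `impInt`. -/
lemma isRhsValue_impInt {ρ μ : ℂ} (hμ : |μ.re| < ρ.re) (hρ : ρ.re < 1) (d : ℤ) {y : ℝ} (θ : ℝ)
    (h : ρ.re < 1 / 2 ∨ 2 < y) :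
    IsRhsValue ρ μ d y θ (impInt ρ μ d (y * Complex.exp (θ * Complex.I))) := by
  refine ⟨fun hm => (rhs_eq_impInt hμ hρ h hm).symm, fun _ => ?_⟩
  have hc : ContinuousAt (fun p : ℂ × ℝ × ℝ =>
      impInt ρ p.1 d (p.2.1 * Complex.exp (p.2.2 * Complex.I))) (μ, y, θ) :=
    ContinuousAt.comp (g := fun q : ℂ × ℂ => impInt ρ q.1 d q.2)
      (f := fun p : ℂ × ℝ × ℝ => (p.1, (p.2.1 * Complex.exp (p.2.2 * Complex.I) : ℂ)))
      (continuousAt_impInt_polar hμ hρ d θ h) (by fun_prop)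
  refine (hc.tendsto.mono_left nhdsWithin_le_nhds).congr' ?_
  have h1 : ∀ᶠ p : ℂ × ℝ × ℝ in 𝓝 (μ, y, θ), |p.1.re| < ρ.re :=
    ContinuousAt.eventually_lt (f := fun p : ℂ × ℝ × ℝ => |p.1.re|) (g := fun _ => ρ.re)
      (by fun_prop) continuousAt_const hμ
  have h2 : ∀ᶠ p : ℂ × ℝ × ℝ in 𝓝 (μ, y, θ), ρ.re < 1 / 2 ∨ 2 < p.2.1 := by
    rcases h with h | h
    · exact Eventually.of_forall fun _ => Or.inl h
    · exact (ContinuousAt.eventually_lt (f := fun _ => (2 : ℝ)) (g := fun p : ℂ × ℝ × ℝ => p.2.1)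
        continuousAt_const (by fun_prop) h).mono fun _ => Or.inr
  filter_upwards [nhdsWithin_le_nhds h1, nhdsWithin_le_nhds h2, self_mem_nhdsWithin]
    with p hp1 hp2 hp3
  exact (rhs_eq_impInt hp1 hρ hp2 hp3).symm

/-! ### The integral in polar coordinates -/

lemma integrand_exp (ρ : ℂ) {μ : ℂ} (h1 : |μ.re| < 1) (d : ℤ) (y θ φ t : ℝ) :
    Real.exp t • integrand ρ μ d y θ φ (Real.exp t) = waveTerm ρ μ d 0 0 (cyl (φ, t)) *
      planeWave (Complex.exp (cyl (φ, t))) (y * Complex.exp (θ * Complex.I)) := by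
  have e1 : ((Real.exp t : ℝ) : ℂ) * Complex.exp (φ * Complex.I) = Complex.exp (cyl (φ, t)) := by
    rw [cyl, Complex.exp_add, Complex.ofReal_exp]
  have e2 : e (-2 * Real.exp t * y * Real.cos (φ + θ)) =
      planeWave (Complex.exp (cyl (φ, t))) (y * Complex.exp (θ * Complex.I)) := by
    have : Complex.exp (cyl (φ, t)) * (y * Complex.exp (θ * Complex.I)) =
        ((Real.exp t * y : ℝ) : ℂ) * Complex.exp ((φ + θ : ℝ) * Complex.I) := by
      rw [← e1, Complex.ofReal_add, add_mul, Complex.exp_add]; push_cast; ring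
    unfold e planeWave
    rw [this, Complex.add_conj, Complex.re_ofReal_mul, Complex.exp_ofReal_mul_I_re]
    congr 1
    push_cast
    ring
  have e3 : (Real.exp t : ℂ) * ((Real.exp t : ℝ) : ℂ) ^ (2 * ρ - 1) =
      Complex.exp ((ρ + (0 : ℤ)) * cyl (φ, t) + (ρ + (0 : ℤ)) * starRingEnd ℂ (cyl (φ, t))) := by
    rw [Complex.cpow_def_of_ne_zero (by simp), ← Complex.ofReal_log (Real.exp_pos t).le,
      Real.log_exp, Complex.ofReal_exp, ← Complex.exp_add]
    congr 1
    simp [cyl]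
    ring
  unfold integrand waveTerm
  rw [e1, e2, boldJ_exp h1, ← e3, Complex.real_smul]
  ring

/-- The substitution x = e^t is made in the inner integral only, which yields integrability on the
product and the iterated integral together. Measurability of the integrand is transported back
through log x. -/
lemma integrand_polar (ρ : ℂ) {μ : ℂ} (h1 : |μ.re| < 1) (d : ℤ) {A : Set ℝ} (hA : MeasurableSet A)
    (hi : IntegrableOn (fun p => waveTerm ρ μ d 0 0 (cyl p)) (Ioc 0 (2 * π) ×ˢ A)) (y θ : ℝ) :
    IntegrableOn (fun p : ℝ × ℝ => integrand ρ μ d y θ p.1 p.2)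
      (Ioc 0 (2 * π) ×ˢ (Real.exp '' A)) ∧
    ∫ φ in (0 : ℝ)..(2 * π), ∫ x in Real.exp '' A, integrand ρ μ d y θ φ x =
      waveInt A ρ μ d 0 0 (y * Complex.exp (θ * Complex.I)) := by
  have hi' := integrableOn_waveTerm_mul hi (y * Complex.exp (θ * Complex.I))
  have hA' : MeasurableSet (Real.exp '' A) :=
    hA.image_of_continuousOn_injOn Real.continuous_exp.continuousOn Real.exp_injective.injOn
  have hpos : ∀ x ∈ Real.exp '' A, 0 < x := by
    rintro x ⟨t, -, rfl⟩; exact Real.exp_pos t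
  have hm : AEStronglyMeasurable (fun p : ℝ × ℝ => integrand ρ μ d y θ p.1 p.2)
      (volume.restrict (Ioc 0 (2 * π) ×ˢ (Real.exp '' A))) := by
    have hW : Measurable fun w : ℂ => waveTerm ρ μ d 0 0 w *
        planeWave (Complex.exp w) (y * Complex.exp (θ * Complex.I)) :=
      (measurable_waveTerm ρ μ d 0 0).mul (continuous_planeWave_exp _).measurable
    have hlog : Measurable fun p : ℝ × ℝ => cyl (p.1, Real.log p.2) :=
      continuous_cyl.measurable.comp
        (measurable_fst.prodMk (Real.measurable_log.comp measurable_snd))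
    have hF : Measurable fun p : ℝ × ℝ => ((p.2 : ℂ))⁻¹ * (waveTerm ρ μ d 0 0
        (cyl (p.1, Real.log p.2)) * planeWave (Complex.exp (cyl (p.1, Real.log p.2)))
          (y * Complex.exp (θ * Complex.I))) :=
      (Complex.measurable_ofReal.comp measurable_snd).inv.mul (hW.comp hlog)
    refine hF.aestronglyMeasurable.congr (ae_restrict_of_forall_mem (measurableSet_Ioc.prod hA')
      fun p hp => ?_)
    have hp2 := hpos p.2 hp.2
    simp only
    rw [← integrand_exp ρ h1, Real.exp_log hp2, Complex.real_smul,
      inv_mul_cancel_left₀ (Complex.ofReal_ne_zero.2 hp2.ne')]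
  have hint : IntegrableOn (fun p : ℝ × ℝ => integrand ρ μ d y θ p.1 p.2)
      (Ioc 0 (2 * π) ×ˢ (Real.exp '' A)) := by
    unfold IntegrableOn at hi' ⊢
    rw [Measure.volume_eq_prod, ← Measure.prod_restrict] at hi' hm ⊢
    obtain ⟨f1, f2⟩ := (integrable_prod_iff hi'.aestronglyMeasurable).1 hi'
    refine (integrable_prod_iff hm).2 ⟨?_, ?_⟩
    · filter_upwards [f1] with φ hφ
      refine (integrableOn_exp_image_iff hA _).2 ?_
      simp only [integrand_exp ρ h1]
      exact hφ
    · refine f2.congr (Eventually.of_forall fun φ => ?_)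
      simp only
      rw [integral_exp_image hA]
      simp only [← integrand_exp ρ h1, norm_smul, Real.norm_of_nonneg (Real.exp_pos _).le,
        smul_eq_mul]
  refine ⟨hint, ?_⟩
  rw [intervalIntegral.integral_of_le Real.two_pi_pos.le, waveInt, Measure.volume_eq_prod,
    setIntegral_prod _ hi']
  simp only [integral_exp_image hA, integrand_exp ρ h1]

end WeberSchafheitlin

end

open WeberSchafheitlin in
theorem theorem1p1 (ρ μ : ℂ) (d : ℤ) (hμ : |μ.re| < ρ.re)
    (y θ : ℝ) (hy : 0 ≤ y) (hθ : θ ∈ Set.Ico 0 (2 * Real.pi)) :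
    -- for `Re ρ < 1/2` the double integral converges absolutely and the formula holds
    (ρ.re < 1 / 2 →
      IntegrableOn (fun p : ℝ × ℝ => integrand ρ μ d y θ p.1 p.2)
        (Set.Ioc 0 (2 * Real.pi) ×ˢ Set.Ioi 0) ∧
      IsRhsValue ρ μ d y θ
        (∫ φ in (0 : ℝ)..(2 * Real.pi), ∫ x in Set.Ioi (0 : ℝ), integrand ρ μ d y θ φ x)) ∧
    -- for `Re ρ < 1` and `y > 2` it converges as an improper integral and the formula holds
    (ρ.re < 1 → 2 < y →
      (∀ R : ℝ, 0 < R → IntegrableOn (fun p : ℝ × ℝ => integrand ρ μ d y θ p.1 p.2)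
        (Set.Ioc 0 (2 * Real.pi) ×ˢ Set.Ioc 0 R)) ∧
      ∃ I : ℂ,
        Tendsto (fun R : ℝ => ∫ φ in (0 : ℝ)..(2 * Real.pi), ∫ x in (0 : ℝ)..R,
          integrand ρ μ d y θ φ x) atTop (𝓝 I) ∧
        IsRhsValue ρ μ d y θ I) := by
  constructor
  · intro hρ
    have hρ1 : ρ.re < 1 := by linarith
    obtain ⟨hi, hI⟩ := impInt_eq_waveInt_univ hμ hρ d (y * Complex.exp (θ * Complex.I))
    obtain ⟨h1, h2⟩ := integrand_polar ρ (hμ.trans hρ1) d MeasurableSet.univ hi y θ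
    rw [Set.image_univ, Real.range_exp] at h1 h2
    refine ⟨h1, ?_⟩
    rw [h2, ← hI]
    exact isRhsValue_impInt hμ hρ1 d θ (Or.inl hρ)
  · intro hρ hy2
    obtain ⟨σ, hσ1, hσ2⟩ := exists_between hμ
    have hi := integrableOn_waveTerm_Iic (ρ := ρ) ((abs_nonneg _).trans_lt hσ1) (hσ2.trans hρ)
      hσ1.le d (j := 0) (k := 0) (by push_cast; linarith)
    have himg : ∀ R : ℝ, 0 < R → Real.exp '' Set.Iic (Real.log R) = Set.Ioc 0 R := fun R hR => by
      ext x
      constructor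
      · rintro ⟨t, ht, rfl⟩
        exact ⟨Real.exp_pos t, (Real.le_log_iff_exp_le hR).1 ht⟩
      · rintro ⟨h0, hx⟩
        exact ⟨Real.log x, Real.log_le_log h0 hx, Real.exp_log h0⟩
    have hp := fun R : ℝ => integrand_polar ρ (hμ.trans hρ) d measurableSet_Iic
      (hi (Real.log R)) y θ
    refine ⟨fun R hR => ?_, _, ?_, isRhsValue_impInt hμ hρ d θ (Or.inr hy2)⟩
    · rw [← himg R hR]
      exact (hp R).1
    -- Since y > 2, |u²| = y² > 4, so u avoids the singular points ±2.
    · have hu : (y * Complex.exp (θ * Complex.I) : ℂ) ^ 2 ≠ 4 := fun h => by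
        have := congrArg norm h
        rw [norm_pow, norm_polar hy, Complex.norm_ofNat] at this
        nlinarith
      refine ((tendsto_impInt hμ hρ d hu).comp Real.tendsto_log_atTop).congr' ?_
      filter_upwards [Filter.eventually_gt_atTop 0] with R hR
      rw [Function.comp_apply, ← (hp R).2, himg R hR]
      simp only [intervalIntegral.integral_of_le hR.le]
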